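/- Let $\Omega=\mathbb R\times(-1,1)$ with points $(x,y)$, and write $\|\cdot\|_{L^q}$ for the norm of $L^q(\Omega)$. Fix a smooth cut-off $\chi:\mathbb R\to[0,1]$ with $\chi(k)=1$ for $|k|\le\frac12$ and $\chi(k)=0$ for $|k|\ge1$, let $\mathcal M=\mathcal M(D_x)$ be the Fourier multiplier in $x$ with symbol $\mathcal M(k)=|k|^{2/3}\chi(k)+1-\chi(k)$, and put $W_s=(1+\nu^{1/3}t\mathcal M)^s$. For $\omega^{in}\in H^3_{x,y}(\Omega)\cap L^1_xH^3_y(\Omega)$ set $$E_0=\|\omega^{in}\|_{H^3_{x,y}}+\|\omega^{in}\|_{L^1_xH^3_y}.$$ Let $0<\nu<1$ and let $\omega_L$ be the (strong $L^2$) solution on $t\ge0$ of $$\partial_t\omega_L+\nu(1-t^2\partial_x^2)\omega_L+y\,\partial_x\omega_L=0,\qquad \omega_L|_{t=0}=\omega^{in},\qquad \omega_L(t,x,\pm1)=0.$$ Let $\phi_L=\Delta^{-1}\omega_L\in H^2(\Omega)$ be the solution of $\Delta\phi_L=\omega_L$ with $\phi_L(t,x,\pm1)=0$, let $u_L=(u_L^{(1)},u_L^{(2)})=(\partial_y,-\partial_x)\phi_L$,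 and let $$E_r=\partial_t\omega_L-\nu\Delta\omega_L+y\,\partial_x\omega_L+u_L\cdot\nabla\omega_L.$$ For every $s\ge0$ there is a constant $C_s$, depending only on $s$ and $\chi$ (not on $\nu$, $t$, $\omega^{in}$), such that the functions above are well defined and the following hold for all $t\ge0$ (in the fifth estimate, for all $t>0$). Weak enhanced dissipation: $$\|W_s\omega_L\|_{L^2}+\|W_s(\partial_y+t\partial_x)\omega_L\|_{L^2}\le C_s(1+\nu t^3)^{-1/4}e^{-\nu t}E_0,$$ $$\|W_s\partial_x\omega_L\|_{L^2}\le C_s(1+\nu t^3)^{-3/4}e^{-\nu t}E_0,$$ $$\|W_s\partial_x\omega_L\|_{L^\infty}\le C_s(1+\nu t^3)^{-1}e^{-\nu t}E_0,$$ $$\|W_s(\partial_y+t\partial_x)\omega_L\|_{L^\infty}\le C_s(1+\nu t^3)^{-1/2}e^{-\nu t}E_0,$$ $$\|W_s\partial_x^2\omega_L\|_{L^\infty}\le C_s(\nu t^3)^{-1/3}(1+\nu t^3)^{-7/6}e^{-\nu t}E_0.$$ Inviscid damping: $$\|W_su_L^{(1)}\|_{L^\infty}+\|W_s(u_L^{(1)}-tu_L^{(2)})\|_{L^\infty}\le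 C_s(1+t)^{-1}e^{-\nu t}E_0,$$ $$\|W_su_L^{(2)}\|_{L^\infty}\le C_s(1+t)^{-2}\ln(2+t)\,e^{-\nu t}E_0.$$ Error estimate: $$\|W_sE_r\|_{L^2}\le C_s\Big((1+t)^{-1}(1+\nu t^3)^{-1/4}E_0+\nu(1+\nu t^3)^{-1/4}+\nu^{2/3}(1+\nu t^3)^{-5/12}\Big)e^{-\nu t}E_0.$$ -/

import Mathlib

open MeasureTheory Set
open scoped ENNReal FourierTransform

noncomputable section

/-- The open channel `ℝ × (-1, 1)`; points are `p = (x, y)`. -/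
def strip : Set (ℝ × ℝ) := univ ×ˢ Ioo (-1) 1

/-- Lebesgue measure on the channel. -/
abbrev stripMeasure : Measure (ℝ × ℝ) := volume.restrict strip

/-- `L²(ℝ × (-1, 1))`, complex valued (real-valued fields are a special case). -/
abbrev StripL2 : Type := Lp ℂ 2 stripMeasure

/-- The classical derivative `∂_x^a ∂_y^b θ` of a (smooth) function of two variables. -/
def classicalPartial (a b : ℕ) (θ : ℝ × ℝ → ℝ) (p : ℝ × ℝ) : ℝ :=
  iteratedDeriv a (fun x => iteratedDeriv b (fun y => θ (x, y)) p.2) p.1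

/-- `g = ∂_x^a ∂_y^b f` in the sense of distributions on the open channel. -/
def HasWeakPartial (a b : ℕ) (f g : StripL2) : Prop :=
  ∀ θ : ℝ × ℝ → ℝ, ContDiff ℝ (⊤ : ℕ∞) θ → HasCompactSupport θ → tsupport θ ⊆ strip →
    ∫ p, f p * (classicalPartial a b θ p : ℂ) ∂stripMeasure =
      (-1) ^ (a + b) * ∫ p, g p * (θ p : ℂ) ∂stripMeasure

/-- The distributional derivative `∂_x^a ∂_y^b f` exists in `L²` of the channel. -/
def WeaklyDiff (a b : ℕ) (f : StripL2) : Prop := ∃ g, HasWeakPartial a b f g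

open Classical in
/-- The distributional derivative `∂_x^a ∂_y^b f` (with the value `0` if it is not in `L²`; it is
only used together with `WeaklyDiff a b f`). -/
def weakPartial (a b : ℕ) (f : StripL2) : StripL2 :=
  if h : WeaklyDiff a b f then h.choose else 0

/-- `f ∈ H^m` of the channel. -/
def MemSobolev (m : ℕ) (f : StripL2) : Prop := ∀ a b : ℕ, a + b ≤ m → WeaklyDiff a b f

/-- `f(x, ±1) = 0`. The function has a derivative `g = ∂_y f` in `L²` and zero trace on both
walls, i.e. Green's formula in `y` holds with no boundary term, also for test functions that do
not vanish near the walls `y = ±1`. -/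
def VanishesOnWalls (f : StripL2) : Prop :=
  ∃ g : StripL2, ∀ θ : ℝ × ℝ → ℝ, ContDiff ℝ (⊤ : ℕ∞) θ → HasCompactSupport θ →
    ∫ p, f p * (classicalPartial 0 1 θ p : ℂ) ∂stripMeasure =
      - ∫ p, g p * (θ p : ℂ) ∂stripMeasure

/-- The norm of `H³_{x,y}` (for `f ∈ H³`). -/
def normH3 (f : StripL2) : ℝ :=
  Real.sqrt (∑ n ∈ Finset.range 4, ∑ q ∈ Finset.HasAntidiagonal.antidiagonal n, ‖weakPartial q.1 q.2 f‖ ^ 2)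

/-- The norm of `L¹_x H³_y` (for `f ∈ H³_{x,y}`), with values in `[0, ∞]`. -/
def normL1H3 (f : StripL2) : ℝ≥0∞ :=
  ∫⁻ x : ℝ, (∑ j ∈ Finset.range 4,
    ∫⁻ y in Ioo (-1 : ℝ) 1, ‖weakPartial 0 j f (x, y)‖ₑ ^ 2) ^ (1 / 2 : ℝ)

/-- `f ∈ H³_{x,y} ∩ L¹_x H³_y`. -/
def MemData (f : StripL2) : Prop := MemSobolev 3 f ∧ normL1H3 f < ∞

/-- `E₀ = ‖f‖_{H³_{x,y}} + ‖f‖_{L¹_x H³_y}`. -/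
def dataSize (f : StripL2) : ℝ := normH3 f + (normL1H3 f).toReal

/-- `h = m(D_x) f`: for almost every `y`, the Fourier transforms in `x` satisfy
`ĥ(k, y) = m(k) f̂(k, y)`. The frequency `k` of the convention `∫ e^{-ikx} f(x) dx` is `2πξ` in
Mathlib's convention `∫ e^{-2πiξx} f(x) dx`. -/
def IsXMultiplier (m : ℝ → ℝ) (f h : StripL2) : Prop :=
  ∀ᵐ y ∂(volume.restrict (Ioo (-1 : ℝ) 1)),
    ∃ (hf : MemLp (fun x : ℝ => f (x, y)) 2 volume) (hh : MemLp (fun x : ℝ => h (x, y)) 2 volume),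
      ((𝓕 (hh.toLp (fun x : ℝ => h (x, y))) : Lp ℂ 2 (volume : Measure ℝ)) : ℝ → ℂ) =ᵐ[volume]
        fun ξ => (m (2 * Real.pi * ξ) : ℂ) * (𝓕 (hf.toLp (fun x : ℝ => f (x, y))) : Lp ℂ 2 (volume : Measure ℝ)) ξ

/-- The norm `‖m(D_x) f‖_{L^p}` over the channel. The function `m(D_x) f` is unique, so the
infimum is over one element; it would be `∞` if `m(D_x) f` were not in `L²`. -/
def multNorm (m : ℝ → ℝ) (p : ℝ≥0∞) (f : StripL2) : ℝ≥0∞ :=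
  ⨅ (h : StripL2) (_ : IsXMultiplier m f h), eLpNorm h p stripMeasure

/-- A smooth cut-off: `χ = 1` for `|k| ≤ 1/2`, `χ = 0` for `|k| ≥ 1`, `0 ≤ χ ≤ 1`. -/
structure IsCutoff (χ : ℝ → ℝ) : Prop where
  smooth : ContDiff ℝ (⊤ : ℕ∞) χ
  mem_Icc : ∀ k, χ k ∈ Icc (0 : ℝ) 1
  eq_one : ∀ k, |k| ≤ 1 / 2 → χ k = 1
  eq_zero : ∀ k, 1 ≤ |k| → χ k = 0

/-- The symbol `M(k) = |k|^{2/3} χ(k) + 1 - χ(k)`. -/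
def symbolM (χ : ℝ → ℝ) (k : ℝ) : ℝ := |k| ^ (2 / 3 : ℝ) * χ k + 1 - χ k

/-- The symbol `(1 + ν^{1/3} t M(k))^s`. -/
def weight (χ : ℝ → ℝ) (s ν t : ℝ) (k : ℝ) : ℝ :=
  (1 + ν ^ (1 / 3 : ℝ) * t * symbolM χ k) ^ s

/-- The time derivative in `L²` of the channel (one-sided at `t = 0`). -/
def timeDeriv (ω : ℝ → StripL2) (t : ℝ) : StripL2 := derivWithin ω (Ici 0) t

/-- `ω` is the (strong `L²`) solution, on `t ≥ 0`, of
`∂_t ω + ν (1 - t² ∂_x²) ω + y ∂_x ω = 0`, `ω(0) = ω^in`, `ω(t, x, ±1) = 0`. -/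
structure IsLinearSolution (ν : ℝ) (ωin : StripL2) (ω : ℝ → StripL2) : Prop where
  init : ω 0 = ωin
  walls : ∀ t, 0 ≤ t → VanishesOnWalls (ω t)
  diff_x : ∀ t, 0 ≤ t → WeaklyDiff 1 0 (ω t)
  diff_xx : ∀ t, 0 ≤ t → WeaklyDiff 2 0 (ω t)
  diff_t : ∀ t, 0 ≤ t → DifferentiableWithinAt ℝ ω (Ici 0) t
  eqn : ∀ t, 0 ≤ t → ∀ᵐ p ∂stripMeasure,
    timeDeriv ω t p + (ν : ℂ) * (ω t p - (t : ℂ) ^ 2 * weakPartial 2 0 (ω t) p)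
      + (p.2 : ℂ) * weakPartial 1 0 (ω t) p = 0

/-- `φ = Δ⁻¹ w`: the solution `φ ∈ H²` of `Δφ = w` in the channel with `φ(x, ±1) = 0`. -/
structure IsStreamFunction (w φ : StripL2) : Prop where
  memSobolev : MemSobolev 2 φ
  walls : VanishesOnWalls φ
  laplace : weakPartial 2 0 φ + weakPartial 0 2 φ = w

/-- `E = ∂_t ω - ν Δω + y ∂_x ω + u · ∇ω` at time `t`, with `u = (∂_y, -∂_x) φ`. -/
def IsErrorTerm (ν : ℝ) (ω : ℝ → StripL2) (t : ℝ) (φ E : StripL2) : Prop :=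
  ∀ᵐ p ∂stripMeasure, E p =
    timeDeriv ω t p
      - (ν : ℂ) * (weakPartial 2 0 (ω t) p + weakPartial 0 2 (ω t) p)
      + (p.2 : ℂ) * weakPartial 1 0 (ω t) p
      + (weakPartial 0 1 φ p * weakPartial 1 0 (ω t) p
        + (-weakPartial 1 0 φ p) * weakPartial 0 1 (ω t) p)

end

/-!
# Weak enhanced dissipation and inviscid damping for a linear equation in a channel

After a Fourier transform in `x`, with frequency `k`, the equation is an ordinary differential equation in `t`
for each `k` and `y`, and its only solution in `L²` is
`ω̂(t, k, y) = exp(-ν t - ν t³ k² / 3) exp(-i k t y) g(k, y)`, with `g` the transform of the data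
(`IsLinearSolution.partialFT`; uniqueness holds because the equation is dissipative). A `Profile` of the data
collects the function `g`, which vanishes at `y = ±1`, its derivatives in `y`, and envelopes of these functions:
functions of `k` that are bounded and have weighted `L²` bounds, in terms of `E₀`. The operator `∂_y + t ∂_x`
acts on `g` alone, since it annihilates `exp(i k x - i k t y)`.

**Enhanced dissipation.** The weight `W_s` is a power of `1 + O((ν t³ k²)^{1/3})`, so that it costs only a part of
the Gaussian decay in `k` (`weight_le_exp`). By Plancherel's theorem, or by the bound of `L^∞` by the `L¹` norm in
frequency, the estimates are Gaussian integrals against the envelopes (`exists_dissipation`).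

**Inviscid damping.** At each frequency the stream function solves `ψ'' - k² ψ = exp(-i k t y) g`, `ψ(±1) = 0`.
Two integrations by parts against Green's function show that, for `|k| t ≥ 1`, it is
`-exp(-i k t y) g / (k² (1 + t²))` up to `O(|k t|⁻³)`, and that `ψ' + i k t ψ = O(|k t|⁻²)` (`greenSol_decay`).
For `|k| t ≤ 1` trivial bounds suffice. Integration in `k` gives the bounds of `u¹ - t u²` and `u²`
(`exists_damping`); the logarithm is the integral of `1/|k|` over `1/t ≤ |k| ≤ 1`. For `u¹` the same logarithm
would appear, but the leading part of its symbol is `1/k` times the transform of a function in `L¹` in `x`: a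
truncated Hilbert transform, which is bounded because the integrals of `sin x / x` are
(`exists_damping_horizontal`). The
weighted Gaussian is compared with the sharp cut-off at `ν t³ k² = 1` for this purpose.

**Error term.** By the equation, the linear part of the error is `-ν (ω + (1 - t²) ∂_x² ω + ∂_y² ω)`. In terms of
`∂_y + t ∂_x` the factors `t²` cancel, and the remaining factor `ν t` in front of `∂_x (∂_y + t ∂_x) ω` is
`ν^{2/3} (ν t³)^{1/3}`. The nonlinear part is `((∂_y + t ∂_x) φ) ∂_x ω - ∂_x φ (∂_y + t ∂_x) ω`. Its symbol is a
convolution, the weight is submultiplicative up to a constant (`weight_add_le`), and Young's inequality for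
`L¹ * L²` gives the estimate from those of the factors (`exists_error`).
-/

noncomputable section

open Filter
open Real (exp log sqrt sinh cosh sin cos)
open Complex (I)
open ENNReal (ofReal)
open scoped Real

/-! ### The Fourier transform on `L¹ ∩ L²` of the line -/

/-- The `L²` Fourier transform paired with a Schwartz function. -/
theorem integral_schwartz_mul_fourier (f : Lp ℂ 2 (volume : Measure ℝ)) (b : SchwartzMap ℝ ℂ) :
    ∫ ξ, b ξ * (𝓕 f : Lp ℂ 2 (volume : Measure ℝ)) ξ = ∫ x, (𝓕 (b : ℝ → ℂ)) x * f x := by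
  have h1 := congrArg (fun T => T b) (Lp.fourier_toTemperedDistribution_eq f)
  simp only [TemperedDistribution.fourier_apply, Lp.toTemperedDistribution_apply,
    SchwartzMap.fourier_coe, smul_eq_mul] at h1
  exact h1.symm

theorem integral_fourier_mul {f b : ℝ → ℂ} (hf : Integrable f) (hb : Integrable b) :
    ∫ ξ, b ξ * 𝓕 f ξ = ∫ x, 𝓕 b x * f x := by
  have := VectorFourier.integral_fourierIntegral_smul_eq_flip (μ := volume) (ν := volume)
    (L := innerₗ ℝ) Real.continuous_fourierChar
    continuous_inner hb hf
  simp only [smul_eq_mul] at this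
  rw [flip_innerₗ] at this
  exact this.symm

/-- On `L¹ ∩ L²` the `L²` Fourier transform is given by the Fourier integral. -/
theorem fourier_toLp_ae_eq {f : ℝ → ℂ} (h1 : Integrable f) (h2 : MemLp f 2 volume) :
    ((𝓕 (h2.toLp f) : Lp ℂ 2 (volume : Measure ℝ)) : ℝ → ℂ) =ᵐ[volume] 𝓕 f := by
  apply ae_eq_of_integral_contDiff_smul_eq
  · exact (Lp.memLp _).locallyIntegrable (by norm_num)
  · exact (VectorFourier.fourierIntegral_continuous (L := innerₗ ℝ) Real.continuous_fourierChar
      continuous_inner h1).locallyIntegrable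
  intro g hg hgc
  have hg₁ : HasCompactSupport (Complex.ofRealCLM ∘ g) := hgc.comp_left rfl
  have hg₂ : ContDiff ℝ (⊤ : ℕ∞) (Complex.ofRealCLM ∘ g) := by fun_prop
  set b := hg₁.toSchwartzMap hg₂
  have e := integral_schwartz_mul_fourier (h2.toLp f) b
  have hb : ∀ x, b x = (g x : ℂ) := fun x => rfl
  simp only [Complex.real_smul, ← hb]
  rw [e, integral_fourier_mul h1 b.integrable]
  apply integral_congr_ae
  filter_upwards [h2.coeFn_toLp] with x hx
  rw [hx]

theorem fourierInv_toLp_ae_eq {f : ℝ → ℂ} (h1 : Integrable f) (h2 : MemLp f 2 volume) :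
    ((FourierTransformInv.fourierInv (h2.toLp f) : Lp ℂ 2 (volume : Measure ℝ)) : ℝ → ℂ)
      =ᵐ[volume] 𝓕⁻ f := by
  apply ae_eq_of_integral_contDiff_smul_eq
  · exact (Lp.memLp _).locallyIntegrable (by norm_num)
  · have : Continuous (𝓕 f) :=
      (VectorFourier.fourierIntegral_continuous (L := innerₗ ℝ) Real.continuous_fourierChar
      continuous_inner h1)
    have h3 : Continuous (𝓕⁻ f) := by
      have e : 𝓕⁻ f = fun x => 𝓕 f (-x) := by
        ext x; exact Real.fourierInv_eq_fourier_neg f x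
      rw [e]; exact this.comp continuous_neg
    exact h3.locallyIntegrable
  intro g hg hgc
  have hg₁ : HasCompactSupport (Complex.ofRealCLM ∘ g) := hgc.comp_left rfl
  have hg₂ : ContDiff ℝ (⊤ : ℕ∞) (Complex.ofRealCLM ∘ g) := by fun_prop
  set b := hg₁.toSchwartzMap hg₂
  have hb : ∀ x, b x = (g x : ℂ) := fun x => rfl
  have h1' := congrArg (fun T => T b) (Lp.fourierInv_toTemperedDistribution_eq (h2.toLp f))
  simp only [TemperedDistribution.fourierInv_apply, Lp.toTemperedDistribution_apply,
    SchwartzMap.fourierInv_coe, smul_eq_mul] at h1'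
  simp only [Complex.real_smul, ← hb]
  rw [← h1']
  have e2 : ∀ u v : ℝ → ℂ, ∫ x, u x * 𝓕⁻ v x = ∫ x, u (-x) * 𝓕 v x := by
    intro u v
    rw [← integral_neg_eq_self]
    simp only [Real.fourierInv_eq_fourier_neg, neg_neg]
  rw [e2, integral_fourier_mul h1 (b.integrable.comp_neg)]
  apply integral_congr_ae
  filter_upwards [h2.coeFn_toLp] with x hx
  rw [hx]
  congr 1
  rw [← Real.fourierInv_eq_fourier_comp_neg]

/-- For `F ∈ L¹ ∩ L²` the function `𝓕⁻ F` is in `L²` with `L²` Fourier transform `F`. -/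
theorem memLp_fourierInv {F : ℝ → ℂ} (h1 : Integrable F) (h2 : MemLp F 2 volume) :
    MemLp (𝓕⁻ F) 2 volume :=
  (memLp_congr_ae (fourierInv_toLp_ae_eq h1 h2)).1 (Lp.memLp _)

theorem fourier_toLp_fourierInv {F : ℝ → ℂ} (h1 : Integrable F) (h2 : MemLp F 2 volume)
    (h3 : MemLp (𝓕⁻ F) 2 volume) :
    (𝓕 (h3.toLp (𝓕⁻ F)) : Lp ℂ 2 (volume : Measure ℝ)) = h2.toLp F := by
  have : h3.toLp (𝓕⁻ F) =
      (FourierTransformInv.fourierInv (h2.toLp F) : Lp ℂ 2 (volume : Measure ℝ)) := by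
    rw [← Lp.toLp_coeFn (FourierTransformInv.fourierInv (h2.toLp F) :
      Lp ℂ 2 (volume : Measure ℝ)) (Lp.memLp _)]
    exact (MemLp.toLp_eq_toLp_iff _ _).2 (fourierInv_toLp_ae_eq h1 h2).symm
  rw [this]
  exact FourierTransform.fourier_fourierInv_eq _

/-! ### The Fourier transform in the first variable -/

/-- Lebesgue measure on the cross section `(-1, 1)`. -/
abbrev sectionMeasure : Measure ℝ := volume.restrict (Ioo (-1 : ℝ) 1)

theorem stripMeasure_eq_prod : stripMeasure = (volume : Measure ℝ).prod sectionMeasure := by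
  have := Measure.prod_restrict (μ := (volume : Measure ℝ)) (ν := (volume : Measure ℝ)) univ
    (Ioo (-1 : ℝ) 1)
  rw [Measure.restrict_univ] at this
  rw [sectionMeasure, this]; rfl

theorem stripMeasure_map_swap :
    (sectionMeasure.prod (volume : Measure ℝ)).map Prod.swap = stripMeasure := by
  rw [Measure.prod_swap, stripMeasure_eq_prod]

theorem ae_ae_of_ae_strip {p : ℝ × ℝ → Prop} (h : ∀ᵐ q ∂stripMeasure, p q) :
    ∀ᵐ y ∂sectionMeasure, ∀ᵐ x : ℝ, p (x, y) := by
  rw [← stripMeasure_map_swap] at h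
  have := ae_of_ae_map measurable_swap.aemeasurable h
  exact Measure.ae_ae_of_ae_prod this

theorem lintegral_strip {f : ℝ × ℝ → ℝ≥0∞} (hf : AEMeasurable f stripMeasure) :
    ∫⁻ p, f p ∂stripMeasure = ∫⁻ y in Ioo (-1 : ℝ) 1, ∫⁻ x : ℝ, f (x, y) := by
  rw [stripMeasure_eq_prod] at hf ⊢
  exact lintegral_prod_symm _ hf

theorem lintegral_strip' {f : ℝ × ℝ → ℝ≥0∞} (hf : AEMeasurable f stripMeasure) :
    ∫⁻ p, f p ∂stripMeasure = ∫⁻ x : ℝ, ∫⁻ y in Ioo (-1 : ℝ) 1, f (x, y) := by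
  rw [stripMeasure_eq_prod] at hf ⊢
  exact lintegral_prod _ hf

theorem eLpNorm_two_sq {α E : Type*} [MeasurableSpace α] [NormedAddCommGroup E] (μ : Measure α)
    (f : α → E) : eLpNorm f 2 μ ^ 2 = ∫⁻ x, ‖f x‖ₑ ^ 2 ∂μ := by
  have := eLpNorm_nnreal_pow_eq_lintegral (f := f) (μ := μ) (p := 2) (by norm_num)
  simpa using this

theorem eLpNorm_two_le_iff {α E : Type*} [MeasurableSpace α] [NormedAddCommGroup E]
    {μ : Measure α} {f : α → E} {c : ℝ≥0∞} :
    eLpNorm f 2 μ ≤ c ↔ ∫⁻ x, ‖f x‖ₑ ^ 2 ∂μ ≤ c ^ 2 := by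
  rw [← eLpNorm_two_sq]
  exact (ENNReal.pow_le_pow_left_iff (by norm_num)).symm

theorem memLp_two_iff {α E : Type*} [MeasurableSpace α] [NormedAddCommGroup E]
    {μ : Measure α} {f : α → E} (hf : AEStronglyMeasurable f μ) :
    MemLp f 2 μ ↔ ∫⁻ x, ‖f x‖ₑ ^ 2 ∂μ < ∞ := by
  rw [← eLpNorm_two_sq, MemLp]
  simp [hf]

theorem aestronglyMeasurable_slice {f : ℝ × ℝ → ℂ} (hf : AEStronglyMeasurable f stripMeasure) :
    ∀ᵐ y ∂sectionMeasure, AEStronglyMeasurable (fun x : ℝ => f (x, y)) volume := by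
  obtain ⟨g, hg, hfg⟩ := hf
  filter_upwards [ae_ae_of_ae_strip hfg] with y hy
  exact ⟨fun x => g (x, y), hg.comp_measurable (by fun_prop), hy⟩

theorem memLp_slice {f : ℝ × ℝ → ℂ} (hf : MemLp f 2 stripMeasure) :
    ∀ᵐ y ∂sectionMeasure, MemLp (fun x : ℝ => f (x, y)) 2 volume := by
  have h := (memLp_two_iff hf.1).1 hf
  have hm : AEMeasurable (fun p => ‖f p‖ₑ ^ 2) stripMeasure := (hf.1.enorm).pow_const 2
  rw [lintegral_strip hm] at h
  have hm2 : AEMeasurable (fun y => ∫⁻ x : ℝ, ‖f (x, y)‖ₑ ^ 2) sectionMeasure := by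
    rw [stripMeasure_eq_prod] at hm
    exact hm.lintegral_prod_left'
  filter_upwards [ae_lt_top' hm2 h.ne, aestronglyMeasurable_slice hf.1] with y hy hy'
  exact (memLp_two_iff hy').2 hy

theorem integrable_slice {f : ℝ × ℝ → ℂ} (hf : Integrable f stripMeasure) :
    ∀ᵐ y ∂sectionMeasure, Integrable (fun x : ℝ => f (x, y)) volume := by
  rw [stripMeasure_eq_prod] at hf
  exact hf.prod_left_ae

/-- `F` is the Fourier transform of `f` in the first variable: for almost every `y` the slice
`F(·, y)` is the `L²` Fourier transform of the slice `f(·, y)`. -/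
def PartialFT (f F : ℝ × ℝ → ℂ) : Prop :=
  ∀ᵐ y ∂sectionMeasure, ∃ (hf : MemLp (fun x : ℝ => f (x, y)) 2 volume)
    (hF : MemLp (fun x : ℝ => F (x, y)) 2 volume),
    (𝓕 (hf.toLp (fun x : ℝ => f (x, y))) : Lp ℂ 2 (volume : Measure ℝ)) =
      hF.toLp (fun x : ℝ => F (x, y))

namespace PartialFT

variable {f F g G f' F' : ℝ × ℝ → ℂ}

theorem congr (h : PartialFT f F) (hf : f =ᵐ[stripMeasure] f') (hF : F =ᵐ[stripMeasure] F') :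
    PartialFT f' F' := by
  filter_upwards [h, ae_ae_of_ae_strip hf, ae_ae_of_ae_strip hF] with y ⟨h1, h2, h3⟩ h4 h5
  refine ⟨(memLp_congr_ae h4).1 h1, (memLp_congr_ae h5).1 h2, ?_⟩
  rw [← (MemLp.toLp_eq_toLp_iff h1 _).2 h4, ← (MemLp.toLp_eq_toLp_iff h2 _).2 h5, h3]

theorem add (h : PartialFT f F) (h' : PartialFT g G) :
    PartialFT (fun p => f p + g p) (fun p => F p + G p) := by
  filter_upwards [h, h'] with y ⟨h1, h2, h3⟩ ⟨h4, h5, h6⟩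
  refine ⟨h1.add h4, h2.add h5, ?_⟩
  have e1 : (h1.add h4).toLp _ = h1.toLp _ + h4.toLp _ := rfl
  have e2 : (h2.add h5).toLp _ = h2.toLp _ + h5.toLp _ := rfl
  refine (congrArg _ e1).trans ?_
  rw [FourierTransform.fourier_add, h3, h6, ← e2]
  rfl

/-- The partial transform commutes with multiplication by functions of the second variable. -/
theorem mul_snd (h : PartialFT f F) (c : ℝ → ℂ) :
    PartialFT (fun p => c p.2 * f p) (fun p => c p.2 * F p) := by
  filter_upwards [h] with y ⟨h1, h2, h3⟩
  refine ⟨h1.const_smul (c y), h2.const_smul (c y), ?_⟩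
  have e1 : (h1.const_smul (c y)).toLp _ = c y • h1.toLp _ := rfl
  have e2 : (h2.const_smul (c y)).toLp _ = c y • h2.toLp _ := rfl
  refine (congrArg _ e1).trans ?_
  rw [FourierTransform.fourier_smul, h3, ← e2]
  rfl

theorem const_mul (h : PartialFT f F) (c : ℂ) :
    PartialFT (fun p => c * f p) (fun p => c * F p) := h.mul_snd fun _ => c

theorem sub (h : PartialFT f F) (h' : PartialFT g G) :
    PartialFT (fun p => f p - g p) (fun p => F p - G p) := by
  have := h.add (h'.const_mul (-1))
  simpa [sub_eq_add_neg] using this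

theorem lintegral_slice_eq {y : ℝ} {hf : MemLp (fun x : ℝ => f (x, y)) 2 volume}
    {hF : MemLp (fun x : ℝ => F (x, y)) 2 volume}
    (h : (𝓕 (hf.toLp (fun x : ℝ => f (x, y))) : Lp ℂ 2 (volume : Measure ℝ)) =
      hF.toLp (fun x : ℝ => F (x, y))) :
    ∫⁻ x, ‖F (x, y)‖ₑ ^ 2 = ∫⁻ x, ‖f (x, y)‖ₑ ^ 2 := by
  rw [← eLpNorm_two_sq, ← eLpNorm_two_sq, ← Lp.enorm_toLp (hf := hF), ← Lp.enorm_toLp (hf := hf),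
    ← h]
  congr 1
  rw [← ofReal_norm, ← ofReal_norm, Lp.norm_fourier_eq]

theorem lintegral_eq (h : PartialFT f F) (hf : AEStronglyMeasurable f stripMeasure)
    (hF : AEStronglyMeasurable F stripMeasure) :
    ∫⁻ p, ‖F p‖ₑ ^ 2 ∂stripMeasure = ∫⁻ p, ‖f p‖ₑ ^ 2 ∂stripMeasure := by
  rw [lintegral_strip (hf.enorm.pow_const 2), lintegral_strip (hF.enorm.pow_const 2)]
  apply lintegral_congr_ae
  filter_upwards [h] with y ⟨h1, h2, h3⟩
  exact lintegral_slice_eq h3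

/-- Plancherel's theorem for the partial transform. -/
theorem eLpNorm_eq (h : PartialFT f F) (hf : AEStronglyMeasurable f stripMeasure)
    (hF : AEStronglyMeasurable F stripMeasure) :
    eLpNorm F 2 stripMeasure = eLpNorm f 2 stripMeasure := by
  have := h.lintegral_eq hf hF
  rw [← eLpNorm_two_sq, ← eLpNorm_two_sq] at this
  exact (ENNReal.pow_right_strictMono (n := 2) (by norm_num)).injective this

end PartialFT

theorem eq_of_eLpNorm_sub_eq_zero {f g : ℝ × ℝ → ℂ} (hf : AEStronglyMeasurable f stripMeasure)
    (hg : AEStronglyMeasurable g stripMeasure)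
    (h : eLpNorm (fun p => f p - g p) 2 stripMeasure = 0) : f =ᵐ[stripMeasure] g := by
  have h := (eLpNorm_eq_zero_iff (hf.sub hg) (by norm_num)).1 h
  filter_upwards [h] with p hp
  exact sub_eq_zero.1 hp

theorem PartialFT.unique {f F F' : ℝ × ℝ → ℂ} (h : PartialFT f F) (h' : PartialFT f F')
    (hf : AEStronglyMeasurable f stripMeasure)
    (hF : AEStronglyMeasurable F stripMeasure) (hF' : AEStronglyMeasurable F' stripMeasure) :
    F =ᵐ[stripMeasure] F' := by
  apply eq_of_eLpNorm_sub_eq_zero hF hF'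
  rw [(h.sub h').eLpNorm_eq (hf.sub hf) (hF.sub hF')]
  simp

theorem PartialFT.injective {f f' F : ℝ × ℝ → ℂ} (h : PartialFT f F) (h' : PartialFT f' F)
    (hf : AEStronglyMeasurable f stripMeasure) (hf' : AEStronglyMeasurable f' stripMeasure)
    (hF : AEStronglyMeasurable F stripMeasure) :
    f =ᵐ[stripMeasure] f' := by
  apply eq_of_eLpNorm_sub_eq_zero hf hf'
  rw [← (h.sub h').eLpNorm_eq (hf.sub hf') (hF.sub hF)]
  simp

theorem stronglyMeasurable_fourier_slice {f : ℝ × ℝ → ℂ} (hf : StronglyMeasurable f) :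
    StronglyMeasurable fun p : ℝ × ℝ => 𝓕 (fun x => f (x, p.2)) p.1 := by
  simp only [Real.fourier_real_eq]
  refine StronglyMeasurable.integral_prod_right (f := fun (p : ℝ × ℝ) (v : ℝ) =>
    Real.fourierChar (-(v * p.1)) • f (v, p.2)) ?_
  have h1 : StronglyMeasurable fun q : (ℝ × ℝ) × ℝ => f (q.2, q.1.2) :=
    hf.comp_measurable (by fun_prop)
  have h2 : Continuous fun q : (ℝ × ℝ) × ℝ => (Real.fourierChar (-(q.2 * q.1.1)) : ℂ) := by
    fun_prop
  exact h2.stronglyMeasurable.smul h1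

theorem stronglyMeasurable_fourierInv_slice {f : ℝ × ℝ → ℂ} (hf : StronglyMeasurable f) :
    StronglyMeasurable fun p : ℝ × ℝ => 𝓕⁻ (fun x => f (x, p.2)) p.1 := by
  simp only [Real.fourierInv_eq_fourier_neg]
  exact (stronglyMeasurable_fourier_slice hf).comp_measurable
    (g := fun p : ℝ × ℝ => (-p.1, p.2)) (by fun_prop)

/-- If the slices are integrable, the partial transform is given by the Fourier integral, and it is
in `L²` by Plancherel's theorem. -/
theorem PartialFT.of_integrable_slices {f : ℝ × ℝ → ℂ} (hf : StronglyMeasurable f)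
    (h2 : MemLp f 2 stripMeasure)
    (h1 : ∀ᵐ y ∂sectionMeasure, Integrable (fun x : ℝ => f (x, y)) volume) :
    PartialFT f (fun p => 𝓕 (fun x => f (x, p.2)) p.1) ∧
      MemLp (fun p : ℝ × ℝ => 𝓕 (fun x => f (x, p.2)) p.1) 2 stripMeasure := by
  have key : PartialFT f (fun p => 𝓕 (fun x => f (x, p.2)) p.1) := by
    filter_upwards [h1, memLp_slice h2] with y hy hy2
    have e := fourier_toLp_ae_eq hy hy2
    have hm := (memLp_congr_ae e).1 (Lp.memLp _)
    refine ⟨hy2, hm, ?_⟩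
    rw [← Lp.toLp_coeFn (𝓕 (hy2.toLp (fun x => f (x, y))) : Lp ℂ 2 (volume : Measure ℝ))
      (Lp.memLp _)]
    exact (MemLp.toLp_eq_toLp_iff _ _).2 e
  have hm := (stronglyMeasurable_fourier_slice hf).aestronglyMeasurable (μ := stripMeasure)
  refine ⟨key, hm, ?_⟩
  rw [key.eLpNorm_eq h2.1 hm]
  exact h2.2

theorem PartialFT.fourierInv_slices {F : ℝ × ℝ → ℂ} (hF : StronglyMeasurable F)
    (h2 : MemLp F 2 stripMeasure)
    (h1 : ∀ᵐ y ∂sectionMeasure, Integrable (fun x : ℝ => F (x, y)) volume) :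
    PartialFT (fun p => 𝓕⁻ (fun x => F (x, p.2)) p.1) F ∧
      MemLp (fun p : ℝ × ℝ => 𝓕⁻ (fun x => F (x, p.2)) p.1) 2 stripMeasure := by
  have key : PartialFT (fun p => 𝓕⁻ (fun x => F (x, p.2)) p.1) F := by
    filter_upwards [h1, memLp_slice h2] with y hy hy2
    exact ⟨memLp_fourierInv hy hy2, hy2, fourier_toLp_fourierInv hy hy2 _⟩
  have hm := (stronglyMeasurable_fourierInv_slice hF).aestronglyMeasurable (μ := stripMeasure)
  refine ⟨key, hm, ?_⟩
  rw [← key.eLpNorm_eq hm h2.1]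
  exact h2.2

theorem stronglyMeasurable_truncate {f : ℝ × ℝ → ℂ} (hf : StronglyMeasurable f) (n : ℕ) :
    StronglyMeasurable fun p : ℝ × ℝ => (Icc (-(n : ℝ)) n).indicator (fun x => f (x, p.2)) p.1 := by
  have e : (fun p : ℝ × ℝ => (Icc (-(n : ℝ)) n).indicator (fun x => f (x, p.2)) p.1) =
      ((fun p : ℝ × ℝ => p.1) ⁻¹' (Icc (-(n : ℝ)) n)).indicator f := by
    ext p; simp [indicator]
  rw [e]
  exact hf.indicator (measurable_fst measurableSet_Icc)

theorem tendsto_eLpNorm_truncate {f : ℝ × ℝ → ℂ} (hf : StronglyMeasurable f)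
    (h2 : MemLp f 2 stripMeasure) :
    Tendsto (fun n : ℕ => ∫⁻ p,
      ‖(Icc (-(n : ℝ)) n).indicator (fun x => f (x, p.2)) p.1 - f p‖ₑ ^ 2 ∂stripMeasure)
      atTop (nhds 0) := by
  have h0 : (0 : ℝ≥0∞) = ∫⁻ p, (0 : ℝ≥0∞) ∂stripMeasure := by simp
  rw [h0]
  refine tendsto_lintegral_of_dominated_convergence (fun p => ‖f p‖ₑ ^ 2) ?_ ?_ ?_ ?_
  · intro n
    exact (((stronglyMeasurable_truncate hf n).sub hf).enorm).pow_const 2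
  · intro n
    filter_upwards with p
    gcongr
    by_cases hp : p.1 ∈ Icc (-(n : ℝ)) n
    · simp [hp]
    · simp [hp]
  · exact ((memLp_two_iff h2.1).1 h2).ne
  · filter_upwards with p
    apply tendsto_const_nhds.congr'
    obtain ⟨N, hN⟩ := exists_nat_ge |p.1|
    filter_upwards [eventually_ge_atTop N] with n hn
    have : p.1 ∈ Icc (-(n : ℝ)) n := by
      rw [mem_Icc, ← abs_le]; exact hN.trans (by exact_mod_cast hn)
    simp [this]

/-- Every function in `L²` of the channel has a partial Fourier transform. It is the `L²` limit of
the transforms of the truncations to `|x| ≤ n`. -/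
theorem exists_partialFT (f : StripL2) : ∃ F : StripL2, PartialFT f F := by
  have hf := Lp.stronglyMeasurable f
  have h2 := Lp.memLp f
  set φ : ℕ → ℝ × ℝ → ℂ := fun n p => (Icc (-(n : ℝ)) n).indicator (fun x => f (x, p.2)) p.1
    with hφ
  have hφm : ∀ n, StronglyMeasurable (φ n) := stronglyMeasurable_truncate hf
  have hφ2 : ∀ n, MemLp (φ n) 2 stripMeasure := fun n =>
    h2.mono (hφm n).aestronglyMeasurable (by
      filter_upwards with p
      simp only [hφ]
      exact norm_indicator_le_norm_self _ _)
  have hφ1 : ∀ n, ∀ᵐ y ∂sectionMeasure, Integrable (fun x : ℝ => φ n (x, y)) volume := by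
    intro n
    filter_upwards [memLp_slice h2] with y hy
    have : IntegrableOn (fun x : ℝ => f (x, y)) (Icc (-(n : ℝ)) n) :=
      (hy.restrict _).integrable (by norm_num)
    exact this.integrable_indicator measurableSet_Icc
  set Φ : ℕ → ℝ × ℝ → ℂ := fun n p => 𝓕 (fun x => φ n (x, p.2)) p.1 with hΦ
  have hP : ∀ n, PartialFT (φ n) (Φ n) ∧ MemLp (Φ n) 2 stripMeasure := fun n =>
    PartialFT.of_integrable_slices (hφm n) (hφ2 n) (hφ1 n)
  have hΦm : ∀ n, StronglyMeasurable (Φ n) := fun n => stronglyMeasurable_fourier_slice (hφm n)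
  have hlim := tendsto_eLpNorm_truncate hf h2
  have hlim' : Tendsto (fun n => eLpNorm (fun p => φ n p - f p) 2 stripMeasure)
      atTop (nhds 0) := by
    have : Tendsto (fun n => (eLpNorm (fun p => φ n p - f p) 2 stripMeasure ^ 2) ^ (1/2 : ℝ))
      atTop (nhds ((0 : ℝ≥0∞) ^ (1/2 : ℝ))) := by
      simp_rw [eLpNorm_two_sq]
      exact hlim.ennrpow_const _
    simp_rw [← ENNReal.rpow_natCast, ← ENNReal.rpow_mul] at this
    simpa using this
  have hT : Tendsto (fun n => (hφ2 n).toLp (φ n)) atTop (nhds f) := by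
    rw [Lp.tendsto_Lp_iff_tendsto_eLpNorm']
    refine hlim'.congr fun n => eLpNorm_congr_ae ?_
    filter_upwards [(hφ2 n).coeFn_toLp] with p hp
    simp [hp]
  -- By Plancherel's theorem the transforms of the truncations form a Cauchy sequence.
  have hC : CauchySeq (fun n => (hP n).2.toLp (Φ n)) := by
    refine Metric.cauchySeq_iff'.2 fun ε hε => ?_
    obtain ⟨N, hN⟩ := Metric.cauchySeq_iff'.1 hT.cauchySeq ε hε
    refine ⟨N, fun n hn => ?_⟩
    have := hN n hn
    rw [Lp.dist_def] at this ⊢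
    have e1 : eLpNorm (⇑((hP n).2.toLp (Φ n)) - ⇑((hP N).2.toLp (Φ N))) 2 stripMeasure =
        eLpNorm (fun p => Φ n p - Φ N p) 2 stripMeasure := by
      apply eLpNorm_congr_ae
      filter_upwards [(hP n).2.coeFn_toLp, (hP N).2.coeFn_toLp] with p h h'
      simp [h, h']
    have e2 : eLpNorm (⇑((hφ2 n).toLp (φ n)) - ⇑((hφ2 N).toLp (φ N))) 2 stripMeasure =
        eLpNorm (fun p => φ n p - φ N p) 2 stripMeasure := by
      apply eLpNorm_congr_ae
      filter_upwards [(hφ2 n).coeFn_toLp, (hφ2 N).coeFn_toLp] with p h h'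
      simp [h, h']
    rw [e1, ((hP n).1.sub (hP N).1).eLpNorm_eq ((hφ2 n).1.sub (hφ2 N).1)
      ((hP n).2.1.sub (hP N).2.1), ← e2]
    exact this
  obtain ⟨F, hF⟩ := cauchySeq_tendsto_of_complete hC
  have hFm := Lp.stronglyMeasurable F
  refine ⟨F, ?_⟩
  have hlimF : Tendsto (fun n => ∫⁻ p, ‖Φ n p - F p‖ₑ ^ 2 ∂stripMeasure)
      atTop (nhds 0) := by
    rw [Lp.tendsto_Lp_iff_tendsto_eLpNorm'] at hF
    have : Tendsto (fun n => (eLpNorm (⇑((hP n).2.toLp (Φ n)) - ⇑F) 2 stripMeasure) ^ 2)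
      atTop (nhds (0 ^ 2)) :=
      ((ENNReal.continuous_pow 2).tendsto 0).comp hF
    simp_rw [eLpNorm_two_sq] at this
    rw [zero_pow two_ne_zero] at this
    refine this.congr fun n => lintegral_congr_ae ?_
    filter_upwards [(hP n).2.coeFn_toLp] with p hp
    simp [hp]
  -- slicewise distances; their sum tends to `0` in mean, so its lower limit vanishes a.e.
  set a : ℕ → ℝ → ℝ≥0∞ := fun n y =>
    (∫⁻ x : ℝ, ‖φ n (x, y) - f (x, y)‖ₑ ^ 2) + ∫⁻ x : ℝ, ‖Φ n (x, y) - F (x, y)‖ₑ ^ 2 with ha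
  have hm1 : ∀ n, Measurable fun p : ℝ × ℝ => ‖φ n p - f p‖ₑ ^ 2 := fun n =>
    (((hφm n).sub hf).enorm).pow_const 2
  have hm2 : ∀ n, Measurable fun p : ℝ × ℝ => ‖Φ n p - F p‖ₑ ^ 2 := fun n =>
    (((hΦm n).sub hFm).enorm).pow_const 2
  have ham : ∀ n, Measurable (a n) := fun n =>
    ((hm1 n).lintegral_prod_left').add ((hm2 n).lintegral_prod_left')
  have hai : Tendsto (fun n => ∫⁻ y, a n y ∂sectionMeasure) atTop (nhds 0) := by
    have e : ∀ n, ∫⁻ y, a n y ∂sectionMeasure = (∫⁻ p, ‖φ n p - f p‖ₑ ^ 2 ∂stripMeasure) +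
        ∫⁻ p, ‖Φ n p - F p‖ₑ ^ 2 ∂stripMeasure := by
      intro n
      rw [lintegral_strip (hm1 n).aemeasurable, lintegral_strip (hm2 n).aemeasurable]
      exact lintegral_add_left ((hm1 n).lintegral_prod_left') _
    simp_rw [e]
    simpa using hlim.add hlimF
  have hliminf : ∀ᵐ y ∂sectionMeasure, liminf (fun n => a n y) atTop = 0 := by
    have h1 := lintegral_liminf_le (μ := sectionMeasure) (u := atTop) ham
    rw [hai.liminf_eq] at h1
    exact (lintegral_eq_zero_iff (Measurable.liminf ham)).1 (le_antisymm h1 bot_le)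
  have hslices : ∀ᵐ y ∂sectionMeasure, ∀ n, ∃ (h1 : MemLp (fun x : ℝ => φ n (x, y)) 2 volume)
    (h2 : MemLp (fun x : ℝ => Φ n (x, y)) 2 volume),
    (𝓕 (h1.toLp (fun x : ℝ => φ n (x, y))) : Lp ℂ 2 (volume : Measure ℝ)) =
      h2.toLp (fun x : ℝ => Φ n (x, y)) := ae_all_iff.2 fun n => (hP n).1
  filter_upwards [hliminf, hslices, memLp_slice h2, memLp_slice (Lp.memLp F)] with y hy hs h3 h4
  refine ⟨h3, h4, ?_⟩
  by_contra hne
  have hd : 0 < edist (𝓕 (h3.toLp (fun x : ℝ => f (x, y))) : Lp ℂ 2 (volume : Measure ℝ))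
      (h4.toLp (fun x : ℝ => F (x, y))) := edist_pos.2 hne
  set D := edist (𝓕 (h3.toLp (fun x : ℝ => f (x, y))) : Lp ℂ 2 (volume : Measure ℝ))
      (h4.toLp (fun x : ℝ => F (x, y))) with hD
  have hle : ∀ n, D ^ 2 ≤ 2 * a n y := by
    intro n
    obtain ⟨h5, h6, h7⟩ := hs n
    have t1 : D ≤ edist (𝓕 (h3.toLp (fun x : ℝ => f (x, y))) : Lp ℂ 2 (volume : Measure ℝ))
        (𝓕 (h5.toLp (fun x : ℝ => φ n (x, y)))) + edist (h6.toLp (fun x : ℝ => Φ n (x, y)))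
        (h4.toLp (fun x : ℝ => F (x, y))) := by
      rw [← h7]; exact edist_triangle _ _ _
    have t2 : edist (𝓕 (h3.toLp (fun x : ℝ => f (x, y))) : Lp ℂ 2 (volume : Measure ℝ))
        (𝓕 (h5.toLp (fun x : ℝ => φ n (x, y)))) =
        eLpNorm (fun x : ℝ => φ n (x, y) - f (x, y)) 2 volume := by
      rw [edist_comm]
      refine ((Lp.fourierTransformₗᵢ ℝ ℂ).isometry.edist_eq _ _).trans ?_
      rw [Lp.edist_toLp_toLp]; rfl
    have t3 : edist (h6.toLp (fun x : ℝ => Φ n (x, y))) (h4.toLp (fun x : ℝ => F (x, y))) =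
        eLpNorm (fun x : ℝ => Φ n (x, y) - F (x, y)) 2 volume := by
      rw [Lp.edist_toLp_toLp]; rfl
    rw [t2, t3] at t1
    calc D ^ 2 ≤ _ := pow_le_pow_left' t1 2
      _ ≤ 2 * (eLpNorm (fun x : ℝ => φ n (x, y) - f (x, y)) 2 volume ^ 2 +
          eLpNorm (fun x : ℝ => Φ n (x, y) - F (x, y)) 2 volume ^ 2) := by
        have := ENNReal.rpow_add_le_mul_rpow_add_rpow
          (eLpNorm (fun x : ℝ => φ n (x, y) - f (x, y)) 2 volume)
          (eLpNorm (fun x : ℝ => Φ n (x, y) - F (x, y)) 2 volume) (p := 2) (by norm_num)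
        norm_num at this
        exact_mod_cast this
      _ = _ := by rw [eLpNorm_two_sq, eLpNorm_two_sq]
  have hle2 : D ^ 2 / 2 ≤ liminf (fun n => a n y) atTop := by
    refine le_liminf_of_le (by isBoundedDefault) (Eventually.of_forall fun n => ?_)
    rw [ENNReal.div_le_iff (by norm_num) (by norm_num), mul_comm]
    exact hle n
  rw [hy] at hle2
  have : D ^ 2 / 2 ≠ 0 := by simp [hd.ne']
  exact this (le_antisymm hle2 bot_le)

/-- The Fourier transform in the first variable as an isometry of `L²` of the channel. -/
def partialFourier : StripL2 →ₗᵢ[ℂ] StripL2 where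
  toFun f := (exists_partialFT f).choose
  map_add' f g := by
    apply Lp.ext
    refine PartialFT.unique (f := ⇑(f + g)) (exists_partialFT (f + g)).choose_spec ?_
      (Lp.aestronglyMeasurable _) (Lp.aestronglyMeasurable _) (Lp.aestronglyMeasurable _)
    refine ((exists_partialFT f).choose_spec.add (exists_partialFT g).choose_spec).congr ?_ ?_
    · exact (Lp.coeFn_add f g).symm
    · exact (Lp.coeFn_add _ _).symm
  map_smul' c f := by
    apply Lp.ext
    refine PartialFT.unique (f := ⇑(c • f)) (exists_partialFT (c • f)).choose_spec ?_
      (Lp.aestronglyMeasurable _) (Lp.aestronglyMeasurable _) (Lp.aestronglyMeasurable _)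
    refine ((exists_partialFT f).choose_spec.const_mul c).congr ?_ ?_
    · exact (Lp.coeFn_smul c f).symm
    · exact (Lp.coeFn_smul c (exists_partialFT f).choose).symm
  norm_map' f := by
    have := (exists_partialFT f).choose_spec.eLpNorm_eq
      (Lp.aestronglyMeasurable _) (Lp.aestronglyMeasurable _)
    rw [Lp.norm_def, Lp.norm_def]
    exact congrArg _ this

theorem partialFT_partialFourier (f : StripL2) : PartialFT f (partialFourier f) :=
  (exists_partialFT f).choose_spec

theorem PartialFT.partialFourier_ae_eq {f : StripL2} {F : ℝ × ℝ → ℂ} (h : PartialFT f F)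
    (hF : AEStronglyMeasurable F stripMeasure) : partialFourier f =ᵐ[stripMeasure] F :=
  (partialFT_partialFourier f).unique h (Lp.aestronglyMeasurable _) (Lp.aestronglyMeasurable _) hF

/-! ### Weak derivatives and test functions -/

instance : IsLocallyFiniteMeasure stripMeasure := by
  unfold stripMeasure; infer_instance

theorem isOpen_strip : IsOpen strip := isOpen_univ.prod isOpen_Ioo

/-- A function that is integrated to zero against all test functions vanishes. -/
theorem ae_eq_zero_of_test {Q : ℝ × ℝ → ℂ} (hQ : LocallyIntegrable Q stripMeasure)
    (h : ∀ θ : ℝ × ℝ → ℝ, ContDiff ℝ (⊤ : ℕ∞) θ → HasCompactSupport θ → tsupport θ ⊆ strip →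
      ∫ p, Q p * (θ p : ℂ) ∂stripMeasure = 0) : ∀ᵐ p ∂stripMeasure, Q p = 0 := by
  have := isOpen_strip.ae_eq_zero_of_integral_contDiff_smul_eq_zero (hQ.locallyIntegrableOn strip)
    (fun θ h1 h2 h3 => by
      simpa only [Complex.real_smul, mul_comm] using h θ h1 h2 h3)
  have hmem : ∀ᵐ p ∂stripMeasure, p ∈ strip := ae_restrict_mem isOpen_strip.measurableSet
  filter_upwards [this, hmem] with p h1 h2 using h1 h2

theorem integrable_mul_test {f : ℝ × ℝ → ℂ} (hf : LocallyIntegrable f stripMeasure)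
    {θ : ℝ × ℝ → ℝ} (hc : Continuous θ) (hs : HasCompactSupport θ) :
    Integrable (fun p => f p * (θ p : ℂ)) stripMeasure := by
  have := hf.integrable_smul_left_of_hasCompactSupport hc hs
  simpa only [Complex.real_smul, mul_comm] using this

theorem StripL2.locallyIntegrable (f : StripL2) : LocallyIntegrable f stripMeasure :=
  (Lp.memLp f).locallyIntegrable (by norm_num)

theorem HasWeakPartial.unique {a b : ℕ} {f g g' : StripL2} (h : HasWeakPartial a b f g)
    (h' : HasWeakPartial a b f g') : g = g' := by
  apply Lp.ext
  have := ae_eq_zero_of_test (Q := fun p => g p - g' p)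
    (g.locallyIntegrable.sub g'.locallyIntegrable) (fun θ h1 h2 h3 => by
      have e1 := h θ h1 h2 h3
      have e2 := h' θ h1 h2 h3
      rw [e1] at e2
      have e3 := mul_left_cancel₀ (pow_ne_zero (a + b) (by norm_num : (-1 : ℂ) ≠ 0)) e2
      simp only [sub_mul]
      rw [integral_sub (integrable_mul_test g.locallyIntegrable h1.continuous h2)
        (integrable_mul_test g'.locallyIntegrable h1.continuous h2), e3, sub_self])
  filter_upwards [this] with p hp using sub_eq_zero.1 hp

theorem WeaklyDiff.hasWeakPartial {a b : ℕ} {f : StripL2} (h : WeaklyDiff a b f) :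
    HasWeakPartial a b f (weakPartial a b f) := by
  unfold weakPartial
  rw [dif_pos h]
  exact h.choose_spec

theorem HasWeakPartial.weakPartial_eq {a b : ℕ} {f g : StripL2} (h : HasWeakPartial a b f g) :
    weakPartial a b f = g :=
  (WeaklyDiff.hasWeakPartial ⟨g, h⟩).unique h

/-- The product identity for weak derivatives: integration against `α(x) γ(y)`. -/
theorem HasWeakPartial.product {a b : ℕ} {f g : StripL2} (h : HasWeakPartial a b f g)
    {α γ : ℝ → ℝ} (hα : ContDiff ℝ (⊤ : ℕ∞) α) (hα' : HasCompactSupport α)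
    (hγ : ContDiff ℝ (⊤ : ℕ∞) γ) (hγ' : HasCompactSupport γ) (hγs : tsupport γ ⊆ Ioo (-1) 1) :
    ∫ p, f p * ((iteratedDeriv a α p.1 * iteratedDeriv b γ p.2 : ℝ) : ℂ) ∂stripMeasure =
      (-1) ^ (a + b) * ∫ p, g p * ((α p.1 * γ p.2 : ℝ) : ℂ) ∂stripMeasure := by
  have hsupp : tsupport (fun p : ℝ × ℝ => α p.1 * γ p.2) ⊆ tsupport α ×ˢ tsupport γ := by
    apply closure_minimal _ ((isClosed_tsupport α).prod (isClosed_tsupport γ))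
    intro p hp
    simp only [Function.mem_support, ne_eq, mul_eq_zero, not_or] at hp
    exact ⟨subset_tsupport _ hp.1, subset_tsupport _ hp.2⟩
  have := h (fun p => α p.1 * γ p.2) ((hα.comp contDiff_fst).mul (hγ.comp contDiff_snd))
    (HasCompactSupport.of_support_subset_isCompact (hα'.isCompact.prod hγ'.isCompact)
      ((subset_tsupport _).trans hsupp))
    (fun p hp => ⟨mem_univ _, hγs (hsupp hp).2⟩)
  rw [← this]
  apply integral_congr_ae
  filter_upwards with p
  congr 2
  unfold classicalPartial
  have e1 : (fun x => iteratedDeriv b (fun y => α x * γ y) p.2) =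
      fun x => iteratedDeriv b γ p.2 * α x := by
    ext x
    rw [iteratedDeriv_const_mul_field, mul_comm]
  simp only []
  rw [e1, iteratedDeriv_const_mul_field, mul_comm]

/-- Products `α(x) γ(y)` of test functions determine a function on the channel. -/
theorem ae_eq_zero_of_product_test {Q : ℝ × ℝ → ℂ}
    (hQ : ∀ R : ℝ, IntegrableOn Q (Icc (-R) R ×ˢ univ) stripMeasure)
    (h : ∀ α γ : ℝ → ℝ, ContDiff ℝ (⊤ : ℕ∞) α → HasCompactSupport α → ContDiff ℝ (⊤ : ℕ∞) γ →
      HasCompactSupport γ → tsupport γ ⊆ Ioo (-1) 1 →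
      ∫ p, Q p * ((α p.1 * γ p.2 : ℝ) : ℂ) ∂stripMeasure = 0) :
    ∀ᵐ p ∂stripMeasure, Q p = 0 := by
  -- integrability against bounded functions supported in a bounded range of `x`
  have hint : ∀ (R : ℝ) (w : ℝ × ℝ → ℂ), Measurable w → (∃ C, ∀ p, ‖w p‖ ≤ C) →
      (∀ p, p.1 ∉ Icc (-R) R → w p = 0) → Integrable (fun p => Q p * w p) stripMeasure := by
    intro R w hw ⟨C, hC⟩ h0
    have h1 : Integrable (fun p => w p * (Icc (-R) R ×ˢ univ).indicator Q p) stripMeasure :=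
      ((hQ R).integrable_indicator (measurableSet_Icc.prod MeasurableSet.univ)).bdd_mul
        hw.aestronglyMeasurable (Eventually.of_forall hC)
    refine h1.congr (Eventually.of_forall fun p => ?_)
    by_cases hp : p.1 ∈ Icc (-R) R
    · simp only [indicator, mem_prod, hp, mem_univ, and_self, if_true]; ring
    · simp [h0 p hp]
  have hbd : ∀ α : ℝ → ℝ, Continuous α → HasCompactSupport α →
      (∃ C, ∀ x, ‖α x‖ ≤ C) ∧ ∃ R, ∀ x, x ∉ Icc (-R) R → α x = 0 := by
    intro α hα hα'
    refine ⟨hα'.exists_bound_of_continuous hα, ?_⟩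
    obtain ⟨R, hR⟩ := hα'.isCompact.isBounded.subset_closedBall 0
    refine ⟨R, fun x hx => ?_⟩
    by_contra hne
    have := hR (subset_tsupport _ hne)
    rw [Metric.mem_closedBall, dist_zero_right, Real.norm_eq_abs, abs_le] at this
    exact hx this
  have hQ1 : ∀ α : ℝ → ℝ, ContDiff ℝ (⊤ : ℕ∞) α → HasCompactSupport α →
      ∀ᵐ y ∂sectionMeasure, ∫ x, Q (x, y) * (α x : ℂ) = 0 := by
    intro α hα hα'
    obtain ⟨⟨C, hC⟩, R, hR⟩ := hbd α hα.continuous hα'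
    have hI : Integrable (fun p => Q p * (α p.1 : ℂ)) stripMeasure :=
      hint R (fun p => (α p.1 : ℂ)) (by
        have := hα.continuous.measurable
        fun_prop) ⟨C, fun p => by simpa using hC p.1⟩ (fun p hp => by simp [hR _ hp])
    rw [stripMeasure_eq_prod] at hI
    have hI2 : Integrable (fun y => ∫ x, Q (x, y) * (α x : ℂ)) sectionMeasure :=
      hI.integral_prod_right
    have := isOpen_Ioo.ae_eq_zero_of_integral_contDiff_smul_eq_zero
      (U := Ioo (-1 : ℝ) 1) (hI2.locallyIntegrable.locallyIntegrableOn _) (fun γ hγ hγ' hγs => by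
        have e := h α γ hα hα' hγ hγ' hγs
        rw [stripMeasure_eq_prod, integral_prod_symm] at e
        · rw [← e]
          apply integral_congr_ae
          filter_upwards with y
          rw [Complex.real_smul, ← integral_const_mul]
          congr 1; ext x; push_cast; ring
        · rw [← stripMeasure_eq_prod]
          obtain ⟨⟨C', hC'⟩, -⟩ := hbd γ hγ.continuous hγ'
          have m1 := hα.continuous.measurable
          have m2 := hγ.continuous.measurable
          refine hint R _ (by fun_prop) ⟨C * C', fun p => ?_⟩ (fun p hp => by simp [hR _ hp])
          rw [Complex.norm_real, norm_mul]
          exact mul_le_mul (hC _) (hC' _) (norm_nonneg _) ((norm_nonneg _).trans (hC p.1)))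
    filter_upwards [this, ae_restrict_mem measurableSet_Ioo] with y h1 h2 using h1 h2
  have hrect : ∀ (R : ℝ) (A S : Set ℝ), MeasurableSet A → MeasurableSet S →
      ∫ p in A ×ˢ S, (Icc (-R) R ×ˢ univ).indicator Q p ∂stripMeasure = 0 := by
    intro R A S hA hS
    have hIR : Integrable ((Icc (-R) R ×ˢ univ).indicator Q) stripMeasure :=
      (hQ R).integrable_indicator (measurableSet_Icc.prod MeasurableSet.univ)
    have hQ2 : ∀ᵐ x : ℝ, ∫ y in S, Q (x, y) ∂sectionMeasure = 0 := by
      have hloc : LocallyIntegrable (fun x => ∫ y in S, Q (x, y) ∂sectionMeasure) volume := by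
        rw [locallyIntegrable_iff]
        intro K hK
        obtain ⟨r, hr⟩ := hK.isBounded.subset_closedBall 0
        have hr' : K ⊆ Icc (-r) r := by
          rw [Real.closedBall_eq_Icc] at hr; simpa using hr
        have h1 : Integrable (fun p => Q p * ((Icc (-r) r ×ˢ S).indicator 1 p : ℂ)) stripMeasure :=
          hint r _ ((measurable_const).indicator (measurableSet_Icc.prod hS)) ⟨1, fun p => by
            by_cases hp : p ∈ Icc (-r) r ×ˢ S <;> simp [hp]⟩ (fun p hp => by
              rw [indicator_of_notMem]; exact fun h => hp h.1)
        rw [stripMeasure_eq_prod] at h1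
        have h2 := h1.integral_prod_left
        have h3 : IntegrableOn (fun x => ∫ y, Q (x, y) * ((Icc (-r) r ×ˢ S).indicator 1 (x, y) : ℂ)
          ∂sectionMeasure) K := h2.integrableOn
        refine h3.congr_fun_ae ?_
        filter_upwards [ae_restrict_mem hK.measurableSet] with x hx
        rw [← integral_indicator hS]
        congr 1; ext y
        by_cases hy : y ∈ S <;> simp [hr' hx, hy, indicator]
      refine ae_eq_zero_of_integral_contDiff_smul_eq_zero hloc (fun α hα hα' => ?_)
      obtain ⟨⟨C, hC⟩, r, hr⟩ := hbd α hα.continuous hα'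
      have mα := hα.continuous.measurable
      have hI : Integrable (fun p => Q p * ((α p.1 : ℂ) * (S.indicator 1 p.2 : ℂ)))
          stripMeasure := by
        refine hint r _ ?_ ⟨C, fun p => ?_⟩ (fun p hp => by simp [hr _ hp])
        · have : Measurable fun p : ℝ × ℝ => (S.indicator 1 p.2 : ℂ) :=
            (measurable_const.indicator hS).comp measurable_snd
          fun_prop
        · by_cases hp : p.2 ∈ S
          · simpa [hp] using hC p.1
          · simpa [hp] using (norm_nonneg _).trans (hC p.1)
      have e1 : ∫ p, Q p * ((α p.1 : ℂ) * (S.indicator 1 p.2 : ℂ)) ∂stripMeasure = 0 := by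
        rw [stripMeasure_eq_prod] at hI ⊢
        rw [integral_prod_symm _ hI]
        refine integral_eq_zero_of_ae ?_
        filter_upwards [hQ1 α hα hα'] with y hy
        simp only [← mul_assoc]
        rw [integral_mul_const, hy, zero_mul]; rfl
      rw [← e1]
      rw [stripMeasure_eq_prod] at hI ⊢
      rw [integral_prod _ hI]
      congr 1; ext x
      rw [← integral_indicator hS, Complex.real_smul, ← integral_const_mul]
      congr 1; ext y
      by_cases hy : y ∈ S <;> simp [hy, mul_comm]
    rw [stripMeasure_eq_prod] at hIR ⊢
    rw [setIntegral_prod _ hIR.integrableOn]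
    refine integral_eq_zero_of_ae ?_
    filter_upwards [ae_restrict_of_ae hQ2] with x hx
    by_cases hxR : x ∈ Icc (-R) R
    · rw [Pi.zero_apply, ← hx]
      congr 1; ext y; simp only [indicator, mem_prod, hxR, mem_univ, and_self, if_true]
    · simp only [indicator, mem_prod, hxR, mem_univ, and_true, if_false]
      simp
  have hall : ∀ (n : ℕ), ∀ᵐ p ∂stripMeasure, (Icc (-(n : ℝ)) n ×ˢ univ).indicator Q p = 0 := by
    intro n
    have hIR : Integrable ((Icc (-(n : ℝ)) n ×ˢ univ).indicator Q) stripMeasure :=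
      (hQ n).integrable_indicator (measurableSet_Icc.prod MeasurableSet.univ)
    have hset : ∀ s : Set (ℝ × ℝ), MeasurableSet s →
        ∫ p in s, (Icc (-(n : ℝ)) n ×ˢ univ).indicator Q p ∂stripMeasure = 0 := by
      intro s hs
      induction s, hs using MeasurableSpace.induction_on_inter
        (s := image2 (· ×ˢ ·) {s : Set ℝ | MeasurableSet s} {t : Set ℝ | MeasurableSet t})
        generateFrom_prod.symm isPiSystem_prod with
      | empty => simp
      | basic t ht =>
        obtain ⟨A, hA, S, hS, rfl⟩ := ht
        exact hrect n A S hA hS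
      | compl t ht ih =>
        have := integral_add_compl ht hIR
        rw [ih, zero_add] at this
        rw [this]
        have := hrect n univ univ MeasurableSet.univ MeasurableSet.univ
        rwa [univ_prod_univ, Measure.restrict_univ] at this
      | iUnion t hd ht ih =>
        rw [integral_iUnion ht hd hIR.integrableOn]
        simp only [ih, tsum_zero]
    exact hIR.ae_eq_zero_of_forall_setIntegral_eq_zero fun s hs _ => hset s hs
  filter_upwards [ae_all_iff.2 hall] with p hp
  obtain ⟨n, hn⟩ := exists_nat_ge |p.1|
  have := hp n
  rwa [indicator_of_mem] at this
  exact ⟨abs_le.1 hn, mem_univ _⟩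

/-! ### Weak derivatives in `x` as multipliers -/

/-- Products `a(x) γ(y)` with `a ∈ L²` are admissible test functions against `L²`. -/
theorem memLp_fst_mul_snd {a γ : ℝ → ℝ} (ha : MemLp a 2 volume) (hγ : Continuous γ)
    (hγ' : HasCompactSupport γ) :
    MemLp (fun p : ℝ × ℝ => a p.1 * γ p.2) 2 stripMeasure := by
  obtain ⟨C, hC⟩ := hγ'.exists_bound_of_continuous hγ
  have h1 : MemLp (fun p : ℝ × ℝ => a p.1) 2 stripMeasure := by
    rw [stripMeasure_eq_prod]; exact ha.comp_fst _
  have := hγ.measurable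
  refine (h1.const_mul C).of_le ?_ ?_
  · exact h1.1.mul (by fun_prop : Measurable fun p : ℝ × ℝ => γ p.2).aestronglyMeasurable
  · filter_upwards with p
    rw [norm_mul, norm_mul, mul_comm]
    gcongr
    exact (hC p.2).trans (le_abs_self C)

theorem integrable_mul_of_memLp_two {f : ℝ × ℝ → ℂ} (hf : MemLp f 2 stripMeasure)
    {w : ℝ × ℝ → ℝ} (hw : MemLp w 2 stripMeasure) :
    Integrable (fun p => f p * ((w p : ℝ) : ℂ)) stripMeasure :=
  hf.integrable_mul (q := 2) hw.ofReal

/-- The defining identity of the weak derivative `∂_x` extends from compactly supported `α(x)` to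
smooth `α ∈ H¹(ℝ)`. -/
theorem weak_dx_extend {f g : ℝ × ℝ → ℂ} (hf : MemLp f 2 stripMeasure)
    (hg : MemLp g 2 stripMeasure) {γ : ℝ → ℝ} (hγ : ContDiff ℝ (⊤ : ℕ∞) γ)
    (hγ' : HasCompactSupport γ)
    (h : ∀ α : ℝ → ℝ, ContDiff ℝ (⊤ : ℕ∞) α → HasCompactSupport α →
      ∫ p, f p * ((deriv α p.1 * γ p.2 : ℝ) : ℂ) ∂stripMeasure =
        - ∫ p, g p * ((α p.1 * γ p.2 : ℝ) : ℂ) ∂stripMeasure)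
    {a : ℝ → ℝ} (ha : ContDiff ℝ (⊤ : ℕ∞) a) (ha1 : MemLp a 2 volume)
    (ha2 : MemLp (deriv a) 2 volume) :
    ∫ p, f p * ((deriv a p.1 * γ p.2 : ℝ) : ℂ) ∂stripMeasure =
      - ∫ p, g p * ((a p.1 * γ p.2 : ℝ) : ℂ) ∂stripMeasure := by
  obtain ⟨η, hηs, hηc, hη1, hle⟩ : ∃ η : ℝ → ℝ, ContDiff ℝ (⊤ : ℕ∞) η ∧ HasCompactSupport η ∧
      (∀ z ∈ Metric.closedBall (0 : ℝ) 1, η z = 1) ∧ ∀ z, |η z| ≤ 1 := by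
    let φ : ContDiffBump (0 : ℝ) := ⟨1, 2, by norm_num, by norm_num⟩
    exact ⟨φ, φ.contDiff, φ.hasCompactSupport, fun z hz => φ.one_of_mem_closedBall hz,
      fun z => by rw [abs_of_nonneg φ.nonneg]; exact φ.le_one⟩
  obtain ⟨C, hC⟩ : ∃ C, ∀ x, ‖deriv η x‖ ≤ C :=
    hηc.deriv.exists_bound_of_continuous
      (hηs.continuous_deriv (by exact_mod_cast le_top))
  have hC0 : 0 ≤ C := (norm_nonneg _).trans (hC 0)
  set e : ℕ → ℝ := fun n => ((n : ℝ) + 1)⁻¹ with he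
  have he0 : ∀ n, 0 < e n := fun n => by positivity
  have he1 : ∀ n, e n ≤ 1 := fun n => inv_le_one_of_one_le₀ (by simp)
  set α : ℕ → ℝ → ℝ := fun n x => η (e n * x) * a x with hα
  have hαs : ∀ n, ContDiff ℝ (⊤ : ℕ∞) (α n) := fun n =>
    (hηs.comp (contDiff_const.mul contDiff_id)).mul ha
  have hαc : ∀ n, HasCompactSupport (α n) := fun n =>
    (hηc.comp_smul (he0 n).ne').mul_right
  have hder : ∀ n x, deriv (α n) x = e n * deriv η (e n * x) * a x + η (e n * x) * deriv a x := by
    intro n x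
    have h1 : HasDerivAt (fun x => η (e n * x)) (deriv η (e n * x) * (e n * 1)) x :=
      HasDerivAt.comp x ((hηs.differentiable (by simp)).differentiableAt.hasDerivAt)
        ((hasDerivAt_id x).const_mul (e n))
    have h2 := h1.mul ((ha.differentiable (by simp)).differentiableAt.hasDerivAt (x := x))
    rw [show α n = (fun x => η (e n * x)) * a from rfl, h2.deriv]
    ring
  have hηev : ∀ x : ℝ, ∀ᶠ n in atTop, η =ᶠ[nhds (e n * x)] fun _ => 1 := by
    intro x
    have : Tendsto (fun n : ℕ => e n * x) atTop (nhds (0 * x)) :=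
      (tendsto_inv_atTop_zero.comp (tendsto_atTop_add_const_right _ _
        tendsto_natCast_atTop_atTop)).mul_const x
    rw [zero_mul] at this
    have h2 := this.eventually (Metric.ball_mem_nhds 0 (by norm_num : (0 : ℝ) < 1))
    filter_upwards [h2] with n hn
    filter_upwards [Metric.isOpen_ball.mem_nhds hn] with z hz
    exact hη1 _ (Metric.ball_subset_closedBall hz)
  have mγ := hγ.continuous.measurable
  have hw1 := memLp_fst_mul_snd ha1 hγ.continuous hγ'
  have hw2 := memLp_fst_mul_snd ha2 hγ.continuous hγ'
  have i1 : Integrable (fun p => ‖f p‖ * (C * ‖a p.1 * γ p.2‖ + ‖deriv a p.1 * γ p.2‖))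
      stripMeasure :=
    hf.norm.integrable_mul (q := 2) ((hw1.norm.const_mul C).add hw2.norm)
  have i2 : Integrable (fun p => ‖g p‖ * ‖a p.1 * γ p.2‖) stripMeasure :=
    hg.norm.integrable_mul (q := 2) hw1.norm
  have l1 : Tendsto (fun n => ∫ p, f p * ((deriv (α n) p.1 * γ p.2 : ℝ) : ℂ) ∂stripMeasure)
      atTop (nhds (∫ p, f p * ((deriv a p.1 * γ p.2 : ℝ) : ℂ) ∂stripMeasure)) := by
    refine tendsto_integral_of_dominated_convergence _ (fun n => ?_) i1 (fun n => ?_) ?_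
    · have := ((hαs n).continuous_deriv (by exact_mod_cast le_top)).measurable
      exact hf.1.mul (by fun_prop : Measurable fun p : ℝ × ℝ =>
        ((deriv (α n) p.1 * γ p.2 : ℝ) : ℂ)).aestronglyMeasurable
    · filter_upwards with p
      rw [norm_mul, Complex.norm_real]
      gcongr
      rw [hder, add_mul]
      refine (norm_add_le _ _).trans ?_
      simp only [norm_mul, Real.norm_eq_abs, abs_of_pos (he0 n)]
      have h1 : e n * |deriv η (e n * p.1)| ≤ 1 * C :=
        mul_le_mul (he1 n) (hC _) (abs_nonneg _) zero_le_one
      have h2 := hle (e n * p.1)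
      have h3 : e n * |deriv η (e n * p.1)| * |a p.1| * |γ p.2| ≤ 1 * C * |a p.1| * |γ p.2| := by
        gcongr
      have h4 : |η (e n * p.1)| * |deriv a p.1| * |γ p.2| ≤ 1 * |deriv a p.1| * |γ p.2| := by
        gcongr
      linarith
    · filter_upwards with p
      apply tendsto_const_nhds.congr'
      filter_upwards [hηev p.1] with n hn
      rw [hder, hn.deriv_eq, hn.eq_of_nhds]
      simp
  have l2 : Tendsto (fun n => ∫ p, g p * ((α n p.1 * γ p.2 : ℝ) : ℂ) ∂stripMeasure)
      atTop (nhds (∫ p, g p * ((a p.1 * γ p.2 : ℝ) : ℂ) ∂stripMeasure)) := by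
    refine tendsto_integral_of_dominated_convergence _ (fun n => ?_) i2 (fun n => ?_) ?_
    · have := (hαs n).continuous.measurable
      exact hg.1.mul (by fun_prop : Measurable fun p : ℝ × ℝ =>
        ((α n p.1 * γ p.2 : ℝ) : ℂ)).aestronglyMeasurable
    · filter_upwards with p
      rw [norm_mul, Complex.norm_real]
      gcongr
      simp only [hα, norm_mul, Real.norm_eq_abs]
      have h2 := hle (e n * p.1)
      have h4 : |η (e n * p.1)| * |a p.1| * |γ p.2| ≤ 1 * |a p.1| * |γ p.2| := by
        gcongr
      linarith
    · filter_upwards with p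
      apply tendsto_const_nhds.congr'
      filter_upwards [hηev p.1] with n hn
      simp only [hα]
      rw [hn.eq_of_nhds]
      simp
  refine tendsto_nhds_unique l1 ?_
  have : (fun n => ∫ p, f p * ((deriv (α n) p.1 * γ p.2 : ℝ) : ℂ) ∂stripMeasure) =
      fun n => - ∫ p, g p * ((α n p.1 * γ p.2 : ℝ) : ℂ) ∂stripMeasure := by
    ext n; exact h _ (hαs n) (hαc n)
  rw [this]
  exact l2.neg

/-- Parseval's identity for the partial transform, tested with `b(ξ) γ(y)`. -/
theorem PartialFT.integral_mul {f F : ℝ × ℝ → ℂ} (h : PartialFT f F) (hf : MemLp f 2 stripMeasure)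
    (hF : MemLp F 2 stripMeasure) (b : SchwartzMap ℝ ℂ) {γ : ℝ → ℝ} (hγ : Continuous γ)
    (hγ' : HasCompactSupport γ) :
    ∫ p, F p * (b p.1 * (γ p.2 : ℂ)) ∂stripMeasure =
      ∫ p, f p * (𝓕 (b : ℝ → ℂ) p.1 * (γ p.2 : ℂ)) ∂stripMeasure := by
  obtain ⟨C, hC⟩ := hγ'.exists_bound_of_continuous hγ
  have key : ∀ (u : ℝ × ℝ → ℂ) (c : SchwartzMap ℝ ℂ), MemLp u 2 stripMeasure →
      Integrable (fun p => u p * (c p.1 * (γ p.2 : ℂ))) stripMeasure := by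
    intro u c hu
    have h1 : MemLp (fun p : ℝ × ℝ => c p.1) 2 stripMeasure := by
      rw [stripMeasure_eq_prod]; exact (c.memLp 2 (μ := volume)).comp_fst _
    have h2 : MemLp (fun p : ℝ × ℝ => c p.1 * (γ p.2 : ℂ)) 2 stripMeasure := by
      refine (h1.const_mul (C : ℂ)).of_le ?_ ?_
      · have := hγ.measurable
        exact h1.1.mul (by fun_prop : Measurable fun p : ℝ × ℝ => (γ p.2 : ℂ)).aestronglyMeasurable
      · filter_upwards with p
        rw [norm_mul, norm_mul, mul_comm, Complex.norm_real, Complex.norm_real]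
        gcongr
        exact (hC p.2).trans (le_abs_self C)
    exact hu.integrable_mul (q := 2) h2
  have i1 := key F b hF
  have i2 := key f (𝓕 b) hf
  rw [SchwartzMap.fourier_coe] at i2
  rw [stripMeasure_eq_prod] at i1 i2 ⊢
  rw [integral_prod_symm _ i1, integral_prod_symm _ i2]
  apply integral_congr_ae
  filter_upwards [h] with y ⟨h1, h2, h3⟩
  simp only [← mul_assoc]
  rw [integral_mul_const, integral_mul_const]
  congr 1
  have e := integral_schwartz_mul_fourier (h1.toLp _) b
  rw [h3] at e
  calc ∫ x, F (x, y) * b x = ∫ x, b x * (h2.toLp _ : ℝ → ℂ) x := by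
        apply integral_congr_ae
        filter_upwards [h2.coeFn_toLp] with x hx
        rw [hx, mul_comm]
    _ = _ := e
    _ = _ := by
        apply integral_congr_ae
        filter_upwards [h1.coeFn_toLp] with x hx
        rw [hx, mul_comm]

theorem integrableOn_slab {Q : ℝ × ℝ → ℂ} (hQ : MemLp Q 2 stripMeasure) (R : ℝ) :
    IntegrableOn Q (Icc (-R) R ×ˢ univ) stripMeasure := by
  have : IsFiniteMeasure (stripMeasure.restrict (Icc (-R) R ×ˢ univ)) := by
    constructor
    rw [Measure.restrict_apply_univ, stripMeasure_eq_prod, Measure.prod_prod]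
    exact ENNReal.mul_lt_top (by simp) (by simp)
  exact (hQ.restrict _).integrable (by norm_num)

/-- The partial transform turns the weak derivative `∂_x` into multiplication by `2πiξ`. -/
theorem PartialFT.weak_dx {f g F G : ℝ × ℝ → ℂ} (hf : MemLp f 2 stripMeasure)
    (hg : MemLp g 2 stripMeasure) (hF : MemLp F 2 stripMeasure) (hG : MemLp G 2 stripMeasure)
    (hfF : PartialFT f F) (hgG : PartialFT g G)
    (h : ∀ α γ : ℝ → ℝ, ContDiff ℝ (⊤ : ℕ∞) α → HasCompactSupport α →
      ContDiff ℝ (⊤ : ℕ∞) γ → HasCompactSupport γ → tsupport γ ⊆ Ioo (-1) 1 →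
      ∫ p, f p * ((deriv α p.1 * γ p.2 : ℝ) : ℂ) ∂stripMeasure =
        - ∫ p, g p * ((α p.1 * γ p.2 : ℝ) : ℂ) ∂stripMeasure) :
    G =ᵐ[stripMeasure] fun p => (2 * π * p.1 * I) * F p := by
  have key : ∀ᵐ p ∂stripMeasure, G p - (2 * π * p.1 * I) * F p = 0 := by
    refine ae_eq_zero_of_product_test (Q := fun p => G p - (2 * π * p.1 * I) * F p)
      (fun R => ?_) (fun b γ hb hb' hγ hγ' hγs => ?_)
    · refine (integrableOn_slab hG R).sub ?_
      have h1 := (integrableOn_slab hF R)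
      refine Integrable.bdd_mul (c := 2 * π * |R|) h1 (by
        apply Measurable.aestronglyMeasurable; fun_prop) ?_
      filter_upwards [ae_restrict_mem (measurableSet_Icc.prod MeasurableSet.univ)] with p hp
      have : |p.1| ≤ |R| := (abs_le.2 hp.1).trans (le_abs_self R)
      simp only [norm_mul, Complex.norm_real, Complex.norm_I, mul_one, Complex.norm_ofNat,
        Real.norm_eq_abs, abs_of_pos Real.pi_pos]
      gcongr
    -- the tests `b` and `-2πiξ b` as Schwartz functions
    have hb₁ : HasCompactSupport (fun x => (b x : ℂ)) := hb'.comp_left Complex.ofReal_zero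
    have hb₂ : ContDiff ℝ (⊤ : ℕ∞) (fun x => (b x : ℂ)) := Complex.ofRealCLM.contDiff.comp hb
    have hc₁ : HasCompactSupport (fun x : ℝ => (-2 * π * I * x) * (b x : ℂ)) :=
      HasCompactSupport.mul_left (f := fun x : ℝ => (-2 * π * I * x : ℂ)) hb₁
    have hc₂ : ContDiff ℝ (⊤ : ℕ∞) (fun x : ℝ => (-2 * π * I * x) * (b x : ℂ)) :=
      (contDiff_const.mul Complex.ofRealCLM.contDiff).mul hb₂
    obtain ⟨B, hBa⟩ : ∃ B : SchwartzMap ℝ ℂ, ∀ x, B x = (b x : ℂ) :=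
      ⟨hb₁.toSchwartzMap hb₂, fun x => rfl⟩
    obtain ⟨D, hDa⟩ : ∃ D : SchwartzMap ℝ ℂ,
        ∀ x, D x = (-2 * π * I * x) * (b x : ℂ) :=
      ⟨hc₁.toSchwartzMap hc₂, fun x => rfl⟩
    have hder : ∀ x, HasDerivAt (𝓕 (B : ℝ → ℂ)) (𝓕 (D : ℝ → ℂ) x) x := by
      intro x
      have h0 : (fun x : ℝ => x • (B x : ℂ)) = fun x : ℝ =>
          (-2 * π * I)⁻¹ * D x := by
        ext x
        rw [hBa, hDa, Complex.real_smul]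
        have : (π : ℂ) ≠ 0 := by exact_mod_cast Real.pi_ne_zero
        field_simp [Complex.I_ne_zero]
      have i0 : Integrable (fun x : ℝ => x • (B x : ℂ)) := by
        rw [h0]
        exact D.integrable.const_mul _
      have h1 := Real.hasDerivAt_fourier B.integrable i0 x
      have h2 : (fun x : ℝ => (-2 * (π : ℂ) * I * (x : ℂ)) • B x) = D := by
        ext x; rw [hDa, hBa, smul_eq_mul]
      rwa [h2] at h1
    obtain ⟨A, hAc⟩ : ∃ A : SchwartzMap ℝ ℂ, 𝓕 (B : ℝ → ℂ) = A :=
      ⟨𝓕 B, (SchwartzMap.fourier_coe B).symm⟩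
    obtain ⟨A', hAc'⟩ : ∃ A' : SchwartzMap ℝ ℂ, 𝓕 (D : ℝ → ℂ) = A' :=
      ⟨𝓕 D, (SchwartzMap.fourier_coe D).symm⟩
    rw [hAc, hAc'] at hder
    have hAs : ContDiff ℝ (⊤ : ℕ∞) A := A.smooth _
    have m1 := A.memLp 2 (μ := volume)
    have m2 := A'.memLp 2 (μ := volume)
    have dre : ∀ x, HasDerivAt (fun x => (A x).re) (A' x).re x := fun x =>
      (Complex.reCLM.hasFDerivAt.comp_hasDerivAt x (hder x))
    have dim : ∀ x, HasDerivAt (fun x => (A x).im) (A' x).im x := fun x =>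
      (Complex.imCLM.hasFDerivAt.comp_hasDerivAt x (hder x))
    have dre' : deriv (fun x => (A x).re) = fun x => (A' x).re := funext fun x => (dre x).deriv
    have dim' : deriv (fun x => (A x).im) = fun x => (A' x).im := funext fun x => (dim x).deriv
    have r1 := weak_dx_extend hf hg hγ hγ' (fun α hα hα' => h α γ hα hα' hγ hγ' hγs)
      (a := fun x => (A x).re) (Complex.reCLM.contDiff.comp hAs) m1.re (by rw [dre']; exact m2.re)
    have r2 := weak_dx_extend hf hg hγ hγ' (fun α hα hα' => h α γ hα hα' hγ hγ' hγs)
      (a := fun x => (A x).im) (Complex.imCLM.contDiff.comp hAs) m1.im (by rw [dim']; exact m2.im)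
    rw [dre'] at r1
    rw [dim'] at r2
    have split : ∀ (u : ℝ × ℝ → ℂ) (c : SchwartzMap ℝ ℂ), MemLp u 2 stripMeasure →
        ∫ p, u p * (c p.1 * (γ p.2 : ℂ)) ∂stripMeasure =
        (∫ p, u p * (((c p.1).re * γ p.2 : ℝ) : ℂ) ∂stripMeasure) +
        I * ∫ p, u p * (((c p.1).im * γ p.2 : ℝ) : ℂ) ∂stripMeasure := by
      intro u c hu
      have i1 := integrable_mul_of_memLp_two hu
        (memLp_fst_mul_snd (c.memLp 2 (μ := volume)).re hγ.continuous hγ')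
      have i2 := integrable_mul_of_memLp_two hu
        (memLp_fst_mul_snd (c.memLp 2 (μ := volume)).im hγ.continuous hγ')
      simp only [RCLike.re_to_complex, RCLike.im_to_complex] at i1 i2
      rw [← integral_const_mul, ← integral_add i1 (i2.const_mul _)]
      congr 1; ext p
      nth_rw 1 [← Complex.re_add_im (c p.1)]
      push_cast; ring
    have e1 := hgG.integral_mul hg hG B hγ.continuous hγ'
    have e2 := hfF.integral_mul hf hF D hγ.continuous hγ'
    rw [hAc] at e1
    rw [hAc'] at e2
    rw [split g A hg] at e1
    rw [split f A' hf] at e2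
    have e3 : ∫ p, G p * (B p.1 * (γ p.2 : ℂ)) ∂stripMeasure =
        - ∫ p, F p * (D p.1 * (γ p.2 : ℂ)) ∂stripMeasure := by
      rw [e1, e2, r1, r2]; ring
    have ib : ∀ (u : ℝ × ℝ → ℂ) (c : SchwartzMap ℝ ℂ), MemLp u 2 stripMeasure →
        Integrable (fun p => u p * (c p.1 * (γ p.2 : ℂ))) stripMeasure := by
      intro u c hu
      have i1 := integrable_mul_of_memLp_two hu
        (memLp_fst_mul_snd (c.memLp 2 (μ := volume)).re hγ.continuous hγ')
      have i2 := integrable_mul_of_memLp_two hu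
        (memLp_fst_mul_snd (c.memLp 2 (μ := volume)).im hγ.continuous hγ')
      simp only [RCLike.re_to_complex, RCLike.im_to_complex] at i1 i2
      refine (i1.add (i2.const_mul I)).congr (Eventually.of_forall fun p => ?_)
      simp only [Pi.add_apply]
      nth_rw 3 [← Complex.re_add_im (c p.1)]
      push_cast; ring
    have e4 := add_eq_zero_iff_eq_neg.2 e3
    rw [← integral_add (ib G B hG) (ib F D hF)] at e4
    rw [← e4]
    congr 1; ext p
    rw [hBa, hDa]
    push_cast; ring
  filter_upwards [key] with p hp using sub_eq_zero.1 hp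

/-! ### Weak derivatives in `y` and primitives -/

/-- Integration by parts for a primitive of an integrable function. -/
theorem integral_primitive_mul_deriv {g B B' : ℝ → ℂ} {a b : ℝ} (hab : a ≤ b)
    (hg : IntervalIntegrable g volume a b) (hB : ∀ y, HasDerivAt B (B' y) y)
    (hB' : Continuous B') :
    ∫ y in a..b, (∫ z in a..y, g z) * B' y =
      (∫ z in a..b, g z) * B b - ∫ z in a..b, g z * B z := by
  have hg' : Integrable g (volume.restrict (Ioc a b)) :=
    (intervalIntegrable_iff_integrableOn_Ioc_of_le hab).1 hg
  have hBi : Integrable B' (volume.restrict (Ioc a b)) :=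
    (intervalIntegrable_iff_integrableOn_Ioc_of_le hab).1 (hB'.intervalIntegrable a b)
  have hprod : Integrable (fun p : ℝ × ℝ => {p : ℝ × ℝ | p.2 ≤ p.1}.indicator
      (fun p => g p.2 * B' p.1) p) ((volume.restrict (Ioc a b)).prod (volume.restrict (Ioc a b))) := by
    refine Integrable.indicator ?_ (measurableSet_le measurable_snd measurable_fst)
    have := hBi.mul_prod hg'
    simpa only [mul_comm] using this
  have hswap := integral_integral_swap (f := fun y z => {p : ℝ × ℝ | p.2 ≤ p.1}.indicator
      (fun p => g p.2 * B' p.1) (y, z)) hprod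
  have e1 : ∫ y in a..b, (∫ z in a..y, g z) * B' y = ∫ y in Ioc a b, ∫ z in Ioc a b,
      {p : ℝ × ℝ | p.2 ≤ p.1}.indicator (fun p => g p.2 * B' p.1) (y, z) := by
    rw [intervalIntegral.integral_of_le hab]
    refine setIntegral_congr_fun measurableSet_Ioc fun y hy => ?_
    rw [intervalIntegral.integral_of_le hy.1.le, ← integral_mul_const,
      ← integral_indicator measurableSet_Ioc, ← integral_indicator measurableSet_Ioc]
    congr 1; ext z
    by_cases h1 : z ∈ Ioc a y
    · have h2 : z ∈ Ioc a b := ⟨h1.1, h1.2.trans hy.2⟩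
      have h3 : z ≤ y := h1.2
      simp [h1, h2, h3, indicator]
    · by_cases h2 : z ∈ Ioc a b
      · have h3 : ¬ z ≤ y := fun h => h1 ⟨h2.1, h⟩
        simp [h1, h3, indicator]
      · rw [indicator_of_notMem h1, indicator_of_notMem h2]
  have e2 : ∫ z in Ioc a b, ∫ y in Ioc a b,
      {p : ℝ × ℝ | p.2 ≤ p.1}.indicator (fun p => g p.2 * B' p.1) (y, z) =
      ∫ z in Ioc a b, g z * (B b - B z) := by
    refine setIntegral_congr_fun measurableSet_Ioc fun z hz => ?_
    have e3 : ∫ y in z..b, B' y = B b - B z :=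
      intervalIntegral.integral_eq_sub_of_hasDerivAt (fun y _ => hB y) (hB'.intervalIntegrable _ _)
    rw [← e3, ← intervalIntegral.integral_const_mul, intervalIntegral.integral_of_le hz.2,
      ← integral_Icc_eq_integral_Ioc (x := z), ← integral_indicator measurableSet_Icc,
      ← integral_indicator measurableSet_Ioc]
    congr 1; ext y
    by_cases h1 : y ∈ Icc z b
    · have h2 : y ∈ Ioc a b := ⟨hz.1.trans_le h1.1, h1.2⟩
      have h3 : z ≤ y := h1.1
      rw [indicator_of_mem h1, indicator_of_mem h2, indicator_of_mem (by exact h3)]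
    · rw [indicator_of_notMem h1]
      by_cases h2 : y ∈ Ioc a b
      · rw [indicator_of_mem h2, indicator_of_notMem]
        intro h; exact h1 ⟨h, h2.2⟩
      · rw [indicator_of_notMem h2]
  rw [e1, hswap, e2]
  simp only [mul_sub]
  have hBc : Continuous B := continuous_iff_continuousAt.2 fun y => (hB y).continuousAt
  rw [intervalIntegral.integral_of_le hab, intervalIntegral.integral_of_le hab,
    integral_sub (hg'.mul_const _), integral_mul_const]
  have := hg.mul_continuousOn (hBc.continuousOn (s := uIcc a b))
  exact (intervalIntegrable_iff_integrableOn_Ioc_of_le hab).1 this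

/-- The primitive in the second variable that vanishes at the wall `y = -1`. -/
def yPrim (g : ℝ × ℝ → ℂ) (p : ℝ × ℝ) : ℂ := ∫ z in (-1 : ℝ)..p.2, g (p.1, z)

theorem norm_yPrim_le (g : ℝ × ℝ → ℂ) {x y : ℝ} (hy : y ∈ Ioo (-1 : ℝ) 1)
    (hg : Integrable (fun z => g (x, z)) sectionMeasure) :
    ‖yPrim g (x, y)‖ ≤ ∫ z, ‖g (x, z)‖ ∂sectionMeasure := by
  unfold yPrim
  simp only []
  rw [intervalIntegral.integral_of_le hy.1.le]
  refine (norm_integral_le_integral_norm _).trans ?_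
  rw [integral_Ioc_eq_integral_Ioo]
  exact setIntegral_mono_set hg.norm (Eventually.of_forall fun z => norm_nonneg _)
    (Ioo_subset_Ioo_right hy.2.le).eventuallyLE

theorem aestronglyMeasurable_yPrim {g : ℝ × ℝ → ℂ} (hg : StronglyMeasurable g) :
    AEStronglyMeasurable (yPrim g) stripMeasure := by
  have h1 : StronglyMeasurable fun p : ℝ × ℝ => ∫ z, {q : (ℝ × ℝ) × ℝ | -1 < q.2 ∧ q.2 ≤ q.1.2}.indicator
      (fun q => g (q.1.1, q.2)) (p, z) := by
    refine StronglyMeasurable.integral_prod_right (f := fun (p : ℝ × ℝ) (z : ℝ) =>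
      {q : (ℝ × ℝ) × ℝ | -1 < q.2 ∧ q.2 ≤ q.1.2}.indicator (fun q => g (q.1.1, q.2)) (p, z)) ?_
    refine StronglyMeasurable.indicator (hg.comp_measurable (by fun_prop)) ?_
    exact (measurableSet_lt measurable_const measurable_snd).inter
      (measurableSet_le measurable_snd measurable_fst.snd)
  refine ⟨_, h1, ?_⟩
  filter_upwards [ae_restrict_mem isOpen_strip.measurableSet] with p hp
  unfold yPrim
  rw [intervalIntegral.integral_of_le hp.2.1.le, ← integral_indicator measurableSet_Ioc]
  rfl

theorem integrable_section_slice {g : ℝ × ℝ → ℂ} (hg : Integrable g stripMeasure) :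
    ∀ᵐ x : ℝ, Integrable (fun z => g (x, z)) sectionMeasure := by
  rw [stripMeasure_eq_prod] at hg
  exact hg.prod_right_ae

theorem integrable_comp_fst {n : ℝ → ℂ} (hn : Integrable n) :
    Integrable (fun p : ℝ × ℝ => n p.1) stripMeasure := by
  rw [stripMeasure_eq_prod]
  exact hn.comp_fst _

theorem integrable_yPrim {g : ℝ × ℝ → ℂ} (hm : StronglyMeasurable g)
    (hg : Integrable g stripMeasure) : Integrable (yPrim g) stripMeasure := by
  have h1 : Integrable (fun x => ((∫ z, ‖g (x, z)‖ ∂sectionMeasure : ℝ) : ℂ)) := by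
    have := hg
    rw [stripMeasure_eq_prod] at this
    exact this.integral_norm_prod_left.ofReal
  refine (integrable_comp_fst h1).mono (aestronglyMeasurable_yPrim hm) ?_
  have h2 := integrable_section_slice hg
  have h3 : ∀ᵐ p ∂stripMeasure, Integrable (fun z => g (p.1, z)) sectionMeasure := by
    rw [stripMeasure_eq_prod]
    exact Measure.quasiMeasurePreserving_fst.ae h2
  filter_upwards [h3, ae_restrict_mem isOpen_strip.measurableSet] with p hp hp2
  rw [Complex.norm_real, Real.norm_of_nonneg (integral_nonneg fun _ => norm_nonneg _)]
  exact norm_yPrim_le g hp2.2 hp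

theorem intervalIntegrable_of_section {g : ℝ → ℂ} (hg : Integrable g sectionMeasure) :
    IntervalIntegrable g volume (-1) 1 := by
  rw [intervalIntegrable_iff_integrableOn_Ioc_of_le (by norm_num)]
  exact (integrableOn_Ioc_iff_integrableOn_Ioo).2 hg

theorem integral_section {g : ℝ → ℂ} :
    ∫ y, g y ∂sectionMeasure = ∫ y in (-1 : ℝ)..1, g y := by
  rw [intervalIntegral.integral_of_le (by norm_num), integral_Ioc_eq_integral_Ioo]

theorem integrable_mul_product {f : ℝ × ℝ → ℂ} (hf : Integrable f stripMeasure) {α γ : ℝ → ℝ}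
    (hα : Continuous α) (hα' : HasCompactSupport α) (hγ : Continuous γ)
    (hγ' : HasCompactSupport γ) :
    Integrable (fun p => f p * ((α p.1 * γ p.2 : ℝ) : ℂ)) stripMeasure := by
  obtain ⟨C, hC⟩ := hα'.exists_bound_of_continuous hα
  obtain ⟨C', hC'⟩ := hγ'.exists_bound_of_continuous hγ
  have m1 := hα.measurable
  have m2 := hγ.measurable
  refine hf.mul_bdd (c := C * C') ?_ (Eventually.of_forall fun p => ?_)
  · apply Measurable.aestronglyMeasurable; fun_prop
  · rw [Complex.norm_real, norm_mul]
    exact mul_le_mul (hC _) (hC' _) (norm_nonneg _) ((norm_nonneg _).trans (hC p.1))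

/-- Green's formula in `y` for the primitive `yPrim g`, tested with `α(x) B(y)`. -/
theorem integral_yPrim_mul {g : ℝ × ℝ → ℂ} (hm : StronglyMeasurable g)
    (hg : Integrable g stripMeasure) {α B : ℝ → ℝ} (hα : Continuous α)
    (hα' : HasCompactSupport α) (hB : ContDiff ℝ (⊤ : ℕ∞) B) (hB' : HasCompactSupport B) :
    ∫ p, yPrim g p * ((α p.1 * deriv B p.2 : ℝ) : ℂ) ∂stripMeasure =
      (∫ x, yPrim g (x, 1) * ((α x * B 1 : ℝ) : ℂ)) -
        ∫ p, g p * ((α p.1 * B p.2 : ℝ) : ℂ) ∂stripMeasure := by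
  have hBd : Continuous (deriv B) := hB.continuous_deriv (by exact_mod_cast le_top)
  have i1 := integrable_mul_product (integrable_yPrim hm hg) hα hα' hBd hB'.deriv
  have i2 := integrable_mul_product hg hα hα' hB.continuous hB'
  have i3 : Integrable (fun x => yPrim g (x, 1) * ((α x * B 1 : ℝ) : ℂ)) := by
    obtain ⟨C, hC⟩ := hα'.exists_bound_of_continuous hα
    have h1 : Integrable (fun x => ∫ z, g (x, z) ∂sectionMeasure) := by
      have := hg
      rw [stripMeasure_eq_prod] at this
      exact this.integral_prod_left
    have h2 : (fun x => yPrim g (x, 1)) = fun x => ∫ z, g (x, z) ∂sectionMeasure := by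
      ext x; rw [integral_section]; rfl
    have h3 : Integrable (fun x => yPrim g (x, 1)) := by rw [h2]; exact h1
    have m1 := hα.measurable
    refine h3.mul_bdd (c := C * |B 1|) (by apply Measurable.aestronglyMeasurable; fun_prop)
      (Eventually.of_forall fun x => ?_)
    rw [Complex.norm_real, norm_mul]
    exact mul_le_mul_of_nonneg_right (hC _) (norm_nonneg _)
  rw [stripMeasure_eq_prod] at i1 i2 ⊢
  rw [integral_prod _ i1, integral_prod _ i2, ← integral_sub i3 i2.integral_prod_left]
  apply integral_congr_ae
  filter_upwards [integrable_section_slice hg] with x hx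
  have := integral_primitive_mul_deriv (g := fun z => g (x, z)) (B := fun y => (B y : ℂ))
    (B' := fun y => ((deriv B y : ℝ) : ℂ)) (a := -1) (b := 1) (by norm_num)
    (intervalIntegrable_of_section hx)
    (fun y => (hB.differentiable (by simp)).differentiableAt.hasDerivAt.ofReal_comp)
    (Complex.continuous_ofReal.comp hBd)
  rw [integral_section, integral_section]
  calc ∫ y in (-1 : ℝ)..1, yPrim g (x, y) * ((α x * deriv B y : ℝ) : ℂ)
      = (α x : ℂ) * ∫ y in (-1 : ℝ)..1, (∫ z in (-1 : ℝ)..y, g (x, z)) * ((deriv B y : ℝ) : ℂ) := by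
        rw [← intervalIntegral.integral_const_mul]
        congr 1; ext y; unfold yPrim; push_cast; ring
    _ = _ := by
        rw [this, mul_sub, ← intervalIntegral.integral_const_mul]
        unfold yPrim
        push_cast
        congr 1
        · ring
        · congr 1; ext y; ring

theorem contDiff_primitive {φ : ℝ → ℝ} (hφ : ContDiff ℝ (⊤ : ℕ∞) φ) (a : ℝ) :
    ContDiff ℝ (⊤ : ℕ∞) (fun y => ∫ z in a..y, φ z) ∧
      deriv (fun y => ∫ z in a..y, φ z) = φ := by
  have h : ∀ y, HasDerivAt (fun y => ∫ z in a..y, φ z) (φ y) y := fun y =>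
    intervalIntegral.integral_hasDerivAt_right (hφ.continuous.intervalIntegrable _ _)
      (hφ.continuous.stronglyMeasurableAtFilter _ _) hφ.continuous.continuousAt
  have hd : deriv (fun y => ∫ z in a..y, φ z) = φ := funext fun y => (h y).deriv
  refine ⟨contDiff_infty_iff_deriv.2 ⟨fun y => (h y).differentiableAt, ?_⟩, hd⟩
  rw [hd]; exact hφ

/-- A test function on the cross section with mean zero is the derivative of a test function. -/
theorem exists_antideriv {φ : ℝ → ℝ} (hφ : ContDiff ℝ (⊤ : ℕ∞) φ)
    (hs : tsupport φ ⊆ Ioo (-1) 1) (h0 : ∫ z in (-1 : ℝ)..1, φ z = 0) :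
    ∃ B : ℝ → ℝ, ContDiff ℝ (⊤ : ℕ∞) B ∧ HasCompactSupport B ∧ tsupport B ⊆ Ioo (-1) 1 ∧
      deriv B = φ := by
  have hball : Ioo (-1 : ℝ) 1 = Metric.ball 0 1 := by rw [Real.ball_eq_Ioo]; norm_num
  obtain ⟨r, hr1, hr⟩ := exists_lt_subset_ball (isClosed_tsupport φ) (hball ▸ hs)
  have hz : ∀ z, r ≤ |z| → φ z = 0 := by
    intro z hz
    by_contra hne
    have := hr (subset_tsupport _ hne)
    rw [Metric.mem_ball, dist_zero_right, Real.norm_eq_abs] at this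
    exact absurd this (not_lt.2 hz)
  have hint : ∀ a b, IntervalIntegrable φ volume a b := fun a b =>
    hφ.continuous.intervalIntegrable a b
  obtain ⟨h1, h2⟩ := contDiff_primitive hφ (-1)
  have hsupp : tsupport (fun y => ∫ z in (-1 : ℝ)..y, φ z) ⊆ Metric.closedBall 0 (max r 0) := by
    apply closure_minimal _ Metric.isClosed_closedBall
    intro y hy
    rw [Metric.mem_closedBall, dist_zero_right, Real.norm_eq_abs]
    by_contra hlt
    push Not at hlt
    have hlt1 : r < |y| := (le_max_left _ _).trans_lt hlt
    have hlt2 : 0 < |y| := (le_max_right _ _).trans_lt hlt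
    refine hy ?_
    rcases le_or_gt y 0 with hy0 | hy0
    · rw [abs_of_nonpos hy0] at hlt1
      refine intervalIntegral.integral_zero_ae (Eventually.of_forall fun z hz' => hz z ?_)
      rw [uIoc, mem_Ioc] at hz'
      have : z < 0 ∧ r ≤ -z := by
        constructor
        · refine lt_of_le_of_lt hz'.2 (max_lt (by norm_num) ?_)
          rcases lt_or_eq_of_le hy0 with h | h
          · exact h
          · rw [h] at hlt2; simp at hlt2
        · have := hz'.2
          rcases le_max_iff.1 this with h | h <;> linarith
      rw [abs_of_neg this.1]; exact this.2
    · rw [abs_of_pos hy0] at hlt1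
      beta_reduce
      rw [← intervalIntegral.integral_add_adjacent_intervals (hint (-1) 1) (hint 1 y), h0, zero_add]
      refine intervalIntegral.integral_zero_ae (Eventually.of_forall fun z hz' => hz z ?_)
      rw [uIoc, mem_Ioc] at hz'
      have h3 : r < z := (lt_min hr1 hlt1).trans hz'.1
      exact h3.le.trans (le_abs_self z)
  refine ⟨_, h1, ?_, hsupp.trans ?_, h2⟩
  · exact HasCompactSupport.of_support_subset_isCompact (isCompact_closedBall 0 (max r 0))
      ((subset_tsupport _).trans hsupp)
  · rw [hball]
    exact Metric.closedBall_subset_ball (max_lt hr1 one_pos)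

/-- An integrable function with an integrable weak derivative `∂_y` is a primitive. -/
theorem exists_eq_add_yPrim {f g : ℝ × ℝ → ℂ} (hf : Integrable f stripMeasure)
    (hgm : StronglyMeasurable g) (hg : Integrable g stripMeasure)
    (h : ∀ α γ : ℝ → ℝ, ContDiff ℝ (⊤ : ℕ∞) α → HasCompactSupport α →
      ContDiff ℝ (⊤ : ℕ∞) γ → HasCompactSupport γ → tsupport γ ⊆ Ioo (-1) 1 →
      ∫ p, f p * ((α p.1 * deriv γ p.2 : ℝ) : ℂ) ∂stripMeasure =
        - ∫ p, g p * ((α p.1 * γ p.2 : ℝ) : ℂ) ∂stripMeasure) :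
    ∃ c : ℝ → ℂ, Integrable c ∧ ∀ᵐ p ∂stripMeasure, f p = c p.1 + yPrim g p := by
  set u : ℝ × ℝ → ℂ := fun p => f p - yPrim g p with hu
  have hyi := integrable_yPrim hgm hg
  have hui : Integrable u stripMeasure := hf.sub hyi
  have hu0 : ∀ α γ : ℝ → ℝ, ContDiff ℝ (⊤ : ℕ∞) α → HasCompactSupport α →
      ContDiff ℝ (⊤ : ℕ∞) γ → HasCompactSupport γ → tsupport γ ⊆ Ioo (-1) 1 →
      ∫ p, u p * ((α p.1 * deriv γ p.2 : ℝ) : ℂ) ∂stripMeasure = 0 := by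
    intro α γ hα hα' hγ hγ' hγs
    have hγd : Continuous (deriv γ) := hγ.continuous_deriv (by exact_mod_cast le_top)
    simp only [hu, sub_mul]
    rw [integral_sub (integrable_mul_product hf hα.continuous hα' hγd hγ'.deriv)
      (integrable_mul_product hyi hα.continuous hα' hγd hγ'.deriv), h α γ hα hα' hγ hγ' hγs,
      integral_yPrim_mul hgm hg hα.continuous hα' hγ hγ']
    have : γ 1 = 0 := by
      by_contra hne
      exact absurd (hγs (subset_tsupport _ hne)) (by simp)
    simp [this]
  -- `∂_y u = 0`: then `u` equals its average `c(x)` against a bump `ρ(y)` of mass one, because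
  -- `γ - (∫ γ) ρ` is the derivative of a test function.
  let φ : ContDiffBump (0 : ℝ) := ⟨1 / 4, 1 / 2, by norm_num, by norm_num⟩
  obtain ⟨ρ, hρs, hρc, hρt, hρ1⟩ : ∃ ρ : ℝ → ℝ, ContDiff ℝ (⊤ : ℕ∞) ρ ∧ HasCompactSupport ρ ∧
      tsupport ρ ⊆ Ioo (-1) 1 ∧ ∫ y in (-1 : ℝ)..1, ρ y = 1 := by
    have ht : tsupport (φ.normed volume) ⊆ Ioo (-1) 1 := by
      rw [φ.tsupport_normed_eq, Real.closedBall_eq_Icc]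
      exact Icc_subset_Ioo (by norm_num) (by norm_num)
    refine ⟨φ.normed volume, φ.contDiff_normed, φ.hasCompactSupport_normed, ht, ?_⟩
    rw [intervalIntegral.integral_of_le (by norm_num)]
    refine Eq.trans ?_ (φ.integral_normed (μ := volume))
    exact setIntegral_eq_integral_of_forall_compl_eq_zero fun y hy => by
      by_contra hne
      exact hy (Ioo_subset_Ioc_self (ht (subset_tsupport _ hne)))
  obtain ⟨C, hC⟩ := hρc.exists_bound_of_continuous hρs.continuous
  have mρ := hρs.continuous.measurable
  have huρ : Integrable (fun p => u p * (ρ p.2 : ℂ)) stripMeasure :=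
    hui.mul_bdd (c := C) (by apply Measurable.aestronglyMeasurable; fun_prop)
      (Eventually.of_forall fun p => by rw [Complex.norm_real]; exact hC _)
  set c : ℝ → ℂ := fun x => ∫ y, u (x, y) * (ρ y : ℂ) ∂sectionMeasure with hc
  have hci : Integrable c := by
    rw [stripMeasure_eq_prod] at huρ
    exact huρ.integral_prod_left
  refine ⟨c, hci, ?_⟩
  have key := ae_eq_zero_of_product_test (Q := fun p => u p - c p.1)
    (fun R => (hui.sub (integrable_comp_fst hci)).integrableOn)
    (fun α γ hα hα' hγ hγ' hγs => by
      set m : ℝ := ∫ y in (-1 : ℝ)..1, γ y with hm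
      have hφs : ContDiff ℝ (⊤ : ℕ∞) (fun y => γ y - m * ρ y) := hγ.sub (contDiff_const.mul hρs)
      have hφt : tsupport (fun y => γ y - m * ρ y) ⊆ Ioo (-1) 1 := by
        have : tsupport (fun y => γ y - m * ρ y) ⊆ tsupport γ ∪ tsupport ρ := by
          apply closure_minimal _ ((isClosed_tsupport _).union (isClosed_tsupport _))
          intro y hy
          by_contra hne
          simp only [mem_union, not_or] at hne
          exact hy (by
            have h1 := image_eq_zero_of_notMem_tsupport hne.1
            have h2 := image_eq_zero_of_notMem_tsupport hne.2
            simp [h1, h2])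
        exact this.trans (union_subset hγs hρt)
      have hφ0 : ∫ y in (-1 : ℝ)..1, (γ y - m * ρ y) = 0 := by
        rw [intervalIntegral.integral_sub (hγ.continuous.intervalIntegrable _ _)
          ((hρs.continuous.intervalIntegrable _ _).const_mul m),
          intervalIntegral.integral_const_mul, hρ1, mul_one, sub_self]
      obtain ⟨B, hB1, hB2, hB3, hB4⟩ := exists_antideriv hφs hφt hφ0
      have e0 := hu0 α B hα hα' hB1 hB2 hB3
      rw [hB4] at e0
      have iγ := integrable_mul_product hui hα.continuous hα' hγ.continuous hγ'
      have iρ := integrable_mul_product hui hα.continuous hα' hρs.continuous hρc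
      have ic := integrable_mul_product (integrable_comp_fst hci) hα.continuous hα'
        hγ.continuous hγ'
      have e1 : ∫ p, u p * ((α p.1 * (γ p.2 - m * ρ p.2) : ℝ) : ℂ) ∂stripMeasure =
          (∫ p, u p * ((α p.1 * γ p.2 : ℝ) : ℂ) ∂stripMeasure) -
          m * ∫ p, u p * ((α p.1 * ρ p.2 : ℝ) : ℂ) ∂stripMeasure := by
        rw [← integral_const_mul, ← integral_sub iγ (iρ.const_mul _)]
        congr 1; ext p; push_cast; ring
      have e2 : ∫ p, c p.1 * ((α p.1 * γ p.2 : ℝ) : ℂ) ∂stripMeasure =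
          m * ∫ p, u p * ((α p.1 * ρ p.2 : ℝ) : ℂ) ∂stripMeasure := by
        rw [stripMeasure_eq_prod] at ic iρ ⊢
        rw [integral_prod _ ic, integral_prod _ iρ, ← integral_const_mul]
        congr 1; ext x
        have s1 : ∫ y, c x * ((α x * γ y : ℝ) : ℂ) ∂sectionMeasure = c x * α x * m := by
          rw [integral_section, hm, ← intervalIntegral.integral_ofReal,
            ← intervalIntegral.integral_const_mul]
          congr 1; ext y; push_cast; ring
        have s2 : ∫ y, u (x, y) * ((α x * ρ y : ℝ) : ℂ) ∂sectionMeasure = α x * c x := by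
          rw [hc, ← integral_const_mul]
          congr 1; ext y; push_cast; ring
        rw [s1, s2]; ring
      simp only [sub_mul]
      rw [integral_sub iγ ic, e2, ← e1, e0])
  filter_upwards [key] with p hp
  have := sub_eq_zero.1 hp
  rw [← this, hu]; ring

/-- A function vanishing on both walls is the primitive of its derivative, and that derivative
has mean zero on almost every cross section. -/
theorem eq_yPrim_of_walls {f g : ℝ × ℝ → ℂ} (hf : Integrable f stripMeasure)
    (hgm : StronglyMeasurable g) (hg : Integrable g stripMeasure)
    (h : ∀ α γ : ℝ → ℝ, ContDiff ℝ (⊤ : ℕ∞) α → HasCompactSupport α →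
      ContDiff ℝ (⊤ : ℕ∞) γ → HasCompactSupport γ →
      ∫ p, f p * ((α p.1 * deriv γ p.2 : ℝ) : ℂ) ∂stripMeasure =
        - ∫ p, g p * ((α p.1 * γ p.2 : ℝ) : ℂ) ∂stripMeasure) :
    (∀ᵐ p ∂stripMeasure, f p = yPrim g p) ∧ ∀ᵐ x : ℝ, yPrim g (x, 1) = 0 := by
  obtain ⟨c, hc, hfc⟩ := exists_eq_add_yPrim hf hgm hg fun α γ hα hα' hγ hγ' _ =>
    h α γ hα hα' hγ hγ'
  have hyi := integrable_yPrim hgm hg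
  have hJi : Integrable (fun x => yPrim g (x, 1)) := by
    have h1 : Integrable (fun x => ∫ z, g (x, z) ∂sectionMeasure) := by
      have := hg
      rw [stripMeasure_eq_prod] at this
      exact this.integral_prod_left
    have h2 : (fun x => yPrim g (x, 1)) = fun x => ∫ z, g (x, z) ∂sectionMeasure := by
      ext x; rw [integral_section]; rfl
    rw [h2]; exact h1
  have main : ∀ γ : ℝ → ℝ, ContDiff ℝ (⊤ : ℕ∞) γ → HasCompactSupport γ →
      ∀ᵐ x : ℝ, c x * ((γ 1 - γ (-1) : ℝ) : ℂ) + yPrim g (x, 1) * ((γ 1 : ℝ) : ℂ) = 0 := by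
    intro γ hγ hγ'
    refine ae_eq_zero_of_integral_contDiff_smul_eq_zero
      ((hc.mul_const _).add (hJi.mul_const _)).locallyIntegrable fun α hα hα' => ?_
    have hγd : Continuous (deriv γ) := hγ.continuous_deriv (by exact_mod_cast le_top)
    have e := h α γ hα hα' hγ hγ'
    have ic := integrable_mul_product (integrable_comp_fst hc) hα.continuous hα' hγd hγ'.deriv
    have iy := integrable_mul_product hyi hα.continuous hα' hγd hγ'.deriv
    have e1 : ∫ p, f p * ((α p.1 * deriv γ p.2 : ℝ) : ℂ) ∂stripMeasure =
        (∫ p, c p.1 * ((α p.1 * deriv γ p.2 : ℝ) : ℂ) ∂stripMeasure) +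
        ∫ p, yPrim g p * ((α p.1 * deriv γ p.2 : ℝ) : ℂ) ∂stripMeasure := by
      rw [← integral_add ic iy]
      apply integral_congr_ae
      filter_upwards [hfc] with p hp
      rw [hp, add_mul]
    rw [e1, integral_yPrim_mul hgm hg hα.continuous hα' hγ hγ'] at e
    have e2 : ∫ p, c p.1 * ((α p.1 * deriv γ p.2 : ℝ) : ℂ) ∂stripMeasure =
        ∫ x, c x * α x * ((γ 1 - γ (-1) : ℝ) : ℂ) := by
      rw [stripMeasure_eq_prod] at ic ⊢
      rw [integral_prod _ ic]
      congr 1; ext x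
      have : ∫ y in (-1 : ℝ)..1, deriv γ y = γ 1 - γ (-1) :=
        intervalIntegral.integral_eq_sub_of_hasDerivAt
          (fun y _ => (hγ.differentiable (by simp)).differentiableAt.hasDerivAt)
          (hγd.intervalIntegrable _ _)
      rw [integral_section, ← this, ← intervalIntegral.integral_ofReal,
        ← intervalIntegral.integral_const_mul]
      congr 1; ext y; push_cast; ring
    have hαb := hα'.exists_bound_of_continuous hα.continuous
    obtain ⟨C, hC⟩ := hαb
    have mα := hα.continuous.measurable
    have i1 : Integrable (fun x => c x * α x * ((γ 1 - γ (-1) : ℝ) : ℂ)) :=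
      (hc.mul_bdd (c := C) (by apply Measurable.aestronglyMeasurable; fun_prop)
        (Eventually.of_forall fun x => by rw [Complex.norm_real]; exact hC x)).mul_const _
    have i2 : Integrable (fun x => yPrim g (x, 1) * ((α x * γ 1 : ℝ) : ℂ)) := by
      refine hJi.mul_bdd (c := C * |γ 1|) (by apply Measurable.aestronglyMeasurable; fun_prop)
        (Eventually.of_forall fun x => ?_)
      rw [Complex.norm_real, norm_mul]
      exact mul_le_mul_of_nonneg_right (hC x) (norm_nonneg _)
    rw [e2] at e
    have e3 : (∫ x, c x * α x * ((γ 1 - γ (-1) : ℝ) : ℂ)) +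
        ∫ x, yPrim g (x, 1) * ((α x * γ 1 : ℝ) : ℂ) = 0 := by linear_combination e
    rw [← integral_add i1 i2] at e3
    rw [← e3]
    congr 1; ext x
    rw [Complex.real_smul]; push_cast; ring
  let φ₀ : ContDiffBump (0 : ℝ) := ⟨2, 3, by norm_num, by norm_num⟩
  let φ₁ : ContDiffBump (1 : ℝ) := ⟨1 / 2, 1, by norm_num, by norm_num⟩
  have a1 : φ₀ 1 = 1 := φ₀.one_of_mem_closedBall (by
    rw [Metric.mem_closedBall, Real.dist_eq]; norm_num [φ₀])
  have a2 : φ₀ (-1) = 1 := φ₀.one_of_mem_closedBall (by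
    rw [Metric.mem_closedBall, Real.dist_eq]; norm_num [φ₀])
  have a3 : φ₁ 1 = 1 := φ₁.one_of_mem_closedBall (by
    rw [Metric.mem_closedBall, Real.dist_eq]; norm_num [φ₁])
  have a4 : φ₁ (-1) = 0 := φ₁.zero_of_le_dist (by
    rw [Real.dist_eq]; norm_num [φ₁])
  have m0 := main φ₀ φ₀.contDiff φ₀.hasCompactSupport
  have m1 := main φ₁ φ₁.contDiff φ₁.hasCompactSupport
  have hJ : ∀ᵐ x : ℝ, yPrim g (x, 1) = 0 := by
    filter_upwards [m0] with x hx
    simpa [a1, a2] using hx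
  have hc0 : ∀ᵐ x : ℝ, c x = 0 := by
    filter_upwards [m1, hJ] with x hx hx2
    simpa [a3, a4, hx2] using hx
  refine ⟨?_, hJ⟩
  have hc1 : ∀ᵐ p ∂stripMeasure, c p.1 = 0 := by
    rw [stripMeasure_eq_prod]
    exact Measure.quasiMeasurePreserving_fst.ae hc0
  filter_upwards [hfc, hc1] with p h1 h2
  rw [h1, h2, zero_add]

/-! ### Fields prescribed on the frequency side -/

theorem hasDerivAt_fst_of_contDiff {θ : ℝ × ℝ → ℝ} (h : ContDiff ℝ (⊤ : ℕ∞) θ) (x y : ℝ) :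
    HasDerivAt (fun x => θ (x, y)) (fderiv ℝ θ (x, y) (1, 0)) x := by
  have h1 := ((h.differentiable (by simp)) (x, y)).hasFDerivAt
  exact h1.comp_hasDerivAt x ((hasDerivAt_id x).prodMk (hasDerivAt_const x y))

theorem hasDerivAt_snd_of_contDiff {θ : ℝ × ℝ → ℝ} (h : ContDiff ℝ (⊤ : ℕ∞) θ) (x y : ℝ) :
    HasDerivAt (fun y => θ (x, y)) (fderiv ℝ θ (x, y) (0, 1)) y := by
  have h1 := ((h.differentiable (by simp)) (x, y)).hasFDerivAt
  exact h1.comp_hasDerivAt y ((hasDerivAt_const y x).prodMk (hasDerivAt_id y))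

theorem classicalPartial_one_zero {θ : ℝ × ℝ → ℝ} (h : ContDiff ℝ (⊤ : ℕ∞) θ) :
    classicalPartial 1 0 θ = fun p => fderiv ℝ θ p (1, 0) := by
  ext p
  simp only [classicalPartial, iteratedDeriv_one, iteratedDeriv_zero]
  exact (hasDerivAt_fst_of_contDiff h p.1 p.2).deriv

theorem classicalPartial_zero_one {θ : ℝ × ℝ → ℝ} (h : ContDiff ℝ (⊤ : ℕ∞) θ) :
    classicalPartial 0 1 θ = fun p => fderiv ℝ θ p (0, 1) := by
  ext p
  simp only [classicalPartial, iteratedDeriv_one, iteratedDeriv_zero]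
  exact (hasDerivAt_snd_of_contDiff h p.1 p.2).deriv

theorem test_fderiv {θ : ℝ × ℝ → ℝ} (h : ContDiff ℝ (⊤ : ℕ∞) θ) (h' : HasCompactSupport θ)
    (v : ℝ × ℝ) : ContDiff ℝ (⊤ : ℕ∞) (fun p => fderiv ℝ θ p v) ∧
      HasCompactSupport (fun p => fderiv ℝ θ p v) ∧
      tsupport (fun p => fderiv ℝ θ p v) ⊆ tsupport θ := by
  refine ⟨?_, h'.fderiv_apply ℝ v, tsupport_fderiv_apply_subset ℝ v⟩
  exact (h.fderiv_right (m := (⊤ : ℕ∞)) (by exact_mod_cast le_top)).clm_apply contDiff_const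

/-- Composition of weak derivatives. -/
theorem HasWeakPartial.comp {a b a' b' : ℕ} {f g k : StripL2} (h : HasWeakPartial a b f g)
    (h' : HasWeakPartial a' b' g k)
    (ht : ∀ θ : ℝ × ℝ → ℝ, ContDiff ℝ (⊤ : ℕ∞) θ → HasCompactSupport θ →
      ContDiff ℝ (⊤ : ℕ∞) (classicalPartial a' b' θ) ∧ HasCompactSupport (classicalPartial a' b' θ) ∧
      tsupport (classicalPartial a' b' θ) ⊆ tsupport θ)
    (hc : ∀ θ : ℝ × ℝ → ℝ,
      classicalPartial (a + a') (b + b') θ = classicalPartial a b (classicalPartial a' b' θ)) :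
    HasWeakPartial (a + a') (b + b') f k := by
  intro θ h1 h2 h3
  obtain ⟨t1, t2, t3⟩ := ht θ h1 h2
  rw [hc, h _ t1 t2 (t3.trans h3), h' θ h1 h2 h3]
  ring

theorem HasWeakPartial.comp_dx {a : ℕ} {f g k : StripL2} (h : HasWeakPartial a 0 f g)
    (h' : HasWeakPartial 1 0 g k) : HasWeakPartial (a + 1) 0 f k := by
  refine h.comp h' (fun θ h1 h2 => ?_) (fun θ => ?_)
  · rw [classicalPartial_one_zero h1]; exact test_fderiv h1 h2 _
  · ext p
    simp only [classicalPartial, iteratedDeriv_zero, iteratedDeriv_succ']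
    rfl

theorem HasWeakPartial.comp_dy {a b : ℕ} {f g k : StripL2} (h : HasWeakPartial a b f g)
    (h' : HasWeakPartial 0 1 g k) : HasWeakPartial a (b + 1) f k := by
  refine h.comp h' (fun θ h1 h2 => ?_) (fun θ => ?_)
  · rw [classicalPartial_zero_one h1]; exact test_fderiv h1 h2 _
  · ext p
    simp only [classicalPartial, iteratedDeriv_zero, iteratedDeriv_succ']
    rfl

theorem hasWeakPartial_zero (f : StripL2) : HasWeakPartial 0 0 f f := by
  intro θ _ _ _
  simp [classicalPartial]

/-- Frequency-side functions whose inverse transform in `x` is an absolutely convergent integral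
and lies in `L²` of the channel. -/
structure FreqAdm (F : ℝ × ℝ → ℂ) : Prop where
  meas : Measurable F
  l1 : Integrable F stripMeasure
  l2 : MemLp F 2 stripMeasure

/-- The inverse Fourier transform in the first variable, as a function. -/
def invFT (F : ℝ × ℝ → ℂ) (p : ℝ × ℝ) : ℂ := 𝓕⁻ (fun ξ => F (ξ, p.2)) p.1

namespace FreqAdm

variable {F G : ℝ × ℝ → ℂ}

theorem partialFT (hF : FreqAdm F) : PartialFT (invFT F) F :=
  (PartialFT.fourierInv_slices hF.meas.stronglyMeasurable hF.l2 (integrable_slice hF.l1)).1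

theorem memLp_invFT (hF : FreqAdm F) : MemLp (invFT F) 2 stripMeasure :=
  (PartialFT.fourierInv_slices hF.meas.stronglyMeasurable hF.l2 (integrable_slice hF.l1)).2

/-- The inverse Fourier transform in the first variable, as an element of `L²` of the channel. -/
def field (hF : FreqAdm F) : StripL2 := hF.memLp_invFT.toLp _

theorem field_ae_eq (hF : FreqAdm F) : hF.field =ᵐ[stripMeasure] invFT F :=
  hF.memLp_invFT.coeFn_toLp

theorem partialFT_field (hF : FreqAdm F) : PartialFT hF.field F :=
  hF.partialFT.congr hF.field_ae_eq.symm (EventuallyEq.refl _ _)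

theorem field_eq (hF : FreqAdm F) {f : StripL2} (h : PartialFT f F) : f = hF.field :=
  Lp.ext (h.injective hF.partialFT_field (Lp.aestronglyMeasurable _) (Lp.aestronglyMeasurable _)
    hF.l2.1)

theorem add (hF : FreqAdm F) (hG : FreqAdm G) : FreqAdm (fun p => F p + G p) :=
  ⟨hF.meas.add hG.meas, hF.l1.add hG.l1, hF.l2.add hG.l2⟩

theorem bdd_mul (hF : FreqAdm F) {m : ℝ × ℝ → ℂ} (hm : Measurable m) {C : ℝ}
    (hC : ∀ p, p.2 ∈ Ioo (-1 : ℝ) 1 → ‖m p‖ ≤ C) : FreqAdm (fun p => m p * F p) := by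
  have hC' : ∀ᵐ p ∂stripMeasure, ‖m p‖ ≤ C := by
    filter_upwards [ae_restrict_mem isOpen_strip.measurableSet] with p hp using hC p hp.2
  refine ⟨hm.mul hF.meas, hF.l1.bdd_mul hm.aestronglyMeasurable hC', ?_⟩
  refine (hF.l2.const_mul (C : ℂ)).of_le (hm.mul hF.meas).aestronglyMeasurable ?_
  filter_upwards [hC'] with p hp
  rw [norm_mul, norm_mul, Complex.norm_real]
  gcongr
  exact hp.trans (le_abs_self C)

theorem const_mul (hF : FreqAdm F) (c : ℂ) : FreqAdm (fun p => c * F p) :=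
  hF.bdd_mul measurable_const (fun _ _ => le_refl ‖c‖)

end FreqAdm

theorem fourierInv_hasDerivAt {u : ℝ → ℂ} (h1 : Integrable u)
    (h2 : Integrable fun ξ : ℝ => (2 * π * ξ * I) * u ξ) (x : ℝ) :
    HasDerivAt (𝓕⁻ u) (𝓕⁻ (fun ξ : ℝ => (2 * π * ξ * I) * u ξ) x) x := by
  have h3 : Integrable fun ξ : ℝ => ξ • u ξ := by
    have := h2.const_mul (2 * π * I)⁻¹
    refine this.congr (Eventually.of_forall fun ξ => ?_)
    have : (π : ℂ) ≠ 0 := by exact_mod_cast Real.pi_ne_zero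
    beta_reduce
    rw [Complex.real_smul]
    field_simp [Complex.I_ne_zero]
  have h4 := Real.hasDerivAt_fourier h1 h3 (-x)
  have h5 := h4.scomp x (hasDerivAt_neg x)
  have e : 𝓕⁻ u = 𝓕 u ∘ Neg.neg := by
    ext z; exact Real.fourierInv_eq_fourier_neg u z
  have e2 : 𝓕⁻ (fun ξ : ℝ => (2 * π * ξ * I) * u ξ) x =
      (-1 : ℝ) • 𝓕 (fun ξ : ℝ => (-2 * π * I * ξ) • u ξ) (-x) := by
    rw [Real.fourierInv_eq_fourier_neg, neg_one_smul]
    simp only [Real.fourier_real_eq]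
    rw [← integral_neg]
    congr 1; ext ξ
    rw [← smul_neg]
    congr 1
    rw [smul_eq_mul]; ring
  rw [e, e2]
  exact h5

/-- Multiplication by `2πiξ` on the frequency side is the weak derivative `∂_x`. -/
theorem FreqAdm.hasWeakPartial_dx {F F' : ℝ × ℝ → ℂ} (hF : FreqAdm F) (hF' : FreqAdm F')
    (h : ∀ p, F' p = (2 * π * p.1 * I) * F p) :
    HasWeakPartial 1 0 hF.field hF'.field := by
  intro θ hθ hθ' _
  rw [classicalPartial_one_zero hθ]
  obtain ⟨t1, t2, -⟩ := test_fderiv hθ hθ' (1, 0)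
  have i1 := integrable_mul_test hF.field.locallyIntegrable t1.continuous t2
  have i2 := integrable_mul_test hF'.field.locallyIntegrable hθ.continuous hθ'
  have e1 := hF.field_ae_eq
  have e2 := hF'.field_ae_eq
  have i1' : Integrable (fun p => invFT F p * ((fderiv ℝ θ p (1, 0) : ℝ) : ℂ)) stripMeasure :=
    i1.congr (by filter_upwards [e1] with p hp; rw [hp])
  have i2' : Integrable (fun p => invFT F' p * (θ p : ℂ)) stripMeasure :=
    i2.congr (by filter_upwards [e2] with p hp; rw [hp])
  have c1 : ∫ p, hF.field p * ((fderiv ℝ θ p (1, 0) : ℝ) : ℂ) ∂stripMeasure =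
      ∫ p, invFT F p * ((fderiv ℝ θ p (1, 0) : ℝ) : ℂ) ∂stripMeasure :=
    integral_congr_ae (by filter_upwards [e1] with p hp; rw [hp])
  have c2 : ∫ p, hF'.field p * (θ p : ℂ) ∂stripMeasure =
      ∫ p, invFT F' p * (θ p : ℂ) ∂stripMeasure :=
    integral_congr_ae (by filter_upwards [e2] with p hp; rw [hp])
  rw [c1, c2]
  have s1 := i1'
  have s2 := i2'
  rw [stripMeasure_eq_prod] at i1' i2' ⊢
  rw [integral_prod_symm _ i1', integral_prod_symm _ i2', ← integral_const_mul]
  apply integral_congr_ae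
  filter_upwards [integrable_slice hF.l1, integrable_slice hF'.l1, integrable_slice s1,
    integrable_slice s2, aestronglyMeasurable_slice hF.memLp_invFT.1] with y h1 h2 h3 h4 h5
  have h2' : Integrable fun ξ : ℝ => (2 * π * ξ * I) * F (ξ, y) := by
    simpa only [h] using h2
  have hd := fourierInv_hasDerivAt h1 h2'
  have hcont : Continuous (fun x => invFT F (x, y)) :=
    continuous_iff_continuousAt.2 fun x => (hd x).continuousAt
  have hsl : HasCompactSupport (fun x => (θ (x, y) : ℂ)) := by
    refine HasCompactSupport.of_support_subset_isCompact
      (hθ'.isCompact.image continuous_fst) (fun x hx => ?_)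
    refine ⟨(x, y), subset_tsupport _ ?_, rfl⟩
    simpa using hx
  have hcθ : Continuous (fun x => (θ (x, y) : ℂ)) :=
    Complex.continuous_ofReal.comp (hθ.continuous.comp (by fun_prop))
  have key := integral_mul_deriv_eq_deriv_mul_of_integrable
    (u := fun x => invFT F (x, y)) (v := fun x => (θ (x, y) : ℂ))
    (u' := fun x => invFT F' (x, y)) (v' := fun x => ((fderiv ℝ θ (x, y) (1, 0) : ℝ) : ℂ))
    (fun x _ => by
      have := hd x
      simp only [invFT, h]
      exact this)
    (fun x _ => (hasDerivAt_fst_of_contDiff hθ x y).ofReal_comp) h3 h4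
    ((hcont.mul hcθ).integrable_of_hasCompactSupport hsl.mul_left)
  rw [key]
  simp

theorem integral_fourierInv_mul {f b : ℝ → ℂ} (hf : Integrable f) (hb : Integrable b) :
    ∫ ξ, b ξ * 𝓕⁻ f ξ = ∫ x, 𝓕⁻ b x * f x := by
  have e2 : ∫ ξ, b ξ * 𝓕⁻ f ξ = ∫ x, b (-x) * 𝓕 f x := by
    rw [← integral_neg_eq_self]
    simp only [Real.fourierInv_eq_fourier_neg, neg_neg]
  rw [e2, integral_fourier_mul hf hb.comp_neg, ← Real.fourierInv_eq_fourier_comp_neg]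

theorem integrable_test_slice {θ : ℝ × ℝ → ℝ} (hθ : Continuous θ) (hθ' : HasCompactSupport θ)
    (y : ℝ) : Integrable (fun x => (θ (x, y) : ℂ)) := by
  refine (Complex.continuous_ofReal.comp (hθ.comp (by fun_prop))).integrable_of_hasCompactSupport ?_
  refine HasCompactSupport.of_support_subset_isCompact
      (hθ'.isCompact.image continuous_fst) (fun x hx => ?_)
  refine ⟨(x, y), subset_tsupport _ ?_, rfl⟩
  simpa using hx

theorem exists_integrable_bound {θ : ℝ × ℝ → ℝ} (hθ : Continuous θ) (hθ' : HasCompactSupport θ) :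
    ∃ b : ℝ → ℝ, Integrable b ∧ ∀ x y, |θ (x, y)| ≤ b x := by
  obtain ⟨C, hC⟩ := hθ'.exists_bound_of_continuous hθ
  have hC0 : 0 ≤ C := (norm_nonneg _).trans (hC 0)
  set K := Prod.fst '' tsupport θ with hK
  have hKc : IsCompact K := hθ'.isCompact.image continuous_fst
  refine ⟨K.indicator fun _ => C, ?_, fun x y => ?_⟩
  · refine (integrable_indicator_iff hKc.measurableSet).2 ?_
    exact integrableOn_const (hKc.measure_lt_top.ne)
  · by_cases hx : x ∈ K
    · rw [indicator_of_mem hx]; exact hC _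
    · rw [indicator_of_notMem hx]
      have : θ (x, y) = 0 := by
        by_contra hne
        exact hx ⟨(x, y), subset_tsupport _ hne, rfl⟩
      simp [this]

theorem hasDerivAt_invFT_test {θ : ℝ × ℝ → ℝ} (hθ : ContDiff ℝ (⊤ : ℕ∞) θ)
    (hθ' : HasCompactSupport θ) (ξ y : ℝ) :
    HasDerivAt (fun y => invFT (fun p => (θ p : ℂ)) (ξ, y))
      (invFT (fun p => ((fderiv ℝ θ p (0, 1) : ℝ) : ℂ)) (ξ, y)) y := by
  obtain ⟨t1, t2, -⟩ := test_fderiv hθ hθ' (0, 1)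
  obtain ⟨b, hb, hb'⟩ := exists_integrable_bound t1.continuous t2
  simp only [invFT, Real.fourierInv_eq]
  have hm : ∀ (ψ : ℝ × ℝ → ℝ) (y : ℝ), Continuous ψ → Continuous fun x : ℝ =>
      Real.fourierChar (inner ℝ x ξ) • (ψ (x, y) : ℂ) := by
    intro ψ y hψ
    have h2 : Continuous fun x : ℝ => (Real.fourierChar (inner ℝ x ξ) : ℂ) := by fun_prop
    have h3 : Continuous fun x : ℝ => (ψ (x, y) : ℂ) :=
      Complex.continuous_ofReal.comp (hψ.comp (by fun_prop))
    exact h2.smul h3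
  refine (hasDerivAt_integral_of_dominated_loc_of_deriv_le (bound := b) (s := univ)
    (F := fun y x => Real.fourierChar (inner ℝ x ξ) • (θ (x, y) : ℂ))
    (F' := fun y x => Real.fourierChar (inner ℝ x ξ) • ((fderiv ℝ θ (x, y) (0, 1) : ℝ) : ℂ))
    univ_mem ?_ ?_ ?_ ?_ hb ?_).2
  · exact Eventually.of_forall fun y => (hm θ y hθ.continuous).aestronglyMeasurable
  · refine (integrable_test_slice hθ.continuous hθ' y).norm.mono'
      (hm θ y hθ.continuous).aestronglyMeasurable (Eventually.of_forall fun x => ?_)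
    rw [Circle.norm_smul]
  · exact (hm _ y t1.continuous).aestronglyMeasurable
  · refine Eventually.of_forall fun x y _ => ?_
    rw [Circle.norm_smul, Complex.norm_real]
    exact hb' x y
  · refine Eventually.of_forall fun x y _ => ?_
    exact ((hasDerivAt_snd_of_contDiff hθ x y).ofReal_comp).const_smul
      (Real.fourierChar (inner ℝ x ξ))

theorem norm_fourierInv_le {u : ℝ → ℂ} (ξ : ℝ) : ‖𝓕⁻ u ξ‖ ≤ ∫ x, ‖u x‖ := by
  rw [Real.fourierInv_eq]
  refine (norm_integral_le_integral_norm _).trans (le_of_eq ?_)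
  congr 1; ext x
  rw [Circle.norm_smul]

theorem measurable_invFT {F : ℝ × ℝ → ℂ} (hF : Measurable F) : Measurable (invFT F) :=
  (stronglyMeasurable_fourierInv_slice hF.stronglyMeasurable).measurable

/-- Green's formula in `y` for a field given on the frequency side. -/
theorem FreqAdm.green_y {F F' : ℝ × ℝ → ℂ} (hF : FreqAdm F) (hF' : FreqAdm F')
    (hd : ∀ ξ y, HasDerivAt (fun y => F (ξ, y)) (F' (ξ, y)) y)
    (hc : ∀ ξ, Continuous fun y => F' (ξ, y)) {θ : ℝ × ℝ → ℝ} (hθ : ContDiff ℝ (⊤ : ℕ∞) θ)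
    (hθ' : HasCompactSupport θ)
    (hw : ∀ ξ x, F (ξ, 1) * (θ (x, 1) : ℂ) = 0 ∧ F (ξ, -1) * (θ (x, -1) : ℂ) = 0) :
    ∫ p, hF.field p * ((classicalPartial 0 1 θ p : ℝ) : ℂ) ∂stripMeasure =
      - ∫ p, hF'.field p * (θ p : ℂ) ∂stripMeasure := by
  rw [classicalPartial_zero_one hθ]
  obtain ⟨t1, t2, -⟩ := test_fderiv hθ hθ' (0, 1)
  have flip : ∀ {G : ℝ × ℝ → ℂ} (hG : FreqAdm G) {ψ : ℝ × ℝ → ℝ}, Continuous ψ →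
      HasCompactSupport ψ →
      Integrable (fun p => G p * invFT (fun p => (ψ p : ℂ)) p) stripMeasure ∧
      ∫ p, hG.field p * (ψ p : ℂ) ∂stripMeasure =
        ∫ p, G p * invFT (fun p => (ψ p : ℂ)) p ∂stripMeasure := by
    intro G hG ψ hψ hψ'
    have i1 := integrable_mul_test hG.field.locallyIntegrable hψ hψ'
    have i1' : Integrable (fun p => invFT G p * (ψ p : ℂ)) stripMeasure :=
      i1.congr (by filter_upwards [hG.field_ae_eq] with p hp; rw [hp])
    have c1 : ∫ p, hG.field p * (ψ p : ℂ) ∂stripMeasure =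
        ∫ p, invFT G p * (ψ p : ℂ) ∂stripMeasure :=
      integral_congr_ae (by filter_upwards [hG.field_ae_eq] with p hp; rw [hp])
    obtain ⟨b, hb, hb'⟩ := exists_integrable_bound hψ hψ'
    have i2 : Integrable (fun p => G p * invFT (fun p => (ψ p : ℂ)) p) stripMeasure := by
      have hm : Measurable (fun p => (ψ p : ℂ)) := Complex.measurable_ofReal.comp hψ.measurable
      refine hG.l1.mul_bdd (c := ∫ x, b x) (measurable_invFT hm).aestronglyMeasurable
        (Eventually.of_forall fun p => ?_)
      refine (norm_fourierInv_le p.1).trans (integral_mono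
        (integrable_test_slice hψ hψ' p.2).norm hb fun x => ?_)
      simpa using hb' x p.2
    refine ⟨i2, ?_⟩
    rw [c1]
    rw [stripMeasure_eq_prod] at i1' i2 ⊢
    rw [integral_prod_symm _ i1', integral_prod_symm _ i2]
    apply integral_congr_ae
    filter_upwards [integrable_slice hG.l1] with y hy
    have := integral_fourierInv_mul (integrable_test_slice hψ hψ' y) hy
    exact this.symm
  obtain ⟨i1, e1⟩ := flip hF t1.continuous t2
  obtain ⟨i2, e2⟩ := flip hF' hθ.continuous hθ'
  rw [e1, e2]
  rw [stripMeasure_eq_prod] at i1 i2 ⊢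
  rw [integral_prod _ i1, integral_prod _ i2, ← integral_neg]
  congr 1; ext ξ
  rw [integral_section, integral_section]
  have hT := hasDerivAt_invFT_test hθ hθ' ξ
  have hT' : Continuous fun y => invFT (fun p => ((fderiv ℝ θ p (0, 1) : ℝ) : ℂ)) (ξ, y) :=
    continuous_iff_continuousAt.2 fun y => (hasDerivAt_invFT_test t1 t2 ξ y).continuousAt
  rw [intervalIntegral.integral_mul_deriv_eq_deriv_mul (u := fun y => F (ξ, y))
    (v := fun y => invFT (fun p => (θ p : ℂ)) (ξ, y)) (u' := fun y => F' (ξ, y))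
    (fun y _ => hd ξ y) (fun y _ => hT y) ((hc ξ).intervalIntegrable _ _)
    (hT'.intervalIntegrable _ _)]
  have hz : ∀ (c : ℂ) (y : ℝ), (∀ x, c * (θ (x, y) : ℂ) = 0) →
      c * invFT (fun p => (θ p : ℂ)) (ξ, y) = 0 := by
    intro c y hcy
    simp only [invFT, Real.fourierInv_eq]
    rw [← integral_const_mul]
    refine integral_eq_zero_of_ae (Eventually.of_forall fun x => ?_)
    beta_reduce
    rw [Circle.smul_def, smul_eq_mul, mul_left_comm, hcy, mul_zero]; rfl
  rw [hz _ _ fun x => (hw ξ x).1, hz _ _ fun x => (hw ξ x).2]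
  simp

theorem FreqAdm.hasWeakPartial_dy {F F' : ℝ × ℝ → ℂ} (hF : FreqAdm F) (hF' : FreqAdm F')
    (hd : ∀ ξ y, HasDerivAt (fun y => F (ξ, y)) (F' (ξ, y)) y)
    (hc : ∀ ξ, Continuous fun y => F' (ξ, y)) : HasWeakPartial 0 1 hF.field hF'.field := by
  intro θ hθ hθ' hs
  have hz : ∀ x y : ℝ, y ∉ Ioo (-1 : ℝ) 1 → θ (x, y) = 0 := by
    intro x y hy
    by_contra hne
    exact hy (hs (subset_tsupport _ hne)).2
  rw [hF.green_y hF' hd hc hθ hθ' fun ξ x => ⟨by rw [hz x 1 (by simp)]; simp,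
    by rw [hz x (-1) (by simp)]; simp⟩]
  simp

/-- A symbol that vanishes at `y = ±1` gives a field that vanishes on the walls. -/
theorem FreqAdm.vanishesOnWalls {F F' : ℝ × ℝ → ℂ} (hF : FreqAdm F) (hF' : FreqAdm F')
    (hd : ∀ ξ y, HasDerivAt (fun y => F (ξ, y)) (F' (ξ, y)) y)
    (hc : ∀ ξ, Continuous fun y => F' (ξ, y)) (h1 : ∀ ξ, F (ξ, 1) = 0)
    (h2 : ∀ ξ, F (ξ, -1) = 0) : VanishesOnWalls hF.field :=
  ⟨hF'.field, fun θ hθ hθ' => hF.green_y hF' hd hc hθ hθ' fun ξ x => by simp [h1, h2]⟩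

/-- A bounded multiplier acting on a field given on the frequency side. -/
theorem multNorm_le {m : ℝ → ℝ} {p : ℝ≥0∞} {f : StripL2} {F : ℝ × ℝ → ℂ} (hf : PartialFT f F)
    {H : ℝ × ℝ → ℂ} (hH : FreqAdm H)
    (h : ∀ q : ℝ × ℝ, H q = (m (2 * π * q.1) : ℂ) * F q) :
    multNorm m p f ≤ eLpNorm hH.field p stripMeasure := by
  refine iInf₂_le hH.field ?_
  filter_upwards [hf, hH.partialFT_field] with y ⟨h1, h2, h3⟩ ⟨h4, h5, h6⟩
  refine ⟨h1, h4, ?_⟩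
  rw [h3, h6]
  filter_upwards [h2.coeFn_toLp, h5.coeFn_toLp] with ξ e1 e2
  rw [e1, e2, h]

theorem FreqAdm.eLpNorm_two_field {H : ℝ × ℝ → ℂ} (hH : FreqAdm H) :
    eLpNorm hH.field 2 stripMeasure = eLpNorm H 2 stripMeasure :=
  (hH.partialFT_field.eLpNorm_eq (Lp.aestronglyMeasurable _) hH.l2.1).symm

/-- The `L^∞` norm of a field is at most the `L¹` norm of its transform. -/
theorem FreqAdm.eLpNorm_top_field_le {H : ℝ × ℝ → ℂ} (hH : FreqAdm H) {c : ℝ≥0∞}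
    (h : ∀ y ∈ Ioo (-1 : ℝ) 1, ∫⁻ ξ, ‖H (ξ, y)‖ₑ ≤ c) :
    eLpNorm hH.field ∞ stripMeasure ≤ c := by
  rw [eLpNorm_exponent_top]
  refine eLpNormEssSup_le_of_ae_enorm_bound ?_
  filter_upwards [hH.field_ae_eq, ae_restrict_mem isOpen_strip.measurableSet] with p hp hp2
  rw [hp]
  refine le_trans ?_ (h p.2 hp2.2)
  simp only [invFT, Real.fourierInv_eq]
  refine (enorm_integral_le_lintegral_enorm _).trans (le_of_eq ?_)
  congr 1; ext x
  rw [← ofReal_norm, ← ofReal_norm, Circle.norm_smul]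

/-! ### The Fourier transform of the data -/

theorem stronglyMeasurable_yPrim {g : ℝ × ℝ → ℂ} (hg : StronglyMeasurable g) :
    StronglyMeasurable (yPrim g) := by
  have key : ∀ s : Set ((ℝ × ℝ) × ℝ), MeasurableSet s → StronglyMeasurable fun p : ℝ × ℝ =>
      ∫ z, s.indicator (fun q => g (q.1.1, q.2)) (p, z) := by
    intro s hs
    refine StronglyMeasurable.integral_prod_right (f := fun (p : ℝ × ℝ) (z : ℝ) =>
      s.indicator (fun q => g (q.1.1, q.2)) (p, z)) ?_
    exact StronglyMeasurable.indicator (hg.comp_measurable (by fun_prop)) hs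
  have h1 := (key {q | -1 < q.2 ∧ q.2 ≤ q.1.2}
    ((measurableSet_lt measurable_const measurable_snd).inter
      (measurableSet_le measurable_snd measurable_fst.snd))).sub
    (key {q | q.1.2 < q.2 ∧ q.2 ≤ -1}
    ((measurableSet_lt measurable_fst.snd measurable_snd).inter
      (measurableSet_le measurable_snd measurable_const)))
  convert h1 using 1
  funext p
  unfold yPrim
  rw [intervalIntegral, ← integral_indicator measurableSet_Ioc, ← integral_indicator measurableSet_Ioc]
  rfl

/-- The Fourier transform in the first variable, as a function. -/
def sliceFT (g : ℝ × ℝ → ℂ) (p : ℝ × ℝ) : ℂ := 𝓕 (fun x => g (x, p.2)) p.1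

theorem norm_sliceFT_le (g : ℝ × ℝ → ℂ) (ξ y : ℝ) : ‖sliceFT g (ξ, y)‖ₑ ≤ ∫⁻ x, ‖g (x, y)‖ₑ := by
  unfold sliceFT
  rw [Real.fourier_eq']
  refine (enorm_integral_le_lintegral_enorm _).trans (lintegral_mono fun x => ?_)
  rw [enorm_smul]
  refine mul_le_of_le_one_left (zero_le) ?_
  rw [← ofReal_norm, Complex.norm_exp_ofReal_mul_I]
  simp

theorem lintegral_sliceFT_le {g : ℝ × ℝ → ℂ} (hg : AEStronglyMeasurable g stripMeasure) (ξ : ℝ) :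
    ∫⁻ y, ‖sliceFT g (ξ, y)‖ₑ ∂sectionMeasure ≤ ∫⁻ p, ‖g p‖ₑ ∂stripMeasure := by
  rw [lintegral_strip hg.enorm]
  exact lintegral_mono fun y => norm_sliceFT_le g ξ y

theorem integrable_sliceFT {g : ℝ × ℝ → ℂ} (hm : StronglyMeasurable g)
    (hg : Integrable g stripMeasure) (ξ : ℝ) :
    Integrable (fun y => sliceFT g (ξ, y)) sectionMeasure :=
  ⟨((stronglyMeasurable_fourier_slice hm).comp_measurable (by fun_prop :
      Measurable fun y : ℝ => (ξ, y))).aestronglyMeasurable,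
    (lintegral_sliceFT_le hg.1 ξ).trans_lt hg.2⟩

theorem sliceFT_yPrim {g : ℝ × ℝ → ℂ} (hg : Integrable g stripMeasure) {y : ℝ}
    (hy : y ∈ Icc (-1 : ℝ) 1) (ξ : ℝ) :
    sliceFT (yPrim g) (ξ, y) = yPrim (sliceFT g) (ξ, y) := by
  unfold sliceFT yPrim
  simp only [Real.fourier_eq', intervalIntegral.integral_of_le hy.1, ← integral_smul]
  rw [integral_integral_swap]
  have h1 : Integrable g ((volume : Measure ℝ).prod (volume.restrict (Ioc (-1 : ℝ) y))) := by
    rw [stripMeasure_eq_prod] at hg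
    refine hg.mono_measure (Measure.prod_mono le_rfl ?_)
    rw [sectionMeasure, restrict_Ioo_eq_restrict_Ioc]
    exact Measure.restrict_mono (Ioc_subset_Ioc_right hy.2) le_rfl
  refine h1.mono (AEStronglyMeasurable.smul (f := fun p : ℝ × ℝ =>
    Complex.exp (((-2 * π * inner ℝ p.1 ξ : ℝ) : ℂ) * I))
    (Continuous.aestronglyMeasurable (by fun_prop)) h1.1) ?_
  refine Eventually.of_forall fun p => ?_
  simp only [Function.uncurry]
  rw [norm_smul, Complex.norm_exp_ofReal_mul_I, one_mul]

theorem integrable_fourier_kernel_smul {f : ℝ → ℂ} (hf : Integrable f) (ξ : ℝ) :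
    Integrable fun x : ℝ =>
      Complex.exp (((-2 * π * inner ℝ x ξ : ℝ) : ℂ) * I) • f x := by
  refine hf.mono (AEStronglyMeasurable.smul (f := fun x : ℝ =>
    Complex.exp (((-2 * π * inner ℝ x ξ : ℝ) : ℂ) * I))
    (Continuous.aestronglyMeasurable (by fun_prop)) hf.1) ?_
  exact Eventually.of_forall fun p => by
    rw [norm_smul, Complex.norm_exp_ofReal_mul_I, one_mul]

/-- If `f = c(x) + ∫_{-1}^y g dz`, the Fourier transforms in `x` satisfy the same relation. -/
theorem sliceFT_eq_add_yPrim {f g : ℝ × ℝ → ℂ} {c : ℝ → ℂ} (hgm : StronglyMeasurable g)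
    (hg : Integrable g stripMeasure) (hc : Integrable c)
    (h : ∀ᵐ p ∂stripMeasure, f p = c p.1 + yPrim g p) :
    ∀ᵐ y ∂sectionMeasure, ∀ ξ, sliceFT f (ξ, y) = 𝓕 c ξ + yPrim (sliceFT g) (ξ, y) := by
  filter_upwards [ae_ae_of_ae_strip h, integrable_slice (integrable_yPrim hgm hg),
    ae_restrict_mem measurableSet_Ioo] with y hy hy2 hyI ξ
  rw [← sliceFT_yPrim hg ⟨hyI.1.le, hyI.2.le⟩]
  unfold sliceFT
  simp only [Real.fourier_eq']
  rw [← integral_add]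
  · refine integral_congr_ae ?_
    filter_upwards [hy] with x hx
    simp only [hx, smul_add]
  · exact integrable_fourier_kernel_smul hc ξ
  · exact integrable_fourier_kernel_smul hy2 ξ

/-- The weak derivatives `∂_x^{a+1} ∂_y^b f` and `∂_x^a ∂_y^b f` differ, on the Fourier side, by the
factor `2πiξ`. -/
theorem partialFourier_weak_succ {a b : ℕ} {f g h : StripL2} (hg : HasWeakPartial a b f g)
    (hh : HasWeakPartial (a + 1) b f h) :
    partialFourier h =ᵐ[stripMeasure]
      fun p => (2 * π * p.1 * I) * partialFourier g p := by
  refine PartialFT.weak_dx (Lp.memLp g) (Lp.memLp h) (Lp.memLp _) (Lp.memLp _)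
    (partialFT_partialFourier g) (partialFT_partialFourier h) ?_
  intro α γ hα hα' hγ hγ' hγs
  have h1 := hg.product (contDiff_infty_iff_deriv.1 hα).2 hα'.deriv hγ hγ' hγs
  have h2 := hh.product hα hα' hγ hγ' hγs
  rw [iteratedDeriv_succ'] at h2
  rw [h1] at h2
  have h3 : ((-1 : ℂ)) ^ (a + b) ≠ 0 := by simp
  refine mul_left_cancel₀ h3 (h2.trans ?_)
  ring

/-- One-dimensional Sobolev inequality on the section `(-1, 1)`: a function with derivative `h` is
bounded by its own `L¹` norm and that of `h`. -/
theorem norm_le_of_eq_primitive {g h : ℝ → ℂ} {c : ℂ} (hh : Integrable h sectionMeasure)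
    (hg : ∀ y ∈ Icc (-1 : ℝ) 1, g y = c + ∫ z in (-1 : ℝ)..y, h z)
    (hgi : Integrable g sectionMeasure) {y : ℝ} (hy : y ∈ Icc (-1 : ℝ) 1) :
    ‖g y‖ ≤ (∫ z, ‖g z‖ ∂sectionMeasure) + ∫ z, ‖h z‖ ∂sectionMeasure := by
  have hhi := intervalIntegrable_of_section hh
  have key : ∀ z ∈ Icc (-1 : ℝ) 1, ‖g y‖ ≤ ‖g z‖ + ∫ z, ‖h z‖ ∂sectionMeasure := by
    intro z hz
    have h1 : IntervalIntegrable h volume (-1) z := hhi.mono_set (by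
      rw [uIcc_of_le hz.1, uIcc_of_le (by norm_num)]; exact Icc_subset_Icc_right hz.2)
    have h2 : IntervalIntegrable h volume (-1) y := hhi.mono_set (by
      rw [uIcc_of_le hy.1, uIcc_of_le (by norm_num)]; exact Icc_subset_Icc_right hy.2)
    have h3 : g y = g z + ∫ x in z..y, h x := by
      rw [hg y hy, hg z hz, ← intervalIntegral.integral_add_adjacent_intervals h1 (h1.symm.trans h2)]
      ring
    rw [h3]
    refine (norm_add_le _ _).trans (add_le_add le_rfl ?_)
    refine (intervalIntegral.norm_integral_le_integral_norm_uIoc).trans ?_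
    rw [sectionMeasure, restrict_Ioo_eq_restrict_Ioc]
    refine setIntegral_mono_set ?_ (Eventually.of_forall fun _ => norm_nonneg _) ?_
    · exact ((integrableOn_Ioc_iff_integrableOn_Ioo).2 hh).norm
    · refine Eventually.of_forall (α := ℝ) fun x hx => ?_
      rcases le_total z y with h | h
      · rw [uIoc_of_le h] at hx; exact ⟨hz.1.trans_lt hx.1, hx.2.trans hy.2⟩
      · rw [uIoc_of_ge h] at hx; exact ⟨hy.1.trans_lt hx.1, hx.2.trans hz.2⟩
  have h4 : ∫ _z, ‖g y‖ ∂sectionMeasure ≤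
      ∫ z, (‖g z‖ + ∫ z, ‖h z‖ ∂sectionMeasure) ∂sectionMeasure := by
    refine integral_mono_ae (integrable_const _) (hgi.norm.add (integrable_const _)) ?_
    filter_upwards [ae_restrict_mem measurableSet_Ioo] with z hz using key z ⟨hz.1.le, hz.2.le⟩
  rw [integral_add hgi.norm (integrable_const _), integral_const, integral_const] at h4
  have h5 : sectionMeasure.real univ = 2 := by
    simp [sectionMeasure, measureReal_def]; norm_num
  rw [h5] at h4
  simp only [smul_eq_mul] at h4
  have h6 : 0 ≤ ∫ z, ‖g z‖ ∂sectionMeasure := integral_nonneg fun _ => norm_nonneg _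
  linarith

theorem yPrim_congr {g g' : ℝ × ℝ → ℂ} {ξ : ℝ}
    (h : ∀ᵐ y ∂sectionMeasure, g (ξ, y) = g' (ξ, y)) {y : ℝ} (hy : y ∈ Icc (-1 : ℝ) 1) :
    yPrim g (ξ, y) = yPrim g' (ξ, y) := by
  unfold yPrim
  rw [intervalIntegral.integral_of_le hy.1, intervalIntegral.integral_of_le hy.1]
  refine setIntegral_congr_ae₀ measurableSet_Ioc.nullMeasurableSet ?_
  rw [sectionMeasure, restrict_Ioo_eq_restrict_Ioc] at h
  filter_upwards [(ae_restrict_iff' measurableSet_Ioc).1 h] with z hz hz2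
  exact hz ⟨hz2.1, hz2.2.trans hy.2⟩

theorem lintegral_section_sq_le (f : ℝ → ℂ) (hf : AEMeasurable f sectionMeasure) :
    (∫⁻ y, ‖f y‖ₑ ∂sectionMeasure) ^ 2 ≤ 2 * ∫⁻ y, ‖f y‖ₑ ^ 2 ∂sectionMeasure := by
  have h := ENNReal.lintegral_mul_le_Lp_mul_Lq sectionMeasure
    (Real.HolderConjugate.two_two) (f := fun _ => 1) (g := fun y => ‖f y‖ₑ) aemeasurable_const
    hf.enorm
  simp only [Pi.mul_apply, one_mul] at h
  have h2 : ∫⁻ _y, (1 : ℝ≥0∞) ^ (2 : ℝ) ∂sectionMeasure = 2 := by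
    simp [sectionMeasure]; norm_num
  rw [h2] at h
  calc (∫⁻ y, ‖f y‖ₑ ∂sectionMeasure) ^ 2 ≤ _ := pow_le_pow_left' h 2
    _ = _ := by
      rw [mul_pow, ← ENNReal.rpow_natCast, ← ENNReal.rpow_natCast, ← ENNReal.rpow_mul,
        ← ENNReal.rpow_mul]
      norm_num

/-- The norm of `L¹_x H³_y` controls `L¹` norms over the channel, because the sections have finite
length. -/
theorem lintegral_weakPartial_le (f : StripL2) {j : ℕ} (hj : j < 4) :
    ∫⁻ p, ‖weakPartial 0 j f p‖ₑ ∂stripMeasure ≤ 2 * normL1H3 f := by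
  have hm := (Lp.stronglyMeasurable (weakPartial 0 j f))
  rw [lintegral_strip' hm.aestronglyMeasurable.enorm, normL1H3, ← lintegral_const_mul']
  · refine lintegral_mono fun x => ?_
    have h1 := lintegral_section_sq_le (fun y => weakPartial 0 j f (x, y))
      (hm.comp_measurable (by fun_prop : Measurable fun y : ℝ => (x, y))).measurable.aemeasurable
    have h2 : ∫⁻ y in Ioo (-1 : ℝ) 1, ‖weakPartial 0 j f (x, y)‖ₑ ^ 2 ≤
        ∑ j ∈ Finset.range 4, ∫⁻ y in Ioo (-1 : ℝ) 1, ‖weakPartial 0 j f (x, y)‖ₑ ^ 2 :=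
      Finset.single_le_sum (f := fun j => ∫⁻ y in Ioo (-1 : ℝ) 1, ‖weakPartial 0 j f (x, y)‖ₑ ^ 2)
        (fun _ _ => zero_le) (Finset.mem_range.2 hj)
    refine (ENNReal.pow_le_pow_left_iff two_ne_zero).1 (h1.trans ?_)
    have h3 : ∀ S : ℝ≥0∞, (2 * S ^ (1 / 2 : ℝ)) ^ 2 = 4 * S := by
      intro S
      rw [mul_pow, ← ENNReal.rpow_natCast (S ^ _), ← ENNReal.rpow_mul]; norm_num
    rw [h3]
    gcongr
    norm_num
  · norm_num

theorem normH3_nonneg (f : StripL2) : 0 ≤ normH3 f := Real.sqrt_nonneg _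

theorem norm_weakPartial_le (f : StripL2) {a b : ℕ} (h : a + b ≤ 3) :
    ‖weakPartial a b f‖ ≤ normH3 f := by
  refine Real.le_sqrt_of_sq_le ?_
  have h1 : ‖weakPartial a b f‖ ^ 2 ≤
      ∑ q ∈ Finset.HasAntidiagonal.antidiagonal (a + b), ‖weakPartial q.1 q.2 f‖ ^ 2 :=
    Finset.single_le_sum (f := fun q : ℕ × ℕ => ‖weakPartial q.1 q.2 f‖ ^ 2) (a := (a, b))
      (fun _ _ => sq_nonneg _) (Finset.HasAntidiagonal.mem_antidiagonal.2 rfl)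
  have h2 : a + b ∈ Finset.range 4 := Finset.mem_range.2 (by omega)
  exact h1.trans (Finset.single_le_sum (f := fun n => ∑ q ∈ Finset.HasAntidiagonal.antidiagonal n,
    ‖weakPartial q.1 q.2 f‖ ^ 2) (fun _ _ => Finset.sum_nonneg fun _ _ => sq_nonneg _) h2)

/-- The Fourier transform in `x` of the initial vorticity, in a form that is defined for every
frequency and every `y`: `g0` is `C²` in `y` with derivatives `g1`, `g2`, and `g2` is a primitive of
`g3`. The functions `N0 ≤ N1 ≤ N2` of the frequency dominate `g0`, `g1`, `g2` uniformly in `y`; they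
are bounded and have weighted `L²` bounds, all of size `E`. By `slices`, almost every slice of the data is in
`L¹` in `x` with norm at most `E`. -/
structure Profile (f : StripL2) (E : ℝ) where
  g0 : ℝ × ℝ → ℂ
  g1 : ℝ × ℝ → ℂ
  g2 : ℝ × ℝ → ℂ
  g3 : ℝ × ℝ → ℂ
  N0 : ℝ → ℝ
  N1 : ℝ → ℝ
  N2 : ℝ → ℝ
  meas0 : Measurable g0
  meas1 : Measurable g1
  measN0 : Measurable N0
  measN1 : Measurable N1
  measN2 : Measurable N2
  deriv0 : ∀ ξ y, HasDerivAt (fun y => g0 (ξ, y)) (g1 (ξ, y)) y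
  deriv1 : ∀ ξ y, HasDerivAt (fun y => g1 (ξ, y)) (g2 (ξ, y)) y
  cont2 : ∀ ξ, Continuous fun y => g2 (ξ, y)
  int3 : ∀ ξ a b, IntervalIntegrable (fun y => g3 (ξ, y)) volume a b
  prim2 : ∀ ξ y, g2 (ξ, y) = g2 (ξ, -1) + ∫ z in (-1 : ℝ)..y, g3 (ξ, z)
  wall_one : ∀ ξ, g0 (ξ, 1) = 0
  wall_neg_one : ∀ ξ, g0 (ξ, -1) = 0
  N0_nonneg : ∀ ξ, 0 ≤ N0 ξ
  N0_le_N1 : ∀ ξ, N0 ξ ≤ N1 ξ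
  N1_le_N2 : ∀ ξ, N1 ξ ≤ N2 ξ
  N2_le : ∀ ξ, N2 ξ ≤ E
  norm0 : ∀ ξ, ∀ y ∈ Icc (-1 : ℝ) 1, ‖g0 (ξ, y)‖ ≤ N0 ξ
  norm1 : ∀ ξ, ∀ y ∈ Icc (-1 : ℝ) 1, ‖g1 (ξ, y)‖ ≤ N1 ξ
  norm2 : ∀ ξ, ∀ y ∈ Icc (-1 : ℝ) 1, ‖g2 (ξ, y)‖ ≤ N2 ξ
  norm3 : ∀ ξ, ∫ y in (-1 : ℝ)..1, ‖g3 (ξ, y)‖ ≤ N2 ξ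
  sq0 : eLpNorm (fun ξ => (1 + |ξ|) ^ 2 * N0 ξ) 2 volume ≤ ofReal E
  sq1 : eLpNorm (fun ξ => (1 + |ξ|) ^ 1 * N1 ξ) 2 volume ≤ ofReal E
  sq2 : eLpNorm N2 2 volume ≤ ofReal E
  adm20 : FreqAdm fun p => (p.1 : ℂ) ^ 2 * g0 p
  adm11 : FreqAdm fun p => (p.1 : ℂ) * g1 p
  adm02 : FreqAdm g2
  partialFT : PartialFT f g0
  slices : ∀ᵐ y ∂sectionMeasure, ∃ u : ℝ → ℂ, Integrable u ∧ ∫ x, ‖u x‖ ≤ E ∧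
    ∀ ξ, g0 (ξ, y) = 𝓕 u ξ

/-- The `L¹` norm over the cross section. -/
def sectionNorm (g : ℝ × ℝ → ℂ) (ξ : ℝ) : ℝ := ∫ y, ‖g (ξ, y)‖ ∂sectionMeasure

theorem sectionNorm_nonneg (g : ℝ × ℝ → ℂ) (ξ : ℝ) : 0 ≤ sectionNorm g ξ :=
  integral_nonneg fun _ => norm_nonneg _

theorem measurable_sectionNorm {g : ℝ × ℝ → ℂ} (hg : Measurable g) :
    Measurable (sectionNorm g) :=
  (StronglyMeasurable.integral_prod_right (f := fun (ξ : ℝ) (y : ℝ) => ‖g (ξ, y)‖)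
    (by simpa [Function.uncurry_def] using hg.norm.stronglyMeasurable)).measurable

theorem ofReal_sectionNorm {g : ℝ × ℝ → ℂ} {ξ : ℝ}
    (h : Integrable (fun y => g (ξ, y)) sectionMeasure) :
    ofReal (sectionNorm g ξ) = ∫⁻ y, ‖g (ξ, y)‖ₑ ∂sectionMeasure :=
  ofReal_integral_norm_eq_lintegral_enorm h

/-- Weighted `L²` bound in the frequency of the cross section norms, by Plancherel's theorem. -/
theorem eLpNorm_sectionNorm_le {f : StripL2} {b : ℕ} {g : ℝ × ℝ → ℂ} (hf : MemSobolev 3 f)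
    (hg : Measurable g) (hgi : ∀ ξ, Integrable (fun y => g (ξ, y)) sectionMeasure)
    (hP : PartialFT (weakPartial 0 b f) g) {m : ℕ} (hm : m + b ≤ 3) :
    eLpNorm (fun ξ => |ξ| ^ m * sectionNorm g ξ) 2 volume ≤ ofReal (2 * normH3 f) := by
  have h1 : ∀ m : ℕ, m + b ≤ 3 → partialFourier (weakPartial m b f) =ᵐ[stripMeasure]
      fun p => (2 * π * p.1 * I) ^ m * g p := by
    intro m
    induction m with
    | zero =>
      intro _
      simpa using hP.partialFourier_ae_eq hg.aestronglyMeasurable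
    | succ m ih =>
      intro hm
      have h2 := partialFourier_weak_succ (hf m b (by omega)).hasWeakPartial
        (hf (m + 1) b (by omega)).hasWeakPartial
      filter_upwards [h2, ih (by omega)] with p hp hp2
      rw [hp, hp2]; ring
  have h2 : ∫⁻ p, ‖(2 * π * p.1 * I) ^ m * g p‖ₑ ^ 2 ∂stripMeasure =
      ofReal (‖weakPartial m b f‖ ^ 2) := by
    rw [← partialFourier.norm_map, ← eLpNorm_two_sq, ← eLpNorm_congr_ae (h1 m hm), Lp.norm_def,
      ENNReal.ofReal_pow ENNReal.toReal_nonneg, ENNReal.ofReal_toReal (Lp.eLpNorm_ne_top _)]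
  have hmeas : Measurable fun p : ℝ × ℝ => (2 * π * p.1 * I) ^ m * g p := by
    fun_prop
  rw [lintegral_strip' (hmeas.enorm.pow_const _).aemeasurable] at h2
  rw [eLpNorm_two_le_iff]
  calc ∫⁻ ξ, ‖|ξ| ^ m * sectionNorm g ξ‖ₑ ^ 2
      ≤ ∫⁻ ξ, 2 * ∫⁻ y in Ioo (-1 : ℝ) 1, ‖(2 * π * ξ * I) ^ m * g (ξ, y)‖ₑ ^ 2 := by
        refine lintegral_mono fun ξ => ?_
        refine le_trans ?_ (lintegral_section_sq_le _ (by fun_prop))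
        gcongr
        rw [enorm_mul, ← ofReal_norm (sectionNorm g ξ), Real.norm_of_nonneg (sectionNorm_nonneg _ _),
          ofReal_sectionNorm (hgi ξ), ← lintegral_const_mul _ (by fun_prop)]
        refine lintegral_mono fun y => ?_
        rw [enorm_mul]
        gcongr
        rw [← ofReal_norm, ← ofReal_norm]
        refine ENNReal.ofReal_le_ofReal ?_
        simp only [norm_pow, norm_mul, Complex.norm_I, Complex.norm_real, Real.norm_eq_abs, abs_abs]
        gcongr
        simp only [Complex.norm_ofNat, abs_of_pos Real.pi_pos, mul_one]
        have := abs_nonneg ξ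
        nlinarith [Real.pi_gt_three]
    _ ≤ ofReal (2 * normH3 f) ^ 2 := by
        have h3 := norm_weakPartial_le f hm
        have h4 := norm_nonneg (weakPartial m b f)
        rw [lintegral_const_mul' _ _ (by norm_num), h2,
          ← ENNReal.ofReal_pow (mul_nonneg two_pos.le (normH3_nonneg f))]
        generalize ‖weakPartial m b f‖ = n at h3 h4
        rw [← ENNReal.ofReal_ofNat, ← ENNReal.ofReal_mul (by norm_num)]
        refine ENNReal.ofReal_le_ofReal ?_
        nlinarith

theorem sectionNorm_sliceFT_le {g : ℝ × ℝ → ℂ} (hg : StronglyMeasurable g) {E : ℝ} (hE : 0 ≤ E)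
    (h : ∫⁻ p, ‖g p‖ₑ ∂stripMeasure ≤ ofReal E) (ξ : ℝ) :
    sectionNorm (sliceFT g) ξ ≤ E := by
  have hi : Integrable g stripMeasure :=
    ⟨hg.aestronglyMeasurable, h.trans_lt ENNReal.ofReal_lt_top⟩
  rw [← ENNReal.ofReal_le_ofReal_iff hE, ofReal_sectionNorm (integrable_sliceFT hg hi ξ)]
  exact (lintegral_sliceFT_le hg.aestronglyMeasurable ξ).trans h

theorem sectionNorm_congr {g g' : ℝ × ℝ → ℂ} {ξ : ℝ}
    (h : ∀ᵐ y ∂sectionMeasure, g (ξ, y) = g' (ξ, y)) : sectionNorm g ξ = sectionNorm g' ξ :=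
  integral_congr_ae (by filter_upwards [h] with y hy; rw [hy])

theorem ae_strip_of_ae_section {P : ℝ × ℝ → Prop} (h : ∀ᵐ y ∂sectionMeasure, ∀ ξ, P (ξ, y)) :
    ∀ᵐ p ∂stripMeasure, P p := by
  rw [stripMeasure_eq_prod]
  filter_upwards [Measure.quasiMeasurePreserving_snd.ae h] with p hp using hp p.1

theorem eLpNorm_one_add_abs_pow_mul_le {l : ℝ → ℝ} (hl : Measurable l) (m : ℕ) (hm : m ≤ 2)
    {D : ℝ} (hD : 0 ≤ D) (h0 : eLpNorm (fun ξ => |ξ| ^ 0 * l ξ) 2 volume ≤ ofReal D)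
    (h1 : eLpNorm (fun ξ => |ξ| ^ m * l ξ) 2 volume ≤ ofReal D) :
    eLpNorm (fun ξ => (1 + |ξ|) ^ m * l ξ) 2 volume ≤ ofReal (4 * D) := by
  calc eLpNorm (fun ξ => (1 + |ξ|) ^ m * l ξ) 2 volume
      ≤ ofReal 2 * eLpNorm (fun ξ => ‖|ξ| ^ 0 * l ξ‖ + ‖|ξ| ^ m * l ξ‖) 2 volume := by
        refine eLpNorm_le_mul_eLpNorm_of_ae_le_mul (Eventually.of_forall fun ξ => ?_) 2
        rw [Real.norm_of_nonneg (by positivity : 0 ≤ ‖|ξ| ^ 0 * l ξ‖ + ‖|ξ| ^ m * l ξ‖),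
          norm_mul, norm_mul, norm_mul]
        have h2 : ‖(1 + |ξ|) ^ m‖ ≤ 2 * (‖|ξ| ^ 0‖ + ‖|ξ| ^ m‖) := by
          have := abs_nonneg ξ
          rw [Real.norm_of_nonneg (by positivity), Real.norm_of_nonneg (by positivity),
            Real.norm_of_nonneg (by positivity)]
          interval_cases m
          · norm_num
          · simp; linarith
          · nlinarith [sq_nonneg (1 - |ξ|)]
        nlinarith [norm_nonneg (l ξ)]
    _ ≤ ofReal 2 * (ofReal D + ofReal D) := by
        gcongr
        refine (eLpNorm_add_le (by fun_prop) (by fun_prop) (by norm_num)).trans ?_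
        rw [eLpNorm_norm, eLpNorm_norm]
        exact add_le_add h0 h1
    _ = _ := by
        rw [← ENNReal.ofReal_add hD hD, ← ENNReal.ofReal_mul (by norm_num)]
        congr 1; ring

theorem memLp_two_strip_of_le {F : ℝ × ℝ → ℂ} (hF : Measurable F) {N : ℝ → ℝ}
    (hN : MemLp N 2 volume) (h : ∀ ξ, ∀ y ∈ Icc (-1 : ℝ) 1, ‖F (ξ, y)‖ ≤ N ξ) :
    MemLp F 2 stripMeasure := by
  have h1 : MemLp (fun p : ℝ × ℝ => N p.1) 2 stripMeasure := by
    rw [stripMeasure_eq_prod]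
    exact hN.comp_fst sectionMeasure
  refine h1.mono hF.aestronglyMeasurable ?_
  filter_upwards [ae_restrict_mem isOpen_strip.measurableSet] with p hp
  exact (h p.1 p.2 ⟨hp.2.1.le, hp.2.2.le⟩).trans (le_abs_self _)

theorem memLp_inv_one_add_abs : MemLp (fun ξ : ℝ => (1 + |ξ|)⁻¹) 2 volume := by
  have hc : Continuous fun ξ : ℝ => (1 + |ξ|)⁻¹ :=
    (by fun_prop : Continuous fun ξ : ℝ => 1 + |ξ|).inv₀ fun ξ => by positivity
  rw [memLp_two_iff_integrable_sq hc.aestronglyMeasurable]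
  refine integrable_inv_one_add_sq.mono (by fun_prop) (Eventually.of_forall fun ξ => ?_)
  rw [Real.norm_of_nonneg (by positivity), Real.norm_of_nonneg (by positivity), inv_pow]
  refine inv_anti₀ (by positivity) ?_
  nlinarith [sq_abs ξ, abs_nonneg ξ]

theorem integrable_of_memLp_one_add_abs_mul {N : ℝ → ℝ}
    (h : MemLp (fun ξ => (1 + |ξ|) * N ξ) 2 volume) : Integrable N := by
  have h1 := memLp_inv_one_add_abs.integrable_mul h
  refine h1.congr (Eventually.of_forall fun ξ => ?_)
  have : (1 + |ξ|) ≠ 0 := by positivity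
  simp only [Pi.mul_apply]
  field_simp

theorem FreqAdm.of_sectionNorm {F : ℝ × ℝ → ℂ} (hF : Measurable F) (h2 : MemLp F 2 stripMeasure)
    (hi : ∀ ξ, Integrable (fun y => F (ξ, y)) sectionMeasure)
    (h : MemLp (fun ξ => (1 + |ξ|) * sectionNorm F ξ) 2 volume) : FreqAdm F := by
  refine ⟨hF, ⟨hF.aestronglyMeasurable, ?_⟩, h2⟩
  have h1 := integrable_of_memLp_one_add_abs_mul h
  unfold HasFiniteIntegral
  rw [lintegral_strip' hF.enorm.aemeasurable]
  refine lt_of_eq_of_lt ?_ h1.2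
  refine lintegral_congr fun ξ => ?_
  rw [← ofReal_sectionNorm (hi ξ), ← ofReal_norm, Real.norm_of_nonneg (sectionNorm_nonneg _ _)]

theorem sectionNorm_pow_mul (g : ℝ × ℝ → ℂ) (m : ℕ) (ξ : ℝ) :
    sectionNorm (fun p => (p.1 : ℂ) ^ m * g p) ξ = |ξ| ^ m * sectionNorm g ξ := by
  unfold sectionNorm
  simp only [norm_mul, norm_pow, Complex.norm_real, Real.norm_eq_abs]
  exact integral_const_mul _ _

theorem hasDerivAt_yPrim {g : ℝ × ℝ → ℂ} {ξ : ℝ} (hg : Continuous fun y => g (ξ, y)) (y : ℝ) :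
    HasDerivAt (fun y => yPrim g (ξ, y)) (g (ξ, y)) y :=
  intervalIntegral.integral_hasDerivAt_right (hg.intervalIntegrable _ _)
    (hg.stronglyMeasurableAtFilter _ _) hg.continuousAt

theorem dataSize_nonneg (f : StripL2) : 0 ≤ dataSize f :=
  add_nonneg (normH3_nonneg f) ENNReal.toReal_nonneg

/-- `f = c(x) + ∫_{-1}^y ∂_y f dz` for consecutive derivatives in `y` of the data. -/
theorem MemData.exists_primitive {f : StripL2} (hf : MemData f)
    (hi : ∀ j < 4, Integrable (weakPartial 0 j f) stripMeasure) {j : ℕ} (hj : j < 3) :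
    ∃ c : ℝ → ℂ, Integrable c ∧
      ∀ᵐ p ∂stripMeasure, weakPartial 0 j f p = c p.1 + yPrim (weakPartial 0 (j + 1) f) p := by
  refine exists_eq_add_yPrim (hi j (by omega)) (Lp.stronglyMeasurable _) (hi (j + 1) (by omega)) ?_
  intro α γ hα hα' hγ hγ' hγs
  have h1 := (hf.1 0 j (by omega)).hasWeakPartial.product hα hα' (contDiff_infty_iff_deriv.1 hγ).2
    hγ'.deriv (tsupport_deriv_subset.trans hγs)
  have h2 := (hf.1 0 (j + 1) (by omega)).hasWeakPartial.product hα hα' hγ hγ' hγs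
  rw [iteratedDeriv_succ'] at h2
  rw [h1] at h2
  have h3 : ((-1 : ℂ)) ^ (0 + j) ≠ 0 := by simp
  refine mul_left_cancel₀ h3 (h2.trans ?_)
  ring

/-- Data that vanish on the walls are the primitive of `∂_y f` from `y = -1`, and this primitive vanishes at
`y = 1`. -/
theorem VanishesOnWalls.eq_yPrim {f : StripL2} (hw : VanishesOnWalls f)
    (hi : ∀ j < 4, Integrable (weakPartial 0 j f) stripMeasure) :
    (∀ᵐ p ∂stripMeasure, f p = yPrim (weakPartial 0 1 f) p) ∧
      ∀ᵐ x : ℝ, yPrim (weakPartial 0 1 f) (x, 1) = 0 := by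
  obtain ⟨g, hg⟩ := hw
  have h0 : weakPartial 0 0 f = f := (hasWeakPartial_zero f).weakPartial_eq
  have h1 : weakPartial 0 1 f = g := by
    refine HasWeakPartial.weakPartial_eq fun θ h1 h2 _ => ?_
    rw [hg θ h1 h2]; ring
  refine eq_yPrim_of_walls (h0 ▸ hi 0 (by norm_num)) (Lp.stronglyMeasurable _) (hi 1 (by norm_num)) ?_
  intro α γ hα hα' hγ hγ'
  have h2 := hg (fun p => α p.1 * γ p.2) (by fun_prop)
    (HasCompactSupport.intro (hα'.isCompact.prod hγ'.isCompact) fun p hp => by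
      by_contra hne
      exact hp ⟨subset_tsupport _ (left_ne_zero_of_mul hne),
        subset_tsupport _ (right_ne_zero_of_mul hne)⟩)
  rw [h1, ← h2]
  refine integral_congr_ae (Eventually.of_forall fun p => ?_)
  simp only [classicalPartial, iteratedDeriv_zero, iteratedDeriv_one]
  rw [deriv_const_mul_field]

set_option maxHeartbeats 1000000 in
/-- Admissible data have a profile: on the Fourier side, `g3` is the transform of `∂_y³ f`, and
`g2`, `g1`, `g0` are obtained by successive primitives in `y`. The envelopes are sums of the `L¹`
norms of `g1`, `g2`, `g3` over the section; `48` collects the numerical constants. -/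
theorem exists_profile {f : StripL2} (hf : MemData f) (hw : VanishesOnWalls f) :
    Nonempty (Profile f (48 * dataSize f)) := by
  set E := dataSize f with hE
  have hE0 : 0 ≤ E := dataSize_nonneg f
  have hN : 0 ≤ normH3 f := normH3_nonneg f
  have hNE : normH3 f ≤ E := le_add_of_nonneg_right ENNReal.toReal_nonneg
  have hL1 : ∀ j < 4, ∫⁻ p, ‖weakPartial 0 j f p‖ₑ ∂stripMeasure ≤ ofReal (2 * E) := by
    intro j hj
    refine (lintegral_weakPartial_le f hj).trans ?_
    rw [ENNReal.ofReal_mul two_pos.le, ENNReal.ofReal_ofNat]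
    gcongr
    rw [← ENNReal.ofReal_toReal hf.2.ne]
    exact ENNReal.ofReal_le_ofReal (le_add_of_nonneg_left hN)
  have hsm : ∀ j, StronglyMeasurable (weakPartial 0 j f) := fun j => Lp.stronglyMeasurable _
  have hi : ∀ j < 4, Integrable (weakPartial 0 j f) stripMeasure := fun j hj =>
    ⟨(hsm j).aestronglyMeasurable, (hL1 j hj).trans_lt ENNReal.ofReal_lt_top⟩
  have hsf : ∀ j, StronglyMeasurable (sliceFT (weakPartial 0 j f)) := fun j =>
    stronglyMeasurable_fourier_slice (hsm j)
  obtain ⟨c1, hc1, hf1⟩ := hf.exists_primitive hi (j := 1) (by norm_num)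
  obtain ⟨c2, hc2, hf2⟩ := hf.exists_primitive hi (j := 2) (by norm_num)
  obtain ⟨hf0, hf0'⟩ := hw.eq_yPrim hi
  -- the transform of `∂_y³ f`, extended by zero
  let g3 : ℝ × ℝ → ℂ := (univ ×ˢ Ioo (-1 : ℝ) 1).indicator (sliceFT (weakPartial 0 3 f))
  have hg3m : StronglyMeasurable g3 := (hsf 3).indicator (MeasurableSet.univ.prod measurableSet_Ioo)
  have hmemIoo : ∀ᵐ y ∂sectionMeasure, y ∈ Ioo (-1 : ℝ) 1 := ae_restrict_mem measurableSet_Ioo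
  have hg3e : ∀ᵐ y ∂sectionMeasure, ∀ ξ, sliceFT (weakPartial 0 3 f) (ξ, y) = g3 (ξ, y) := by
    filter_upwards [hmemIoo] with y hy ξ
    exact (indicator_of_mem (show (ξ, y) ∈ univ ×ˢ Ioo (-1 : ℝ) 1 from ⟨mem_univ _, hy⟩) _).symm
  have hint3 : ∀ ξ a b, IntervalIntegrable (fun y => g3 (ξ, y)) volume a b := by
    intro ξ a b
    refine (Integrable.integrableOn ?_).intervalIntegrable
    have h := (integrable_indicator_iff measurableSet_Ioo).2 (integrable_sliceFT (hsm 3) (hi 3 (by norm_num)) ξ)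
    convert h using 1
    funext y
    simp [g3, indicator]
  let g2 : ℝ × ℝ → ℂ := fun p => 𝓕 c2 p.1 + yPrim g3 p
  have hFm : ∀ c : ℝ → ℂ, Integrable c → StronglyMeasurable fun p : ℝ × ℝ => 𝓕 c p.1 := fun c hc =>
    ((VectorFourier.fourierIntegral_continuous Real.continuous_fourierChar
      (by exact continuous_inner) hc).comp continuous_fst).stronglyMeasurable
  have hg2m : StronglyMeasurable g2 := (hFm c2 hc2).add (stronglyMeasurable_yPrim hg3m)
  have hg2e : ∀ᵐ y ∂sectionMeasure, ∀ ξ, sliceFT (weakPartial 0 2 f) (ξ, y) = g2 (ξ, y) := by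
    filter_upwards [sliceFT_eq_add_yPrim (hsm 3) (hi 3 (by norm_num)) hc2 hf2, hmemIoo] with y hy hyI ξ
    rw [hy ξ, yPrim_congr (g' := g3) (by filter_upwards [hg3e] with z hz using hz ξ)
      ⟨hyI.1.le, hyI.2.le⟩]
  have hg2c : ∀ ξ, Continuous fun y => g2 (ξ, y) := fun ξ =>
    (continuous_const (y := 𝓕 c2 ξ)).add
      (intervalIntegral.continuous_primitive (fun a b => hint3 ξ a b) (-1))
  let g1 : ℝ × ℝ → ℂ := fun p => 𝓕 c1 p.1 + yPrim g2 p
  have hg1m : StronglyMeasurable g1 := (hFm c1 hc1).add (stronglyMeasurable_yPrim hg2m)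
  have hg1e : ∀ᵐ y ∂sectionMeasure, ∀ ξ, sliceFT (weakPartial 0 1 f) (ξ, y) = g1 (ξ, y) := by
    filter_upwards [sliceFT_eq_add_yPrim (hsm 2) (hi 2 (by norm_num)) hc1 hf1, hmemIoo] with y hy hyI ξ
    rw [hy ξ, yPrim_congr (g' := g2) (by filter_upwards [hg2e] with z hz using hz ξ)
      ⟨hyI.1.le, hyI.2.le⟩]
  have hg1d : ∀ ξ y, HasDerivAt (fun y => g1 (ξ, y)) (g2 (ξ, y)) y := fun ξ y =>
    (hasDerivAt_yPrim (hg2c ξ) y).const_add (𝓕 c1 ξ)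
  have hg1c : ∀ ξ, Continuous fun y => g1 (ξ, y) := fun ξ =>
    continuous_iff_continuousAt.2 fun y => (hg1d ξ y).continuousAt
  have hg0e : ∀ ξ, ∀ y ∈ Icc (-1 : ℝ) 1,
      sliceFT (yPrim (weakPartial 0 1 f)) (ξ, y) = yPrim g1 (ξ, y) := by
    intro ξ y hy
    rw [sliceFT_yPrim (hi 1 (by norm_num)) hy,
      yPrim_congr (g' := g1) (by filter_upwards [hg1e] with z hz using hz ξ) hy]
  -- The wall `y = 1`, where the primitive of `∂_y f` vanishes.
  have hg0w : ∀ ξ, yPrim g1 (ξ, 1) = 0 := by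
    intro ξ
    rw [← hg0e ξ 1 (by norm_num), sliceFT, Real.fourier_eq']
    refine integral_eq_zero_of_ae ?_
    filter_upwards [hf0'] with x hx
    simp [hx]
  -- bounds of the cross section norms
  have hsi : ∀ j < 4, ∀ g : ℝ × ℝ → ℂ,
      (∀ᵐ y ∂sectionMeasure, ∀ ξ, sliceFT (weakPartial 0 j f) (ξ, y) = g (ξ, y)) →
      ∀ ξ, Integrable (fun y => g (ξ, y)) sectionMeasure := by
    intro j hj g hg ξ
    refine (integrable_sliceFT (hsm j) (hi j hj) ξ).congr ?_
    filter_upwards [hg] with y hy using hy ξ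
  have hsE : ∀ j < 4, ∀ g : ℝ × ℝ → ℂ,
      (∀ᵐ y ∂sectionMeasure, ∀ ξ, sliceFT (weakPartial 0 j f) (ξ, y) = g (ξ, y)) →
      ∀ ξ, sectionNorm g ξ ≤ 2 * E := by
    intro j hj g hg ξ
    rw [← sectionNorm_congr (g := sliceFT (weakPartial 0 j f))
      (by filter_upwards [hg] with y hy using hy ξ)]
    exact sectionNorm_sliceFT_le (hsm j) (by positivity) (hL1 j hj) ξ
  have hsP : ∀ j < 4, ∀ g : ℝ × ℝ → ℂ,
      (∀ᵐ y ∂sectionMeasure, ∀ ξ, sliceFT (weakPartial 0 j f) (ξ, y) = g (ξ, y)) →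
      PartialFT (weakPartial 0 j f) g := by
    intro j hj g hg
    refine (PartialFT.of_integrable_slices (hsm j) (Lp.memLp _) (integrable_slice (hi j hj))).1.congr
      (EventuallyEq.refl _ _) (ae_strip_of_ae_section hg)
  -- Weighted `L²` bounds in the frequency; at most three derivatives in total are available.
  have hsq : ∀ j < 4, ∀ g : ℝ × ℝ → ℂ, Measurable g →
      (∀ᵐ y ∂sectionMeasure, ∀ ξ, sliceFT (weakPartial 0 j f) (ξ, y) = g (ξ, y)) →
      ∀ m : ℕ, m ≤ 2 → m + j ≤ 3 →
      eLpNorm (fun ξ => (1 + |ξ|) ^ m * sectionNorm g ξ) 2 volume ≤ ofReal (8 * E) := by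
    intro j hj g hgm hg m hm hmj
    have h := fun n hn => (eLpNorm_sectionNorm_le hf.1 hgm (hsi j hj g hg) (hsP j hj g hg) (m := n) hn).trans
      (ENNReal.ofReal_le_ofReal (by linarith : 2 * normH3 f ≤ 2 * E))
    refine (eLpNorm_one_add_abs_pow_mul_le (measurable_sectionNorm hgm) m hm (by positivity)
      (h 0 (by omega)) (h m hmj)).trans (ENNReal.ofReal_le_ofReal (by linarith))
  have hg0m := (stronglyMeasurable_yPrim hg1m).measurable
  have hadm : ∀ j < 4, ∀ g : ℝ × ℝ → ℂ, Measurable g →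
      (∀ ξ, Integrable (fun y => g (ξ, y)) sectionMeasure) → PartialFT (weakPartial 0 j f) g →
      ∀ m : ℕ, m + 1 + j ≤ 3 → MemLp (fun p => (p.1 : ℂ) ^ m * g p) 2 stripMeasure →
      FreqAdm fun p => (p.1 : ℂ) ^ m * g p := by
    intro j hj g hgm hg hP m hmj h2
    refine FreqAdm.of_sectionNorm (by fun_prop) h2 (fun ξ => (hg ξ).const_mul ((ξ : ℂ) ^ m)) ?_
    have hsm := measurable_sectionNorm hgm
    have h := fun n hn => (eLpNorm_sectionNorm_le hf.1 hgm hg hP (m := n) hn).trans_lt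
      ENNReal.ofReal_lt_top
    have h3 : MemLp _ 2 volume := MemLp.add (f := fun ξ => |ξ| ^ m * sectionNorm g ξ)
      (g := fun ξ => |ξ| ^ (m + 1) * sectionNorm g ξ)
      ⟨(by fun_prop), h m (by omega)⟩ ⟨(by fun_prop), h (m + 1) hmj⟩
    refine h3.congr_norm (by
      simp only [sectionNorm_pow_mul]; fun_prop) (Eventually.of_forall fun ξ => ?_)
    rw [sectionNorm_pow_mul]
    congr 1
    simp only [Pi.add_apply]
    ring
  have hm1 := measurable_sectionNorm hg1m.measurable
  have hm2 := measurable_sectionNorm hg2m.measurable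
  have hm3 := measurable_sectionNorm hg3m.measurable
  have hp1 := sectionNorm_nonneg g1
  have hp2 := sectionNorm_nonneg g2
  have hp3 := sectionNorm_nonneg g3
  have hi1 := hsi 1 (by norm_num) g1 hg1e
  have hi2 := hsi 2 (by norm_num) g2 hg2e
  have hi3 := hsi 3 (by norm_num) g3 hg3e
  have h_norm0 : ∀ ξ, ∀ y ∈ Icc (-1 : ℝ) 1, ‖yPrim g1 (ξ, y)‖ ≤ sectionNorm g1 ξ := by
    intro ξ y hy
    refine (intervalIntegral.norm_integral_le_integral_norm hy.1).trans ?_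
    rw [intervalIntegral.integral_of_le hy.1, sectionNorm, sectionMeasure, restrict_Ioo_eq_restrict_Ioc]
    exact setIntegral_mono_set ((integrableOn_Ioc_iff_integrableOn_Ioo).2 (hi1 ξ)).norm
      (Eventually.of_forall fun _ => norm_nonneg _)
      (Ioc_subset_Ioc_right hy.2).eventuallyLE
  have h_norm1 : ∀ ξ, ∀ y ∈ Icc (-1 : ℝ) 1, ‖g1 (ξ, y)‖ ≤ sectionNorm g1 ξ + sectionNorm g2 ξ := by
    intro ξ y hy
    exact norm_le_of_eq_primitive (c := 𝓕 c1 ξ) (hi2 ξ) (fun y _ => rfl) (hi1 ξ) hy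
  have h_norm2 : ∀ ξ, ∀ y ∈ Icc (-1 : ℝ) 1,
      ‖g2 (ξ, y)‖ ≤ sectionNorm g1 ξ + sectionNorm g2 ξ + sectionNorm g3 ξ := by
    intro ξ y hy
    have h := norm_le_of_eq_primitive (g := fun y => g2 (ξ, y)) (c := 𝓕 c2 ξ) (hi3 ξ)
      (fun y _ => rfl) (hi2 ξ) hy
    have := hp1 ξ
    simp only [sectionNorm] at h this ⊢
    linarith
  have h_sq0 : eLpNorm (fun ξ => (1 + |ξ|) ^ 2 * sectionNorm g1 ξ) 2 volume ≤
      ofReal (48 * E) :=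
    (hsq 1 (by norm_num) g1 hg1m.measurable hg1e 2 le_rfl (by norm_num)).trans
      (ENNReal.ofReal_le_ofReal (by linarith))
  have h_sq1 : eLpNorm (fun ξ => (1 + |ξ|) ^ 1 * (sectionNorm g1 ξ + sectionNorm g2 ξ)) 2 volume ≤
      ofReal (48 * E) := by
    simp only [mul_add]
    refine (eLpNorm_add_le (by fun_prop) (by fun_prop) (by norm_num)).trans ((add_le_add
      (hsq 1 (by norm_num) g1 hg1m.measurable hg1e 1 (by norm_num) (by norm_num))
      (hsq 2 (by norm_num) g2 hg2m.measurable hg2e 1 (by norm_num) (by norm_num))).trans ?_)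
    rw [← ENNReal.ofReal_add (by positivity) (by positivity)]
    exact ENNReal.ofReal_le_ofReal (by linarith)
  have h_sq2 : eLpNorm (fun ξ => sectionNorm g1 ξ + sectionNorm g2 ξ + sectionNorm g3 ξ) 2 volume ≤
      ofReal (48 * E) := by
    have h1 := hsq 1 (by norm_num) g1 hg1m.measurable hg1e 0 (by norm_num) (by norm_num)
    have h2 := hsq 2 (by norm_num) g2 hg2m.measurable hg2e 0 (by norm_num) (by norm_num)
    have h3 := hsq 3 (by norm_num) g3 hg3m.measurable hg3e 0 (by norm_num) (by norm_num)
    simp only [pow_zero, one_mul] at h1 h2 h3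
    refine (eLpNorm_add_le (by fun_prop) (by fun_prop) (by norm_num)).trans ((add_le_add
      ((eLpNorm_add_le (by fun_prop) (by fun_prop) (by norm_num)).trans (add_le_add h1 h2)) h3).trans ?_)
    rw [← ENNReal.ofReal_add (by positivity) (by positivity),
      ← ENNReal.ofReal_add (by positivity) (by positivity)]
    exact ENNReal.ofReal_le_ofReal (by linarith)
  have h_partialFT : PartialFT f (yPrim g1) := by
    have h1 := integrable_yPrim (hsm 1) (hi 1 (by norm_num))
    have h2 : MemLp (yPrim (weakPartial 0 1 f)) 2 stripMeasure := (memLp_congr_ae hf0).1 (Lp.memLp f)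
    refine (PartialFT.of_integrable_slices (stronglyMeasurable_yPrim (hsm 1)) h2
      (integrable_slice h1)).1.congr
      (by filter_upwards [hf0] with p hp using hp.symm) (ae_strip_of_ae_section ?_)
    filter_upwards [hmemIoo] with y hy ξ using hg0e ξ y ⟨hy.1.le, hy.2.le⟩
  have h0 : weakPartial 0 0 f = f := (hasWeakPartial_zero f).weakPartial_eq
  have hi0 : ∀ ξ, Integrable (fun y => yPrim g1 (ξ, y)) sectionMeasure := by
    intro ξ
    have hc : Continuous fun y => yPrim g1 (ξ, y) :=
      continuous_iff_continuousAt.2 fun y => (hasDerivAt_yPrim (hg1c ξ) y).continuousAt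
    exact (hc.integrableOn_Icc (a := -1) (b := 1)).mono_set Ioo_subset_Icc_self
  refine ⟨{
    g0 := yPrim g1
    g1 := g1
    g2 := g2
    g3 := g3
    N0 := sectionNorm g1
    N1 := fun ξ => sectionNorm g1 ξ + sectionNorm g2 ξ
    N2 := fun ξ => sectionNorm g1 ξ + sectionNorm g2 ξ + sectionNorm g3 ξ
    meas0 := (stronglyMeasurable_yPrim hg1m).measurable
    meas1 := hg1m.measurable
    measN0 := hm1
    measN1 := hm1.add hm2
    measN2 := (hm1.add hm2).add hm3
    deriv0 := fun ξ y => hasDerivAt_yPrim (hg1c ξ) y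
    deriv1 := hg1d
    cont2 := hg2c
    int3 := hint3
    prim2 := fun ξ y => by simp [g2, yPrim]
    wall_one := hg0w
    wall_neg_one := fun ξ => by simp [yPrim]
    N0_nonneg := hp1
    N0_le_N1 := fun ξ => le_add_of_nonneg_right (hp2 ξ)
    N1_le_N2 := fun ξ => le_add_of_nonneg_right (hp3 ξ)
    N2_le := fun ξ => ?_
    norm0 := h_norm0
    norm1 := h_norm1
    norm2 := h_norm2
    norm3 := fun ξ => ?_
    sq0 := h_sq0
    sq1 := h_sq1
    sq2 := h_sq2
    adm20 := ?_
    adm11 := ?_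
    adm02 := ?_
    partialFT := h_partialFT
    slices := ?_ }⟩
  · have h1 := hsE 1 (by norm_num) g1 hg1e ξ
    have h2 := hsE 2 (by norm_num) g2 hg2e ξ
    have h3 := hsE 3 (by norm_num) g3 hg3e ξ
    linarith
  · have h : ∫ y in (-1 : ℝ)..1, ‖g3 (ξ, y)‖ = sectionNorm g3 ξ := by
      rw [sectionNorm, sectionMeasure, restrict_Ioo_eq_restrict_Ioc,
        intervalIntegral.integral_of_le (by norm_num)]
    rw [h]
    linarith [hp1 ξ, hp2 ξ]
  · refine hadm 0 (by norm_num) _ hg0m hi0 (h0.symm ▸ h_partialFT) 2 (by norm_num) ?_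
    refine memLp_two_strip_of_le (by fun_prop) (N := fun ξ => (1 + |ξ|) ^ 2 * sectionNorm g1 ξ)
      ⟨by fun_prop, h_sq0.trans_lt ENNReal.ofReal_lt_top⟩ fun ξ y hy => ?_
    rw [norm_mul, norm_pow, Complex.norm_real, Real.norm_eq_abs]
    have := abs_nonneg ξ
    gcongr
    · linarith
    · exact h_norm0 ξ y hy
  · have h := hadm 1 (by norm_num) g1 hg1m.measurable hi1 (hsP 1 (by norm_num) g1 hg1e) 1 (by norm_num)
    simp only [pow_one] at h
    refine h (memLp_two_strip_of_le (by fun_prop)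
      (N := fun ξ => (1 + |ξ|) ^ 1 * (sectionNorm g1 ξ + sectionNorm g2 ξ))
      ⟨by fun_prop, h_sq1.trans_lt ENNReal.ofReal_lt_top⟩ fun ξ y hy => ?_)
    rw [norm_mul, Complex.norm_real, Real.norm_eq_abs, pow_one]
    have := abs_nonneg ξ
    gcongr
    · linarith
    · exact h_norm1 ξ y hy
  · have h := hadm 2 (by norm_num) g2 hg2m.measurable hi2 (hsP 2 (by norm_num) g2 hg2e) 0 (by norm_num)
    simp only [pow_zero, one_mul] at h
    exact h (memLp_two_strip_of_le hg2m.measurable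
      ⟨by fun_prop, h_sq2.trans_lt ENNReal.ofReal_lt_top⟩ h_norm2)
  · have h1 := integrable_yPrim (hsm 1) (hi 1 (by norm_num))
    filter_upwards [hmemIoo, integrable_slice h1] with y hy hy2
    refine ⟨fun x => yPrim (weakPartial 0 1 f) (x, y), hy2, ?_,
      fun ξ => (hg0e ξ y ⟨hy.1.le, hy.2.le⟩).symm⟩
    rw [← ENNReal.ofReal_le_ofReal_iff (by positivity), ofReal_integral_norm_eq_lintegral_enorm hy2]
    refine le_trans ?_ ((hL1 1 (by norm_num)).trans (ENNReal.ofReal_le_ofReal (by linarith)))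
    rw [lintegral_strip' (hsm 1).aestronglyMeasurable.enorm]
    refine lintegral_mono fun x => ?_
    unfold yPrim
    rw [intervalIntegral.integral_of_le hy.1.le]
    refine (enorm_integral_le_lintegral_enorm _).trans ?_
    exact lintegral_mono_set (Ioc_subset_Ioo_right hy.2)

/-! ### The explicit solution of the linear equation -/

/-- Differentiation of a curve in `L²` that is given by functions differentiable in the parameter,
with a locally uniform `L²` majorant of the derivative. -/
theorem hasDerivWithinAt_Lp_of_dominated {α : Type*} [MeasurableSpace α] {μ : Measure α}
    {K K' : ℝ → α → ℂ} {B : α → ℝ} {s₀ : ℝ} (hs₀ : 0 ≤ s₀) (hKm : ∀ s, Measurable (K s))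
    (hKm' : Measurable (K' s₀)) (hB : MemLp B 2 μ)
    (hd : ∀ p s, HasDerivAt (fun s => K s p) (K' s p) s)
    (hbd : ∀ᵐ p ∂μ, ∀ s ∈ Icc (0 : ℝ) (s₀ + 1), ‖K' s p‖ ≤ B p)
    {M : ℝ → Lp ℂ 2 μ} (hM : ∀ s, 0 ≤ s → M s =ᵐ[μ] K s) {M' : Lp ℂ 2 μ}
    (hM' : M' =ᵐ[μ] K' s₀) : HasDerivWithinAt M M' (Ici 0) s₀ := by
  rw [hasDerivWithinAt_iff_tendsto_slope, Lp.tendsto_Lp_iff_tendsto_eLpNorm']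
  have hmem : ∀ᶠ s in nhdsWithin s₀ (Ici 0 \ {s₀}), s ∈ Icc (0 : ℝ) (s₀ + 1) ∧ s ≠ s₀ := by
    filter_upwards [self_mem_nhdsWithin,
      nhdsWithin_le_nhds (Iio_mem_nhds (show s₀ < s₀ + 1 by linarith))] with s hs hs2
    exact ⟨⟨hs.1, le_of_lt hs2⟩, hs.2⟩
  have hlim : Tendsto (fun s => ∫⁻ p, ‖(s - s₀)⁻¹ • (K s p - K s₀ p) - K' s₀ p‖ₑ ^ 2 ∂μ)
      (nhdsWithin s₀ (Ici 0 \ {s₀})) (nhds (∫⁻ _p, 0 ∂μ)) := by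
    refine tendsto_lintegral_filter_of_dominated_convergence (fun p => ‖2 * B p‖ₑ ^ 2) ?_ ?_ ?_ ?_
    · refine Eventually.of_forall fun s => ?_
      have h1 := hKm s
      have h2 := hKm s₀
      fun_prop
    · filter_upwards [hmem] with s hs
      filter_upwards [hbd] with p hp
      have hs0 : s₀ ∈ Icc (0 : ℝ) (s₀ + 1) := ⟨hs₀, by linarith⟩
      have h1 := (convex_Icc (0 : ℝ) (s₀ + 1)).norm_image_sub_le_of_norm_hasDerivWithin_le
        (fun x _ => (hd p x).hasDerivWithinAt) hp hs0 hs.1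
      have h2 : ‖(s - s₀)⁻¹ • (K s p - K s₀ p)‖ ≤ B p := by
        rw [norm_smul, norm_inv, inv_mul_le_iff₀ (norm_pos_iff.2 (sub_ne_zero.2 hs.2)), mul_comm]
        exact h1
      gcongr
      rw [enorm_le_iff_norm_le, Real.norm_eq_abs]
      refine (norm_sub_le _ _).trans (le_trans ?_ (le_abs_self _))
      linarith [hp s₀ hs0]
    · have h := hB.const_mul 2
      exact ((memLp_two_iff h.1).1 h).ne
    · refine Eventually.of_forall fun p => ?_
      have h1 : Tendsto (fun s => (s - s₀)⁻¹ • (K s p - K s₀ p))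
          (nhdsWithin s₀ (Ici 0 \ {s₀})) (nhds (K' s₀ p)) :=
        hasDerivWithinAt_iff_tendsto_slope.1 (hd p s₀).hasDerivWithinAt
      have h2 := ((ENNReal.continuous_pow 2).tendsto _).comp (h1.sub_const (K' s₀ p)).enorm
      simpa [Function.comp_def] using h2
  rw [lintegral_zero] at hlim
  have h3 := (ENNReal.continuous_rpow_const (y := (1 / 2 : ℝ))).tendsto 0 |>.comp hlim
  simp only [ENNReal.zero_rpow_of_pos (show (0 : ℝ) < 1 / 2 by norm_num)] at h3
  refine h3.congr' ?_
  filter_upwards [hmem] with s hs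
  have h4 : ((slope M s₀ s : Lp ℂ 2 μ) : α → ℂ) - (M' : α → ℂ) =ᵐ[μ] fun p => (s - s₀)⁻¹ • (K s p - K s₀ p) - K' s₀ p := by
    filter_upwards [Lp.coeFn_smul (s - s₀)⁻¹ (M s - M s₀), Lp.coeFn_sub (M s) (M s₀), hM s hs.1.1,
      hM s₀ hs₀, hM'] with p h1 h2 h3 h4 h5
    simp only [Pi.sub_apply, slope, vsub_eq_sub] at h1 ⊢
    rw [h1, Pi.smul_apply, h2, Pi.sub_apply, h3, h4, h5]
  rw [eLpNorm_congr_ae h4]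
  simp only [Function.comp_apply]
  rw [← eLpNorm_two_sq, ← ENNReal.rpow_natCast, ← ENNReal.rpow_mul]
  norm_num

/-- A solution of `d' = -(a + i b) d` in `L²` with `a ≥ 0` and zero initial value vanishes: the
energy `‖d‖²` does not increase. -/
theorem eq_zero_of_dissipative {α : Type*} [MeasurableSpace α] {μ : Measure α}
    {d d' : ℝ → Lp ℂ 2 μ} {a b : ℝ → α → ℝ} (ha : ∀ s p, 0 ≤ a s p)
    (hd : ∀ s, 0 ≤ s → HasDerivWithinAt d (d' s) (Ici 0) s)
    (heq : ∀ s, 0 ≤ s → ∀ᵐ p ∂μ, d' s p = -((a s p : ℂ) + (b s p : ℂ) * I) * d s p)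
    (h0 : d 0 = 0) {t : ℝ} (ht : 0 ≤ t) : d t = 0 := by
  have h1 : ∀ s, 0 ≤ s → HasDerivWithinAt (fun s => ‖d s‖ ^ 2) (2 * inner ℝ (d s) (d' s)) (Ici 0) s :=
    fun s hs => (hd s hs).norm_sq
  have h2 : ∀ s, 0 ≤ s → inner ℝ (d s) (d' s) ≤ 0 := by
    intro s hs
    rw [L2.inner_def]
    refine integral_nonpos_of_ae ?_
    filter_upwards [heq s hs] with p hp
    rw [hp, Complex.inner]
    have : ((starRingEnd ℂ) (d s p) * (-((a s p : ℂ) + (b s p : ℂ) * I) * d s p)).re =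
        -(a s p * Complex.normSq (d s p)) := by
      simp [Complex.normSq_apply]; ring
    first
      | rw [this]
      | (rw [mul_comm] at this; rw [this])
    exact neg_nonpos.2 (mul_nonneg (ha s p) (Complex.normSq_nonneg _))
  have h3 : AntitoneOn (fun s => ‖d s‖ ^ 2) (Ici 0) := by
    refine antitoneOn_of_deriv_nonpos (convex_Ici 0) (fun s hs => (h1 s hs).continuousWithinAt) ?_ ?_
    · intro s hs
      rw [interior_Ici] at hs ⊢
      exact ((h1 s (le_of_lt hs)).hasDerivAt (Ici_mem_nhds hs)).differentiableAt.differentiableWithinAt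
    · intro s hs
      rw [interior_Ici] at hs
      rw [((h1 s (le_of_lt hs)).hasDerivAt (Ici_mem_nhds hs)).deriv]
      linarith [h2 s (le_of_lt hs)]
  have h4 := h3 (self_mem_Ici (a := (0 : ℝ))) (show t ∈ Ici (0 : ℝ) from ht) ht
  simp only [h0, norm_zero] at h4
  have : ‖d t‖ = 0 := by nlinarith [norm_nonneg (d t)]
  exact norm_eq_zero.1 this

/-- The frequency-side propagator `exp(-νt - νt³k²/3 - i k t y)` of the linear equation, `k = 2πξ`. -/
def propagator (ν t : ℝ) (p : ℝ × ℝ) : ℂ :=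
  Complex.exp (((-(ν * t) - ν * t ^ 3 * (2 * π * p.1) ^ 2 / 3 : ℝ) : ℂ)
    - ((2 * π * p.1 * t * p.2 : ℝ) : ℂ) * I)

theorem measurable_propagator (ν t : ℝ) : Measurable (propagator ν t) := by
  unfold propagator; fun_prop

theorem norm_propagator (ν t : ℝ) (p : ℝ × ℝ) :
    ‖propagator ν t p‖ = exp (-(ν * t) - ν * t ^ 3 * (2 * π * p.1) ^ 2 / 3) := by
  rw [propagator, Complex.norm_exp, Complex.sub_re, Complex.re_ofReal_mul, Complex.ofReal_re]
  simp

theorem norm_propagator_le_one {ν t : ℝ} (hν : 0 ≤ ν) (ht : 0 ≤ t) (p : ℝ × ℝ) :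
    ‖propagator ν t p‖ ≤ 1 := by
  rw [norm_propagator]
  refine Real.exp_le_one_iff.2 ?_
  have h1 : 0 ≤ ν * t := by positivity
  have h2 : 0 ≤ ν * t ^ 3 * (2 * π * p.1) ^ 2 / 3 := by positivity
  linarith

theorem hasDerivAt_propagator (ν s : ℝ) (p : ℝ × ℝ) :
    HasDerivAt (fun s => propagator ν s p)
      (-(((ν + ν * s ^ 2 * (2 * π * p.1) ^ 2 : ℝ) : ℂ)
        + ((2 * π * p.1 * p.2 : ℝ) : ℂ) * I) * propagator ν s p) s := by
  have h1 : HasDerivAt (fun s : ℝ => -(ν * s) - ν * s ^ 3 * (2 * π * p.1) ^ 2 / 3)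
      (-(ν + ν * s ^ 2 * (2 * π * p.1) ^ 2)) s := by
    have h := ((hasDerivAt_id s).const_mul ν).neg.sub
      ((((hasDerivAt_pow 3 s).const_mul ν).mul_const ((2 * π * p.1) ^ 2)).div_const 3)
    refine h.congr_deriv ?_
    push_cast
    ring
  have h2 : HasDerivAt (fun s : ℝ => 2 * π * p.1 * s * p.2) (2 * π * p.1 * p.2) s := by
    have h := ((hasDerivAt_id s).const_mul (2 * π * p.1)).mul_const p.2
    simpa using h
  refine (h1.ofReal_comp.fun_sub (h2.ofReal_comp.mul_const I)).cexp.congr_deriv ?_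
  simp only [propagator]
  push_cast
  ring

namespace Profile

variable {f : StripL2} {E : ℝ} (P : Profile f E)

theorem memLp_N0 : MemLp (fun ξ => (1 + |ξ|) ^ 2 * P.N0 ξ) 2 volume := by
  have := P.measN0
  exact ⟨by fun_prop, P.sq0.trans_lt ENNReal.ofReal_lt_top⟩

theorem memLp_N1 : MemLp (fun ξ => (1 + |ξ|) * P.N1 ξ) 2 volume := by
  have := P.measN1
  have h := P.sq1
  simp only [pow_one] at h
  exact ⟨by fun_prop, h.trans_lt ENNReal.ofReal_lt_top⟩

end Profile

theorem FreqAdm.of_le {F : ℝ × ℝ → ℂ} (hF : Measurable F) {N : ℝ → ℝ} (hN : Measurable N)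
    (h2 : MemLp (fun ξ => (1 + |ξ|) * N ξ) 2 volume)
    (h : ∀ ξ, ∀ y ∈ Icc (-1 : ℝ) 1, ‖F (ξ, y)‖ ≤ N ξ) : FreqAdm F := by
  refine ⟨hF, ?_, memLp_two_strip_of_le hF (N := N) ?_ h⟩
  · have h1 : Integrable (fun p : ℝ × ℝ => N p.1) stripMeasure := by
      rw [stripMeasure_eq_prod]
      exact (integrable_of_memLp_one_add_abs_mul h2).comp_fst sectionMeasure
    refine h1.mono hF.aestronglyMeasurable ?_
    filter_upwards [ae_restrict_mem isOpen_strip.measurableSet] with p hp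
    exact (h p.1 p.2 ⟨hp.2.1.le, hp.2.2.le⟩).trans (le_abs_self _)
  · refine h2.mono hN.aestronglyMeasurable (Eventually.of_forall fun ξ => ?_)
    rw [norm_mul, Real.norm_of_nonneg (by positivity : 0 ≤ 1 + |ξ|)]
    exact le_mul_of_one_le_left (norm_nonneg _) (by linarith [abs_nonneg ξ])

/-- The solution of the linear equation is given on the Fourier side by the propagator. -/
theorem IsLinearSolution.partialFT {ν E : ℝ} (hν : 0 ≤ ν) {ωin : StripL2} {ω : ℝ → StripL2}
    (h : IsLinearSolution ν ωin ω) (P : Profile ωin E) {t : ℝ} (ht : 0 ≤ t) :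
    PartialFT (ω t) (fun p => propagator ν t p * P.g0 p) := by
  have hg := P.meas0
  have hKm : ∀ s, Measurable fun p => propagator ν s p * P.g0 p := fun s =>
    (measurable_propagator ν s).mul hg
  have hN0 : MemLp P.N0 2 volume := by
    refine P.memLp_N0.mono P.measN0.aestronglyMeasurable (Eventually.of_forall fun ξ => ?_)
    rw [norm_mul, Real.norm_of_nonneg (by positivity : 0 ≤ (1 + |ξ|) ^ 2)]
    exact le_mul_of_one_le_left (norm_nonneg _) (by nlinarith [abs_nonneg ξ])
  have hK2 : ∀ s, 0 ≤ s → MemLp (fun p => propagator ν s p * P.g0 p) 2 stripMeasure := by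
    intro s hs
    refine memLp_two_strip_of_le (hKm s) hN0 fun ξ y hy => ?_
    rw [norm_mul]
    exact (mul_le_of_le_one_left (norm_nonneg _) (norm_propagator_le_one hν hs _)).trans
      (P.norm0 ξ y hy)
  let a : ℝ → ℝ × ℝ → ℝ := fun s p => ν + ν * s ^ 2 * (2 * π * p.1) ^ 2
  let b : ℝ → ℝ × ℝ → ℝ := fun s p => 2 * π * p.1 * p.2
  let K' : ℝ → ℝ × ℝ → ℂ := fun s p =>
    -((a s p : ℂ) + (b s p : ℂ) * I) * (propagator ν s p * P.g0 p)
  have hKm' : ∀ s, Measurable (K' s) := fun s => by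
    have := hKm s
    simp only [K', a, b]
    fun_prop
  have hd : ∀ p s, HasDerivAt (fun s => propagator ν s p * P.g0 p) (K' s p) s := by
    intro p s
    refine ((hasDerivAt_propagator ν s p).mul_const (P.g0 p)).congr_deriv ?_
    simp only [K', a, b]
    ring
  -- an `L²` majorant of the time derivative for times up to `T`
  let B : ℝ → ℝ × ℝ → ℝ := fun T p =>
    (ν + ν * T ^ 2 * (2 * π) ^ 2 + 2 * π) * ((1 + |p.1|) ^ 2 * P.N0 p.1)
  have hB : ∀ T, MemLp (B T) 2 stripMeasure := by
    intro T
    rw [stripMeasure_eq_prod]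
    exact (P.memLp_N0.comp_fst sectionMeasure).const_mul _
  have hbd : ∀ T, ∀ᵐ p ∂stripMeasure, ∀ s ∈ Icc (0 : ℝ) T, ‖K' s p‖ ≤ B T p := by
    intro T
    filter_upwards [ae_restrict_mem isOpen_strip.measurableSet] with p hp s hs
    have hy : |p.2| ≤ 1 := abs_le.2 ⟨hp.2.1.le, hp.2.2.le⟩
    have h1 : ‖propagator ν s p * P.g0 p‖ ≤ P.N0 p.1 := by
      rw [norm_mul]
      exact (mul_le_of_le_one_left (norm_nonneg _) (norm_propagator_le_one hν hs.1 _)).trans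
        (P.norm0 p.1 p.2 ⟨hp.2.1.le, hp.2.2.le⟩)
    have h2 : ‖-((a s p : ℂ) + (b s p : ℂ) * I)‖ ≤
        (ν + ν * T ^ 2 * (2 * π) ^ 2 + 2 * π) * (1 + |p.1|) ^ 2 := by
      rw [norm_neg]
      refine (norm_add_le _ _).trans ?_
      rw [norm_mul, Complex.norm_I, mul_one, Complex.norm_real, Complex.norm_real,
        Real.norm_of_nonneg (by positivity : 0 ≤ a s p), Real.norm_eq_abs]
      have h3 : |b s p| ≤ 2 * π * |p.1| := by
        simp only [b, abs_mul, Nat.abs_ofNat, abs_of_pos Real.pi_pos]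
        exact mul_le_of_le_one_right (by positivity) hy
      have h4 : a s p ≤ ν + ν * T ^ 2 * ((2 * π) ^ 2 * |p.1| ^ 2) := by
        simp only [a, mul_pow, sq_abs]
        have := hs.1
        gcongr
        exact hs.2
      have h5 : |p.1| ^ 2 ≤ (1 + |p.1|) ^ 2 := by gcongr; linarith
      have h6 : |p.1| ≤ (1 + |p.1|) ^ 2 := by nlinarith [abs_nonneg p.1]
      have h7 : 1 ≤ (1 + |p.1|) ^ 2 := by nlinarith [abs_nonneg p.1]
      calc a s p + |b s p| ≤ (ν * 1 + ν * T ^ 2 * ((2 * π) ^ 2 * |p.1| ^ 2)) + 2 * π * |p.1| := by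
            linarith
        _ ≤ (ν * (1 + |p.1|) ^ 2 + ν * T ^ 2 * ((2 * π) ^ 2 * (1 + |p.1|) ^ 2))
            + 2 * π * (1 + |p.1|) ^ 2 := by
            have := Real.pi_pos
            gcongr
        _ = _ := by ring
    simp only [K', B]
    rw [norm_mul, ← mul_assoc]
    exact mul_le_mul h2 h1 (norm_nonneg _) (by have := Real.pi_pos; positivity)
  have hK'2 : ∀ s, 0 ≤ s → MemLp (K' s) 2 stripMeasure := by
    intro s hs
    refine (hB s).mono (hKm' s).aestronglyMeasurable ?_
    filter_upwards [hbd s] with p hp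
    exact (hp s ⟨hs, le_rfl⟩).trans (le_abs_self _)
  classical
  -- The explicit solution and its time derivative as curves in `L²` for `t ≥ 0`.
  let M : ℝ → StripL2 := fun s => if hs : 0 ≤ s then (hK2 s hs).toLp _ else 0
  let M' : ℝ → StripL2 := fun s => if hs : 0 ≤ s then (hK'2 s hs).toLp _ else 0
  have hM : ∀ s, 0 ≤ s → M s =ᵐ[stripMeasure] fun p => propagator ν s p * P.g0 p := by
    intro s hs
    simp only [M, dif_pos hs]
    exact MemLp.coeFn_toLp _
  have hM' : ∀ s, 0 ≤ s → M' s =ᵐ[stripMeasure] K' s := by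
    intro s hs
    simp only [M', dif_pos hs]
    exact MemLp.coeFn_toLp _
  have hMd : ∀ s, 0 ≤ s → HasDerivWithinAt M (M' s) (Ici 0) s := fun s hs =>
    hasDerivWithinAt_Lp_of_dominated hs hKm (hKm' s) (hB (s + 1)) hd (hbd (s + 1)) hM (hM' s hs)
  have hωd : ∀ s, 0 ≤ s → HasDerivWithinAt (fun s => partialFourier (ω s))
      (partialFourier (timeDeriv ω s)) (Ici 0) s := fun s hs =>
    ((partialFourier.toContinuousLinearMap.restrictScalars ℝ).hasFDerivAt.comp_hasDerivWithinAt s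
      (h.diff_t s hs).hasDerivWithinAt)
  have hPeq : ∀ s, 0 ≤ s → ∀ᵐ p ∂stripMeasure, partialFourier (timeDeriv ω s) p =
      -((a s p : ℂ) + (b s p : ℂ) * I) * partialFourier (ω s) p := by
    intro s hs
    have e1 := partialFourier_weak_succ (hasWeakPartial_zero (ω s)) (h.diff_x s hs).hasWeakPartial
    have e2 := partialFourier_weak_succ (h.diff_x s hs).hasWeakPartial (h.diff_xx s hs).hasWeakPartial
    have p1 := (((partialFT_partialFourier (ω s)).sub ((partialFT_partialFourier
      (weakPartial 2 0 (ω s))).const_mul ((s : ℂ) ^ 2))).const_mul (-(ν : ℂ))).sub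
      ((partialFT_partialFourier (weakPartial 1 0 (ω s))).mul_snd (fun y => (y : ℂ)))
    have p2 : PartialFT (timeDeriv ω s) _ := p1.congr (by
      filter_upwards [h.eqn s hs] with p hp
      linear_combination -hp) (EventuallyEq.refl _ _)
    have p3 := p2.partialFourier_ae_eq (by
      have := fun g : StripL2 => (Lp.stronglyMeasurable g).aestronglyMeasurable (μ := stripMeasure)
      have h1 := this (partialFourier (ω s))
      have h2 := this (partialFourier (weakPartial 2 0 (ω s)))
      have h3 := this (partialFourier (weakPartial 1 0 (ω s)))
      have h4 : AEStronglyMeasurable (fun p : ℝ × ℝ => (p.2 : ℂ)) stripMeasure := by fun_prop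
      exact ((h1.sub (h2.const_mul _)).const_mul _).sub (h4.mul h3))
    filter_upwards [p3, e1, e2] with p h1 h2 h3
    rw [h1, h3, h2]
    simp only [a, b]
    push_cast
    ring_nf
    rw [Complex.I_sq]
    ring
  -- Uniqueness: the difference to the transformed solution solves a dissipative equation.
  have hzero := eq_zero_of_dissipative (d := fun s => partialFourier (ω s) - M s)
    (d' := fun s => partialFourier (timeDeriv ω s) - M' s) (a := a) (b := b)
    (fun s p => by simp only [a]; positivity) (fun s hs => (hωd s hs).sub (hMd s hs)) (by
      intro s hs
      filter_upwards [hPeq s hs, hM s hs, hM' s hs, Lp.coeFn_sub (partialFourier (timeDeriv ω s)) (M' s),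
        Lp.coeFn_sub (partialFourier (ω s)) (M s)] with p h1 h2 h3 h4 h5
      rw [h4, h5, Pi.sub_apply, Pi.sub_apply, h1, h2, h3]
      simp only [K']
      ring) (by
      rw [sub_eq_zero]
      refine Lp.ext ?_
      have h1 := P.partialFT.partialFourier_ae_eq hg.aestronglyMeasurable
      rw [h.init]
      filter_upwards [h1, hM 0 le_rfl] with p h2 h3
      rw [h2, h3]
      simp [propagator]) ht
  rw [sub_eq_zero] at hzero
  refine (partialFT_partialFourier (ω t)).congr (EventuallyEq.refl _ _) ?_
  have h0 := hM t ht
  rwa [← hzero] at h0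

/-! ### Oscillatory integrals -/

/-- `q` is a primitive of the locally integrable function `q'`. -/
structure IsPrimitive (q q' : ℝ → ℂ) : Prop where
  int : ∀ a b, IntervalIntegrable q' volume a b
  eq : ∀ a b, q b - q a = ∫ z in a..b, q' z

theorem IsPrimitive.of_hasDerivAt {q q' : ℝ → ℂ} (h : ∀ y, HasDerivAt q (q' y) y)
    (hc : Continuous q') : IsPrimitive q q' :=
  ⟨fun a b => hc.intervalIntegrable a b, fun a b =>
    (intervalIntegral.integral_eq_sub_of_hasDerivAt (fun y _ => h y) (hc.intervalIntegrable a b)).symm⟩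

theorem IsPrimitive.continuous {q q' : ℝ → ℂ} (h : IsPrimitive q q') : Continuous q := by
  have h1 : q = fun y => q 0 + ∫ z in (0 : ℝ)..y, q' z := by
    funext y
    rw [← h.eq 0 y]; ring
  rw [h1]
  exact continuous_const.add (intervalIntegral.continuous_primitive h.int 0)

theorem IsPrimitive.integral_mul_deriv {q q' B B' : ℝ → ℂ} (h : IsPrimitive q q') {a b : ℝ}
    (hab : a ≤ b) (hB : ∀ y, HasDerivAt B (B' y) y) (hB' : Continuous B') :
    ∫ y in a..b, q y * B' y = q b * B b - q a * B a - ∫ y in a..b, q' y * B y := by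
  have h1 := integral_primitive_mul_deriv hab (h.int a b) hB hB'
  have h2 : ∫ y in a..b, q y * B' y =
      ∫ y in a..b, (q a * B' y + (∫ z in a..y, q' z) * B' y) := by
    refine intervalIntegral.integral_congr fun y _ => ?_
    rw [← h.eq a y]; ring
  have i1 : IntervalIntegrable (fun y => q a * B' y) volume a b :=
    (continuous_const.mul hB').intervalIntegrable _ _
  have i2 : IntervalIntegrable (fun y => (∫ z in a..y, q' z) * B' y) volume a b :=
    ((intervalIntegral.continuous_primitive h.int a).mul hB').intervalIntegrable _ _
  rw [h2, intervalIntegral.integral_add i1 i2, h1,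
    intervalIntegral.integral_const_mul, ← h.eq a b,
    intervalIntegral.integral_eq_sub_of_hasDerivAt (fun y _ => hB y) (hB'.intervalIntegrable a b)]
  ring

/-- The `j`-th iterated primitive of the oscillation `exp(-iθy)`. -/
def osc (θ : ℝ) (j : ℕ) (y : ℝ) : ℂ := (I / θ) ^ j * Complex.exp (-((θ * y : ℝ) : ℂ) * I)

theorem continuous_osc (θ : ℝ) (j : ℕ) : Continuous (osc θ j) := by
  unfold osc; fun_prop

theorem norm_osc (θ : ℝ) (j : ℕ) (y : ℝ) : ‖osc θ j y‖ = (|θ| ^ j)⁻¹ := by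
  rw [osc, norm_mul, ← Complex.ofReal_neg, Complex.norm_exp_ofReal_mul_I]
  simp

theorem hasDerivAt_osc_zero (θ y : ℝ) :
    HasDerivAt (osc θ 0) (-(θ * I) * osc θ 0 y) y := by
  have h1 : HasDerivAt (fun y : ℝ => -((θ * y : ℝ) : ℂ) * I) (-(θ : ℂ) * I) y := by
    have h := (((hasDerivAt_id y).const_mul θ).ofReal_comp.neg).mul_const I
    simpa using h
  have h2 := h1.cexp.const_mul ((I / θ) ^ 0)
  refine h2.congr_deriv ?_
  simp only [osc]; ring

theorem hasDerivAt_osc {θ : ℝ} (hθ : θ ≠ 0) (j : ℕ) (y : ℝ) :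
    HasDerivAt (osc θ (j + 1)) (osc θ j y) y := by
  have h2 := (hasDerivAt_osc_zero θ y).const_mul ((I / θ) ^ (j + 1))
  have h3 : osc θ (j + 1) = fun y => (I / θ) ^ (j + 1) * osc θ 0 y := by
    funext y; simp [osc]
  rw [h3]
  refine h2.congr_deriv ?_
  have h4 : (θ : ℂ) ≠ 0 := by exact_mod_cast hθ
  have h5 : -(I / θ) * (θ * I) = 1 := by
    field_simp; rw [Complex.I_sq]; ring
  simp only [osc, pow_succ, pow_zero, one_mul]
  linear_combination ((I / θ) ^ j * Complex.exp (-((θ * y : ℝ) : ℂ) * I)) * h5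

/-- One integration by parts against the oscillation `osc θ j`, with a weight `W`. -/
theorem osc_integration_by_parts {θ : ℝ} (hθ : θ ≠ 0) {q q' : ℝ → ℂ} (h : IsPrimitive q q')
    {W W' : ℝ → ℝ} (hW : ∀ y, HasDerivAt W (W' y) y) (hW' : Continuous W') (j : ℕ) {a b : ℝ}
    (hab : a ≤ b) :
    ∫ y in a..b, q y * (W y * osc θ j y) =
      q b * (W b * osc θ (j + 1) b) - q a * (W a * osc θ (j + 1) a)
        - (∫ y in a..b, q' y * (W y * osc θ (j + 1) y))
        - ∫ y in a..b, q y * (W' y * osc θ (j + 1) y) := by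
  have hWc : Continuous W := continuous_iff_continuousAt.2 fun y => (hW y).continuousAt
  have hB : ∀ y, HasDerivAt (fun y => (W y : ℂ) * osc θ (j + 1) y)
      ((W' y : ℂ) * osc θ (j + 1) y + (W y : ℂ) * osc θ j y) y := fun y =>
    (hW y).ofReal_comp.mul (hasDerivAt_osc hθ j y)
  have ho := continuous_osc θ
  have h1 := h.integral_mul_deriv hab hB (by have := ho j; have := ho (j + 1); fun_prop)
  rw [← h1, ← intervalIntegral.integral_sub]
  · refine intervalIntegral.integral_congr fun y _ => ?_
    ring
  · have := ho j; have := ho (j + 1); have := h.continuous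
    exact Continuous.intervalIntegrable (by fun_prop) _ _
  · have := ho (j + 1); have := h.continuous
    exact Continuous.intervalIntegrable (by fun_prop) _ _

theorem norm_integral_osc_le_of_bounded {θ : ℝ} {q : ℝ → ℂ} {Q : ℝ} {V : ℝ → ℝ} (hV : Continuous V)
    (j : ℕ) {a b : ℝ} (hab : a ≤ b) (hq : ∀ y ∈ Icc a b, ‖q y‖ ≤ Q) :
    ‖∫ y in a..b, q y * (V y * osc θ j y)‖ ≤ (|θ| ^ j)⁻¹ * (Q * ∫ y in a..b, |V y|) := by
  rw [← intervalIntegral.integral_const_mul, ← intervalIntegral.integral_const_mul]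
  refine intervalIntegral.norm_integral_le_of_norm_le hab (Eventually.of_forall fun y hy => ?_)
    (Continuous.intervalIntegrable (by fun_prop) _ _)
  rw [norm_mul, norm_mul, norm_osc, Complex.norm_real, Real.norm_eq_abs]
  calc _ = (|θ| ^ j)⁻¹ * (‖q y‖ * |V y|) := by ring
    _ ≤ _ := by gcongr; exact hq y ⟨hy.1.le, hy.2⟩

theorem norm_integral_osc_le_of_integrable {θ : ℝ} {q : ℝ → ℂ} {W : ℝ → ℝ} {D Q : ℝ} (j : ℕ) {a b : ℝ}
    (ha : -1 ≤ a) (hab : a ≤ b) (hb : b ≤ 1) (hq : ∀ a b, IntervalIntegrable q volume a b)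
    (hW : ∀ y ∈ Icc a b, |W y| ≤ D) (hQ : ∫ y in (-1 : ℝ)..1, ‖q y‖ ≤ Q) :
    ‖∫ y in a..b, q y * (W y * osc θ j y)‖ ≤ (|θ| ^ j)⁻¹ * (D * Q) := by
  have hD : 0 ≤ D := (abs_nonneg _).trans (hW a ⟨le_rfl, hab⟩)
  calc ‖∫ y in a..b, q y * (W y * osc θ j y)‖
      ≤ ∫ y in a..b, (|θ| ^ j)⁻¹ * (D * ‖q y‖) := by
        refine intervalIntegral.norm_integral_le_of_norm_le hab
          (Eventually.of_forall fun y hy => ?_) (((hq a b).norm.const_mul _).const_mul _)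
        rw [norm_mul, norm_mul, norm_osc, Complex.norm_real, Real.norm_eq_abs]
        calc _ = (|θ| ^ j)⁻¹ * (|W y| * ‖q y‖) := by ring
          _ ≤ _ := by gcongr; exact hW y ⟨hy.1.le, hy.2⟩
    _ = (|θ| ^ j)⁻¹ * (D * ∫ y in a..b, ‖q y‖) := by
        rw [intervalIntegral.integral_const_mul, intervalIntegral.integral_const_mul]
    _ ≤ (|θ| ^ j)⁻¹ * (D * Q) := by
        gcongr
        refine le_trans ?_ hQ
        exact intervalIntegral.integral_mono_interval ha hab hb
          (Eventually.of_forall fun _ => norm_nonneg _) (hq _ _).norm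

/-! ### Green's function of `ψ'' - κ² ψ` on `(-1, 1)` -/

/-- The solution `sinh (κ (1 + y))` of `u'' = κ² u` that vanishes at `y = -1`. -/
def sinhL (κ y : ℝ) : ℝ := sinh (κ * (1 + y))

/-- The solution `sinh (κ (1 - y))` of `u'' = κ² u` that vanishes at `y = 1`. -/
def sinhR (κ y : ℝ) : ℝ := sinh (κ * (1 - y))

/-- The derivative of `sinhL` divided by `κ`. -/
def coshL (κ y : ℝ) : ℝ := cosh (κ * (1 + y))

/-- The derivative of `sinhR` divided by `-κ`. -/
def coshR (κ y : ℝ) : ℝ := cosh (κ * (1 - y))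

theorem hasDerivAt_sinhL (κ y : ℝ) : HasDerivAt (sinhL κ) (κ * coshL κ y) y := by
  have h := (((hasDerivAt_id y).const_add 1).const_mul κ).sinh
  exact h.congr_deriv (by simp [coshL]; ring)

theorem hasDerivAt_sinhR (κ y : ℝ) : HasDerivAt (sinhR κ) (-(κ * coshR κ y)) y := by
  have h := (((hasDerivAt_id y).const_sub 1).const_mul κ).sinh
  exact h.congr_deriv (by simp [coshR]; ring)

theorem hasDerivAt_coshL (κ y : ℝ) : HasDerivAt (coshL κ) (κ * sinhL κ y) y := by
  have h := (((hasDerivAt_id y).const_add 1).const_mul κ).cosh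
  exact h.congr_deriv (by simp [sinhL]; ring)

theorem hasDerivAt_coshR (κ y : ℝ) : HasDerivAt (coshR κ) (-(κ * sinhR κ y)) y := by
  have h := (((hasDerivAt_id y).const_sub 1).const_mul κ).cosh
  exact h.congr_deriv (by simp [sinhR]; ring)

@[fun_prop]
theorem continuous_sinhL (κ : ℝ) : Continuous (sinhL κ) := by unfold sinhL; fun_prop

@[fun_prop]
theorem continuous_sinhR (κ : ℝ) : Continuous (sinhR κ) := by unfold sinhR; fun_prop

@[fun_prop]
theorem continuous_coshL (κ : ℝ) : Continuous (coshL κ) := by unfold coshL; fun_prop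

@[fun_prop]
theorem continuous_coshR (κ : ℝ) : Continuous (coshR κ) := by unfold coshR; fun_prop

/-- The Wronskian of `sinhL` and `sinhR`, up to the factor `-κ`. -/
theorem sinh_mul_cosh_add (κ y : ℝ) :
    sinhL κ y * coshR κ y + sinhR κ y * coshL κ y = sinh (2 * κ) := by
  have h : 2 * κ = κ * (1 + y) + κ * (1 - y) := by ring
  rw [h, Real.sinh_add]
  simp only [sinhL, sinhR, coshL, coshR]
  ring

theorem sinhL_nonneg {κ y : ℝ} (hκ : 0 ≤ κ) (hy : -1 ≤ y) : 0 ≤ sinhL κ y :=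
  Real.sinh_nonneg_iff.2 (mul_nonneg hκ (by linarith))

theorem sinhR_nonneg {κ y : ℝ} (hκ : 0 ≤ κ) (hy : y ≤ 1) : 0 ≤ sinhR κ y :=
  Real.sinh_nonneg_iff.2 (mul_nonneg hκ (by linarith))

theorem coshL_pos (κ y : ℝ) : 0 < coshL κ y := Real.cosh_pos _

theorem coshR_pos (κ y : ℝ) : 0 < coshR κ y := Real.cosh_pos _

theorem sinhL_mono {κ z y : ℝ} (hκ : 0 ≤ κ) (h : z ≤ y) : sinhL κ z ≤ sinhL κ y :=
  Real.sinh_le_sinh.2 (by gcongr)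

theorem sinhR_anti {κ z y : ℝ} (hκ : 0 ≤ κ) (h : z ≤ y) : sinhR κ y ≤ sinhR κ z :=
  Real.sinh_le_sinh.2 (by gcongr)

theorem sinhL_le_coshL (κ y : ℝ) : sinhL κ y ≤ coshL κ y := (Real.sinh_lt_cosh _).le

theorem sinhR_le_coshR (κ y : ℝ) : sinhR κ y ≤ coshR κ y := (Real.sinh_lt_cosh _).le

theorem integral_coshL {κ y : ℝ} (hκ : 0 ≤ κ) : ∫ z in (-1 : ℝ)..y, |κ * coshL κ z| = sinhL κ y := by
  rw [intervalIntegral.integral_congr (g := fun z => κ * coshL κ z) fun z _ =>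
    abs_of_nonneg (mul_nonneg hκ (coshL_pos κ z).le),
    intervalIntegral.integral_eq_sub_of_hasDerivAt (fun z _ => hasDerivAt_sinhL κ z)
      (Continuous.intervalIntegrable (by fun_prop) _ _)]
  simp [sinhL]

theorem integral_coshR {κ y : ℝ} (hκ : 0 ≤ κ) : ∫ z in y..1, |-(κ * coshR κ z)| = sinhR κ y := by
  rw [intervalIntegral.integral_congr (g := fun z => -(-(κ * coshR κ z))) fun z _ => by
    simp only [abs_neg, neg_neg]
    exact abs_of_nonneg (mul_nonneg hκ (coshR_pos κ z).le),
    intervalIntegral.integral_neg,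
    intervalIntegral.integral_eq_sub_of_hasDerivAt (fun z _ => hasDerivAt_sinhR κ z)
      (Continuous.intervalIntegrable (by fun_prop) _ _)]
  simp [sinhR]

theorem integral_sinhL_le {κ y : ℝ} (hκ : 0 ≤ κ) (hy : -1 ≤ y) :
    ∫ z in (-1 : ℝ)..y, |κ * (κ * sinhL κ z)| ≤ κ * coshL κ y := by
  rw [intervalIntegral.integral_congr (g := fun z => κ * (κ * sinhL κ z)) fun z hz => by
    rw [uIcc_of_le hy] at hz
    exact abs_of_nonneg (mul_nonneg hκ (mul_nonneg hκ (sinhL_nonneg hκ hz.1))),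
    intervalIntegral.integral_const_mul,
    intervalIntegral.integral_eq_sub_of_hasDerivAt (fun z _ => hasDerivAt_coshL κ z)
      (Continuous.intervalIntegrable (by fun_prop) _ _)]
  have := coshL_pos κ (-1)
  gcongr
  linarith

theorem integral_sinhR_le {κ y : ℝ} (hκ : 0 ≤ κ) (hy : y ≤ 1) :
    ∫ z in y..1, |-(κ * -(κ * sinhR κ z))| ≤ κ * coshR κ y := by
  rw [intervalIntegral.integral_congr (g := fun z => -κ * -(κ * sinhR κ z)) fun z hz => by
    rw [uIcc_of_le hy] at hz
    have h := mul_nonneg hκ (mul_nonneg hκ (sinhR_nonneg hκ hz.2))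
    rw [abs_of_nonneg (by linarith)]
    ring,
    intervalIntegral.integral_const_mul,
    intervalIntegral.integral_eq_sub_of_hasDerivAt (fun z _ => hasDerivAt_coshR κ z)
      (Continuous.intervalIntegrable (by fun_prop) _ _)]
  have := coshR_pos κ 1
  nlinarith

/-- The solution of `ψ'' - κ² ψ = f`, `ψ(±1) = 0`, by Green's function. -/
def greenSol (κ : ℝ) (f : ℝ → ℂ) (y : ℝ) : ℂ :=
  -((sinhR κ y : ℂ) * (∫ z in (-1 : ℝ)..y, sinhL κ z * f z)
    + (sinhL κ y : ℂ) * ∫ z in y..1, sinhR κ z * f z) / ((κ * sinh (2 * κ) : ℝ) : ℂ)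

/-- The derivative of `greenSol κ f`. -/
def greenDer (κ : ℝ) (f : ℝ → ℂ) (y : ℝ) : ℂ :=
  ((coshR κ y : ℂ) * (∫ z in (-1 : ℝ)..y, sinhL κ z * f z)
    - (coshL κ y : ℂ) * ∫ z in y..1, sinhR κ z * f z) / ((sinh (2 * κ) : ℝ) : ℂ)

theorem sinh_two_mul_pos {κ : ℝ} (hκ : 0 < κ) : 0 < sinh (2 * κ) :=
  Real.sinh_pos_iff.2 (by linarith)

theorem hasDerivAt_integral_left {w : ℝ → ℝ} (hw : Continuous w) {f : ℝ → ℂ} (hf : Continuous f)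
    (y : ℝ) : HasDerivAt (fun y => ∫ z in (-1 : ℝ)..y, (w z : ℂ) * f z) (w y * f y) y := by
  have hc : Continuous fun z => (w z : ℂ) * f z := by fun_prop
  exact intervalIntegral.integral_hasDerivAt_right (hc.intervalIntegrable _ _)
    (hc.stronglyMeasurableAtFilter _ _) hc.continuousAt

theorem hasDerivAt_integral_right {w : ℝ → ℝ} (hw : Continuous w) {f : ℝ → ℂ} (hf : Continuous f)
    (y : ℝ) : HasDerivAt (fun y => ∫ z in y..1, (w z : ℂ) * f z) (-(w y * f y)) y := by
  have hc : Continuous fun z => (w z : ℂ) * f z := by fun_prop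
  exact intervalIntegral.integral_hasDerivAt_left (hc.intervalIntegrable _ _)
    (hc.stronglyMeasurableAtFilter _ _) hc.continuousAt

theorem hasDerivAt_greenSol {κ : ℝ} (hκ : 0 < κ) {f : ℝ → ℂ} (hf : Continuous f) (y : ℝ) :
    HasDerivAt (greenSol κ f) (greenDer κ f y) y := by
  have h := ((((hasDerivAt_sinhR κ y).ofReal_comp.mul
    (hasDerivAt_integral_left (continuous_sinhL κ) hf y)).add ((hasDerivAt_sinhL κ y).ofReal_comp.mul
    (hasDerivAt_integral_right (continuous_sinhR κ) hf y))).neg).div_const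
      ((κ * sinh (2 * κ) : ℝ) : ℂ)
  refine h.congr_deriv ?_
  have h1 : (κ : ℂ) ≠ 0 := by exact_mod_cast hκ.ne'
  have h2 : ((sinh (2 * κ) : ℝ) : ℂ) ≠ 0 := by exact_mod_cast (sinh_two_mul_pos hκ).ne'
  simp only [greenDer, Complex.ofReal_mul, Complex.ofReal_neg]
  generalize ((sinh (2 * κ) : ℝ) : ℂ) = S at *
  rw [div_eq_div_iff (mul_ne_zero h1 h2) h2]
  ring

theorem hasDerivAt_greenDer {κ : ℝ} (hκ : 0 < κ) {f : ℝ → ℂ} (hf : Continuous f) (y : ℝ) :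
    HasDerivAt (greenDer κ f) ((κ : ℂ) ^ 2 * greenSol κ f y + f y) y := by
  have h := (((hasDerivAt_coshR κ y).ofReal_comp.mul
    (hasDerivAt_integral_left (continuous_sinhL κ) hf y)).sub ((hasDerivAt_coshL κ y).ofReal_comp.mul
    (hasDerivAt_integral_right (continuous_sinhR κ) hf y))).div_const ((sinh (2 * κ) : ℝ) : ℂ)
  refine h.congr_deriv ?_
  have h1 : (κ : ℂ) ≠ 0 := by exact_mod_cast hκ.ne'
  have h2 : ((sinh (2 * κ) : ℝ) : ℂ) ≠ 0 := by exact_mod_cast (sinh_two_mul_pos hκ).ne'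
  have h3 : (sinhL κ y : ℂ) * coshR κ y + sinhR κ y * coshL κ y = ((sinh (2 * κ) : ℝ) : ℂ) := by
    exact_mod_cast sinh_mul_cosh_add κ y
  simp only [greenSol, Complex.ofReal_mul, Complex.ofReal_neg]
  generalize ((sinh (2 * κ) : ℝ) : ℂ) = S at *
  rw [div_eq_iff h2]
  field_simp
  rw [← h3]
  ring

theorem greenSol_one (κ : ℝ) (f : ℝ → ℂ) : greenSol κ f 1 = 0 := by
  simp [greenSol, sinhR]

theorem greenSol_neg_one (κ : ℝ) (f : ℝ → ℂ) : greenSol κ f (-1) = 0 := by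
  simp [greenSol, sinhL]

/-- Bounds of the two half integrals by `L` times the boundary factors bound the derivative of the
solution by `L`, thanks to `sinh_mul_cosh_add`. -/
theorem norm_greenDer_le {κ : ℝ} (hκ : 0 < κ) {f : ℝ → ℂ} {y L : ℝ}
    (hl : ‖∫ z in (-1 : ℝ)..y, sinhL κ z * f z‖ ≤ L * sinhL κ y)
    (hr : ‖∫ z in y..1, sinhR κ z * f z‖ ≤ L * sinhR κ y) : ‖greenDer κ f y‖ ≤ L := by
  have hS := sinh_two_mul_pos hκ
  rw [greenDer, norm_div, Complex.norm_real, Real.norm_of_nonneg hS.le, div_le_iff₀ hS,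
    ← sinh_mul_cosh_add κ y]
  refine (norm_sub_le _ _).trans ?_
  rw [norm_mul, norm_mul, Complex.norm_real, Complex.norm_real, Real.norm_of_nonneg (coshR_pos κ y).le,
    Real.norm_of_nonneg (coshL_pos κ y).le]
  nlinarith [coshL_pos κ y, coshR_pos κ y]

theorem norm_mul_greenSol_le {κ : ℝ} (hκ : 0 < κ) {f : ℝ → ℂ} {y L : ℝ} (hy : y ∈ Icc (-1 : ℝ) 1)
    (hL : 0 ≤ L) (hl : ‖∫ z in (-1 : ℝ)..y, sinhL κ z * f z‖ ≤ L * sinhL κ y)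
    (hr : ‖∫ z in y..1, sinhR κ z * f z‖ ≤ L * sinhR κ y) : κ * ‖greenSol κ f y‖ ≤ L := by
  have hS := sinh_two_mul_pos hκ
  have h1 := sinhL_nonneg hκ.le hy.1
  have h2 := sinhR_nonneg hκ.le hy.2
  rw [greenSol, norm_div, Complex.norm_real, Real.norm_of_nonneg (mul_pos hκ hS).le, norm_neg,
    ← mul_div_assoc, div_le_iff₀ (mul_pos hκ hS), mul_left_comm]
  refine mul_le_mul_of_nonneg_left ?_ hκ.le
  rw [← sinh_mul_cosh_add κ y]
  refine (norm_add_le _ _).trans ?_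
  rw [norm_mul, norm_mul, Complex.norm_real, Complex.norm_real, Real.norm_of_nonneg h1,
    Real.norm_of_nonneg h2]
  have h3 := sinhL_le_coshL κ y
  have h4 := sinhR_le_coshR κ y
  have h5 : sinhL κ y * sinhR κ y ≤ sinhL κ y * coshR κ y := by gcongr
  have h6 : sinhR κ y * sinhL κ y ≤ sinhR κ y * coshL κ y := by gcongr
  nlinarith

theorem norm_greenSol_le {κ : ℝ} (hκ : 0 < κ) {f : ℝ → ℂ} (hf : Continuous f) {L : ℝ}
    (h : ∀ y ∈ Icc (-1 : ℝ) 1, ‖greenDer κ f y‖ ≤ L) {y : ℝ} (hy : y ∈ Icc (-1 : ℝ) 1) :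
    ‖greenSol κ f y‖ ≤ 2 * L := by
  have h1 := (convex_Icc (-1 : ℝ) 1).norm_image_sub_le_of_norm_hasDerivWithin_le
    (fun x _ => (hasDerivAt_greenSol hκ hf x).hasDerivWithinAt) h
    (left_mem_Icc.2 (by norm_num)) hy
  rw [greenSol_neg_one, sub_zero, Real.norm_of_nonneg (by linarith [hy.1])] at h1
  have h2 : 0 ≤ L := (norm_nonneg _).trans (h y hy)
  nlinarith [hy.2]

theorem sinh_mul_sinh_le {κ : ℝ} (hκ : 0 < κ) {y : ℝ} (hy : y ∈ Icc (-1 : ℝ) 1) :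
    sinhR κ y * sinhL κ y ≤ 2 * (κ * sinh (2 * κ)) := by
  have h1 := sinhL_nonneg hκ.le hy.1
  have h2 := sinhR_nonneg hκ.le hy.2
  have h3 : sinhR κ y ≤ κ * (1 - y) * coshR κ y := by
    have h := (convex_Icc y 1).norm_image_sub_le_of_norm_hasDerivWithin_le (C := κ * coshR κ y)
      (fun x _ => (hasDerivAt_sinhR κ x).hasDerivWithinAt) (fun x hx => by
        rw [norm_neg, Real.norm_of_nonneg (mul_pos hκ (coshR_pos κ x)).le]
        gcongr
        refine Real.cosh_le_cosh.2 ?_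
        rw [abs_of_nonneg (mul_nonneg hκ.le (by linarith [hx.2])),
          abs_of_nonneg (mul_nonneg hκ.le (by linarith [hy.2]))]
        gcongr
        exact hx.1) (left_mem_Icc.2 hy.2) (right_mem_Icc.2 hy.2)
    have h0 : sinhR κ 1 = 0 := by simp [sinhR]
    rw [h0, zero_sub, norm_neg, Real.norm_of_nonneg h2, Real.norm_of_nonneg (by linarith [hy.2])] at h
    linarith
  have h4 : sinhL κ y * coshR κ y ≤ sinh (2 * κ) := by
    rw [← sinh_mul_cosh_add κ y]
    nlinarith [coshL_pos κ y]
  have h5 := coshR_pos κ y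
  calc sinhR κ y * sinhL κ y ≤ (κ * (1 - y) * coshR κ y) * sinhL κ y := by gcongr
    _ = (κ * (1 - y)) * (sinhL κ y * coshR κ y) := by ring
    _ ≤ (κ * 2) * sinh (2 * κ) := by
        have : 0 ≤ sinhL κ y * coshR κ y := by positivity
        gcongr
        linarith [hy.1]
    _ = _ := by ring

/-! ### Green's function with an oscillating source -/

theorem sinhL_neg_one (κ : ℝ) : sinhL κ (-1) = 0 := by simp [sinhL]

theorem sinhR_one (κ : ℝ) : sinhR κ 1 = 0 := by simp [sinhR]

section Oscillation

variable {κ θ : ℝ} {q q' q'' : ℝ → ℂ} {Q₀ Q₁ Q₂ y : ℝ}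

/-- One integration by parts gains one power of the frequency of oscillation. -/
theorem norm_integral_osc_le (hθ : θ ≠ 0) (hq : IsPrimitive q q')
    (hQ₀ : ∀ z ∈ Icc (-1 : ℝ) 1, ‖q z‖ ≤ Q₀) (hQ₁ : ∫ z in (-1 : ℝ)..1, ‖q' z‖ ≤ Q₁) {W W' : ℝ → ℝ} {a b D : ℝ}
    (hW : ∀ z, HasDerivAt W (W' z) z) (hW' : Continuous W') (ha : -1 ≤ a) (hab : a ≤ b) (hb : b ≤ 1)
    (hD : ∀ z ∈ Icc a b, |W z| ≤ D) (hD' : ∫ z in a..b, |W' z| = D) (hend : |W a| + |W b| ≤ D) :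
    ‖∫ z in a..b, W z * (q z * osc θ 0 z)‖ ≤ (|θ|)⁻¹ * (2 * Q₀ + Q₁) * D := by
  have e : ∫ z in a..b, W z * (q z * osc θ 0 z) = ∫ z in a..b, q z * (W z * osc θ 0 z) :=
    intervalIntegral.integral_congr fun z _ => by ring
  rw [e, osc_integration_by_parts hθ hq hW hW' 0 hab]
  have b1 : ∀ z ∈ Icc (-1 : ℝ) 1, ‖q z * (W z * osc θ 1 z)‖ ≤ (|θ|)⁻¹ * (Q₀ * |W z|) := fun z hz => by
    rw [norm_mul, norm_mul, norm_osc, Complex.norm_real, Real.norm_eq_abs, pow_one]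
    have := hQ₀ z hz
    calc _ = (|θ|)⁻¹ * (‖q z‖ * |W z|) := by ring
      _ ≤ _ := by gcongr
  have b2 := norm_integral_osc_le_of_integrable (θ := θ) 1 ha hab hb hq.int hD hQ₁
  have b3 := norm_integral_osc_le_of_bounded (θ := θ) (q := q) hW' 1 hab
    (fun z hz => hQ₀ z ⟨ha.trans hz.1, hz.2.trans hb⟩)
  rw [hD'] at b3
  simp only [pow_one] at b2 b3
  refine (norm_sub_le _ _).trans ((add_le_add ((norm_sub_le _ _).trans (add_le_add
    ((norm_sub_le _ _).trans (add_le_add (b1 b ⟨ha.trans hab, hb⟩) (b1 a ⟨ha, hab.trans hb⟩))) b2)) b3).trans ?_)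
  have hQ : 0 ≤ Q₀ := (norm_nonneg _).trans (hQ₀ 1 (by norm_num))
  have h : (|θ|)⁻¹ * (Q₀ * (|W a| + |W b|)) ≤ (|θ|)⁻¹ * (Q₀ * D) := by gcongr
  linarith

/-- The derivative of the solution with an oscillating source gains one power of the frequency of
oscillation. -/
theorem norm_greenDer_osc_le (hκ : 0 < κ) (hθ : θ ≠ 0) (hq : IsPrimitive q q')
    (hQ₀ : ∀ z ∈ Icc (-1 : ℝ) 1, ‖q z‖ ≤ Q₀) (hQ₁ : ∫ z in (-1 : ℝ)..1, ‖q' z‖ ≤ Q₁)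
    (hy : y ∈ Icc (-1 : ℝ) 1) :
    ‖greenDer κ (fun z => q z * osc θ 0 z) y‖ ≤ (|θ|)⁻¹ * (2 * Q₀ + Q₁) :=
  norm_greenDer_le hκ
    (norm_integral_osc_le hθ hq hQ₀ hQ₁ (hasDerivAt_sinhL κ) (by fun_prop) le_rfl hy.1 hy.2
      (fun z hz => by rw [abs_of_nonneg (sinhL_nonneg hκ.le hz.1)]; exact sinhL_mono hκ.le hz.2)
      (integral_coshL hκ.le) (by rw [sinhL_neg_one, abs_zero, zero_add, abs_of_nonneg (sinhL_nonneg hκ.le hy.1)]))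
    (norm_integral_osc_le hθ hq hQ₀ hQ₁ (hasDerivAt_sinhR κ) (by fun_prop) hy.1 hy.2 le_rfl
      (fun z hz => by rw [abs_of_nonneg (sinhR_nonneg hκ.le hz.2)]; exact sinhR_anti hκ.le hz.1)
      (integral_coshR hκ.le) (by rw [sinhR_one, abs_zero, add_zero, abs_of_nonneg (sinhR_nonneg hκ.le hy.2)]))

/-- The part of `∫ W q e^{-iθz}` that is left after two integrations by parts. -/
theorem norm_remainder_le {W W' W'' : ℝ → ℝ} (hW'c : Continuous W')
    (hW''c : Continuous W'') {a b D V : ℝ} (ha : -1 ≤ a) (hab : a ≤ b) (hb : b ≤ 1)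
    (hq' : ∀ a b, IntervalIntegrable q'' volume a b)
    (hQ₀ : ∀ z ∈ Icc (-1 : ℝ) 1, ‖q z‖ ≤ Q₀) (hQ₁ : ∀ z ∈ Icc (-1 : ℝ) 1, ‖q' z‖ ≤ Q₁)
    (hQ₂ : ∫ z in (-1 : ℝ)..1, ‖q'' z‖ ≤ Q₂) (hD : ∀ z ∈ Icc a b, |W z| ≤ D)
    (hD' : ∫ z in a..b, |W' z| = D) (hV : ∫ z in a..b, |W'' z| ≤ V) :
    ‖(∫ z in a..b, q'' z * (W z * osc θ 2 z)) + 2 * (∫ z in a..b, q' z * (W' z * osc θ 2 z))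
      + ∫ z in a..b, q z * (W'' z * osc θ 2 z)‖ ≤
      (|θ| ^ 2)⁻¹ * (D * (Q₂ + 2 * Q₁) + Q₀ * V) := by
  have b1 := norm_integral_osc_le_of_integrable (θ := θ) 2 ha hab hb hq' hD hQ₂
  have b2 := norm_integral_osc_le_of_bounded (θ := θ) hW'c 2 hab
    (fun z hz => hQ₁ z ⟨ha.trans hz.1, hz.2.trans hb⟩)
  have b3 := norm_integral_osc_le_of_bounded (θ := θ) hW''c 2 hab
    (fun z hz => hQ₀ z ⟨ha.trans hz.1, hz.2.trans hb⟩)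
  have hQ0' : 0 ≤ Q₀ := (norm_nonneg _).trans (hQ₀ a ⟨ha, hab.trans hb⟩)
  rw [hD'] at b2
  have b3' : (|θ| ^ 2)⁻¹ * (Q₀ * ∫ z in a..b, |W'' z|) ≤ (|θ| ^ 2)⁻¹ * (Q₀ * V) := by gcongr
  have b2' : ‖2 * ∫ z in a..b, q' z * (W' z * osc θ 2 z)‖ ≤ 2 * ((|θ| ^ 2)⁻¹ * (Q₁ * D)) := by
    rw [norm_mul, Complex.norm_ofNat]
    gcongr
  refine (norm_add_le _ _).trans ((add_le_add ((norm_add_le _ _).trans (add_le_add b1 b2'))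
    (b3.trans b3')).trans (le_of_eq ?_))
  ring

/-- Two integrations by parts against the oscillation: boundary terms and a remainder of order
`θ⁻²`. -/
theorem integral_osc_twice (hθ : θ ≠ 0) (hq : IsPrimitive q q') (hq' : IsPrimitive q' q'')
    {W W' W'' : ℝ → ℝ} (hW : ∀ y, HasDerivAt W (W' y) y) (hW' : ∀ y, HasDerivAt W' (W'' y) y)
    (hW''c : Continuous W'') {a b : ℝ} (hab : a ≤ b) :
    ∫ z in a..b, W z * (q z * osc θ 0 z) =
      (q b * (W b * osc θ 1 b) - q' b * (W b * osc θ 2 b) - q b * (W' b * osc θ 2 b))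
      - (q a * (W a * osc θ 1 a) - q' a * (W a * osc θ 2 a) - q a * (W' a * osc θ 2 a))
      + ((∫ z in a..b, q'' z * (W z * osc θ 2 z)) + 2 * (∫ z in a..b, q' z * (W' z * osc θ 2 z))
      + ∫ z in a..b, q z * (W'' z * osc θ 2 z)) := by
  have e : ∫ z in a..b, W z * (q z * osc θ 0 z) = ∫ z in a..b, q z * (W z * osc θ 0 z) :=
    intervalIntegral.integral_congr fun z _ => by ring
  have hW'c : Continuous W' := continuous_iff_continuousAt.2 fun y => (hW' y).continuousAt
  rw [e, osc_integration_by_parts hθ hq hW hW'c 0 hab,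
    osc_integration_by_parts hθ hq' hW hW'c 1 hab,
    osc_integration_by_parts hθ hq hW' hW''c 1 hab]
  ring

/-- The solution with an oscillating source gains two powers of the frequency of oscillation. -/
theorem norm_greenSol_osc_le (hκ : 0 < κ) (hθ : θ ≠ 0) (hq : IsPrimitive q q')
    (hq' : IsPrimitive q' q'') (hQ₀ : ∀ z ∈ Icc (-1 : ℝ) 1, ‖q z‖ ≤ Q₀)
    (hQ₁ : ∀ z ∈ Icc (-1 : ℝ) 1, ‖q' z‖ ≤ Q₁) (hQ₂ : ∫ z in (-1 : ℝ)..1, ‖q'' z‖ ≤ Q₂)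
    (hy : y ∈ Icc (-1 : ℝ) 1) :
    ‖greenSol κ (fun z => q z * osc θ 0 z) y‖ ≤ (|θ| ^ 2)⁻¹ * (4 * Q₀ + 8 * Q₁ + 4 * Q₂) := by
  have hS := sinh_two_mul_pos hκ
  have hLn := sinhL_nonneg hκ.le hy.1
  have hRn := sinhR_nonneg hκ.le hy.2
  have hLc := sinhL_le_coshL κ y
  have hRc := sinhR_le_coshR κ y
  have hsum := sinh_mul_cosh_add κ y
  have hQ0' : 0 ≤ Q₀ := (norm_nonneg _).trans (hQ₀ y hy)
  have hQ1' : 0 ≤ Q₁ := (norm_nonneg _).trans (hQ₁ y hy)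
  have hQ2' : 0 ≤ Q₂ := (intervalIntegral.integral_nonneg (by norm_num) fun _ _ => norm_nonneg _).trans hQ₂
  have hl := integral_osc_twice (θ := θ) hθ hq hq' (hasDerivAt_sinhL κ)
    (fun y => (hasDerivAt_coshL κ y).const_mul κ) (by fun_prop) hy.1
  have hr := integral_osc_twice (θ := θ) hθ hq hq' (hasDerivAt_sinhR κ)
    (fun y => ((hasDerivAt_coshR κ y).const_mul κ).neg) (by fun_prop) hy.2
  have bl := norm_remainder_le (θ := θ) (q := q) (q' := q') (W := sinhL κ)
    (W' := fun z => κ * coshL κ z) (W'' := fun z => κ * (κ * sinhL κ z))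
    (by fun_prop) (by fun_prop) le_rfl hy.1 hy.2 hq'.int hQ₀ hQ₁ hQ₂ (fun z hz => by
      rw [abs_of_nonneg (sinhL_nonneg hκ.le hz.1)]; exact sinhL_mono hκ.le hz.2)
    (integral_coshL hκ.le) (integral_sinhL_le hκ.le hy.1)
  have br := norm_remainder_le (θ := θ) (q := q) (q' := q') (W := sinhR κ)
    (W' := fun z => -(κ * coshR κ z)) (W'' := fun z => -(κ * -(κ * sinhR κ z)))
    (by fun_prop) (by fun_prop) hy.1 hy.2 le_rfl hq'.int hQ₀ hQ₁ hQ₂ (fun z hz => by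
      rw [abs_of_nonneg (sinhR_nonneg hκ.le hz.2)]; exact sinhR_anti hκ.le hz.1)
    (integral_coshR hκ.le) (integral_sinhR_le hκ.le hy.2)
  set RL := (∫ z in (-1 : ℝ)..y, q'' z * (sinhL κ z * osc θ 2 z)) + 2 * (∫ z in (-1 : ℝ)..y,
    q' z * ((κ * coshL κ z : ℝ) * osc θ 2 z))
      + ∫ z in (-1 : ℝ)..y, q z * ((κ * (κ * sinhL κ z) : ℝ) * osc θ 2 z) with hRL
  set RR := (∫ z in y..1, q'' z * (sinhR κ z * osc θ 2 z)) + 2 * (∫ z in y..1,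
    q' z * ((-(κ * coshR κ z) : ℝ) * osc θ 2 z))
      + ∫ z in y..1, q z * ((-(κ * -(κ * sinhR κ z)) : ℝ) * osc θ 2 z) with hRR
  have hden : ((κ * sinh (2 * κ) : ℝ) : ℂ) ≠ 0 := by exact_mod_cast (mul_pos hκ hS).ne'
  have hc1 : coshL κ (-1) = 1 := by simp [coshL]
  have hc2 : coshR κ 1 = 1 := by simp [coshR]
  have hsumC : (sinhL κ y : ℂ) * coshR κ y + sinhR κ y * coshL κ y = ((sinh (2 * κ) : ℝ) : ℂ) := by
    exact_mod_cast hsum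
  have key : greenSol κ (fun z => q z * osc θ 0 z) y = q y * osc θ 2 y
      - (((κ * sinhR κ y : ℝ) : ℂ) * (q (-1) * osc θ 2 (-1)) + ((κ * sinhL κ y : ℝ) : ℂ) * (q 1 * osc θ 2 1)
        + sinhR κ y * RL + sinhL κ y * RR) / ((κ * sinh (2 * κ) : ℝ) : ℂ) := by
    rw [greenSol, hl, hr, sinhL_neg_one, sinhR_one, hc1, hc2, eq_sub_iff_add_eq, ← add_div,
      div_eq_iff hden, Complex.ofReal_mul κ (sinh _), ← hsumC]
    push_cast
    ring
  rw [key]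
  refine (norm_sub_le _ _).trans ?_
  have c1 : ‖q y * osc θ 2 y‖ ≤ (|θ| ^ 2)⁻¹ * Q₀ := by
    rw [norm_mul, norm_osc, mul_comm]; gcongr; exact hQ₀ y hy
  have c2 : ‖q (-1) * osc θ 2 (-1)‖ ≤ (|θ| ^ 2)⁻¹ * Q₀ := by
    rw [norm_mul, norm_osc, mul_comm]; gcongr; exact hQ₀ _ (by norm_num)
  have c3 : ‖q 1 * osc θ 2 1‖ ≤ (|θ| ^ 2)⁻¹ * Q₀ := by
    rw [norm_mul, norm_osc, mul_comm]; gcongr; exact hQ₀ _ (by norm_num)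
  have hLS : sinhL κ y ≤ sinh (2 * κ) := Real.sinh_le_sinh.2 (by nlinarith [hy.2])
  have hRS : sinhR κ y ≤ sinh (2 * κ) := Real.sinh_le_sinh.2 (by nlinarith [hy.1])
  have c4 : ‖(((κ * sinhR κ y : ℝ) : ℂ) * (q (-1) * osc θ 2 (-1)) + ((κ * sinhL κ y : ℝ) : ℂ) * (q 1 * osc θ 2 1)
        + sinhR κ y * RL + sinhL κ y * RR) / ((κ * sinh (2 * κ) : ℝ) : ℂ)‖ ≤
      (|θ| ^ 2)⁻¹ * (3 * Q₀ + 8 * Q₁ + 4 * Q₂) := by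
    rw [norm_div, Complex.norm_real, Real.norm_of_nonneg (mul_pos hκ hS).le, div_le_iff₀ (mul_pos hκ hS)]
    set θ2 := (|θ| ^ 2)⁻¹
    have hθ2 : 0 ≤ θ2 := by positivity
    have d1 : ‖((κ * sinhR κ y : ℝ) : ℂ) * (q (-1) * osc θ 2 (-1))‖ ≤
        κ * sinh (2 * κ) * (θ2 * Q₀) := by
      rw [norm_mul, Complex.norm_real, Real.norm_of_nonneg (by positivity)]
      gcongr
    have d2 : ‖((κ * sinhL κ y : ℝ) : ℂ) * (q 1 * osc θ 2 1)‖ ≤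
        κ * sinh (2 * κ) * (θ2 * Q₀) := by
      rw [norm_mul, Complex.norm_real, Real.norm_of_nonneg (by positivity)]
      gcongr
    have d3 : ‖(sinhR κ y : ℂ) * RL‖ ≤
        sinhR κ y * (θ2 * (sinhL κ y * (Q₂ + 2 * Q₁) + Q₀ * (κ * coshL κ y))) := by
      rw [norm_mul, Complex.norm_real, Real.norm_of_nonneg hRn]
      gcongr
    have d4 : ‖(sinhL κ y : ℂ) * RR‖ ≤
        sinhL κ y * (θ2 * (sinhR κ y * (Q₂ + 2 * Q₁) + Q₀ * (κ * coshR κ y))) := by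
      rw [norm_mul, Complex.norm_real, Real.norm_of_nonneg hLn]
      gcongr
    refine (norm_add_le _ _).trans ((add_le_add ((norm_add_le _ _).trans (add_le_add
      ((norm_add_le _ _).trans (add_le_add d1 d2)) d3)) d4).trans ?_)
    have hprod := sinh_mul_sinh_le hκ hy
    have h5 : θ2 * (Q₂ + 2 * Q₁) * (2 * (sinhR κ y * sinhL κ y)) ≤
        θ2 * (Q₂ + 2 * Q₁) * (4 * (κ * sinh (2 * κ))) := by
      gcongr ?_ * ?_
      linarith
    have h6 : θ2 * Q₀ * κ * (sinhL κ y * coshR κ y + sinhR κ y * coshL κ y) =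
        θ2 * Q₀ * κ * sinh (2 * κ) := by rw [hsum]
    linarith
  linarith

end Oscillation

/-- A function that vanishes at `±1` is represented by Green's function. -/
theorem eq_greenSol {κ : ℝ} (hκ : 0 < κ) {v v' v'' : ℝ → ℂ} (hv : ∀ y, HasDerivAt v (v' y) y)
    (hv' : ∀ y, HasDerivAt v' (v'' y) y) (hv'' : Continuous v'') (h1 : v 1 = 0) (h2 : v (-1) = 0)
    (y : ℝ) : v y = greenSol κ (fun z => v'' z - (κ : ℂ) ^ 2 * v z) y := by
  have hvc : Continuous v := continuous_iff_continuousAt.2 fun y => (hv y).continuousAt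
  have hS := sinh_two_mul_pos hκ
  have hl : ∫ z in (-1 : ℝ)..y, sinhL κ z * (v'' z - (κ : ℂ) ^ 2 * v z) =
      sinhL κ y * v' y - ((κ * coshL κ y : ℝ) : ℂ) * v y := by
    rw [intervalIntegral.integral_eq_sub_of_hasDerivAt (f := fun y =>
      (sinhL κ y : ℂ) * v' y - ((κ * coshL κ y : ℝ) : ℂ) * v y) (fun z _ => ?_)
      (Continuous.intervalIntegrable (by fun_prop) _ _)]
    · simp [h2, sinhL_neg_one]
    · refine (((hasDerivAt_sinhL κ z).ofReal_comp.mul (hv' z)).fun_sub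
        (((hasDerivAt_coshL κ z).const_mul κ).ofReal_comp.mul (hv z))).congr_deriv ?_
      push_cast; ring
  have hr : ∫ z in y..1, sinhR κ z * (v'' z - (κ : ℂ) ^ 2 * v z) =
      -(sinhR κ y * v' y + ((κ * coshR κ y : ℝ) : ℂ) * v y) := by
    rw [intervalIntegral.integral_eq_sub_of_hasDerivAt (f := fun y =>
      (sinhR κ y : ℂ) * v' y + ((κ * coshR κ y : ℝ) : ℂ) * v y) (fun z _ => ?_)
      (Continuous.intervalIntegrable (by fun_prop) _ _)]
    · simp [h1, sinhR_one]
    · refine (((hasDerivAt_sinhR κ z).ofReal_comp.mul (hv' z)).fun_add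
        (((hasDerivAt_coshR κ z).const_mul κ).ofReal_comp.mul (hv z))).congr_deriv ?_
      push_cast; ring
  have hden : ((κ * sinh (2 * κ) : ℝ) : ℂ) ≠ 0 := by exact_mod_cast (mul_pos hκ hS).ne'
  have hsumC : (sinhL κ y : ℂ) * coshR κ y + sinhR κ y * coshL κ y = ((sinh (2 * κ) : ℝ) : ℂ) := by
    exact_mod_cast sinh_mul_cosh_add κ y
  rw [greenSol, hl, hr, eq_div_iff hden, Complex.ofReal_mul κ (sinh _), ← hsumC]
  push_cast
  ring

theorem greenSol_add_mul (κ : ℝ) {f g : ℝ → ℂ} (hf : Continuous f) (hg : Continuous g) (c : ℂ) (y : ℝ) :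
    greenSol κ (fun z => f z + c * g z) y = greenSol κ f y + c * greenSol κ g y := by
  have key : ∀ (w : ℝ → ℝ) (a b : ℝ), Continuous w → ∫ z in a..b, (w z : ℂ) * (f z + c * g z) =
      (∫ z in a..b, (w z : ℂ) * f z) + c * ∫ z in a..b, (w z : ℂ) * g z := by
    intro w a b hw
    rw [← intervalIntegral.integral_const_mul, ← intervalIntegral.integral_add
      (Continuous.intervalIntegrable (by fun_prop) _ _) (Continuous.intervalIntegrable (by fun_prop) _ _)]
    exact intervalIntegral.integral_congr fun z _ => by ring
  simp only [greenSol]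
  rw [key _ _ _ (continuous_sinhL κ), key _ _ _ (continuous_sinhR κ)]
  ring

section Oscillation

variable {κ θ : ℝ} {q₀ q₁ q₂ q₃ : ℝ → ℂ} {N₀ N y : ℝ}

theorem norm_integral_weighted_le {W : ℝ → ℝ} {f : ℝ → ℂ} {a b D L : ℝ}
    (hab : a ≤ b) (hf : ∀ z ∈ Icc a b, ‖f z‖ ≤ L) (hWD : ∀ z ∈ Icc a b, |W z| ≤ D)
    (hlen : b - a ≤ 2) :
    ‖∫ z in a..b, W z * f z‖ ≤ 2 * L * D := by
  have hL : 0 ≤ L := (norm_nonneg _).trans (hf a ⟨le_rfl, hab⟩)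
  have hD : 0 ≤ D := (abs_nonneg _).trans (hWD a ⟨le_rfl, hab⟩)
  have h := intervalIntegral.norm_integral_le_of_norm_le_const (f := fun z => (W z : ℂ) * f z)
    (a := a) (b := b) (C := D * L) (fun z hz => by
      rw [uIoc_of_le hab] at hz
      rw [norm_mul, Complex.norm_real, Real.norm_eq_abs]
      gcongr
      · exact hWD z ⟨hz.1.le, hz.2⟩
      · exact hf z ⟨hz.1.le, hz.2⟩)
  rw [abs_of_nonneg (by linarith)] at h
  refine h.trans ?_
  have : D * L * (b - a) ≤ D * L * 2 := by gcongr
  linarith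

theorem norm_mul_osc_zero (q : ℝ → ℂ) (z : ℝ) : ‖q z * osc θ 0 z‖ = ‖q z‖ := by
  rw [norm_mul, norm_osc]; simp

/-- Bounds of the solution by the supremum of the source, with no use of oscillation. -/
theorem greenSol_bounds (hκ : 0 < κ) {f : ℝ → ℂ} (hf : ∀ z ∈ Icc (-1 : ℝ) 1, ‖f z‖ ≤ N₀)
    (hy : y ∈ Icc (-1 : ℝ) 1) :
    ‖greenDer κ f y‖ ≤ 2 * N₀ ∧ κ * ‖greenSol κ f y‖ ≤ 2 * N₀ := by
  have h1 := norm_integral_weighted_le (W := sinhL κ) hy.1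
    (fun z hz => hf z ⟨hz.1, hz.2.trans hy.2⟩) (D := sinhL κ y) (fun z hz => by
      rw [abs_of_nonneg (sinhL_nonneg hκ.le hz.1)]; exact sinhL_mono hκ.le hz.2) (by linarith [hy.2])
  have h2 := norm_integral_weighted_le (W := sinhR κ) hy.2
    (fun z hz => hf z ⟨hy.1.trans hz.1, hz.2⟩) (D := sinhR κ y) (fun z hz => by
      rw [abs_of_nonneg (sinhR_nonneg hκ.le hz.2)]; exact sinhR_anti hκ.le hz.1) (by linarith [hy.1])
  have hN : 0 ≤ N₀ := (norm_nonneg _).trans (hf y hy)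
  exact ⟨norm_greenDer_le hκ h1 h2, norm_mul_greenSol_le hκ hy (by positivity) h1 h2⟩

/-- The leading part of the solution of `ψ'' - κ² ψ = q₀ e^{-iθy}`. -/
def leading (κ θ : ℝ) (q : ℝ → ℂ) (y : ℝ) : ℂ := -(q y * osc θ 0 y) / ((κ ^ 2 + θ ^ 2 : ℝ) : ℂ)

/-- The leading part solves the equation with the source `q₀ e^{-iθy}` up to the sources `q₂
e^{-iθy}` and `q₁ e^{-iθy}`, with coefficients of order `1` and `θ`, divided by `κ² + θ²`; it
vanishes at `y = ±1` because `q₀` does. -/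
theorem greenSol_sub_leading (hκ : 0 < κ) (h0 : ∀ y, HasDerivAt q₀ (q₁ y) y)
    (h1 : ∀ y, HasDerivAt q₁ (q₂ y) y) (h2 : Continuous q₂) (hw : q₀ 1 = 0) (hw' : q₀ (-1) = 0)
    (y : ℝ) :
    greenSol κ (fun z => q₀ z * osc θ 0 z) y = leading κ θ q₀ y +
        (greenSol κ (fun z => q₂ z * osc θ 0 z) y
          - 2 * θ * I * greenSol κ (fun z => q₁ z * osc θ 0 z) y) / ((κ ^ 2 + θ ^ 2 : ℝ) : ℂ) ∧
      greenDer κ (fun z => q₀ z * osc θ 0 z) y =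
        -((q₁ y - θ * I * q₀ y) * osc θ 0 y) / ((κ ^ 2 + θ ^ 2 : ℝ) : ℂ) +
        (greenDer κ (fun z => q₂ z * osc θ 0 z) y
          - 2 * θ * I * greenDer κ (fun z => q₁ z * osc θ 0 z) y) / ((κ ^ 2 + θ ^ 2 : ℝ) : ℂ) := by
  have ho := continuous_osc θ 0
  have hc0 : Continuous q₀ := continuous_iff_continuousAt.2 fun y => (h0 y).continuousAt
  have hc1 : Continuous q₁ := continuous_iff_continuousAt.2 fun y => (h1 y).continuousAt
  have hD : ((κ ^ 2 + θ ^ 2 : ℝ) : ℂ) ≠ 0 := by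
    have : 0 < κ ^ 2 + θ ^ 2 := by positivity
    exact_mod_cast this.ne'
  have dv : ∀ y, HasDerivAt (leading κ θ q₀)
      (-((q₁ y - θ * I * q₀ y) * osc θ 0 y) / ((κ ^ 2 + θ ^ 2 : ℝ) : ℂ)) y := fun y =>
    ((((h0 y).mul (hasDerivAt_osc_zero θ y)).neg).div_const _).congr_deriv (by congr 1; ring)
  have dv' : ∀ y, HasDerivAt
      (fun y => -((q₁ y - θ * I * q₀ y) * osc θ 0 y) / ((κ ^ 2 + θ ^ 2 : ℝ) : ℂ))
      (-((q₂ y - 2 * θ * I * q₁ y - θ ^ 2 * q₀ y) * osc θ 0 y) / ((κ ^ 2 + θ ^ 2 : ℝ) : ℂ)) y :=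
    fun y => (((((h1 y).sub ((h0 y).const_mul ((θ : ℂ) * I))).mul
      (hasDerivAt_osc_zero θ y)).neg).div_const _).congr_deriv (by
        congr 1
        simp only [Pi.sub_apply]
        linear_combination (-(θ : ℂ) ^ 2 * q₀ y * osc θ 0 y) * Complex.I_sq)
  have key : ∀ y, greenSol κ (fun z => q₀ z * osc θ 0 z) y = leading κ θ q₀ y +
        (greenSol κ (fun z => q₂ z * osc θ 0 z) y
          - 2 * θ * I * greenSol κ (fun z => q₁ z * osc θ 0 z) y) / ((κ ^ 2 + θ ^ 2 : ℝ) : ℂ) := by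
    intro y
    have e1 := eq_greenSol hκ dv dv' (by fun_prop) (by simp [leading, hw]) (by simp [leading, hw']) y
    have e2 : (fun z => -((q₂ z - 2 * θ * I * q₁ z - θ ^ 2 * q₀ z) * osc θ 0 z)
        / ((κ ^ 2 + θ ^ 2 : ℝ) : ℂ) - (κ : ℂ) ^ 2 * leading κ θ q₀ z) = fun z =>
        q₀ z * osc θ 0 z + (-1 / ((κ ^ 2 + θ ^ 2 : ℝ) : ℂ)) *
          (q₂ z * osc θ 0 z + (-(2 * θ * I)) * (q₁ z * osc θ 0 z)) := by
      funext z
      rw [leading]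
      field_simp
      push_cast
      ring
    rw [e2, greenSol_add_mul κ (by fun_prop) (by fun_prop), greenSol_add_mul κ (by fun_prop) (by fun_prop)] at e1
    rw [e1]
    ring
  refine ⟨key y, ?_⟩
  refine (hasDerivAt_greenSol hκ (by fun_prop) y).unique ?_
  have e3 : greenSol κ (fun z => q₀ z * osc θ 0 z) = _ := funext key
  rw [e3]
  exact (dv y).fun_add (((hasDerivAt_greenSol hκ (by fun_prop) y).fun_sub
    ((hasDerivAt_greenSol hκ (by fun_prop) y).const_mul _)).div_const _)

/-- Inviscid damping on the Fourier side: the solution of `ψ'' - κ² ψ = q₀ e^{-iθy}` for large `θ`. -/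
theorem greenSol_decay (hκ : 0 < κ) (hθ : 1 ≤ |θ|) (h0 : ∀ y, HasDerivAt q₀ (q₁ y) y)
    (h1 : ∀ y, HasDerivAt q₁ (q₂ y) y) (h2 : IsPrimitive q₂ q₃) (hw : q₀ 1 = 0) (hw' : q₀ (-1) = 0)
    (hN₁ : ∀ z ∈ Icc (-1 : ℝ) 1, ‖q₁ z‖ ≤ N) (hN₂ : ∀ z ∈ Icc (-1 : ℝ) 1, ‖q₂ z‖ ≤ N)
    (hN₃ : ∫ z in (-1 : ℝ)..1, ‖q₃ z‖ ≤ N) (hy : y ∈ Icc (-1 : ℝ) 1) :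
    ‖greenSol κ (fun z => q₀ z * osc θ 0 z) y - leading κ θ q₀ y‖ ≤ 38 * N / |θ| ^ 3 ∧
      ‖greenDer κ (fun z => q₀ z * osc θ 0 z) y
        + θ * I * greenSol κ (fun z => q₀ z * osc θ 0 z) y‖ ≤ 50 * N / |θ| ^ 2 := by
  have ho := continuous_osc θ 0
  have hθ0 : θ ≠ 0 := by rintro rfl; norm_num at hθ
  have hc1 : Continuous q₁ := continuous_iff_continuousAt.2 fun y => (h1 y).continuousAt
  have hc2 := h2.continuous
  have hN : 0 ≤ N := (norm_nonneg _).trans (hN₁ y hy)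
  obtain ⟨e1, e2⟩ := greenSol_sub_leading (θ := θ) hκ h0 h1 hc2 hw hw' y
  have hp1 : IsPrimitive q₁ q₂ := IsPrimitive.of_hasDerivAt h1 hc2
  have hi2 : ∫ z in (-1 : ℝ)..1, ‖q₂ z‖ ≤ 2 * N := by
    have h := intervalIntegral.norm_integral_le_of_norm_le_const (f := fun z => ‖q₂ z‖)
      (a := -1) (b := 1) (C := N) (fun z hz => by
        rw [uIoc_of_le (by norm_num)] at hz
        rw [norm_norm]
        exact hN₂ z ⟨hz.1.le, hz.2⟩)
    have h' := (le_abs_self _).trans h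
    norm_num at h'
    linarith
  have r1 := norm_greenSol_osc_le hκ hθ0 hp1 h2 hN₁ hN₂ hN₃ hy
  have r1' := norm_greenDer_osc_le hκ hθ0 hp1 hN₁ hi2 hy
  have r2' := fun y hy => norm_greenDer_osc_le (y := y) hκ hθ0 h2 hN₂ hN₃ hy
  have r2 := norm_greenSol_le hκ (by fun_prop) r2' hy
  have r2'' := r2' y hy
  have hθp : 0 < |θ| := by linarith
  have hDθ : |θ| ^ 2 ≤ ‖((κ ^ 2 + θ ^ 2 : ℝ) : ℂ)‖ := by
    rw [Complex.norm_real, Real.norm_of_nonneg (by positivity), sq_abs]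
    nlinarith
  have hnI : ‖2 * (θ : ℂ) * I‖ = 2 * |θ| := by simp
  have hnI' : ‖(θ : ℂ) * I‖ = |θ| := by simp
  have b1 : ‖(greenSol κ (fun z => q₂ z * osc θ 0 z) y
      - 2 * θ * I * greenSol κ (fun z => q₁ z * osc θ 0 z) y) / ((κ ^ 2 + θ ^ 2 : ℝ) : ℂ)‖
      ≤ 38 * N / |θ| ^ 3 := by
    rw [norm_div]
    calc _ ≤ (38 * N / |θ|) / |θ| ^ 2 := by
          gcongr
          refine (norm_sub_le _ _).trans ?_
          rw [norm_mul, hnI]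
          calc _ ≤ 2 * (|θ|⁻¹ * (2 * N + N)) + 2 * |θ| * ((|θ| ^ 2)⁻¹ * (4 * N + 8 * N + 4 * N)) := by
                gcongr
            _ = 38 * N / |θ| := by field_simp; ring
      _ = _ := by field_simp
  have b2 : ‖(greenDer κ (fun z => q₂ z * osc θ 0 z) y
      - 2 * θ * I * greenDer κ (fun z => q₁ z * osc θ 0 z) y) / ((κ ^ 2 + θ ^ 2 : ℝ) : ℂ)‖
      ≤ 11 * N / |θ| ^ 2 := by
    rw [norm_div]
    gcongr
    refine (norm_sub_le _ _).trans ?_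
    rw [norm_mul, hnI]
    calc _ ≤ (|θ|⁻¹ * (2 * N + N)) + 2 * |θ| * (|θ|⁻¹ * (2 * N + 2 * N)) := by gcongr
      _ ≤ (1⁻¹ * (2 * N + N)) + 2 * |θ| * (|θ|⁻¹ * (2 * N + 2 * N)) := by gcongr
      _ = 11 * N := by field_simp; ring
  refine ⟨by rw [e1, add_sub_cancel_left]; exact b1, ?_⟩
  have e3 : greenDer κ (fun z => q₀ z * osc θ 0 z) y
        + θ * I * greenSol κ (fun z => q₀ z * osc θ 0 z) y =
      -(q₁ y * osc θ 0 y) / ((κ ^ 2 + θ ^ 2 : ℝ) : ℂ) +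
      (greenDer κ (fun z => q₂ z * osc θ 0 z) y
      - 2 * θ * I * greenDer κ (fun z => q₁ z * osc θ 0 z) y) / ((κ ^ 2 + θ ^ 2 : ℝ) : ℂ) +
      θ * I * ((greenSol κ (fun z => q₂ z * osc θ 0 z) y
      - 2 * θ * I * greenSol κ (fun z => q₁ z * osc θ 0 z) y) / ((κ ^ 2 + θ ^ 2 : ℝ) : ℂ)) := by
    rw [e1, e2, leading]
    ring
  rw [e3]
  have b3 : ‖-(q₁ y * osc θ 0 y) / ((κ ^ 2 + θ ^ 2 : ℝ) : ℂ)‖ ≤ N / |θ| ^ 2 := by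
    rw [norm_div, norm_neg, norm_mul_osc_zero]
    gcongr
    exact hN₁ y hy
  have b4 : ‖(θ : ℂ) * I * ((greenSol κ (fun z => q₂ z * osc θ 0 z) y
      - 2 * θ * I * greenSol κ (fun z => q₁ z * osc θ 0 z) y) / ((κ ^ 2 + θ ^ 2 : ℝ) : ℂ))‖ ≤
      |θ| * (38 * N / |θ| ^ 3) := by
    rw [norm_mul, hnI']
    gcongr
  refine (norm_add_le _ _).trans ((add_le_add ((norm_add_le _ _).trans (add_le_add b3 b2)) b4).trans
    (le_of_eq ?_))
  field_simp; ring

end Oscillation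

/-! ### The stream function on the frequency side -/

namespace Profile

variable {f : StripL2} {E : ℝ} (P : Profile f E)

theorem continuous_g0 (ξ : ℝ) : Continuous fun y => P.g0 (ξ, y) :=
  continuous_iff_continuousAt.2 fun y => (P.deriv0 ξ y).continuousAt

theorem isPrimitive2 (ξ : ℝ) : IsPrimitive (fun y => P.g2 (ξ, y)) (fun y => P.g3 (ξ, y)) :=
  ⟨P.int3 ξ, fun a b => by
    rw [P.prim2 ξ a, P.prim2 ξ b, add_sub_add_left_eq_sub]
    exact intervalIntegral.integral_interval_sub_left (P.int3 ξ _ _) (P.int3 ξ _ _)⟩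

/-- The profile times the transport phase `e^{-ikty}`, `k = 2πξ`: the source of the stream function. -/
def source (t : ℝ) (p : ℝ × ℝ) : ℂ := P.g0 p * osc (2 * π * p.1 * t) 0 p.2

/-- The stream function on the Fourier side, without the viscous decay factor. The frequency zero
is immaterial. -/
def stream (t : ℝ) (p : ℝ × ℝ) : ℂ :=
  if p.1 = 0 then 0 else greenSol |2 * π * p.1| (fun z => P.source t (p.1, z)) p.2

/-- The derivative of `stream` in `y`. -/
def streamDeriv (t : ℝ) (p : ℝ × ℝ) : ℂ :=
  if p.1 = 0 then 0 else greenDer |2 * π * p.1| (fun z => P.source t (p.1, z)) p.2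

/-- The second derivative of `stream` in `y`. -/
def streamDeriv2 (t : ℝ) (p : ℝ × ℝ) : ℂ :=
  if p.1 = 0 then 0 else (2 * π * p.1 : ℂ) ^ 2 * P.stream t p + P.source t p

theorem measurable_source (t : ℝ) : Measurable (P.source t) := by
  have := P.meas0
  unfold source osc
  fun_prop

theorem continuous_source (t ξ : ℝ) : Continuous fun y => P.source t (ξ, y) :=
  (P.continuous_g0 ξ).mul (continuous_osc (2 * π * ξ * t) 0)

theorem measurable_weighted (t : ℝ) {w : ℝ → ℝ → ℝ} (hw : Measurable fun p : ℝ × ℝ => w p.1 p.2)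
    (hwc : ∀ κ, Continuous (w κ)) :
    (Measurable fun p : ℝ × ℝ => ∫ z in (-1 : ℝ)..p.2, (w |2 * π * p.1| z : ℂ) * P.source t (p.1, z)) ∧
    Measurable fun p : ℝ × ℝ => ∫ z in p.2..1, (w |2 * π * p.1| z : ℂ) * P.source t (p.1, z) := by
  have h0 : Measurable fun p : ℝ × ℝ => (w |2 * π * p.1| p.2 : ℂ) * P.source t p := by
    have h1 := hw.comp (show Measurable fun p : ℝ × ℝ => (|2 * π * p.1|, p.2) by fun_prop)
    exact (Complex.measurable_ofReal.comp h1).mul (P.measurable_source t)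
  have h1 := (stronglyMeasurable_yPrim h0.stronglyMeasurable).measurable
  refine ⟨h1, ?_⟩
  have h2 : (fun p : ℝ × ℝ => ∫ z in p.2..1, (w |2 * π * p.1| z : ℂ) * P.source t (p.1, z)) =
      fun p => yPrim (fun p : ℝ × ℝ => (w |2 * π * p.1| p.2 : ℂ) * P.source t p) (p.1, 1)
        - yPrim (fun p : ℝ × ℝ => (w |2 * π * p.1| p.2 : ℂ) * P.source t p) p := by
    funext p
    have hc : Continuous fun z => (w |2 * π * p.1| z : ℂ) * P.source t (p.1, z) := by
      have := hwc |2 * π * p.1|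
      have := P.continuous_source t p.1
      fun_prop
    exact (intervalIntegral.integral_interval_sub_left (hc.intervalIntegrable _ _)
      (hc.intervalIntegrable _ _)).symm
  rw [h2]
  exact (h1.comp (by fun_prop)).sub h1

theorem measurable_stream (t : ℝ) : Measurable (P.stream t) := by
  have h1 := (P.measurable_weighted t (w := sinhL) (by unfold sinhL; fun_prop) continuous_sinhL).1
  have h2 := (P.measurable_weighted t (w := sinhR) (by unfold sinhR; fun_prop) continuous_sinhR).2
  unfold stream greenSol
  refine Measurable.ite (measurableSet_eq_fun measurable_fst measurable_const) measurable_const ?_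
  have h3 : Measurable fun p : ℝ × ℝ => (sinhR |2 * π * p.1| p.2 : ℂ) := by
    unfold sinhR; fun_prop
  have h4 : Measurable fun p : ℝ × ℝ => (sinhL |2 * π * p.1| p.2 : ℂ) := by
    unfold sinhL; fun_prop
  have h5 : Measurable fun p : ℝ × ℝ =>
      (((|2 * π * p.1| * sinh (2 * |2 * π * p.1|) : ℝ)) : ℂ) := by fun_prop
  exact (((h3.mul h1).add (h4.mul h2)).neg).div h5

theorem measurable_streamDeriv (t : ℝ) : Measurable (P.streamDeriv t) := by
  have h1 := (P.measurable_weighted t (w := sinhL) (by unfold sinhL; fun_prop) continuous_sinhL).1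
  have h2 := (P.measurable_weighted t (w := sinhR) (by unfold sinhR; fun_prop) continuous_sinhR).2
  unfold streamDeriv greenDer
  refine Measurable.ite (measurableSet_eq_fun measurable_fst measurable_const) measurable_const ?_
  have h3 : Measurable fun p : ℝ × ℝ => (coshR |2 * π * p.1| p.2 : ℂ) := by
    unfold coshR; fun_prop
  have h4 : Measurable fun p : ℝ × ℝ => (coshL |2 * π * p.1| p.2 : ℂ) := by
    unfold coshL; fun_prop
  have h5 : Measurable fun p : ℝ × ℝ => ((sinh (2 * |2 * π * p.1|) : ℝ) : ℂ) := by fun_prop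
  exact ((h3.mul h1).sub (h4.mul h2)).div h5

theorem measurable_streamDeriv2 (t : ℝ) : Measurable (P.streamDeriv2 t) := by
  have h1 := P.measurable_stream t
  have h2 := P.measurable_source t
  unfold streamDeriv2
  exact Measurable.ite (measurableSet_eq_fun measurable_fst measurable_const) measurable_const
    (by fun_prop)

theorem abs_two_pi_pos {ξ : ℝ} (hξ : ξ ≠ 0) : 0 < |2 * π * ξ| :=
  abs_pos.2 (mul_ne_zero (by positivity) hξ)

theorem hasDerivAt_stream (t ξ y : ℝ) :
    HasDerivAt (fun y => P.stream t (ξ, y)) (P.streamDeriv t (ξ, y)) y := by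
  by_cases hξ : ξ = 0
  · simp only [stream, streamDeriv, hξ, if_true]
    exact hasDerivAt_const _ _
  · simp only [stream, streamDeriv, hξ, if_false]
    exact hasDerivAt_greenSol (abs_two_pi_pos hξ) (P.continuous_source t ξ) y

theorem hasDerivAt_streamDeriv (t ξ y : ℝ) :
    HasDerivAt (fun y => P.streamDeriv t (ξ, y)) (P.streamDeriv2 t (ξ, y)) y := by
  by_cases hξ : ξ = 0
  · simp only [streamDeriv, streamDeriv2, hξ, if_true]
    exact hasDerivAt_const _ _
  · simp only [streamDeriv, streamDeriv2, stream, hξ, if_false]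
    refine (hasDerivAt_greenDer (abs_two_pi_pos hξ) (P.continuous_source t ξ) y).congr_deriv ?_
    congr 2
    rw [← Complex.ofReal_pow, sq_abs]
    push_cast
    ring

theorem continuous_stream (t ξ : ℝ) : Continuous fun y => P.stream t (ξ, y) :=
  continuous_iff_continuousAt.2 fun y => (P.hasDerivAt_stream t ξ y).continuousAt

theorem continuous_streamDeriv (t ξ : ℝ) : Continuous fun y => P.streamDeriv t (ξ, y) :=
  continuous_iff_continuousAt.2 fun y => (P.hasDerivAt_streamDeriv t ξ y).continuousAt

theorem continuous_streamDeriv2 (t ξ : ℝ) : Continuous fun y => P.streamDeriv2 t (ξ, y) := by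
  by_cases hξ : ξ = 0
  · simp only [streamDeriv2, hξ, if_true]; exact continuous_const
  · simp only [streamDeriv2, hξ, if_false]
    have := P.continuous_stream t ξ
    have := P.continuous_source t ξ
    fun_prop

theorem stream_wall (t ξ : ℝ) : P.stream t (ξ, 1) = 0 ∧ P.stream t (ξ, -1) = 0 := by
  by_cases hξ : ξ = 0
  · simp [stream, hξ]
  · simp [stream, hξ, greenSol_one, greenSol_neg_one]

theorem norm_source_le (t ξ : ℝ) {y : ℝ} (hy : y ∈ Icc (-1 : ℝ) 1) : ‖P.source t (ξ, y)‖ ≤ P.N0 ξ := by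
  rw [source, norm_mul, norm_osc]
  simpa using P.norm0 ξ y hy

theorem norm_streamDeriv_le (t ξ : ℝ) {y : ℝ} (hy : y ∈ Icc (-1 : ℝ) 1) :
    ‖P.streamDeriv t (ξ, y)‖ ≤ 2 * P.N0 ξ := by
  have h0 := P.N0_nonneg ξ
  by_cases hξ : ξ = 0
  · simp only [streamDeriv, hξ, if_true, norm_zero]
    rw [hξ] at h0; positivity
  · simp only [streamDeriv, hξ, if_false]
    exact (greenSol_bounds (abs_two_pi_pos hξ) (fun z hz => P.norm_source_le t ξ hz) hy).1

theorem abs_mul_norm_stream_le (t ξ : ℝ) {y : ℝ} (hy : y ∈ Icc (-1 : ℝ) 1) :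
    |2 * π * ξ| * ‖P.stream t (ξ, y)‖ ≤ 2 * P.N0 ξ := by
  have h0 := P.N0_nonneg ξ
  by_cases hξ : ξ = 0
  · simp only [stream, hξ, if_true, norm_zero, mul_zero]
    rw [hξ] at h0; positivity
  · simp only [stream, hξ, if_false]
    exact (greenSol_bounds (abs_two_pi_pos hξ) (fun z hz => P.norm_source_le t ξ hz) hy).2

theorem norm_stream_le (t ξ : ℝ) {y : ℝ} (hy : y ∈ Icc (-1 : ℝ) 1) :
    ‖P.stream t (ξ, y)‖ ≤ 4 * P.N0 ξ := by
  have h0 := P.N0_nonneg ξ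
  by_cases hξ : ξ = 0
  · simp only [stream, hξ, if_true, norm_zero]
    rw [hξ] at h0; positivity
  · simp only [stream, hξ, if_false]
    have h := norm_greenSol_le (abs_two_pi_pos hξ) (P.continuous_source t ξ)
      (fun z hz => (greenSol_bounds (abs_two_pi_pos hξ) (fun z hz => P.norm_source_le t ξ hz) hz).1) hy
    linarith

/-- The leading part `-e^{-ikty} g0 / (k² (1 + t²))` of the stream function at large times. -/
def streamLeading (t : ℝ) (p : ℝ × ℝ) : ℂ :=
  leading |2 * π * p.1| (2 * π * p.1 * t) (fun z => P.g0 (p.1, z)) p.2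

/-- Inviscid damping at a single frequency, `greenSol_decay` with `κ = |k|` and `θ = k t`. -/
theorem stream_decay {t ξ : ℝ} (h : 1 ≤ |2 * π * ξ * t|) {y : ℝ} (hy : y ∈ Icc (-1 : ℝ) 1) :
    ‖P.stream t (ξ, y) - P.streamLeading t (ξ, y)‖ ≤ 38 * P.N2 ξ / |2 * π * ξ * t| ^ 3 ∧
      ‖P.streamDeriv t (ξ, y) + (2 * π * ξ * t : ℝ) * I * P.stream t (ξ, y)‖ ≤
        50 * P.N2 ξ / |2 * π * ξ * t| ^ 2 := by
  have hξ : ξ ≠ 0 := by rintro rfl; norm_num at h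
  have e1 : P.stream t (ξ, y) = greenSol |2 * π * ξ|
      (fun z => P.g0 (ξ, z) * osc (2 * π * ξ * t) 0 z) y := if_neg hξ
  have e2 : P.streamDeriv t (ξ, y) = greenDer |2 * π * ξ|
      (fun z => P.g0 (ξ, z) * osc (2 * π * ξ * t) 0 z) y := if_neg hξ
  rw [e1, e2]
  exact greenSol_decay (q₀ := fun z => P.g0 (ξ, z)) (q₁ := fun z => P.g1 (ξ, z))
    (q₂ := fun z => P.g2 (ξ, z)) (q₃ := fun z => P.g3 (ξ, z))
    (abs_two_pi_pos hξ) h (P.deriv0 ξ) (P.deriv1 ξ) (P.isPrimitive2 ξ)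
    (P.wall_one ξ) (P.wall_neg_one ξ) (fun z hz => (P.norm1 ξ z hz).trans (P.N1_le_N2 ξ))
    (P.norm2 ξ) (P.norm3 ξ) hy

end Profile

/-! ### The weight -/

section Weight

variable {χ : ℝ → ℝ}

namespace IsCutoff

theorem min_le_symbolM (hχ : IsCutoff χ) (k : ℝ) : min 1 (|k| ^ (2 / 3 : ℝ)) ≤ symbolM χ k := by
  have h := hχ.mem_Icc k
  unfold symbolM
  rcases min_cases 1 (|k| ^ (2 / 3 : ℝ)) with ⟨e, h'⟩ | ⟨e, h'⟩ <;> rw [e] <;> nlinarith [h.1, h.2]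

theorem symbolM_le (hχ : IsCutoff χ) (k : ℝ) : symbolM χ k ≤ 2 * min 1 (|k| ^ (2 / 3 : ℝ)) := by
  have h := hχ.mem_Icc k
  have h0 : 0 ≤ |k| ^ (2 / 3 : ℝ) := by positivity
  have key : symbolM χ k ≤ 1 := by
    unfold symbolM
    rcases le_total 1 |k| with hk | hk
    · rw [hχ.eq_zero k hk]; simp
    · have : |k| ^ (2 / 3 : ℝ) ≤ 1 := Real.rpow_le_one (abs_nonneg k) hk (by norm_num)
      nlinarith [h.1]
  rw [mul_min_of_nonneg _ _ two_pos.le]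
  refine le_min (by linarith) ?_
  rcases le_total |k| (1 / 2) with hk | hk
  · unfold symbolM
    rw [hχ.eq_one k hk]; linarith
  · refine key.trans ?_
    have h1 : (1 / 2 : ℝ) ≤ |k| ^ (2 / 3 : ℝ) := by
      rcases le_total 1 |k| with h2 | h2
      · have := Real.one_le_rpow h2 (show (0 : ℝ) ≤ 2 / 3 by norm_num)
        linarith
      · calc (1 / 2 : ℝ) ≤ |k| ^ (1 : ℝ) := by rwa [Real.rpow_one]
          _ ≤ |k| ^ (2 / 3 : ℝ) :=
            Real.rpow_le_rpow_of_exponent_ge (by linarith) h2 (by norm_num)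
    linarith

theorem symbolM_nonneg (hχ : IsCutoff χ) (k : ℝ) : 0 ≤ symbolM χ k :=
  le_trans (by positivity) (hχ.min_le_symbolM k)

/-- Quasi-subadditivity of `M`. Only the bounds `min 1 |k|^{2/3} ≤ M(k) ≤ 2 min 1 |k|^{2/3}` enter. -/
theorem symbolM_add_le (hχ : IsCutoff χ) (k l : ℝ) :
    symbolM χ (k + l) ≤ 2 * (symbolM χ k + symbolM χ l) := by
  refine (hχ.symbolM_le _).trans ?_
  have h1 := hχ.min_le_symbolM k
  have h2 := hχ.min_le_symbolM l
  have h3 : min 1 (|k + l| ^ (2 / 3 : ℝ)) ≤ min 1 (|k| ^ (2 / 3 : ℝ)) + min 1 (|l| ^ (2 / 3 : ℝ)) := by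
    have h4 : |k + l| ^ (2 / 3 : ℝ) ≤ |k| ^ (2 / 3 : ℝ) + |l| ^ (2 / 3 : ℝ) :=
      (Real.rpow_le_rpow (abs_nonneg _) (abs_add_le k l) (by norm_num)).trans
        (Real.rpow_add_le_add_rpow (abs_nonneg k) (abs_nonneg l) (by norm_num) (by norm_num))
    have h5 : 0 ≤ |k| ^ (2 / 3 : ℝ) := by positivity
    have h6 : 0 ≤ |l| ^ (2 / 3 : ℝ) := by positivity
    rcases min_cases 1 (|k| ^ (2 / 3 : ℝ)) with ⟨e, _⟩ | ⟨e, _⟩ <;>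
    rcases min_cases 1 (|l| ^ (2 / 3 : ℝ)) with ⟨e', _⟩ | ⟨e', _⟩ <;> rw [e, e']
    · exact (min_le_left _ _).trans (by linarith)
    · exact (min_le_left _ _).trans (by linarith)
    · exact (min_le_left _ _).trans (by linarith)
    · exact (min_le_right _ _).trans h4
  linarith

end IsCutoff

variable {s ν t : ℝ}

theorem measurable_weight (hχ : IsCutoff χ) (s ν t : ℝ) : Measurable (weight χ s ν t) := by
  have := hχ.smooth.continuous.measurable
  unfold weight symbolM
  fun_prop

theorem one_le_weight (hχ : IsCutoff χ) (hs : 0 ≤ s) (hν : 0 ≤ ν) (ht : 0 ≤ t) (k : ℝ) :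
    1 ≤ weight χ s ν t k := by
  have := hχ.symbolM_nonneg k
  refine Real.one_le_rpow ?_ hs
  have : 0 ≤ ν ^ (1 / 3 : ℝ) * t * symbolM χ k := by positivity
  linarith

/-- The weight is submultiplicative up to a constant; this controls products of fields. -/
theorem weight_add_le (hχ : IsCutoff χ) (hs : 0 ≤ s) (hν : 0 ≤ ν) (ht : 0 ≤ t) (k l : ℝ) :
    weight χ s ν t (k + l) ≤ 2 ^ s * (weight χ s ν t k * weight χ s ν t l) := by
  have hk := hχ.symbolM_nonneg k
  have hl := hχ.symbolM_nonneg l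
  have hkl := hχ.symbolM_nonneg (k + l)
  have ha : 0 ≤ ν ^ (1 / 3 : ℝ) * t := by positivity
  unfold weight
  rw [← Real.mul_rpow (by positivity) (by positivity), ← Real.mul_rpow (by positivity) (by positivity)]
  refine Real.rpow_le_rpow (by positivity) ?_ hs
  have h := mul_le_mul_of_nonneg_left (hχ.symbolM_add_le k l) ha
  have h1 : 0 ≤ (ν ^ (1 / 3 : ℝ) * t * symbolM χ k) * (ν ^ (1 / 3 : ℝ) * t * symbolM χ l) := by positivity
  nlinarith

/-- The weight is a power of `1 + O((ν t³ k²)^{1/3})`. -/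
theorem weight_base_le (hχ : IsCutoff χ) (hν : 0 ≤ ν) (ht : 0 ≤ t) (k : ℝ) :
    ν ^ (1 / 3 : ℝ) * t * symbolM χ k ≤ 2 * (ν * t ^ 3 * k ^ 2) ^ (1 / 3 : ℝ) := by
  have h1 : (ν * t ^ 3 * k ^ 2) ^ (1 / 3 : ℝ) = ν ^ (1 / 3 : ℝ) * t * |k| ^ (2 / 3 : ℝ) := by
    rw [Real.mul_rpow (by positivity) (by positivity), Real.mul_rpow hν (by positivity),
      ← Real.rpow_natCast t 3, ← Real.rpow_mul ht, ← sq_abs k, ← Real.rpow_natCast |k| 2,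
      ← Real.rpow_mul (abs_nonneg k)]
    norm_num
  rw [h1]
  have ha : 0 ≤ ν ^ (1 / 3 : ℝ) * t := by positivity
  have h2 := (hχ.symbolM_le k).trans (mul_le_mul_of_nonneg_left (min_le_right _ _) two_pos.le)
  nlinarith

/-- The weight is bounded by a slowly growing Gaussian in `k`: the rate `1/12` leaves the rate `1/4` out of the
decay rate `1/3` of the propagator. -/
theorem weight_le_exp (hχ : IsCutoff χ) (hs : 0 ≤ s) (hν : 0 ≤ ν) (ht : 0 ≤ t) (k : ℝ) :
    weight χ s ν t k ≤ (36 * (s + 1)) ^ s * exp (ν * t ^ 3 * k ^ 2 / 12) := by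
  set x := ν * t ^ 3 * k ^ 2 with hx
  have hx0 : 0 ≤ x := by positivity
  have h1 : 1 + ν ^ (1 / 3 : ℝ) * t * symbolM χ k ≤ 3 * (1 + x) := by
    have h := weight_base_le hχ hν ht k
    rw [← hx] at h
    have h2 : x ^ (1 / 3 : ℝ) ≤ 1 + x := by
      rcases le_total x 1 with h3 | h3
      · linarith [Real.rpow_le_one hx0 h3 (show (0 : ℝ) ≤ 1 / 3 by norm_num)]
      · have := Real.rpow_le_rpow_of_exponent_le h3 (show (1 / 3 : ℝ) ≤ 1 by norm_num)
        rw [Real.rpow_one] at this; linarith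
    linarith
  have h2 : 3 * (1 + x) ≤ 36 * (s + 1) * exp (x / (12 * (s + 1))) := by
    have h := Real.add_one_le_exp (x / (12 * (s + 1)))
    have h3 : 36 * (s + 1) * (x / (12 * (s + 1)) + 1) = 3 * x + 36 * (s + 1) := by field_simp; ring
    nlinarith
  have hk := hχ.symbolM_nonneg k
  calc weight χ s ν t k ≤ (36 * (s + 1) * exp (x / (12 * (s + 1)))) ^ s :=
        Real.rpow_le_rpow (by positivity) (h1.trans h2) hs
    _ = (36 * (s + 1)) ^ s * exp (x / (12 * (s + 1)) * s) := by
        rw [Real.mul_rpow (by positivity) (Real.exp_pos _).le, ← Real.exp_mul]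
    _ ≤ _ := by
        gcongr
        rw [div_mul_eq_mul_div, div_le_div_iff₀ (by positivity) (by norm_num)]
        nlinarith

/-- Below the dissipative frequency `(ν t³)^{-1/2}` the weighted Gaussian is a small perturbation
of `1`. -/
theorem abs_weight_mul_exp_sub_one_le (hχ : IsCutoff χ) (hs : 0 ≤ s) (hν : 0 ≤ ν) (ht : 0 ≤ t) (k : ℝ)
    (hx1 : ν * t ^ 3 * k ^ 2 ≤ 1) :
    |weight χ s ν t k * exp (-(ν * t ^ 3 * k ^ 2 / 3)) - 1| ≤
      (2 * s * exp (2 * s) + 1) * (ν * t ^ 3 * k ^ 2) ^ (1 / 3 : ℝ) := by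
  have h := weight_base_le hχ hν ht k
  have hk := hχ.symbolM_nonneg k
  have hw1 := one_le_weight hχ hs hν ht k
  set x := ν * t ^ 3 * k ^ 2 with hx
  have hx0 : 0 ≤ x := by positivity
  set r := x ^ (1 / 3 : ℝ)
  have hr0 : 0 ≤ r := by positivity
  have hr1 : r ≤ 1 := Real.rpow_le_one hx0 hx1 (by norm_num)
  have hxr : x ≤ r := by
    have := Real.rpow_le_rpow_of_exponent_ge' hx0 hx1 (show (0 : ℝ) ≤ 1 / 3 by norm_num) (show (1 / 3 : ℝ) ≤ 1 by norm_num)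
    rwa [Real.rpow_one] at this
  have h1 : weight χ s ν t k ≤ exp (2 * s * r) := by
    have h2 : 1 + ν ^ (1 / 3 : ℝ) * t * symbolM χ k ≤ exp (2 * r) := by
      linarith [Real.add_one_le_exp (2 * r)]
    calc weight χ s ν t k ≤ (exp (2 * r)) ^ s := Real.rpow_le_rpow (by positivity) h2 hs
      _ = _ := by rw [← Real.exp_mul]; ring_nf
  have h2 : exp (2 * s * r) - 1 ≤ 2 * s * exp (2 * s) * r := by
    have h3 := Real.add_one_le_exp (-(2 * s * r))
    have h4 : exp (2 * s * r) * exp (-(2 * s * r)) = 1 := by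
      rw [← Real.exp_add]; simp
    have h5 : exp (2 * s * r) ≤ exp (2 * s) := Real.exp_le_exp.2 (by nlinarith)
    have h6 : 0 ≤ 2 * s * r := by positivity
    nlinarith [Real.exp_pos (2 * s * r)]
  have h3 := Real.add_one_le_exp (-(x / 3))
  have h4 : exp (-(x / 3)) ≤ 1 := Real.exp_le_one_iff.2 (by linarith)
  have h5 := Real.exp_pos (-(x / 3))
  rw [abs_le]
  constructor
  · have : 0 ≤ 2 * s * exp (2 * s) * r := by positivity
    nlinarith
  · nlinarith

/-- The weight costs only a fraction of the Gaussian decay of the propagator. -/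
theorem weight_mul_norm_propagator_le (hχ : IsCutoff χ) (hs : 0 ≤ s) (hν : 0 ≤ ν) (ht : 0 ≤ t)
    (p : ℝ × ℝ) :
    weight χ s ν t (2 * π * p.1) * ‖propagator ν t p‖ ≤
      (36 * (s + 1)) ^ s * exp (-(ν * t)) * exp (-(ν * t ^ 3 * p.1 ^ 2)) := by
  have h := weight_le_exp hχ hs hν ht (2 * π * p.1)
  rw [norm_propagator]
  refine (mul_le_mul_of_nonneg_right h (Real.exp_pos _).le).trans ?_
  rw [mul_assoc ((36 * (s + 1)) ^ s), mul_assoc ((36 * (s + 1)) ^ s), ← Real.exp_add,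
    ← Real.exp_add]
  refine mul_le_mul_of_nonneg_left (Real.exp_le_exp.2 ?_) (by positivity)
  have h1 : 0 ≤ ν * t ^ 3 * p.1 ^ 2 := by positivity
  have h2 : (2 * π * p.1) ^ 2 = 4 * π ^ 2 * p.1 ^ 2 := by ring
  rw [h2]
  have h3 : 9 ≤ π ^ 2 := by nlinarith [Real.pi_gt_three]
  nlinarith

end Weight

/-! ### Integrals over the frequency -/

/-- The integral of a (nonnegative) function of the frequency, with values in `[0, ∞]`. -/
def freqInt (h : ℝ → ℝ) : ℝ≥0∞ := ∫⁻ ξ, ofReal (h ξ)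

theorem freqInt_mono {g h : ℝ → ℝ} (hgh : ∀ ξ, g ξ ≤ h ξ) : freqInt g ≤ freqInt h :=
  lintegral_mono fun ξ => ENNReal.ofReal_le_ofReal (hgh ξ)

theorem freqInt_const_mul {c : ℝ} (hc : 0 ≤ c) (h : ℝ → ℝ) :
    freqInt (fun ξ => c * h ξ) = ofReal c * freqInt h := by
  simp only [freqInt, ENNReal.ofReal_mul hc]
  exact lintegral_const_mul' _ _ ENNReal.ofReal_ne_top

theorem freqInt_add_le {g h : ℝ → ℝ} (hg : Measurable g) :
    freqInt (fun ξ => g ξ + h ξ) ≤ freqInt g + freqInt h := by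
  unfold freqInt
  rw [← lintegral_add_left (by fun_prop)]
  exact lintegral_mono fun ξ => ENNReal.ofReal_add_le

theorem freqInt_mul_le {g h : ℝ → ℝ} (hg : Measurable g) (hh : Measurable h) :
    freqInt (fun ξ => g ξ * h ξ) ≤ eLpNorm g 2 volume * eLpNorm h 2 volume := by
  have h1 := ENNReal.lintegral_mul_le_Lp_mul_Lq volume Real.HolderConjugate.two_two
    (f := fun ξ => ‖g ξ‖ₑ) (g := fun ξ => ‖h ξ‖ₑ) hg.enorm.aemeasurable hh.enorm.aemeasurable
  have h2 : ∀ g : ℝ → ℝ, (∫⁻ ξ, ‖g ξ‖ₑ ^ (2 : ℝ)) ^ (1 / 2 : ℝ) = eLpNorm g 2 volume := by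
    intro g
    rw [eLpNorm_eq_lintegral_rpow_enorm_toReal (by norm_num) (by norm_num)]
    norm_num
  rw [h2, h2] at h1
  refine le_trans (lintegral_mono fun ξ => ?_) h1
  simp only [Pi.mul_apply]
  rw [← enorm_mul, ← ofReal_norm]
  exact ENNReal.ofReal_le_ofReal (le_abs_self _)

/-- Weighted `L²` bounds of an envelope imply `L¹` bounds, by the Cauchy-Schwarz inequality. -/
theorem freqInt_le_of_memLp {r : ℝ} (hr : 1 / 2 < r) :
    ∃ C : ℝ, 0 < C ∧ ∀ (N : ℝ → ℝ) (E : ℝ), Measurable N →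
      eLpNorm (fun ξ => (1 + |ξ|) ^ r * N ξ) 2 volume ≤ ofReal E →
      freqInt N ≤ ofReal (C * E) := by
  have h1 : MemLp (fun ξ : ℝ => (1 + |ξ|) ^ (-r)) 2 volume := by
    rw [memLp_two_iff_integrable_sq (by fun_prop : Measurable fun ξ : ℝ => (1 + |ξ|) ^ (-r)).aestronglyMeasurable]
    have h := integrable_one_add_norm (E := ℝ) (μ := volume) (r := 2 * r) (by simp; linarith)
    refine h.congr (Eventually.of_forall fun ξ => ?_)
    simp only [Real.norm_eq_abs]
    rw [← Real.rpow_natCast, ← Real.rpow_mul (by positivity)]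
    congr 1; push_cast; ring
  refine ⟨(eLpNorm (fun ξ : ℝ => (1 + |ξ|) ^ (-r)) 2 volume).toReal + 1, by positivity, fun N E hN h => ?_⟩
  have h2 := freqInt_mul_le (g := fun ξ : ℝ => (1 + |ξ|) ^ (-r)) (h := fun ξ => (1 + |ξ|) ^ r * N ξ)
    (by fun_prop) (by fun_prop)
  have h3 : (fun ξ : ℝ => (1 + |ξ|) ^ (-r) * ((1 + |ξ|) ^ r * N ξ)) = N := by
    funext ξ
    have : (0 : ℝ) < 1 + |ξ| := by positivity
    rw [← mul_assoc, ← Real.rpow_add this]; simp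
  rw [h3] at h2
  refine h2.trans ?_
  rw [ENNReal.ofReal_mul (by positivity)]
  gcongr
  refine (ENNReal.ofReal_toReal h1.2.ne).symm.trans_le (ENNReal.ofReal_le_ofReal (by linarith))

theorem freqInt_comp_abs {g : ℝ → ℝ} (hg : Measurable g) :
    freqInt (fun ξ => g |ξ|) = 2 * ∫⁻ ξ in Ioi (0 : ℝ), ofReal (g ξ) := by
  have h1 : ∫⁻ ξ in Ioi (0 : ℝ), ofReal (g |ξ|) = ∫⁻ ξ in Ioi (0 : ℝ), ofReal (g ξ) :=
    setLIntegral_congr_fun measurableSet_Ioi fun ξ hξ => by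
      rw [mem_Ioi] at hξ; simp only [abs_of_pos hξ]
  have h2 : ∫⁻ ξ in Iio (0 : ℝ), ofReal (g |ξ|) = ∫⁻ ξ in Ioi (0 : ℝ), ofReal (g |ξ|) := by
    have := (Measure.measurePreserving_neg (volume : Measure ℝ)).setLIntegral_comp_preimage
      (s := Ioi (0 : ℝ)) measurableSet_Ioi (f := fun ξ => ofReal (g |ξ|)) (by fun_prop)
    rw [← this]
    simp [abs_neg]
  rw [freqInt, ← lintegral_add_compl _ (measurableSet_Ioi (a := (0 : ℝ))), compl_Ioi,
    setLIntegral_congr Iio_ae_eq_Iic.symm, h2, h1, two_mul]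

/-- Gaussian moments, by scaling. -/
theorem freqInt_rpow_mul_gaussian {q : ℝ} (hq : -1 < q) : ∃ K : ℝ, 0 < K ∧ ∀ τ : ℝ, 0 < τ →
    freqInt (fun ξ => |ξ| ^ q * exp (-(τ * ξ ^ 2))) ≤ ofReal (K * τ ^ (-((q + 1) / 2))) := by
  have h1 := integrableOn_rpow_mul_exp_neg_mul_sq one_pos hq
  set K := ∫ x in Ioi (0 : ℝ), x ^ q * exp (-1 * x ^ 2) with hK
  have hK0 : 0 ≤ K := setIntegral_nonneg measurableSet_Ioi fun x hx => by
    rw [mem_Ioi] at hx; positivity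
  refine ⟨2 * K + 1, by positivity, fun τ hτ => ?_⟩
  have hr : ∀ r : ℝ, Measurable fun x : ℝ => x ^ r := fun r => by fun_prop
  have h2 := freqInt_comp_abs (g := fun x => x ^ q * exp (-(τ * x ^ 2))) (by fun_prop)
  simp only [sq_abs] at h2
  set c := sqrt τ with hc
  have hcp : 0 < c := Real.sqrt_pos.2 hτ
  have hcs : c ^ 2 = τ := Real.sq_sqrt hτ.le
  have h3 : ∀ x ∈ Ioi (0 : ℝ), x ^ q * exp (-(τ * x ^ 2)) =
      c ^ (-q) * ((c * x) ^ q * exp (-1 * (c * x) ^ 2)) := fun x hx => by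
    rw [mem_Ioi] at hx
    have h4 : c ^ (-q) * c ^ q = 1 := by rw [← Real.rpow_add hcp]; simp
    rw [Real.mul_rpow hcp.le hx.le, mul_pow, hcs, neg_one_mul]
    calc _ = (c ^ (-q) * c ^ q) * (x ^ q * exp (-(τ * x ^ 2))) := by rw [h4, one_mul]
      _ = _ := by ring
  have h4 : IntegrableOn (fun x => c ^ (-q) * ((c * x) ^ q * exp (-1 * (c * x) ^ 2))) (Ioi 0) := by
    refine Integrable.const_mul ?_ _
    have := (integrableOn_Ioi_comp_mul_left_iff (fun x : ℝ => x ^ q * exp (-1 * x ^ 2)) 0 hcp).2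
    rw [mul_zero] at this
    exact this h1
  rw [h2, setLIntegral_congr_fun measurableSet_Ioi fun x hx => congrArg ofReal (h3 x hx),
    ← ofReal_integral_eq_lintegral_ofReal h4 ((ae_restrict_iff' measurableSet_Ioi).2
      (Eventually.of_forall fun x hx => by rw [mem_Ioi] at hx; positivity)),
    integral_const_mul,
    integral_comp_mul_left_Ioi (fun x : ℝ => x ^ q * exp (-1 * x ^ 2)) 0 hcp, mul_zero, ← hK,
    ← ENNReal.ofReal_ofNat, ← ENNReal.ofReal_mul two_pos.le]
  refine ENNReal.ofReal_le_ofReal ?_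
  have h5 : τ ^ (-((q + 1) / 2)) = c ^ (-q) * c⁻¹ := by
    rw [hc, Real.sqrt_eq_rpow, ← Real.rpow_mul hτ.le, ← Real.rpow_neg hτ.le, ← Real.rpow_add hτ]
    congr 1; ring
  rw [h5, smul_eq_mul]
  have : 0 < c ^ (-q) * c⁻¹ := by positivity
  nlinarith

theorem freqInt_gaussian (p : ℕ) {b : ℝ} (hb : 0 < b) : ∃ K : ℝ, 0 < K ∧ ∀ τ : ℝ, 0 < τ →
    freqInt (fun ξ => |ξ| ^ p * exp (-(b * (τ * ξ ^ 2)))) ≤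
      ofReal (K * τ ^ (-((p + 1) / 2 : ℝ))) := by
  obtain ⟨K, hK, h⟩ := freqInt_rpow_mul_gaussian (q := p) (by linarith [p.cast_nonneg (α := ℝ)])
  refine ⟨K * b ^ (-((p + 1) / 2 : ℝ)), by positivity, fun τ hτ => ?_⟩
  have h1 := h (b * τ) (by positivity)
  simp only [Real.rpow_natCast, mul_assoc] at h1
  rwa [Real.mul_rpow hb.le hτ.le, ← mul_assoc] at h1

theorem freqInt_inv_abs_le {a : ℝ} (ha : 0 < a) (ha1 : a ≤ 1) :
    freqInt (fun ξ => if a ≤ |ξ| ∧ |ξ| ≤ 1 then |ξ|⁻¹ else 0) ≤ ofReal (2 * log (1 / a)) := by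
  have hm : Measurable fun ξ : ℝ => if a ≤ ξ ∧ ξ ≤ 1 then ξ⁻¹ else 0 :=
    Measurable.ite measurableSet_Icc measurable_inv measurable_const
  have h := freqInt_comp_abs hm
  rw [h, ENNReal.ofReal_mul two_pos.le, ENNReal.ofReal_ofNat]
  gcongr
  have h1 : ∀ ξ : ℝ, ofReal (if a ≤ ξ ∧ ξ ≤ 1 then ξ⁻¹ else 0) =
      (Icc a 1).indicator (fun ξ => ofReal ξ⁻¹) ξ := fun ξ => by
    by_cases hξ : ξ ∈ Icc a 1
    · rw [indicator_of_mem hξ, if_pos (mem_Icc.1 hξ)]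
    · rw [indicator_of_notMem hξ, if_neg (fun h => hξ (mem_Icc.2 h)), ENNReal.ofReal_zero]
  simp only [h1]
  refine (setLIntegral_le_lintegral _ _).trans ?_
  rw [lintegral_indicator measurableSet_Icc]
  have hi : IntegrableOn (fun ξ : ℝ => ξ⁻¹) (Icc a 1) :=
    (continuousOn_inv₀.mono fun x hx => (ha.trans_le hx.1).ne').integrableOn_Icc
  rw [← ofReal_integral_eq_lintegral_ofReal hi ((ae_restrict_iff' measurableSet_Icc).2
    (Eventually.of_forall fun x hx => inv_nonneg.2 (ha.le.trans hx.1))),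
    integral_Icc_eq_integral_Ioc, ← intervalIntegral.integral_of_le ha1, integral_inv_of_pos ha one_pos]

theorem freqInt_inv_one_add_sq {c : ℝ} (hc : 0 < c) :
    freqInt (fun ξ => (1 + (c * ξ) ^ 2)⁻¹) ≤ ofReal (π / c) := by
  have h : Integrable fun ξ : ℝ => (1 + (c * ξ) ^ 2)⁻¹ := integrable_inv_one_add_sq.comp_mul_left' hc.ne'
  rw [freqInt, ← ofReal_integral_eq_lintegral_ofReal h (Eventually.of_forall fun ξ => by positivity),
    Measure.integral_comp_mul_left (fun x : ℝ => (1 + x ^ 2)⁻¹) c, integral_univ_inv_one_add_sq,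
    abs_of_pos (inv_pos.2 hc), smul_eq_mul, inv_mul_eq_div]

/-- A bound for all `τ` from a bound for small and a bound for large `τ`. -/
theorem le_of_le_of_le_rpow {X : ℝ≥0∞} {A τ q : ℝ} (hA : 0 ≤ A) (hq : 0 ≤ q) (hτ : 0 ≤ τ)
    (h1 : X ≤ ofReal A) (h2 : 0 < τ → X ≤ ofReal (A * τ ^ (-q))) :
    X ≤ ofReal (2 ^ q * (A * (1 + τ) ^ (-q))) := by
  rcases le_total τ 1 with h | h
  · refine h1.trans (ENNReal.ofReal_le_ofReal ?_)
    have : (2 : ℝ) ^ (-q) ≤ (1 + τ) ^ (-q) :=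
      Real.rpow_le_rpow_of_nonpos (by linarith) (by linarith) (by linarith)
    have h3 : (2 : ℝ) ^ q * 2 ^ (-q) = 1 := by rw [← Real.rpow_add two_pos]; simp
    calc A = A * (2 ^ q * 2 ^ (-q)) := by rw [h3, mul_one]
      _ ≤ A * (2 ^ q * (1 + τ) ^ (-q)) := by gcongr
      _ = _ := by ring
  · refine (h2 (by linarith)).trans (ENNReal.ofReal_le_ofReal ?_)
    have h3 : τ ^ (-q) ≤ 2 ^ q * (1 + τ) ^ (-q) := by
      have : (2 * τ) ^ (-q) ≤ (1 + τ) ^ (-q) :=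
        Real.rpow_le_rpow_of_nonpos (by linarith) (by linarith) (by linarith)
      have h3 : (2 : ℝ) ^ q * 2 ^ (-q) = 1 := by rw [← Real.rpow_add two_pos]; simp
      calc τ ^ (-q) = 2 ^ q * 2 ^ (-q) * τ ^ (-q) := by rw [h3, one_mul]
        _ = 2 ^ q * (2 * τ) ^ (-q) := by rw [Real.mul_rpow two_pos.le (by linarith)]; ring
        _ ≤ _ := by gcongr
    calc _ ≤ A * (2 ^ q * (1 + τ) ^ (-q)) := by gcongr
      _ = _ := by ring

/-- `L¹` bounds of Gaussian times envelope. -/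
theorem freqInt_gaussian_mul (p : ℕ) : ∃ K : ℝ, 0 < K ∧ ∀ (N : ℝ → ℝ) (E A τ : ℝ), 0 ≤ E → 0 ≤ A →
    0 ≤ τ → (∀ ξ, 0 ≤ N ξ) → (∀ ξ, N ξ ≤ E) → freqInt (fun ξ => |ξ| ^ p * N ξ) ≤ ofReal (A * E) →
    freqInt (fun ξ => |ξ| ^ p * exp (-(τ * ξ ^ 2)) * N ξ) ≤
      ofReal (K * (1 + A) * (1 + τ) ^ (-((p + 1) / 2 : ℝ)) * E) := by
  obtain ⟨K, hK, h⟩ := freqInt_gaussian p one_pos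
  simp only [one_mul] at h
  refine ⟨2 ^ ((p + 1) / 2 : ℝ) * (K + 1), by positivity, fun N E A τ hE hA hτ hN0 hNE hA1 => ?_⟩
  have hp0 : (0 : ℝ) ≤ (p + 1) / 2 := by positivity
  refine (le_of_le_of_le_rpow (A := (K + 1) * (1 + A) * E) (by positivity) hp0 hτ ?_ ?_).trans
    (ENNReal.ofReal_le_ofReal (le_of_eq (by ring)))
  · refine ((freqInt_mono fun ξ => ?_).trans hA1).trans (ENNReal.ofReal_le_ofReal ?_)
    · have : exp (-(τ * ξ ^ 2)) ≤ 1 := Real.exp_le_one_iff.2 (neg_nonpos.2 (by positivity))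
      have := mul_le_mul_of_nonneg_left this (show 0 ≤ |ξ| ^ p by positivity)
      nlinarith [hN0 ξ]
    · gcongr
      nlinarith
  · intro hτ'
    have h2 : freqInt (fun ξ => |ξ| ^ p * exp (-(τ * ξ ^ 2)) * N ξ) ≤
        freqInt fun ξ => E * (|ξ| ^ p * exp (-(τ * ξ ^ 2))) := freqInt_mono fun ξ => by
      rw [mul_comm E]
      have := hNE ξ
      gcongr
    refine h2.trans ?_
    rw [freqInt_const_mul hE]
    refine (mul_le_mul_right (h τ hτ') _).trans ?_
    rw [← ENNReal.ofReal_mul hE]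
    refine ENNReal.ofReal_le_ofReal ?_
    have h5 : 0 ≤ τ ^ (-((p + 1) / 2 : ℝ)) := by positivity
    calc E * (K * τ ^ (-((p + 1) / 2 : ℝ))) = K * E * τ ^ (-((p + 1) / 2 : ℝ)) := by ring
      _ ≤ _ := by gcongr; nlinarith

/-- `L²` bounds of Gaussian times envelope. -/
theorem eLpNorm_gaussian_mul (p : ℕ) : ∃ K : ℝ, 0 < K ∧ ∀ (N : ℝ → ℝ) (E τ : ℝ), 0 ≤ E →
    0 ≤ τ → (∀ ξ, 0 ≤ N ξ) → (∀ ξ, N ξ ≤ E) →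
    eLpNorm (fun ξ => |ξ| ^ p * N ξ) 2 volume ≤ ofReal E →
    eLpNorm (fun ξ => |ξ| ^ p * exp (-(τ * ξ ^ 2)) * N ξ) 2 volume ≤
      ofReal (K * (1 + τ) ^ (-((2 * p + 1) / 4 : ℝ)) * E) := by
  obtain ⟨K, hK, h⟩ := freqInt_gaussian (2 * p) two_pos
  refine ⟨2 ^ ((2 * p + 1) / 4 : ℝ) * (K + 1), by positivity, fun N E τ hE hτ hN0 hNE hA1 => ?_⟩
  have hp0 : (0 : ℝ) ≤ (2 * p + 1) / 4 := by positivity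
  refine (le_of_le_of_le_rpow (A := (K + 1) * E) (by positivity) hp0 hτ ?_ ?_).trans
    (ENNReal.ofReal_le_ofReal (le_of_eq (by ring)))
  · refine (eLpNorm_mono fun ξ => ?_).trans (hA1.trans (ENNReal.ofReal_le_ofReal (by nlinarith)))
    have : exp (-(τ * ξ ^ 2)) ≤ 1 := Real.exp_le_one_iff.2 (neg_nonpos.2 (by positivity))
    have h0 := hN0 ξ
    rw [Real.norm_of_nonneg (by positivity), Real.norm_of_nonneg (by positivity)]
    have := mul_le_mul_of_nonneg_left this (show 0 ≤ |ξ| ^ p by positivity)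
    nlinarith
  · intro hτ'
    rw [eLpNorm_two_le_iff]
    have h2 : ∫⁻ ξ, ‖|ξ| ^ p * exp (-(τ * ξ ^ 2)) * N ξ‖ₑ ^ 2 ≤
        freqInt fun ξ => E ^ 2 * (|ξ| ^ (2 * p) * exp (-(2 * (τ * ξ ^ 2)))) := by
      refine lintegral_mono fun ξ => ?_
      have h0 := hN0 ξ
      rw [← ofReal_norm, ← ENNReal.ofReal_pow (norm_nonneg _)]
      refine ENNReal.ofReal_le_ofReal ?_
      show _ ≤ E ^ 2 * (|ξ| ^ (2 * p) * exp (-(2 * (τ * ξ ^ 2))))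
      have e : exp (-(2 * (τ * ξ ^ 2))) = exp (-(τ * ξ ^ 2)) ^ 2 := by
        rw [← Real.exp_nat_mul]; congr 1; push_cast; ring
      rw [e, Real.norm_of_nonneg (by positivity), mul_pow, mul_pow, ← pow_mul, mul_comm p 2, mul_comm]
      have := hNE ξ
      gcongr
    refine h2.trans ?_
    rw [freqInt_const_mul (by positivity), ← ENNReal.ofReal_pow (by positivity)]
    refine (mul_le_mul_right (h τ hτ') _).trans ?_
    rw [← ENNReal.ofReal_mul (by positivity)]
    refine ENNReal.ofReal_le_ofReal ?_
    have e : (τ ^ (-((2 * p + 1) / 4 : ℝ))) ^ 2 = τ ^ (-(((2 * p : ℕ) + 1) / 2 : ℝ)) := by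
      rw [← Real.rpow_natCast, ← Real.rpow_mul hτ]
      congr 1; push_cast; ring
    rw [mul_pow, mul_pow, e]
    have h5 : 0 ≤ τ ^ (-(((2 * p : ℕ) + 1) / 2 : ℝ)) := by positivity
    calc _ = K * (E ^ 2 * τ ^ (-(((2 * p : ℕ) + 1) / 2 : ℝ))) := by ring
      _ ≤ (K + 1) ^ 2 * (E ^ 2 * τ ^ (-(((2 * p : ℕ) + 1) / 2 : ℝ))) := by
        gcongr; nlinarith
      _ = _ := by ring

/-! ### Weighted norms of fields prescribed on the frequency side -/

section

/-- The modulus of the propagator. -/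
def decay (ν t ξ : ℝ) : ℝ := exp (-(ν * t) - ν * t ^ 3 * (2 * π * ξ) ^ 2 / 3)

theorem measurable_decay (ν t : ℝ) : Measurable (decay ν t) := by unfold decay; fun_prop

theorem decay_pos (ν t ξ : ℝ) : 0 < decay ν t ξ := Real.exp_pos _

theorem propagator_eq (ν t : ℝ) (p : ℝ × ℝ) :
    propagator ν t p = (decay ν t p.1 : ℂ) * osc (2 * π * p.1 * t) 0 p.2 := by
  simp only [propagator, decay, osc, pow_zero, one_mul]
  rw [sub_eq_add_neg, Complex.exp_add, Complex.ofReal_exp, neg_mul]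

theorem decay_le_one {ν t : ℝ} (hν : 0 ≤ ν) (ht : 0 ≤ t) (ξ : ℝ) : decay ν t ξ ≤ 1 := by
  have : 0 ≤ ν * t ^ 3 * (2 * π * ξ) ^ 2 / 3 := by positivity
  have : 0 ≤ ν * t := by positivity
  exact Real.exp_le_one_iff.2 (by linarith)

variable {χ : ℝ → ℝ} {s ν t : ℝ}

/-- The constant lost when the weight is absorbed into the Gaussian decay. -/
def weightConst (s : ℝ) : ℝ := (36 * (s + 1)) ^ s

theorem weightConst_pos (hs : 0 ≤ s) : 0 < weightConst s := by unfold weightConst; positivity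

/-- The function of the frequency with the decay of the propagator, followed by the weight. -/
def weightedDecay (χ : ℝ → ℝ) (s ν t ξ : ℝ) : ℝ := weight χ s ν t (2 * π * ξ) * decay ν t ξ

theorem weightedDecay_le (hχ : IsCutoff χ) (hs : 0 ≤ s) (hν : 0 ≤ ν) (ht : 0 ≤ t) (ξ : ℝ) :
    weightedDecay χ s ν t ξ ≤ weightConst s * exp (-(ν * t)) * exp (-(ν * t ^ 3 * ξ ^ 2)) :=
  (congrArg _ (norm_propagator ν t (ξ, 0)).symm).trans_le (weight_mul_norm_propagator_le hχ hs hν ht (ξ, 0))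

theorem weightedDecay_nonneg (hχ : IsCutoff χ) (hs : 0 ≤ s) (hν : 0 ≤ ν) (ht : 0 ≤ t) (ξ : ℝ) :
    0 ≤ weightedDecay χ s ν t ξ :=
  mul_nonneg (zero_le_one.trans (one_le_weight hχ hs hν ht _)) (decay_pos _ _ _).le

theorem measurable_weightedDecay (hχ : IsCutoff χ) (s ν t : ℝ) : Measurable (weightedDecay χ s ν t) := by
  have h1 := measurable_weight hχ s ν t
  have h2 := measurable_decay ν t
  unfold weightedDecay
  fun_prop

theorem weightedDecay_le_const (hχ : IsCutoff χ) (hs : 0 ≤ s) (hν : 0 ≤ ν) (ht : 0 ≤ t) (ξ : ℝ) :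
    weightedDecay χ s ν t ξ ≤ weightConst s * exp (-(ν * t)) := by
  refine (weightedDecay_le hχ hs hν ht ξ).trans ?_
  have h1 : exp (-(ν * t ^ 3 * ξ ^ 2)) ≤ 1 := Real.exp_le_one_iff.2 (neg_nonpos.2 (by positivity))
  have h2 : 0 ≤ weightConst s * exp (-(ν * t)) := by have := weightConst_pos hs; positivity
  nlinarith

namespace FreqAdm

variable {F : ℝ × ℝ → ℂ}

theorem decay (hF : FreqAdm F) (hν : 0 ≤ ν) (ht : 0 ≤ t) :
    FreqAdm fun p => (decay ν t p.1 : ℂ) * F p := by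
  have := measurable_decay ν t
  refine hF.bdd_mul (m := fun p => (_root_.decay ν t p.1 : ℂ)) (by fun_prop) (C := 1) fun p _ => ?_
  rw [Complex.norm_real, Real.norm_of_nonneg (decay_pos _ _ _).le]
  exact decay_le_one hν ht _

theorem weightedDecay (hF : FreqAdm F) (hχ : IsCutoff χ) (hs : 0 ≤ s) (hν : 0 ≤ ν) (ht : 0 ≤ t) :
    FreqAdm fun p => (weightedDecay χ s ν t p.1 : ℂ) * F p := by
  have := measurable_weightedDecay hχ s ν t
  refine hF.bdd_mul (m := fun p => (_root_.weightedDecay χ s ν t p.1 : ℂ)) (by fun_prop)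
    (C := weightConst s * exp (-(ν * t))) fun p _ => ?_
  rw [Complex.norm_real, Real.norm_of_nonneg (weightedDecay_nonneg hχ hs hν ht _)]
  exact weightedDecay_le_const hχ hs hν ht _

theorem multNorm_weight_le (hF : FreqAdm F) (hχ : IsCutoff χ) (hs : 0 ≤ s) (hν : 0 ≤ ν) (ht : 0 ≤ t)
    {f : StripL2} (hf : PartialFT f fun p => (_root_.decay ν t p.1 : ℂ) * F p) (q : ℝ≥0∞) :
    multNorm (weight χ s ν t) q f ≤
      eLpNorm (hF.weightedDecay hχ hs hν ht).field q stripMeasure := by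
  refine multNorm_le hf _ fun p => ?_
  simp only [_root_.weightedDecay]
  push_cast; ring

theorem multNorm_weight_two_le (hF : FreqAdm F) (hχ : IsCutoff χ) (hs : 0 ≤ s) (hν : 0 ≤ ν)
    (ht : 0 ≤ t) {f : StripL2} (hf : PartialFT f fun p => (_root_.decay ν t p.1 : ℂ) * F p) {c : ℝ≥0∞}
    (h : eLpNorm (fun p => (_root_.weightedDecay χ s ν t p.1 : ℂ) * F p) 2 stripMeasure ≤ c) :
    multNorm (weight χ s ν t) 2 f ≤ c :=
  (hF.multNorm_weight_le hχ hs hν ht hf 2).trans ((eLpNorm_two_field _).trans_le h)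

theorem multNorm_weight_top_le (hF : FreqAdm F) (hχ : IsCutoff χ) (hs : 0 ≤ s) (hν : 0 ≤ ν)
    (ht : 0 ≤ t) {f : StripL2} (hf : PartialFT f fun p => (_root_.decay ν t p.1 : ℂ) * F p) {h : ℝ → ℝ}
    (hh : ∀ ξ, ∀ y ∈ Icc (-1 : ℝ) 1, _root_.weightedDecay χ s ν t ξ * ‖F (ξ, y)‖ ≤ h ξ) :
    multNorm (weight χ s ν t) ∞ f ≤ freqInt h := by
  refine (hF.multNorm_weight_le hχ hs hν ht hf ∞).trans (eLpNorm_top_field_le _ fun y hy => ?_)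
  refine lintegral_mono fun ξ => ?_
  rw [← ofReal_norm]
  refine ENNReal.ofReal_le_ofReal ?_
  rw [norm_mul, Complex.norm_real, Real.norm_of_nonneg (weightedDecay_nonneg hχ hs hν ht _)]
  exact hh ξ y (Ioo_subset_Icc_self hy)

end FreqAdm

/-- The channel has width `2`. -/
theorem eLpNorm_two_strip_le {F : ℝ × ℝ → ℂ} (hF : Measurable F) {h : ℝ → ℝ} (hm : Measurable h)
    (hh : ∀ ξ, ∀ y ∈ Icc (-1 : ℝ) 1, ‖F (ξ, y)‖ ≤ h ξ) :
    eLpNorm F 2 stripMeasure ≤ 2 * eLpNorm h 2 volume := by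
  have h0 : ∀ ξ, 0 ≤ h ξ := fun ξ => (norm_nonneg _).trans (hh ξ 0 (by norm_num))
  rw [eLpNorm_two_le_iff, mul_pow, eLpNorm_two_sq, lintegral_strip' (by fun_prop),
    ← lintegral_const_mul _ (by fun_prop)]
  refine lintegral_mono fun ξ => ?_
  calc ∫⁻ y, ‖F (ξ, y)‖ₑ ^ 2 ∂sectionMeasure ≤ ∫⁻ _ in Ioo (-1 : ℝ) 1, ‖h ξ‖ₑ ^ 2 := by
        refine setLIntegral_mono measurable_const fun y hy => ?_
        gcongr
        rw [← ofReal_norm, ← ofReal_norm]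
        refine ENNReal.ofReal_le_ofReal ?_
        rw [Real.norm_of_nonneg (h0 ξ)]
        exact hh ξ y (Ioo_subset_Icc_self hy)
    _ = 2 * ‖h ξ‖ₑ ^ 2 := by
        rw [setLIntegral_const, Real.volume_Ioo, mul_comm]; norm_num
    _ ≤ _ := by gcongr; norm_num

/-- A field whose symbol, without the decay, is twice differentiable in `y` is in `H²`, if the symbols of the
derivatives are admissible. -/
theorem FreqAdm.sobolev_two_decay (hν : 0 ≤ ν) (ht : 0 ≤ t) {G G' G'' G₁ G₂ G₁' : ℝ × ℝ → ℂ}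
    (h00 : FreqAdm G) (h10 : FreqAdm G₁)
    (h20 : FreqAdm G₂) (h01 : FreqAdm G') (h11 : FreqAdm G₁') (h02 : FreqAdm G'')
    (e₁ : ∀ p, G₁ p = (2 * π * p.1 * I) * G p)
    (e₂ : ∀ p, G₂ p = (2 * π * p.1 * I) * G₁ p)
    (e₁' : ∀ p, G₁' p = (2 * π * p.1 * I) * G' p)
    (hd : ∀ ξ y, HasDerivAt (fun y => G (ξ, y)) (G' (ξ, y)) y)
    (hd' : ∀ ξ y, HasDerivAt (fun y => G' (ξ, y)) (G'' (ξ, y)) y)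
    (hc : ∀ ξ, Continuous fun y => G'' (ξ, y)) :
    MemSobolev 2 (h00.decay hν ht).field ∧
      weakPartial 1 0 (h00.decay hν ht).field = (h10.decay hν ht).field ∧
      weakPartial 2 0 (h00.decay hν ht).field = (h20.decay hν ht).field ∧
      weakPartial 0 1 (h00.decay hν ht).field = (h01.decay hν ht).field ∧
      weakPartial 0 2 (h00.decay hν ht).field = (h02.decay hν ht).field := by
  have hc' : ∀ ξ, Continuous fun y => G' (ξ, y) := fun ξ =>
    continuous_iff_continuousAt.2 fun y => (hd' ξ y).continuousAt
  have w10 := (h00.decay hν ht).hasWeakPartial_dx (h10.decay hν ht) fun p => by rw [e₁]; ring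
  have w20 := w10.comp_dx ((h10.decay hν ht).hasWeakPartial_dx (h20.decay hν ht) fun p => by rw [e₂]; ring)
  have w01 := (h00.decay hν ht).hasWeakPartial_dy (h01.decay hν ht) (fun ξ y => (hd ξ y).const_mul (_root_.decay ν t ξ : ℂ))
    fun ξ => (hc' ξ).const_mul (_root_.decay ν t ξ : ℂ)
  have w02 := w01.comp_dy ((h01.decay hν ht).hasWeakPartial_dy (h02.decay hν ht)
    (fun ξ y => (hd' ξ y).const_mul (_root_.decay ν t ξ : ℂ))
    fun ξ => (hc ξ).const_mul (_root_.decay ν t ξ : ℂ))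
  have w11 := w10.comp_dy ((h10.decay hν ht).hasWeakPartial_dy (h11.decay hν ht)
    (fun ξ y => by simp only [e₁, e₁']; exact ((hd ξ y).const_mul _).const_mul (_root_.decay ν t ξ : ℂ))
    fun ξ => by simp only [e₁']; exact continuous_const.mul (continuous_const.mul (hc' ξ)))
  refine ⟨fun a b hab => ?_, w10.weakPartial_eq, w20.weakPartial_eq, w01.weakPartial_eq,
    w02.weakPartial_eq⟩
  obtain ⟨rfl | rfl | rfl, rfl | rfl | rfl⟩ : (a = 0 ∨ a = 1 ∨ a = 2) ∧ (b = 0 ∨ b = 1 ∨ b = 2) := by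
    omega
  all_goals first
    | exact ⟨_, hasWeakPartial_zero _⟩
    | exact ⟨_, w10⟩
    | exact ⟨_, w01⟩
    | exact ⟨_, w20⟩
    | exact ⟨_, w02⟩
    | exact ⟨_, w11⟩
    | omega

end

/-! ### The vorticity and its derivatives -/

theorem FreqAdm.wave {F : ℝ × ℝ → ℂ} (hF : FreqAdm F) (t : ℝ) :
    FreqAdm fun p => osc (2 * π * p.1 * t) 0 p.2 * F p :=
  hF.bdd_mul (m := fun p => osc (2 * π * p.1 * t) 0 p.2) (by simp only [osc]; fun_prop) (C := 1)
    fun p _ => by rw [norm_osc]; simp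

theorem FreqAdm.congr {F G : ℝ × ℝ → ℂ} (hF : FreqAdm F) (h : ∀ p, G p = F p) : FreqAdm G := by
  rwa [funext h]

namespace Profile

variable {f : StripL2} {E : ℝ} (P : Profile f E)

theorem N1_nonneg (ξ : ℝ) : 0 ≤ P.N1 ξ := (P.N0_nonneg ξ).trans (P.N0_le_N1 ξ)

theorem N2_nonneg (ξ : ℝ) : 0 ≤ P.N2 ξ := (P.N1_nonneg ξ).trans (P.N1_le_N2 ξ)

theorem N1_le (ξ : ℝ) : P.N1 ξ ≤ E := (P.N1_le_N2 ξ).trans (P.N2_le ξ)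

theorem N0_le (ξ : ℝ) : P.N0 ξ ≤ E := (P.N0_le_N1 ξ).trans (P.N1_le ξ)

include P in
theorem size_nonneg : 0 ≤ E := (P.N0_nonneg 0).trans (P.N0_le 0)

/-- The factor `e^{-ikty} ∂_y ĝ` of the symbol of `(∂_y + t ∂_x) ω`. -/
def source1 (t : ℝ) (p : ℝ × ℝ) : ℂ := P.g1 p * osc (2 * π * p.1 * t) 0 p.2

/-- The factor `e^{-ikty} ∂_y² ĝ` of the symbol of `(∂_y + t ∂_x)² ω`. -/
def source2 (t : ℝ) (p : ℝ × ℝ) : ℂ := P.g2 p * osc (2 * π * p.1 * t) 0 p.2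

theorem norm_source1_le (t ξ : ℝ) {y : ℝ} (hy : y ∈ Icc (-1 : ℝ) 1) :
    ‖P.source1 t (ξ, y)‖ ≤ P.N1 ξ := by
  rw [source1, norm_mul, norm_osc]; simpa using P.norm1 ξ y hy

theorem norm_source2_le (t ξ : ℝ) {y : ℝ} (hy : y ∈ Icc (-1 : ℝ) 1) :
    ‖P.source2 t (ξ, y)‖ ≤ P.N2 ξ := by
  rw [source2, norm_mul, norm_osc]; simpa using P.norm2 ξ y hy

theorem hasDerivAt_source (t ξ y : ℝ) : HasDerivAt (fun y => P.source t (ξ, y))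
    (P.source1 t (ξ, y) + (-(t : ℂ)) * ((2 * π * ξ * I) * P.source t (ξ, y))) y := by
  refine ((P.deriv0 ξ y).mul (hasDerivAt_osc_zero (2 * π * ξ * t) y)).congr_deriv ?_
  simp only [source, source1]; push_cast; ring

theorem hasDerivAt_source1 (t ξ y : ℝ) : HasDerivAt (fun y => P.source1 t (ξ, y))
    (P.source2 t (ξ, y) + (-(t : ℂ)) * ((2 * π * ξ * I) * P.source1 t (ξ, y))) y := by
  refine ((P.deriv1 ξ y).mul (hasDerivAt_osc_zero (2 * π * ξ * t) y)).congr_deriv ?_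
  simp only [source1, source2]; push_cast; ring

theorem memLp_one_add_abs_mul_mul_N0 (c : ℝ) :
    MemLp (fun ξ => (1 + |ξ|) * (c * (1 + |ξ|) * P.N0 ξ)) 2 volume :=
  (P.memLp_N0.const_mul c).congr_norm
    (by have := P.measN0; exact Measurable.aestronglyMeasurable (by fun_prop))
    (Eventually.of_forall fun ξ => congrArg norm (by ring))

theorem adm_of_le_one {F : ℝ × ℝ → ℂ} (hF : Measurable F) (c : ℝ)
    (h : ∀ ξ, ∀ y ∈ Icc (-1 : ℝ) 1, ‖F (ξ, y)‖ ≤ c * (1 + |ξ|) * P.N0 ξ) : FreqAdm F :=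
  FreqAdm.of_le hF (N := fun ξ => c * (1 + |ξ|) * P.N0 ξ) (by have := P.measN0; fun_prop)
    (P.memLp_one_add_abs_mul_mul_N0 c) h

theorem norm_two_pi_I (ξ : ℝ) : ‖(2 * π * ξ * I : ℂ)‖ = |2 * π * ξ| := by
  rw [norm_mul, Complex.norm_I, mul_one, ← Real.norm_eq_abs, ← Complex.norm_real]
  push_cast; rfl

theorem abs_two_pi_le (ξ : ℝ) : |2 * π * ξ| ≤ 7 * |ξ| := by
  rw [abs_mul, abs_of_pos Real.two_pi_pos]
  have := Real.pi_lt_d2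
  nlinarith [abs_nonneg ξ]

theorem adm_source (t : ℝ) : FreqAdm (P.source t) :=
  P.adm_of_le_one (P.measurable_source t) 1 fun ξ y hy => by
    have := P.norm_source_le t ξ hy
    nlinarith [abs_nonneg ξ, P.N0_nonneg ξ]

theorem adm_dx_source (t : ℝ) : FreqAdm fun p => (2 * π * p.1 * I) * P.source t p := by
  have := P.measurable_source t
  refine P.adm_of_le_one (by fun_prop) 7 fun ξ y hy => ?_
  have h := P.norm_source_le t ξ hy
  rw [norm_mul, norm_two_pi_I]
  have h2 := abs_two_pi_le ξ
  have h3 := P.N0_nonneg ξ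
  calc |2 * π * ξ| * ‖P.source t (ξ, y)‖ ≤ (7 * |ξ|) * P.N0 ξ := by gcongr
    _ ≤ _ := by nlinarith

theorem adm_dxx_source (t : ℝ) : FreqAdm fun p =>
    (2 * π * p.1 * I) * ((2 * π * p.1 * I) * P.source t p) :=
  ((P.adm20.wave t).const_mul ((2 * π * I) ^ 2)).congr fun p => by
    simp only [source]; ring

theorem adm_source1 (t : ℝ) : FreqAdm (P.source1 t) :=
  ((FreqAdm.of_le P.meas1 P.measN1 P.memLp_N1 P.norm1).wave t).congr fun p => by
    simp only [source1]; ring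

theorem adm_dx_source1 (t : ℝ) : FreqAdm fun p => (2 * π * p.1 * I) * P.source1 t p :=
  ((P.adm11.wave t).const_mul (2 * π * I)).congr fun p => by
    simp only [source1]; ring

theorem adm_source2 (t : ℝ) : FreqAdm (P.source2 t) :=
  (P.adm02.wave t).congr fun p => by simp only [source2]; ring

/-- The symbol of `∂_y² ω`, without the decay. -/
def sourceYY (t : ℝ) (p : ℝ × ℝ) : ℂ :=
  P.source2 t p + (-2 * (t : ℂ)) * ((2 * π * p.1 * I) * P.source1 t p) +
    (t : ℂ) ^ 2 * ((2 * π * p.1 * I) * ((2 * π * p.1 * I) * P.source t p))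

theorem adm_sourceYY (t : ℝ) : FreqAdm (P.sourceYY t) :=
  ((P.adm_source2 t).add ((P.adm_dx_source1 t).const_mul (-2 * (t : ℂ)))).add
    ((P.adm_dxx_source t).const_mul ((t : ℂ) ^ 2))

theorem adm_sourceY (t : ℝ) : FreqAdm fun p => P.source1 t p + (-(t : ℂ)) * ((2 * π * p.1 * I) * P.source t p) :=
  (P.adm_source1 t).add ((P.adm_dx_source t).const_mul (-(t : ℂ)))

theorem continuous_source1 (t ξ : ℝ) : Continuous fun y => P.source1 t (ξ, y) :=
  continuous_iff_continuousAt.2 fun y => (P.hasDerivAt_source1 t ξ y).continuousAt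

/-- The derivatives of the explicit vorticity. -/
theorem sobolev_vorticity {ν : ℝ} (hν : 0 ≤ ν) {t : ℝ} (ht : 0 ≤ t) :
    MemSobolev 2 ((P.adm_source t).decay hν ht).field ∧
      weakPartial 1 0 ((P.adm_source t).decay hν ht).field = ((P.adm_dx_source t).decay hν ht).field ∧
      weakPartial 2 0 ((P.adm_source t).decay hν ht).field = ((P.adm_dxx_source t).decay hν ht).field ∧
      weakPartial 0 1 ((P.adm_source t).decay hν ht).field = ((P.adm_sourceY t).decay hν ht).field ∧
      weakPartial 0 2 ((P.adm_source t).decay hν ht).field = ((P.adm_sourceYY t).decay hν ht).field := by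
  refine FreqAdm.sobolev_two_decay hν ht (P.adm_source t) (P.adm_dx_source t)
    (P.adm_dxx_source t) (P.adm_sourceY t) (((P.adm_dx_source1 t).add
    ((P.adm_dxx_source t).const_mul (-(t : ℂ))))) (P.adm_sourceYY t) (fun _ => rfl) (fun _ => rfl) (fun p => by ring)
    (P.hasDerivAt_source t) (fun ξ y => ?_) fun ξ => ?_
  · have h := (P.hasDerivAt_source1 t ξ y).add
      (((P.hasDerivAt_source t ξ y).const_mul (2 * π * ξ * I)).const_mul (-(t : ℂ)))
    exact h.congr_deriv (by simp only [sourceYY]; ring)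
  · have h2 : Continuous fun y => P.source2 t (ξ, y) := (P.cont2 ξ).mul (continuous_osc (2 * π * ξ * t) 0)
    exact (h2.add ((((P.continuous_source1 t ξ).const_mul (2 * π * ξ * I)).const_mul
      (-2 * (t : ℂ))))).add ((((P.continuous_source t ξ).const_mul (2 * π * ξ * I)).const_mul
      (2 * π * ξ * I)).const_mul ((t : ℂ) ^ 2))

/-- The solution of the linear equation is the explicit field. -/
theorem solution_eq_field {ω : ℝ → StripL2} {ν : ℝ} (hν : 0 ≤ ν) (h : IsLinearSolution ν f ω) {t : ℝ}
    (ht : 0 ≤ t) : ω t = ((P.adm_source t).decay hν ht).field := by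
  refine FreqAdm.field_eq _ ((h.partialFT hν P ht).congr (EventuallyEq.refl _ _)
    (Eventually.of_forall fun p => ?_))
  simp only [source, propagator_eq]; ring

/-- On the Fourier side `∂_y + t ∂_x` acts on the profile only, not on the transport phase. -/
theorem partialFT_good_derivative {ν : ℝ} (hν : 0 ≤ ν) {t : ℝ} (ht : 0 ≤ t) :
    PartialFT (((P.adm_sourceY t).decay hν ht).field + t • ((P.adm_dx_source t).decay hν ht).field :
      StripL2) fun p => (decay ν t p.1 : ℂ) * P.source1 t p := by
  have h := ((P.adm_sourceY t).decay hν ht).partialFT_field.add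
    (((P.adm_dx_source t).decay hν ht).partialFT_field.const_mul (t : ℂ))
  refine h.congr ?_ (Eventually.of_forall fun p => by ring)
  filter_upwards [Lp.coeFn_add ((P.adm_sourceY t).decay hν ht).field
    (t • ((P.adm_dx_source t).decay hν ht).field),
    Lp.coeFn_smul t ((P.adm_dx_source t).decay hν ht).field] with p h1 h2
  rw [h1, Pi.add_apply, h2, Pi.smul_apply, Complex.real_smul]

end Profile

/-! ### Weak enhanced dissipation -/

section

variable {χ : ℝ → ℝ} {s : ℝ}

theorem eLpNorm_weightedDecay_mul_le (hχ : IsCutoff χ) (hs : 0 ≤ s) {ν t : ℝ} (hν : 0 ≤ ν) (ht : 0 ≤ t)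
    {F : ℝ × ℝ → ℂ} (hFm : Measurable F) {N : ℝ → ℝ} (hN : Measurable N)
    (h : ∀ ξ, ∀ y ∈ Icc (-1 : ℝ) 1, ‖F (ξ, y)‖ ≤ N ξ) {A : ℝ}
    (hA : eLpNorm (fun ξ => exp (-(ν * t ^ 3 * ξ ^ 2)) * N ξ) 2 volume ≤ ofReal A) :
    eLpNorm (fun p => (weightedDecay χ s ν t p.1 : ℂ) * F p) 2 stripMeasure ≤
      ofReal (2 * weightConst s * exp (-(ν * t)) * A) := by
  have hK := weightConst_pos hs
  have hd := measurable_weightedDecay hχ s ν t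
  refine (eLpNorm_two_strip_le (by fun_prop) (h := fun ξ => (weightConst s * exp (-(ν * t))) *
    (exp (-(ν * t ^ 3 * ξ ^ 2)) * N ξ)) (by fun_prop) fun ξ y hy => ?_).trans ?_
  · rw [norm_mul, Complex.norm_real, Real.norm_of_nonneg (weightedDecay_nonneg hχ hs hν ht _),
      ← mul_assoc]
    exact mul_le_mul (weightedDecay_le hχ hs hν ht ξ) (h ξ y hy) (norm_nonneg _) (by positivity)
  · have e := eLpNorm_const_smul (weightConst s * exp (-(ν * t)))
      (fun ξ => exp (-(ν * t ^ 3 * ξ ^ 2)) * N ξ) 2 volume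
    have e' : (weightConst s * exp (-(ν * t))) • (fun ξ => exp (-(ν * t ^ 3 * ξ ^ 2)) * N ξ) =
      fun ξ => (weightConst s * exp (-(ν * t))) * (exp (-(ν * t ^ 3 * ξ ^ 2)) * N ξ) := rfl
    rw [← e', e, ENNReal.ofReal_mul (by positivity), mul_assoc 2 (weightConst s),
      ENNReal.ofReal_mul two_pos.le, ← mul_assoc, ← ofReal_norm,
      Real.norm_of_nonneg (by positivity), ENNReal.ofReal_ofNat]
    gcongr

/-- The `L²` norm of a weighted field with envelope `N`. -/
theorem FreqAdm.multNorm_weight_two_le_of_envelope {F : ℝ × ℝ → ℂ} (hF : FreqAdm F) (hχ : IsCutoff χ)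
    (hs : 0 ≤ s) {ν t : ℝ} (hν : 0 ≤ ν) (ht : 0 ≤ t) {f : StripL2}
    (hf : PartialFT f fun p => (_root_.decay ν t p.1 : ℂ) * F p) {N : ℝ → ℝ} (hN : Measurable N)
    (h : ∀ ξ, ∀ y ∈ Icc (-1 : ℝ) 1, ‖F (ξ, y)‖ ≤ N ξ) {A : ℝ}
    (hA : eLpNorm (fun ξ => exp (-(ν * t ^ 3 * ξ ^ 2)) * N ξ) 2 volume ≤ ofReal A) :
    multNorm (weight χ s ν t) 2 f ≤
      ofReal (2 * weightConst s * exp (-(ν * t)) * A) :=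
  hF.multNorm_weight_two_le hχ hs hν ht hf
    (eLpNorm_weightedDecay_mul_le hχ hs hν ht hF.meas hN h hA)

/-- The supremum norm of a weighted field with envelope `N`. -/
theorem FreqAdm.multNorm_weight_top_le_of_envelope {F : ℝ × ℝ → ℂ} (hF : FreqAdm F) (hχ : IsCutoff χ)
    (hs : 0 ≤ s) {ν t : ℝ} (hν : 0 ≤ ν) (ht : 0 ≤ t) {f : StripL2}
    (hf : PartialFT f fun p => (_root_.decay ν t p.1 : ℂ) * F p) {N : ℝ → ℝ}
    (h : ∀ ξ, ∀ y ∈ Icc (-1 : ℝ) 1, ‖F (ξ, y)‖ ≤ N ξ) {A : ℝ}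
    (hA : freqInt (fun ξ => exp (-(ν * t ^ 3 * ξ ^ 2)) * N ξ) ≤ ofReal A) :
    multNorm (weight χ s ν t) ∞ f ≤
      ofReal (weightConst s * exp (-(ν * t)) * A) := by
  have hK := weightConst_pos hs
  refine (hF.multNorm_weight_top_le hχ hs hν ht hf (h := fun ξ => (weightConst s * exp (-(ν * t))) *
    (exp (-(ν * t ^ 3 * ξ ^ 2)) * N ξ)) fun ξ y hy => ?_).trans ?_
  · rw [← mul_assoc]
    exact mul_le_mul (weightedDecay_le hχ hs hν ht ξ) (h ξ y hy) (norm_nonneg _) (by positivity)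
  · rw [freqInt_const_mul (by positivity), ENNReal.ofReal_mul (p := weightConst s * _) (by positivity)]
    gcongr

namespace Profile

variable {f : StripL2} {E : ℝ} (P : Profile f E)

theorem eLpNorm_N0_le : eLpNorm P.N0 2 volume ≤ ofReal E :=
  (eLpNorm_mono_real fun ξ => by
    rw [Real.norm_of_nonneg (P.N0_nonneg ξ)]
    have := P.N0_nonneg ξ
    nlinarith [abs_nonneg ξ, mul_nonneg (abs_nonneg ξ) this, mul_nonneg (mul_nonneg (abs_nonneg ξ) this) (abs_nonneg ξ)]).trans P.sq0

theorem eLpNorm_abs_mul_N0_le : eLpNorm (fun ξ => |ξ| ^ 1 * P.N0 ξ) 2 volume ≤ ofReal E :=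
  (eLpNorm_mono_real fun ξ => by
    rw [Real.norm_of_nonneg (mul_nonneg (by positivity) (P.N0_nonneg ξ))]
    have := P.N0_nonneg ξ
    nlinarith [abs_nonneg ξ, mul_nonneg (abs_nonneg ξ) this, mul_nonneg (mul_nonneg (abs_nonneg ξ) this) (abs_nonneg ξ)]).trans P.sq0

theorem eLpNorm_N1_le : eLpNorm P.N1 2 volume ≤ ofReal E :=
  (eLpNorm_mono_real fun ξ => by
    rw [Real.norm_of_nonneg (P.N1_nonneg ξ)]
    nlinarith [abs_nonneg ξ, mul_nonneg (abs_nonneg ξ) (P.N1_nonneg ξ)]).trans P.sq1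

end Profile

/-- `L¹` bounds of the envelopes. -/
theorem Profile.freqInt_envelopes_le : ∃ C : ℝ, 0 < C ∧ ∀ {f : StripL2} {E : ℝ} (P : Profile f E),
    freqInt P.N0 ≤ ofReal (C * E) ∧
    freqInt (fun ξ => |ξ| ^ 1 * P.N0 ξ) ≤ ofReal (C * E) ∧
    freqInt (fun ξ => |ξ| ^ (4 / 3 : ℝ) * P.N0 ξ) ≤ ofReal (C * E) ∧
    freqInt P.N1 ≤ ofReal (C * E) := by
  obtain ⟨C₁, hC₁, h₁⟩ := freqInt_le_of_memLp (r := 1) (by norm_num)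
  obtain ⟨C₂, hC₂, h₂⟩ := freqInt_le_of_memLp (r := 2 / 3) (by norm_num)
  refine ⟨C₁ + C₂, by positivity, fun {f E} P => ?_⟩
  have hE := P.size_nonneg
  have m0 := P.measN0
  have key : ∀ C, 0 ≤ C → C ≤ C₁ + C₂ → ofReal (C * E) ≤ ofReal ((C₁ + C₂) * E) :=
    fun C _ hC => ENNReal.ofReal_le_ofReal (by gcongr)
  refine ⟨(h₁ _ _ P.measN0 ((eLpNorm_mono_real fun ξ => ?_).trans P.sq0)).trans (key _ hC₁.le (by linarith)),
    (h₁ _ _ (by fun_prop) ((eLpNorm_mono_real fun ξ => ?_).trans P.sq0)).trans (key _ hC₁.le (by linarith)),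
    (h₂ _ _ (by fun_prop) ((eLpNorm_mono_real fun ξ => ?_).trans P.sq0)).trans (key _ hC₂.le (by linarith)),
    (h₁ _ _ P.measN1 ((eLpNorm_mono_real fun ξ => ?_).trans P.sq1)).trans (key _ hC₁.le (by linarith))⟩
  · have := P.N0_nonneg ξ
    rw [Real.norm_of_nonneg (by positivity), Real.rpow_one]
    gcongr
    nlinarith [abs_nonneg ξ]
  · have := P.N0_nonneg ξ
    rw [Real.norm_of_nonneg (by positivity), Real.rpow_one, ← mul_assoc]
    gcongr
    nlinarith [abs_nonneg ξ]
  · have := P.N0_nonneg ξ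
    rw [Real.norm_of_nonneg (by positivity), ← mul_assoc]
    gcongr
    have h3 : (0 : ℝ) < 1 + |ξ| := by positivity
    calc (1 + |ξ|) ^ (2 / 3 : ℝ) * |ξ| ^ (4 / 3 : ℝ) ≤ (1 + |ξ|) ^ (2 / 3 : ℝ) * (1 + |ξ|) ^ (4 / 3 : ℝ) := by
          gcongr; linarith
      _ = _ := by rw [← Real.rpow_add h3, ← Real.rpow_natCast]; norm_num
  · have := P.N1_nonneg ξ
    rw [Real.norm_of_nonneg (by positivity), Real.rpow_one, pow_one]

/-- `x e^{-x} ≤ x^{2/3}`, in the form used for two derivatives in `x`. -/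
theorem sq_mul_exp_neg_le {τ : ℝ} (hτ : 0 < τ) (ξ : ℝ) :
    |ξ| ^ 2 * exp (-(τ * ξ ^ 2)) ≤ τ ^ (-(1 / 3) : ℝ) * |ξ| ^ (4 / 3 : ℝ) := by
  set a := τ * ξ ^ 2 with ha
  have ha0 : 0 ≤ a := by positivity
  have h1 : a ^ (1 / 3 : ℝ) * exp (-a) ≤ 1 := by
    have h2 : a ^ (1 / 3 : ℝ) ≤ 1 + a := by
      rcases le_total a 1 with h3 | h3
      · linarith [Real.rpow_le_one ha0 h3 (show (0 : ℝ) ≤ 1 / 3 by norm_num)]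
      · have := Real.rpow_le_rpow_of_exponent_le h3 (show (1 / 3 : ℝ) ≤ 1 by norm_num)
        rw [Real.rpow_one] at this; linarith
    have h3 := Real.add_one_le_exp a
    have h4 : exp a * exp (-a) = 1 := by rw [← Real.exp_add]; simp
    nlinarith [Real.exp_pos (-a)]
  have h2 : |ξ| ^ 2 = τ ^ (-(1 / 3) : ℝ) * |ξ| ^ (4 / 3 : ℝ) * a ^ (1 / 3 : ℝ) := by
    rw [ha, Real.mul_rpow hτ.le (by positivity), ← sq_abs ξ, ← Real.rpow_natCast |ξ| 2,
      ← Real.rpow_mul (abs_nonneg ξ)]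
    have h5 : τ ^ (-(1 / 3) : ℝ) * τ ^ (1 / 3 : ℝ) = 1 := by rw [← Real.rpow_add hτ]; simp
    have h6 : |ξ| ^ (4 / 3 : ℝ) * |ξ| ^ ((2 : ℕ) * (1 / 3) : ℝ) = |ξ| ^ ((2 : ℕ) : ℝ) := by
      rw [← Real.rpow_add_of_nonneg (abs_nonneg ξ) (by norm_num) (by norm_num)]; norm_num
    rw [← h6]
    calc _ = (τ ^ (-(1 / 3) : ℝ) * τ ^ (1 / 3 : ℝ)) * (|ξ| ^ (4 / 3 : ℝ) * |ξ| ^ ((2 : ℕ) * (1 / 3) : ℝ)) := by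
          rw [h5, one_mul]
      _ = _ := by ring
  rw [h2, mul_assoc]
  have h3 : 0 ≤ τ ^ (-(1 / 3) : ℝ) * |ξ| ^ (4 / 3 : ℝ) := by positivity
  nlinarith

/-- The weak enhanced dissipation: the weight costs a part of the Gaussian `exp(-ν t³ k² / 3)`, and the powers of
`1 + ν t³` are Gaussian moments against the envelopes. -/
theorem exists_dissipation (hχ : IsCutoff χ) (hs : 0 ≤ s) : ∃ C : ℝ, 0 < C ∧
    ∀ {f : StripL2} {E : ℝ} (P : Profile f E) {ν t : ℝ} (hν : 0 < ν) (ht : 0 ≤ t),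
    multNorm (weight χ s ν t) 2 ((P.adm_source t).decay hν.le ht).field ≤
      ofReal (C * (1 + ν * t ^ 3) ^ (-(1 / 4) : ℝ) * exp (-ν * t) * E) ∧
    multNorm (weight χ s ν t) 2
        (((P.adm_sourceY t).decay hν.le ht).field + t • ((P.adm_dx_source t).decay hν.le ht).field) ≤
      ofReal (C * (1 + ν * t ^ 3) ^ (-(1 / 4) : ℝ) * exp (-ν * t) * E) ∧
    multNorm (weight χ s ν t) 2 ((P.adm_dx_source t).decay hν.le ht).field ≤
      ofReal (C * (1 + ν * t ^ 3) ^ (-(3 / 4) : ℝ) * exp (-ν * t) * E) ∧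
    multNorm (weight χ s ν t) ∞ ((P.adm_dx_source t).decay hν.le ht).field ≤
      ofReal (C * (1 + ν * t ^ 3) ^ (-1 : ℝ) * exp (-ν * t) * E) ∧
    multNorm (weight χ s ν t) ∞
        (((P.adm_sourceY t).decay hν.le ht).field + t • ((P.adm_dx_source t).decay hν.le ht).field) ≤
      ofReal (C * (1 + ν * t ^ 3) ^ (-(1 / 2) : ℝ) * exp (-ν * t) * E) ∧
    (0 < t → multNorm (weight χ s ν t) ∞ ((P.adm_dxx_source t).decay hν.le ht).field ≤
      ofReal (C * (ν * t ^ 3) ^ (-(1 / 3) : ℝ) * (1 + ν * t ^ 3) ^ (-(7 / 6) : ℝ)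
        * exp (-ν * t) * E)) := by
  obtain ⟨A, hA, hA'⟩ := Profile.freqInt_envelopes_le
  obtain ⟨K₀, hK₀, h₀⟩ := eLpNorm_gaussian_mul 0
  obtain ⟨K₁, hK₁, h₁⟩ := eLpNorm_gaussian_mul 1
  obtain ⟨L₀, hL₀, l₀⟩ := freqInt_gaussian_mul 0
  obtain ⟨L₁, hL₁, l₁⟩ := freqInt_gaussian_mul 1
  obtain ⟨G, hG, g⟩ := freqInt_gaussian 2 one_pos
  have hW := weightConst_pos hs
  set W := weightConst s with hWdef
  set C₀ := 2 * W * K₀ with hC₀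
  set C₁ := 2 * W * (K₁ * 7) with hC₁
  set C₂ := W * (L₀ * (1 + A)) with hC₂
  set C₃ := W * (7 * (L₁ * (1 + A))) with hC₃
  set C₄ := W * (49 * (2 ^ (7 / 6 : ℝ) * (A + G))) with hC₄
  have c₀ : 0 < C₀ := by positivity
  have c₁ : 0 < C₁ := by positivity
  have c₂ : 0 < C₂ := by positivity
  have c₃ : 0 < C₃ := by positivity
  have c₄ : 0 < C₄ := by positivity
  refine ⟨C₀ + C₁ + C₂ + C₃ + C₄, by positivity, fun {f E} P {ν t} hν ht => ?_⟩
  obtain ⟨a0, a1, a43, aN1⟩ := hA' P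
  have hE := P.size_nonneg
  have m0 := P.measN0
  have m1 := P.measN1
  have hτ : 0 ≤ ν * t ^ 3 := by positivity
  have e1 : ∀ N : ℝ → ℝ, (fun ξ => exp (-(ν * t ^ 3 * ξ ^ 2)) * N ξ) =
      fun ξ => |ξ| ^ 0 * exp (-(ν * t ^ 3 * ξ ^ 2)) * N ξ := fun N => by funext ξ; ring
  have e2 : ∀ N : ℝ → ℝ, (fun ξ => exp (-(ν * t ^ 3 * ξ ^ 2)) * (7 * |ξ| * N ξ)) =
      fun ξ => 7 * (|ξ| ^ 1 * exp (-(ν * t ^ 3 * ξ ^ 2)) * N ξ) := fun N => by funext ξ; ring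
  have hdx : ∀ ξ, ∀ y ∈ Icc (-1 : ℝ) 1, ‖2 * π * ξ * I * P.source t (ξ, y)‖ ≤
      7 * |ξ| * P.N0 ξ := fun ξ y hy => by
    rw [norm_mul, Profile.norm_two_pi_I]
    exact mul_le_mul (Profile.abs_two_pi_le ξ) (P.norm_source_le t ξ hy) (norm_nonneg _) (by positivity)
  have fin : ∀ D B : ℝ, 0 ≤ B → D ≤ C₀ + C₁ + C₂ + C₃ + C₄ →
      ofReal (D * B * exp (-ν * t) * E) ≤
        ofReal ((C₀ + C₁ + C₂ + C₃ + C₄) * B * exp (-ν * t) * E) := fun D B hB hD =>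
    ENNReal.ofReal_le_ofReal (by gcongr)
  rw [neg_mul] at fin ⊢
  refine ⟨?_, ?_, ?_, ?_, ?_, fun ht' => ?_⟩
  · refine ((P.adm_source t).multNorm_weight_two_le_of_envelope hχ hs hν.le ht
      ((P.adm_source t).decay hν.le ht).partialFT_field P.measN0 (fun ξ y hy => P.norm_source_le t ξ hy)
      (A := K₀ * (1 + ν * t ^ 3) ^ (-(1 / 4) : ℝ) * E) ?_).trans
      ((ENNReal.ofReal_le_ofReal (le_of_eq ?_)).trans (fin C₀ ((1 + ν * t ^ 3) ^ (-(1 / 4) : ℝ)) (by positivity) (by linarith)))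
    · rw [e1]
      convert h₀ P.N0 E _ hE hτ P.N0_nonneg P.N0_le (by simpa using P.eLpNorm_N0_le) using 4
      norm_num
    · ring
  · refine ((P.adm_source1 t).multNorm_weight_two_le_of_envelope hχ hs hν.le ht
      (P.partialFT_good_derivative hν.le ht) P.measN1 (fun ξ y hy => P.norm_source1_le t ξ hy)
      (A := K₀ * (1 + ν * t ^ 3) ^ (-(1 / 4) : ℝ) * E) ?_).trans
      ((ENNReal.ofReal_le_ofReal (le_of_eq ?_)).trans (fin C₀ ((1 + ν * t ^ 3) ^ (-(1 / 4) : ℝ)) (by positivity) (by linarith)))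
    · rw [e1]
      convert h₀ P.N1 E _ hE hτ P.N1_nonneg P.N1_le (by simpa using P.eLpNorm_N1_le) using 4
      norm_num
    · ring
  · refine ((P.adm_dx_source t).multNorm_weight_two_le_of_envelope hχ hs hν.le ht
      ((P.adm_dx_source t).decay hν.le ht).partialFT_field (N := fun ξ => 7 * |ξ| * P.N0 ξ) (by fun_prop) hdx
      (A := 7 * (K₁ * (1 + ν * t ^ 3) ^ (-(3 / 4) : ℝ) * E)) ?_).trans
      ((ENNReal.ofReal_le_ofReal (le_of_eq ?_)).trans (fin C₁ ((1 + ν * t ^ 3) ^ (-(3 / 4) : ℝ)) (by positivity) (by linarith)))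
    · rw [e2]
      have e := eLpNorm_const_smul (7 : ℝ)
        (fun ξ => |ξ| ^ 1 * exp (-(ν * t ^ 3 * ξ ^ 2)) * P.N0 ξ) 2 volume
      refine (le_of_eq e).trans ?_
      rw [ENNReal.ofReal_mul (by norm_num), ← ofReal_norm, Real.norm_of_nonneg (by norm_num)]
      gcongr
      exact (h₁ P.N0 E _ hE hτ P.N0_nonneg P.N0_le P.eLpNorm_abs_mul_N0_le).trans_eq (by norm_num)
    · ring
  · refine ((P.adm_dx_source t).multNorm_weight_top_le_of_envelope hχ hs hν.le ht
      ((P.adm_dx_source t).decay hν.le ht).partialFT_field hdx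
      (A := 7 * (L₁ * (1 + A) * (1 + ν * t ^ 3) ^ (-1 : ℝ) * E)) ?_).trans
      ((ENNReal.ofReal_le_ofReal (le_of_eq ?_)).trans (fin C₃ ((1 + ν * t ^ 3) ^ (-1 : ℝ)) (by positivity) (by linarith)))
    · rw [e2, freqInt_const_mul (by norm_num), ENNReal.ofReal_mul (by norm_num)]
      gcongr
      exact (l₁ P.N0 E A _ hE hA.le hτ P.N0_nonneg P.N0_le a1).trans_eq (by norm_num)
    · ring
  · refine ((P.adm_source1 t).multNorm_weight_top_le_of_envelope hχ hs hν.le ht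
      (P.partialFT_good_derivative hν.le ht) (fun ξ y hy => P.norm_source1_le t ξ hy)
      (A := L₀ * (1 + A) * (1 + ν * t ^ 3) ^ (-(1 / 2) : ℝ) * E) ?_).trans
      ((ENNReal.ofReal_le_ofReal (le_of_eq ?_)).trans (fin C₂ ((1 + ν * t ^ 3) ^ (-(1 / 2) : ℝ)) (by positivity) (by linarith)))
    · rw [e1]
      convert l₀ P.N1 E A _ hE hA.le hτ P.N1_nonneg P.N1_le (by simpa using aN1) using 4
      norm_num
    · ring
  -- For small `ν t³` one uses `x^{1/3} e^{-x} ≤ 1` to trade `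
  -- ξ
  -- ²` for `
  -- ξ
  -- ^{4/3}`, which is integrable
  -- against the envelope; for large `ν t³` the Gaussian moment.
  · have hτ' : 0 < ν * t ^ 3 := by positivity
    refine ((P.adm_dxx_source t).multNorm_weight_top_le_of_envelope hχ hs hν.le ht
      ((P.adm_dxx_source t).decay hν.le ht).partialFT_field (N := fun ξ => 49 * |ξ| ^ 2 * P.N0 ξ)
      (fun ξ y hy => ?_)
      (A := 49 * (2 ^ (7 / 6 : ℝ) * ((A + G) * (ν * t ^ 3) ^ (-(1 / 3) : ℝ) * E *
        (1 + ν * t ^ 3) ^ (-(7 / 6) : ℝ)))) ?_).trans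
      ((ENNReal.ofReal_le_ofReal (le_of_eq ?_)).trans (fin C₄ ((ν * t ^ 3) ^ (-(1 / 3) : ℝ) *
        (1 + ν * t ^ 3) ^ (-(7 / 6) : ℝ)) (by positivity) (by linarith)) |>.trans (le_of_eq (by ring_nf)))
    · rw [norm_mul, Profile.norm_two_pi_I]
      have h1 := Profile.abs_two_pi_le ξ
      calc _ ≤ 7 * |ξ| * (7 * |ξ| * P.N0 ξ) := by gcongr; exact hdx ξ y hy
        _ = _ := by ring
    · rw [show (fun ξ => exp (-(ν * t ^ 3 * ξ ^ 2)) * (49 * |ξ| ^ 2 * P.N0 ξ)) =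
        fun ξ => 49 * (|ξ| ^ 2 * exp (-(ν * t ^ 3 * ξ ^ 2)) * P.N0 ξ) by funext ξ; ring,
        freqInt_const_mul (by norm_num), ENNReal.ofReal_mul (by norm_num)]
      gcongr
      refine le_of_le_of_le_rpow (by positivity) (by norm_num) hτ ?_ fun _ => ?_
      · refine (freqInt_mono fun ξ => ?_).trans ((le_of_eq (freqInt_const_mul
          (c := (ν * t ^ 3) ^ (-(1 / 3) : ℝ)) (by positivity)
          (fun ξ => |ξ| ^ (4 / 3 : ℝ) * P.N0 ξ))).trans ((mul_le_mul_right a43 _).trans ?_))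
        · rw [← mul_assoc]
          exact mul_le_mul_of_nonneg_right (sq_mul_exp_neg_le hτ' ξ) (P.N0_nonneg ξ)
        · rw [← ENNReal.ofReal_mul (by positivity)]
          refine ENNReal.ofReal_le_ofReal ?_
          calc _ = A * (ν * t ^ 3) ^ (-(1 / 3) : ℝ) * E := by ring
            _ ≤ _ := by gcongr; linarith
      · refine (freqInt_mono fun ξ => ?_).trans ((le_of_eq (freqInt_const_mul hE
          (fun ξ => |ξ| ^ 2 * exp (-(1 * (ν * t ^ 3 * ξ ^ 2)))))).trans
            ((mul_le_mul_right (g _ hτ') _).trans ?_))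
        · rw [one_mul, mul_comm E]
          exact mul_le_mul_of_nonneg_left (P.N0_le ξ) (by positivity)
        · rw [← ENNReal.ofReal_mul hE]
          refine ENNReal.ofReal_le_ofReal ?_
          have h5 : (ν * t ^ 3) ^ (-(((2 : ℕ) + 1) / 2 : ℝ)) =
              (ν * t ^ 3) ^ (-(1 / 3) : ℝ) * (ν * t ^ 3) ^ (-(7 / 6) : ℝ) := by
            rw [← Real.rpow_add hτ']; norm_num
          rw [h5]
          calc _ = G * (ν * t ^ 3) ^ (-(1 / 3) : ℝ) * E * (ν * t ^ 3) ^ (-(7 / 6) : ℝ) := by ring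
            _ ≤ _ := by gcongr; linarith
    · ring

end

/-! ### The velocity field -/

namespace Profile

variable {f : StripL2} {E : ℝ} (P : Profile f E)

theorem adm_stream (t : ℝ) : FreqAdm (P.stream t) :=
  P.adm_of_le_one (P.measurable_stream t) 4 fun ξ y hy => by
    have := P.norm_stream_le t ξ hy
    nlinarith [mul_nonneg (abs_nonneg ξ) (P.N0_nonneg ξ)]

theorem norm_dx_stream_le (t ξ : ℝ) {y : ℝ} (hy : y ∈ Icc (-1 : ℝ) 1) :
    ‖2 * π * ξ * I * P.stream t (ξ, y)‖ ≤ 2 * P.N0 ξ := by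
  rw [norm_mul, norm_two_pi_I]; exact P.abs_mul_norm_stream_le t ξ hy

theorem adm_dx_stream (t : ℝ) : FreqAdm fun p => (2 * π * p.1 * I) * P.stream t p := by
  have := P.measurable_stream t
  refine P.adm_of_le_one (by fun_prop) 2 fun ξ y hy => ?_
  have := P.norm_dx_stream_le t ξ hy
  nlinarith [mul_nonneg (abs_nonneg ξ) (P.N0_nonneg ξ)]

theorem adm_dxx_stream (t : ℝ) : FreqAdm fun p =>
    (2 * π * p.1 * I) * ((2 * π * p.1 * I) * P.stream t p) := by
  have := P.measurable_stream t
  refine P.adm_of_le_one (by fun_prop) 14 fun ξ y hy => ?_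
  rw [norm_mul, norm_two_pi_I]
  have h := mul_le_mul (abs_two_pi_le ξ) (P.norm_dx_stream_le t ξ hy) (norm_nonneg _) (by positivity)
  nlinarith [mul_nonneg (abs_nonneg ξ) (P.N0_nonneg ξ), P.N0_nonneg ξ]

theorem adm_streamDeriv (t : ℝ) : FreqAdm (P.streamDeriv t) :=
  P.adm_of_le_one (P.measurable_streamDeriv t) 2 fun ξ y hy => by
    have := P.norm_streamDeriv_le t ξ hy
    nlinarith [mul_nonneg (abs_nonneg ξ) (P.N0_nonneg ξ)]

theorem adm_dx_streamDeriv (t : ℝ) : FreqAdm fun p => (2 * π * p.1 * I) * P.streamDeriv t p := by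
  have := P.measurable_streamDeriv t
  refine P.adm_of_le_one (by fun_prop) 14 fun ξ y hy => ?_
  rw [norm_mul, norm_two_pi_I]
  have h := mul_le_mul (abs_two_pi_le ξ) (P.norm_streamDeriv_le t ξ hy) (norm_nonneg _) (by positivity)
  nlinarith [mul_nonneg (abs_nonneg ξ) (P.N0_nonneg ξ), P.N0_nonneg ξ]

theorem streamDeriv2_of_ne (t : ℝ) {p : ℝ × ℝ} (hp : p.1 ≠ 0) : P.streamDeriv2 t p =
    -((2 * π * p.1 * I) * ((2 * π * p.1 * I) * P.stream t p)) + P.source t p := by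
  simp only [streamDeriv2, hp, if_false]
  linear_combination ((2 * π * p.1 : ℂ) ^ 2 * P.stream t p) * Complex.I_sq

theorem adm_streamDeriv2 (t : ℝ) : FreqAdm (P.streamDeriv2 t) := by
  refine P.adm_of_le_one (P.measurable_streamDeriv2 t) 15 fun ξ y hy => ?_
  have h0 := P.N0_nonneg ξ
  by_cases hξ : ξ = 0
  · simp only [streamDeriv2, hξ, if_true, norm_zero]
    rw [hξ] at h0; positivity
  · rw [P.streamDeriv2_of_ne t (p := (ξ, y)) hξ]
    refine (norm_add_le _ _).trans ?_
    rw [norm_neg, norm_mul, norm_two_pi_I]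
    have h := mul_le_mul (abs_two_pi_le ξ) (P.norm_dx_stream_le t ξ hy) (norm_nonneg _) (by positivity)
    have h2 := P.norm_source_le t ξ hy
    nlinarith [mul_nonneg (abs_nonneg ξ) (P.N0_nonneg ξ), P.N0_nonneg ξ]

theorem sobolev_stream {ν : ℝ} (hν : 0 ≤ ν) {t : ℝ} (ht : 0 ≤ t) :
    MemSobolev 2 ((P.adm_stream t).decay hν ht).field ∧
      weakPartial 1 0 ((P.adm_stream t).decay hν ht).field = ((P.adm_dx_stream t).decay hν ht).field ∧
      weakPartial 2 0 ((P.adm_stream t).decay hν ht).field = ((P.adm_dxx_stream t).decay hν ht).field ∧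
      weakPartial 0 1 ((P.adm_stream t).decay hν ht).field = ((P.adm_streamDeriv t).decay hν ht).field ∧
      weakPartial 0 2 ((P.adm_stream t).decay hν ht).field = ((P.adm_streamDeriv2 t).decay hν ht).field :=
  FreqAdm.sobolev_two_decay hν ht (P.adm_stream t) (P.adm_dx_stream t) (P.adm_dxx_stream t)
    (P.adm_streamDeriv t) (P.adm_dx_streamDeriv t) (P.adm_streamDeriv2 t) (fun _ => rfl) (fun _ => rfl)
    (fun _ => rfl) (P.hasDerivAt_stream t) (P.hasDerivAt_streamDeriv t) (P.continuous_streamDeriv2 t)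

/-- The stream function given by Green's function at each frequency. The frequency zero, where
`stream` does not solve the equation, has measure zero. -/
theorem isStreamFunction {ν : ℝ} (hν : 0 ≤ ν) {t : ℝ} (ht : 0 ≤ t) :
    IsStreamFunction ((P.adm_source t).decay hν ht).field ((P.adm_stream t).decay hν ht).field := by
  obtain ⟨h1, -, h20, -, h02⟩ := P.sobolev_stream hν ht
  refine ⟨h1, FreqAdm.vanishesOnWalls ((P.adm_stream t).decay hν ht) ((P.adm_streamDeriv t).decay hν ht)
    (fun ξ y => (P.hasDerivAt_stream t ξ y).const_mul (decay ν t ξ : ℂ))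
    (fun ξ => (P.continuous_streamDeriv t ξ).const_mul (decay ν t ξ : ℂ))
    (fun ξ => by rw [(P.stream_wall t ξ).1, mul_zero]) (fun ξ => by rw [(P.stream_wall t ξ).2, mul_zero]), ?_⟩
  rw [h20, h02]
  refine FreqAdm.field_eq _ ((((P.adm_dxx_stream t).decay hν ht).partialFT_field.add
    ((P.adm_streamDeriv2 t).decay hν ht).partialFT_field).congr (Lp.coeFn_add _ _).symm ?_)
  have h0 : ∀ᵐ p ∂stripMeasure, p.1 ≠ 0 := by
    have : ∀ᵐ p : ℝ × ℝ ∂(volume.prod volume), p.1 ≠ 0 :=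
      (Measure.quasiMeasurePreserving_fst (μ := volume) (ν := volume)).ae (Measure.ae_ne volume 0)
    exact ae_restrict_of_ae this
  filter_upwards [h0] with p hp
  rw [P.streamDeriv2_of_ne t hp]; ring

/-- `(∂_y + t ∂_x) φ` in frequency. -/
theorem partialFT_good_stream {ν : ℝ} (hν : 0 ≤ ν) {t : ℝ} (ht : 0 ≤ t) :
    PartialFT (((P.adm_streamDeriv t).decay hν ht).field - t • (-((P.adm_dx_stream t).decay hν ht).field) :
      StripL2) fun p => (decay ν t p.1 : ℂ) *
        (P.streamDeriv t p + (t : ℂ) * ((2 * π * p.1 * I) * P.stream t p)) := by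
  have h := ((P.adm_streamDeriv t).decay hν ht).partialFT_field.add
    (((P.adm_dx_stream t).decay hν ht).partialFT_field.const_mul (t : ℂ))
  refine h.congr ?_ (Eventually.of_forall fun p => by ring)
  rw [smul_neg, sub_neg_eq_add]
  filter_upwards [Lp.coeFn_add ((P.adm_streamDeriv t).decay hν ht).field
    (t • ((P.adm_dx_stream t).decay hν ht).field),
    Lp.coeFn_smul t ((P.adm_dx_stream t).decay hν ht).field] with p h1 h2
  rw [h1, Pi.add_apply, h2, Pi.smul_apply, Complex.real_smul]

theorem partialFT_neg_dx_stream {ν : ℝ} (hν : 0 ≤ ν) {t : ℝ} (ht : 0 ≤ t) :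
    PartialFT (-((P.adm_dx_stream t).decay hν ht).field : StripL2) fun p => (decay ν t p.1 : ℂ) *
        (-1 * ((2 * π * p.1 * I) * P.stream t p)) := by
  refine (((P.adm_dx_stream t).decay hν ht).partialFT_field.const_mul (-1)).congr ?_
    (Eventually.of_forall fun p => by ring)
  filter_upwards [Lp.coeFn_neg ((P.adm_dx_stream t).decay hν ht).field] with p h1
  rw [h1, Pi.neg_apply, neg_one_mul]

end Profile

/-! ### Inviscid damping of `u²` and `u¹ - t u²` -/

section

variable {χ : ℝ → ℝ} {s : ℝ}

/-- The supremum norm of a weighted field from an `L¹` envelope of its symbol, with no use of the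
viscous decay. -/
theorem FreqAdm.multNorm_weight_top_le_of_freqInt {F : ℝ × ℝ → ℂ} (hF : FreqAdm F) (hχ : IsCutoff χ)
    (hs : 0 ≤ s) {ν t : ℝ} (hν : 0 ≤ ν) (ht : 0 ≤ t) {f : StripL2}
    (hf : PartialFT f fun p => (_root_.decay ν t p.1 : ℂ) * F p) {N : ℝ → ℝ}
    (h : ∀ ξ, ∀ y ∈ Icc (-1 : ℝ) 1, ‖F (ξ, y)‖ ≤ N ξ) {A : ℝ} (hA : freqInt N ≤ ofReal A) :
    multNorm (weight χ s ν t) ∞ f ≤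
      ofReal (weightConst s * exp (-(ν * t)) * A) := by
  refine hF.multNorm_weight_top_le_of_envelope hχ hs hν ht hf h ((freqInt_mono fun ξ => ?_).trans hA)
  have h1 : exp (-(ν * t ^ 3 * ξ ^ 2)) ≤ 1 := Real.exp_le_one_iff.2 (neg_nonpos.2 (by positivity))
  have h2 : 0 ≤ N ξ := (norm_nonneg _).trans (h ξ 0 (by norm_num))
  nlinarith

namespace Profile

variable {f : StripL2} {E : ℝ} (P : Profile f E)

/-- Bound of the symbol of `u¹ - t u² = (∂_y + t ∂_x) φ`, without the decay. -/
theorem norm_good_stream_le {t : ℝ} (ξ : ℝ) {y : ℝ} (hy : y ∈ Icc (-1 : ℝ) 1) :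
    ‖P.streamDeriv t (ξ, y) + (t : ℂ) * ((2 * π * ξ * I) * P.stream t (ξ, y))‖ ≤
      100 * E * (1 + (2 * π * t * ξ) ^ 2)⁻¹ := by
  have hE := P.size_nonneg
  have hN := P.N0_le ξ
  have e : 2 * π * t * ξ = 2 * π * ξ * t := by ring
  rw [e, ← div_eq_mul_inv, le_div_iff₀ (by positivity)]
  set θ := 2 * π * ξ * t with hθ
  rcases lt_or_ge |θ| 1 with h | h
  · have h2 : θ ^ 2 ≤ 1 := by rw [← sq_abs]; nlinarith [abs_nonneg θ]
    have h3 : ‖(t : ℂ) * ((2 * π * ξ * I) * P.stream t (ξ, y))‖ ≤ 4 * E := by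
      rw [norm_mul, norm_mul, norm_two_pi_I, ← mul_assoc, Complex.norm_real, Real.norm_eq_abs, ← abs_mul,
        mul_comm t, ← hθ]
      have := P.norm_stream_le t ξ hy
      nlinarith [abs_nonneg θ, norm_nonneg (P.stream t (ξ, y))]
    have h4 := norm_add_le (P.streamDeriv t (ξ, y)) ((t : ℂ) * ((2 * π * ξ * I) * P.stream t (ξ, y)))
    have h5 := P.norm_streamDeriv_le t ξ hy
    nlinarith [norm_nonneg (P.streamDeriv t (ξ, y) + (t : ℂ) * ((2 * π * ξ * I) * P.stream t (ξ, y)))]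
  · have h1 := (P.stream_decay h hy).2
    rw [le_div_iff₀ (by positivity), sq_abs, ← hθ] at h1
    have e2 : (θ : ℂ) * I * P.stream t (ξ, y) =
        (t : ℂ) * ((2 * π * ξ * I) * P.stream t (ξ, y)) := by
      rw [hθ]; push_cast; ring
    rw [e2] at h1
    have h2 : 1 ≤ θ ^ 2 := by rw [← sq_abs]; nlinarith
    have := P.N2_le ξ
    nlinarith [norm_nonneg (P.streamDeriv t (ξ, y) + (t : ℂ) * ((2 * π * ξ * I) * P.stream t (ξ, y)))]

theorem norm_streamLeading_le (t ξ : ℝ) {y : ℝ} (hy : y ∈ Icc (-1 : ℝ) 1) :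
    ‖P.streamLeading t (ξ, y)‖ ≤ P.N0 ξ / ((2 * π * ξ) ^ 2 * (1 + t ^ 2)) := by
  have h : |2 * π * ξ| ^ 2 + (2 * π * ξ * t) ^ 2 = (2 * π * ξ) ^ 2 * (1 + t ^ 2) := by
    rw [sq_abs]; ring
  rw [streamLeading, leading, norm_div, norm_neg, norm_mul, norm_osc, h, Complex.norm_real,
    Real.norm_of_nonneg (by positivity)]
  have := P.norm0 ξ y hy
  simp only [pow_zero, inv_one, mul_one]
  gcongr

theorem abs_le_abs_two_pi (ξ : ℝ) : |ξ| ≤ |2 * π * ξ| := by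
  rw [abs_mul, abs_of_pos Real.two_pi_pos]
  nlinarith [abs_nonneg ξ, Real.pi_gt_three]

/-- Bound of the symbol of `u²`, without the decay. -/
theorem norm_dx_stream_decay {t : ℝ} (ht : 1 ≤ t) (ξ : ℝ) {y : ℝ} (hy : y ∈ Icc (-1 : ℝ) 1) :
    ‖2 * π * ξ * I * P.stream t (ξ, y)‖ ≤
      76 * E * t⁻¹ * (1 + (2 * π * t * ξ) ^ 2)⁻¹ +
        (t ^ 2)⁻¹ * (P.N0 ξ + E * if (2 * π * t)⁻¹ ≤ |ξ| ∧ |ξ| ≤ 1 then |ξ|⁻¹ else 0) := by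
  have hE := P.size_nonneg
  have hN := P.N0_le ξ
  have hN0 := P.N0_nonneg ξ
  have ht0 : 0 < t := by linarith
  have e : 2 * π * t * ξ = 2 * π * ξ * t := by ring
  set X := ‖2 * π * ξ * I * P.stream t (ξ, y)‖ with hX
  have hXe : X = |2 * π * ξ| * ‖P.stream t (ξ, y)‖ := by rw [hX, norm_mul, norm_two_pi_I]
  have hJ : 0 ≤ if (2 * π * t)⁻¹ ≤ |ξ| ∧ |ξ| ≤ 1 then |ξ|⁻¹ else 0 := by
    split_ifs <;> positivity
  rw [e]
  set θ := 2 * π * ξ * t with hθ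
  have hθa : |θ| = |2 * π * ξ| * t := by rw [hθ, abs_mul, abs_of_pos ht0]
  rcases lt_or_ge |θ| 1 with h | h
  · have h2 : θ ^ 2 ≤ 1 := by rw [← sq_abs]; nlinarith [abs_nonneg θ]
    have h3 : X ≤ 4 * E * t⁻¹ := by
      rw [hXe, ← div_eq_mul_inv, le_div_iff₀ ht0]
      have := P.norm_stream_le t ξ hy
      calc _ = |θ| * ‖P.stream t (ξ, y)‖ := by rw [hθa]; ring
        _ ≤ 1 * (4 * E) := by gcongr; linarith
        _ = _ := one_mul _
    have h4 : 4 * E * t⁻¹ ≤ 76 * E * t⁻¹ * (1 + θ ^ 2)⁻¹ := by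
      rw [← div_eq_mul_inv (76 * E * t⁻¹), le_div_iff₀ (by positivity)]
      have : 0 ≤ E * t⁻¹ := by positivity
      nlinarith
    have h5 : 0 ≤ (t ^ 2)⁻¹ * (P.N0 ξ + E * if (2 * π * t)⁻¹ ≤ |ξ| ∧ |ξ| ≤ 1 then |ξ|⁻¹ else 0) := by
      positivity
    linarith
  · have h1 := (P.stream_decay h hy).1
    have hL := P.norm_streamLeading_le t ξ hy
    have hξ : ξ ≠ 0 := by rintro rfl; simp [hθ] at h; linarith
    have hκ := abs_two_pi_pos hξ
    set κ := |2 * π * ξ| with hκd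
    have hξκ : |ξ| ≤ κ := abs_le_abs_two_pi ξ
    have hξp : 0 < |ξ| := abs_pos.2 hξ
    have h2 : 1 ≤ θ ^ 2 := by rw [← sq_abs]; nlinarith
    have h3 : X ≤ κ * (38 * P.N2 ξ / |θ| ^ 3) + κ * (P.N0 ξ / ((2 * π * ξ) ^ 2 * (1 + t ^ 2))) := by
      rw [hXe, ← mul_add]
      gcongr
      calc ‖P.stream t (ξ, y)‖ = ‖(P.stream t (ξ, y) - P.streamLeading t (ξ, y)) + P.streamLeading t (ξ, y)‖ := by
            rw [sub_add_cancel]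
        _ ≤ _ := (norm_add_le _ _).trans (add_le_add h1 hL)
    have h4 : κ * (38 * P.N2 ξ / |θ| ^ 3) ≤ 76 * E * t⁻¹ * (1 + θ ^ 2)⁻¹ := by
      have e3 : κ * (38 * P.N2 ξ / |θ| ^ 3) = 38 * P.N2 ξ * t⁻¹ * (θ ^ 2)⁻¹ := by
        rw [← sq_abs θ, hθa]; field_simp
      rw [e3]
      have h6 : (θ ^ 2)⁻¹ ≤ 2 * (1 + θ ^ 2)⁻¹ := by
        rw [← div_eq_mul_inv, le_div_iff₀ (by positivity), inv_mul_le_iff₀ (by positivity)]; linarith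
      calc _ ≤ 38 * E * t⁻¹ * (2 * (1 + θ ^ 2)⁻¹) := by gcongr; exact P.N2_le ξ
        _ = _ := by ring
    have h5 : κ * (P.N0 ξ / ((2 * π * ξ) ^ 2 * (1 + t ^ 2))) ≤ (t ^ 2)⁻¹ * (P.N0 ξ * |ξ|⁻¹) := by
      have e3 : κ * (P.N0 ξ / ((2 * π * ξ) ^ 2 * (1 + t ^ 2))) = (1 + t ^ 2)⁻¹ * (P.N0 ξ * κ⁻¹) := by
        rw [← sq_abs (2 * π * ξ), ← hκd]; field_simp
      rw [e3]
      gcongr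
      linarith
    have h6 : P.N0 ξ * |ξ|⁻¹ ≤ P.N0 ξ + E * if (2 * π * t)⁻¹ ≤ |ξ| ∧ |ξ| ≤ 1 then |ξ|⁻¹ else 0 := by
      rcases le_total |ξ| 1 with h7 | h7
      · have h8 : (2 * π * t)⁻¹ ≤ |ξ| := by
          have hp := Real.pi_pos
          rw [inv_le_iff_one_le_mul₀ (by positivity)]
          rw [hθa, hκd, abs_mul, abs_of_pos Real.two_pi_pos] at h
          linarith
        rw [if_pos ⟨h8, h7⟩]
        have : P.N0 ξ * |ξ|⁻¹ ≤ E * |ξ|⁻¹ := by gcongr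
        linarith
      · have : |ξ|⁻¹ ≤ 1 := inv_le_one_of_one_le₀ h7
        have := mul_le_mul_of_nonneg_left this hN0
        have := mul_nonneg hE hJ
        linarith
    have h7 := mul_le_mul_of_nonneg_left h6 (show 0 ≤ (t ^ 2)⁻¹ by positivity)
    linarith

end Profile

theorem inv_le_two_mul_inv_one_add {t : ℝ} (ht : 1 ≤ t) : t⁻¹ ≤ 2 * (1 + t)⁻¹ := by
  rw [← div_eq_mul_inv, le_div_iff₀ (by positivity), inv_mul_le_iff₀ (by linarith)]; linarith

theorem freqInt_inv_one_add_sq_two_pi {t : ℝ} (ht : 0 < t) :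
    freqInt (fun ξ => (1 + (2 * π * t * ξ) ^ 2)⁻¹) ≤ ofReal (t⁻¹ / 2) := by
  have := Real.pi_pos
  refine (freqInt_inv_one_add_sq (c := 2 * π * t) (by positivity)).trans (le_of_eq ?_)
  congr 1; field_simp

/-- The symbol of `(∂_y + t ∂_x) φ` is `O(1/t)` in `L¹` of the frequency. -/
theorem exists_good_stream_envelope : ∃ C : ℝ, 0 < C ∧ ∀ {f : StripL2} {E : ℝ} (P : Profile f E) {t : ℝ},
    0 ≤ t → ∃ N : ℝ → ℝ, Measurable N ∧ (∀ ξ, ∀ y ∈ Icc (-1 : ℝ) 1,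
      ‖P.streamDeriv t (ξ, y) + (t : ℂ) * ((2 * π * ξ * I) * P.stream t (ξ, y))‖ ≤ N ξ) ∧
      freqInt N ≤ ofReal (C * (1 + t)⁻¹ * E) := by
  obtain ⟨A, hA, hA'⟩ := Profile.freqInt_envelopes_le
  refine ⟨100 + 8 * A, by positivity, fun {f E} P {t} ht => ?_⟩
  have hE := P.size_nonneg
  have m0 := P.measN0
  rcases le_total t 1 with h1 | h1
  · refine ⟨fun ξ => 4 * P.N0 ξ, by fun_prop, fun ξ y hy => ?_, ?_⟩
    · have h4 := P.norm_dx_stream_le t ξ hy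
      have h5 := P.norm_streamDeriv_le t ξ hy
      refine (norm_add_le _ _).trans ?_
      rw [norm_mul (t : ℂ), Complex.norm_real, Real.norm_of_nonneg ht]
      nlinarith [norm_nonneg (2 * π * ξ * I * P.stream t (ξ, y))]
    · rw [freqInt_const_mul (by norm_num)]
      refine (mul_le_mul_right (hA' P).1 _).trans ?_
      rw [← ENNReal.ofReal_mul (by norm_num)]
      refine ENNReal.ofReal_le_ofReal ?_
      have h2 : (1 / 2 : ℝ) ≤ (1 + t)⁻¹ := by
        rw [one_div]; exact inv_anti₀ (by positivity) (by linarith)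
      rw [← mul_assoc]
      exact mul_le_mul_of_nonneg_right (by nlinarith) hE
  · refine ⟨_, by fun_prop, fun ξ y hy => P.norm_good_stream_le ξ hy, ?_⟩
    rw [freqInt_const_mul (by positivity)]
    refine (mul_le_mul_right (freqInt_inv_one_add_sq_two_pi (by linarith)) _).trans ?_
    rw [← ENNReal.ofReal_mul (by positivity)]
    refine ENNReal.ofReal_le_ofReal ?_
    have h2 := inv_le_two_mul_inv_one_add h1
    have : 0 ≤ A * (1 + t)⁻¹ := by positivity
    calc _ = 50 * t⁻¹ * E := by ring
      _ ≤ _ := mul_le_mul_of_nonneg_right (by linarith) hE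

/-- The symbol of `u²` is `O(log t / t²)` in `L¹` of the frequency. -/
theorem exists_dx_stream_envelope : ∃ C : ℝ, 0 < C ∧ ∀ {f : StripL2} {E : ℝ} (P : Profile f E) {t : ℝ},
    0 ≤ t → ∃ N : ℝ → ℝ, Measurable N ∧ (∀ ξ, ∀ y ∈ Icc (-1 : ℝ) 1,
      ‖2 * π * ξ * I * P.stream t (ξ, y)‖ ≤ N ξ) ∧
      freqInt N ≤ ofReal (C * ((1 + t) ^ 2)⁻¹ * log (2 + t) * E) := by
  obtain ⟨A, hA, hA'⟩ := Profile.freqInt_envelopes_le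
  refine ⟨400 + 16 * A, by positivity, fun {f E} P {t} ht => ?_⟩
  have hE := P.size_nonneg
  have m0 := P.measN0
  have a0 := (hA' P).1
  have hlog : 1 / 2 ≤ log (2 + t) := by
    have h1 : log 2 ≤ log (2 + t) := Real.log_le_log two_pos (by linarith)
    linarith [Real.log_two_gt_d9]
  rcases le_total t 1 with h1 | h1
  · refine ⟨fun ξ => 2 * P.N0 ξ, by fun_prop, fun ξ y hy => P.norm_dx_stream_le t ξ hy, ?_⟩
    rw [freqInt_const_mul (by norm_num)]
    refine (mul_le_mul_right a0 _).trans ?_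
    rw [← ENNReal.ofReal_mul (by norm_num)]
    refine ENNReal.ofReal_le_ofReal ?_
    have h3 : (1 / 4 : ℝ) ≤ ((1 + t) ^ 2)⁻¹ := by
      rw [one_div]; exact inv_anti₀ (by positivity) (by nlinarith)
    have h4 : (1 / 8 : ℝ) ≤ ((1 + t) ^ 2)⁻¹ * log (2 + t) := by nlinarith
    rw [← mul_assoc]
    exact mul_le_mul_of_nonneg_right (by nlinarith) hE
  · have ht0 : 0 < t := by linarith
    have hpi := Real.pi_gt_three
    have h3 : (t ^ 2)⁻¹ ≤ 4 * ((1 + t) ^ 2)⁻¹ := by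
      rw [← inv_pow, ← inv_pow]
      have := inv_le_two_mul_inv_one_add h1
      have : 0 ≤ t⁻¹ := by positivity
      nlinarith
    have mr : Measurable fun ξ : ℝ => if (2 * π * t)⁻¹ ≤ |ξ| ∧ |ξ| ≤ 1 then |ξ|⁻¹ else 0 :=
      Measurable.ite (((measurable_norm (α := ℝ)) measurableSet_Icc :
        MeasurableSet ((‖·‖) ⁻¹' Icc (2 * π * t)⁻¹ 1))) (by fun_prop) measurable_const
    refine ⟨_, by fun_prop, fun ξ y hy => P.norm_dx_stream_decay h1 ξ hy, ?_⟩
    have ha1 : (2 * π * t)⁻¹ ≤ 1 := inv_le_one_of_one_le₀ (by nlinarith)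
    have hl0 : 0 ≤ log (2 * π * t) := Real.log_nonneg (by nlinarith)
    have h5 := freqInt_inv_abs_le (a := (2 * π * t)⁻¹) (by positivity) ha1
    rw [one_div, inv_inv] at h5
    have h6 : freqInt (fun ξ => P.N0 ξ + E * if (2 * π * t)⁻¹ ≤ |ξ| ∧ |ξ| ≤ 1 then |ξ|⁻¹ else 0) ≤
        ofReal (A * E + E * (2 * log (2 * π * t))) := by
      refine (freqInt_add_le m0).trans ?_
      rw [ENNReal.ofReal_add (by positivity) (by positivity), freqInt_const_mul hE, ENNReal.ofReal_mul (p := E) hE]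
      gcongr
    refine (freqInt_add_le (by fun_prop)).trans ?_
    rw [freqInt_const_mul (by positivity), freqInt_const_mul (by positivity)]
    refine (add_le_add (mul_le_mul_right (freqInt_inv_one_add_sq_two_pi ht0) _) (mul_le_mul_right h6 _)).trans ?_
    rw [← ENNReal.ofReal_mul (by positivity), ← ENNReal.ofReal_mul (by positivity),
      ← ENNReal.ofReal_add (by positivity) (by positivity)]
    refine ENNReal.ofReal_le_ofReal ?_
    have hl : log (2 * π * t) ≤ 5 * log (2 + t) := by
      have h6 : 2 * π * t ≤ (2 + t) ^ 5 := by
        have h7 : 2 * π * t ≤ 7 * t := by nlinarith [Real.pi_lt_d2]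
        have h8 : (3 : ℝ) ^ 4 ≤ (2 + t) ^ 4 := by gcongr; linarith
        nlinarith
      calc _ ≤ log ((2 + t) ^ 5) := Real.log_le_log (by positivity) h6
        _ = _ := by rw [Real.log_pow]; norm_num
    calc _ = E * ((t ^ 2)⁻¹ * (38 + A + 2 * log (2 * π * t))) := by
          rw [← inv_pow]; ring
      _ ≤ E * ((4 * ((1 + t) ^ 2)⁻¹) * ((100 + 4 * A) * log (2 + t))) := by
        refine mul_le_mul_of_nonneg_left (mul_le_mul h3 ?_ (by positivity) (by positivity)) hE
        nlinarith
      _ = _ := by ring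

/-- The inviscid damping of `u¹ - t u²` and of `u²`. -/
theorem exists_damping (hχ : IsCutoff χ) (hs : 0 ≤ s) : ∃ C : ℝ, 0 < C ∧
    ∀ {f : StripL2} {E : ℝ} (P : Profile f E) {ν t : ℝ} (hν : 0 < ν) (ht : 0 ≤ t),
    multNorm (weight χ s ν t) ∞ (((P.adm_streamDeriv t).decay hν.le ht).field -
        t • (-((P.adm_dx_stream t).decay hν.le ht).field)) ≤
      ofReal (C * (1 + t)⁻¹ * exp (-ν * t) * E) ∧
    multNorm (weight χ s ν t) ∞ (-((P.adm_dx_stream t).decay hν.le ht).field) ≤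
      ofReal (C * ((1 + t) ^ 2)⁻¹ * log (2 + t) * exp (-ν * t) * E) := by
  obtain ⟨C₁, hC₁, h₁⟩ := exists_good_stream_envelope
  obtain ⟨C₂, hC₂, h₂⟩ := exists_dx_stream_envelope
  have hW := weightConst_pos hs
  refine ⟨weightConst s * (C₁ + C₂), by positivity, fun {f E} P {ν t} hν ht => ?_⟩
  have hE := P.size_nonneg
  obtain ⟨N₁, -, b₁, i₁⟩ := h₁ P ht
  obtain ⟨N₂, -, b₂, i₂⟩ := h₂ P ht
  have hlog : 0 ≤ log (2 + t) := Real.log_nonneg (by linarith)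
  rw [neg_mul]
  refine ⟨(((P.adm_streamDeriv t).add ((P.adm_dx_stream t).const_mul (t : ℂ))).multNorm_weight_top_le_of_freqInt
      hχ hs hν.le ht (P.partialFT_good_stream hν.le ht) b₁ i₁).trans (ENNReal.ofReal_le_ofReal ?_),
    (((P.adm_dx_stream t).const_mul (-1)).multNorm_weight_top_le_of_freqInt hχ hs hν.le ht
      (P.partialFT_neg_dx_stream hν.le ht) (fun ξ y hy => ?_) i₂).trans (ENNReal.ofReal_le_ofReal ?_)⟩
  · calc _ = weightConst s * C₁ * (1 + t)⁻¹ * exp (-(ν * t)) * E := by ring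
      _ ≤ _ := by gcongr; linarith
  · rw [norm_mul, norm_neg, norm_one, one_mul]
    exact b₂ ξ y hy
  · calc _ = weightConst s * C₂ * ((1 + t) ^ 2)⁻¹ * log (2 + t) * exp (-(ν * t)) * E := by ring
      _ ≤ _ := by gcongr; linarith

end

/-! ### The truncated Hilbert transform of the data -/

theorem abs_integral_sin_div_le_one {c a b : ℝ} (hc : 0 < c) (ha : 0 < a) (hab : a ≤ b) (hb : c * b ≤ 1) :
    |∫ x in a..b, sin (c * x) / x| ≤ 1 := by
  have h := intervalIntegral.norm_integral_le_of_norm_le_const (a := a) (b := b) (C := c)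
    (f := fun x => sin (c * x) / x) (fun x hx => by
      rw [uIoc_of_le hab] at hx
      have hx0 : 0 < x := ha.trans hx.1
      rw [Real.norm_eq_abs, abs_div, abs_of_pos hx0, div_le_iff₀ hx0]
      refine Real.abs_sin_le_abs.trans ?_
      rw [abs_of_pos (by positivity)])
  rw [Real.norm_eq_abs, abs_of_nonneg (sub_nonneg.2 hab)] at h
  nlinarith

theorem abs_integral_sin_div_le_two {c a b : ℝ} (hc : 0 < c) (ha : 0 < a) (hab : a ≤ b) (hca : 1 ≤ c * a) :
    |∫ x in a..b, sin (c * x) / x| ≤ 2 := by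
  have hne : ∀ x ∈ uIcc a b, x ≠ 0 := fun x hx => by
    rw [uIcc_of_le hab] at hx; exact (ha.trans_le hx.1).ne'
  have hF : ∀ x ∈ uIcc a b, HasDerivAt (fun x => -cos (c * x) / (c * x))
      (sin (c * x) / x + cos (c * x) / (c * x ^ 2)) x := fun x hx => by
    have hx0 := hne x hx
    have h1 : HasDerivAt (fun x => c * x) c x := by simpa using (hasDerivAt_id x).const_mul c
    refine (h1.cos.neg.div h1 (mul_ne_zero hc.ne' hx0)).congr_deriv ?_
    simp only [Pi.neg_apply]
    field_simp
    ring
  have hc1 : ContinuousOn (fun x => sin (c * x) / x) (uIcc a b) :=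
    ContinuousOn.div (by fun_prop) continuousOn_id hne
  have hc2 : ContinuousOn (fun x => cos (c * x) / (c * x ^ 2)) (uIcc a b) :=
    ContinuousOn.div (by fun_prop) (by fun_prop) fun x hx =>
      mul_ne_zero hc.ne' (pow_ne_zero 2 (hne x hx))
  have hc3 : ContinuousOn (fun x => c⁻¹ * (x ^ 2)⁻¹) (uIcc a b) :=
    continuousOn_const.mul (ContinuousOn.inv₀ (by fun_prop) fun x hx => pow_ne_zero 2 (hne x hx))
  have h := intervalIntegral.integral_eq_sub_of_hasDerivAt hF
    (hc1.add hc2).intervalIntegrable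
  rw [intervalIntegral.integral_add hc1.intervalIntegrable hc2.intervalIntegrable] at h
  have hb := ha.trans_le hab
  have h3 : |∫ x in a..b, cos (c * x) / (c * x ^ 2)| ≤ c⁻¹ * (a⁻¹ - b⁻¹) := by
    have h4 : ∫ x in a..b, c⁻¹ * (x ^ 2)⁻¹ = c⁻¹ * (a⁻¹ - b⁻¹) := by
      rw [intervalIntegral.integral_eq_sub_of_hasDerivAt (f := fun x => -(c⁻¹ * x⁻¹)) (fun x hx => by
        refine ((hasDerivAt_inv (hne x hx)).const_mul c⁻¹).neg.congr_deriv (by ring)) hc3.intervalIntegrable]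
      ring
    rw [← h4, ← Real.norm_eq_abs]
    refine intervalIntegral.norm_integral_le_of_norm_le hab (Eventually.of_forall fun x hx => ?_)
      hc3.intervalIntegrable
    have hx0 : 0 < x := ha.trans hx.1
    rw [Real.norm_eq_abs, abs_div, abs_of_pos (by positivity : 0 < c * x ^ 2), ← mul_inv,
      ← one_div]
    gcongr
    exact Real.abs_cos_le_one _
  have h5 : ∀ x, 0 < x → |-cos (c * x) / (c * x)| ≤ c⁻¹ * x⁻¹ := fun x hx => by
    rw [abs_div, abs_neg, abs_of_pos (by positivity : 0 < c * x), ← mul_inv,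
      ← one_div]
    gcongr
    exact Real.abs_cos_le_one _
  have h6 := h5 a ha
  have h7 := h5 b hb
  have h8 : c⁻¹ * a⁻¹ ≤ 1 := by rw [← mul_inv]; exact inv_le_one_of_one_le₀ hca
  rw [abs_le] at h3 h6 h7 ⊢
  constructor <;> linarith [h3.1, h3.2, h6.1, h6.2, h7.1, h7.2]

/-- The truncated sine integrals are uniformly bounded. -/
theorem abs_integral_sin_div_le (c : ℝ) {a b : ℝ} (ha : 0 < a) (hab : a ≤ b) :
    |∫ x in a..b, sin (c * x) / x| ≤ 3 := by
  have pos : ∀ c : ℝ, 0 < c → |∫ x in a..b, sin (c * x) / x| ≤ 3 := fun c hc => by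
    rcases le_total (c * b) 1 with h | h
    · exact (abs_integral_sin_div_le_one hc ha hab h).trans (by norm_num)
    rcases le_total 1 (c * a) with h' | h'
    · exact (abs_integral_sin_div_le_two hc ha hab h').trans (by norm_num)
    have h1 : a ≤ c⁻¹ := by rw [← one_div, le_div_iff₀ hc]; linarith
    have h2 : c⁻¹ ≤ b := by rw [inv_le_iff_one_le_mul₀ hc]; linarith
    have hi : ∀ u v : ℝ, a ≤ u → u ≤ v → IntervalIntegrable (fun x => sin (c * x) / x) volume u v :=
      fun u v hu huv => (ContinuousOn.div (by fun_prop) continuousOn_id fun x hx => by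
        rw [uIcc_of_le huv] at hx
        exact (ha.trans_le (hu.trans hx.1)).ne').intervalIntegrable
    rw [← intervalIntegral.integral_add_adjacent_intervals (hi a c⁻¹ le_rfl h1) (hi c⁻¹ b h1 h2)]
    have h3 := abs_integral_sin_div_le_one hc ha h1 (mul_inv_cancel₀ hc.ne').le
    have h4 := abs_integral_sin_div_le_two hc (inv_pos.2 hc) h2 (mul_inv_cancel₀ hc.ne').ge
    exact (abs_add_le _ _).trans (by linarith)
  rcases lt_trichotomy c 0 with h | rfl | h
  · have := pos (-c) (by linarith)
    simpa [neg_mul, neg_div] using this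
  · simp
  · exact pos c h

/-- `1/ξ`, truncated to `a ≤ |ξ| ≤ b`. -/
def truncInv (a b ξ : ℝ) : ℝ := if a ≤ |ξ| ∧ |ξ| ≤ b then ξ⁻¹ else 0

theorem measurable_truncInv (a b : ℝ) : Measurable (truncInv a b) :=
  Measurable.ite (((measurable_norm (α := ℝ)) measurableSet_Icc : MeasurableSet ((‖·‖) ⁻¹' Icc a b)))
    measurable_inv measurable_const

theorem abs_truncInv_le {a : ℝ} (ha : 0 < a) (b ξ : ℝ) : |truncInv a b ξ| ≤ a⁻¹ := by
  unfold truncInv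
  split_ifs with h
  · rw [abs_inv]; exact inv_anti₀ ha h.1
  · rw [abs_zero]; positivity

theorem integrable_truncInv {a : ℝ} (ha : 0 < a) (b : ℝ) : Integrable (truncInv a b) := by
  have h1 : Integrable ((Icc (-b) b).indicator fun _ : ℝ => a⁻¹) :=
    (integrable_indicator_iff measurableSet_Icc).2 (by simp)
  refine h1.mono' (measurable_truncInv a b).aestronglyMeasurable (Eventually.of_forall fun ξ => ?_)
  by_cases h : ξ ∈ Icc (-b) b
  · rw [indicator_of_mem h]; exact abs_truncInv_le ha b ξ
  · rw [indicator_of_notMem h, truncInv, if_neg fun h' => h (abs_le.1 h'.2), norm_zero]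

/-- The truncated Hilbert transform kernel is uniformly bounded. -/
theorem norm_integral_truncInv_mul_exp_le {a : ℝ} (ha : 0 < a) (b c : ℝ) :
    ‖∫ ξ, (truncInv a b ξ : ℂ) * Complex.exp ((c * ξ : ℝ) * I)‖ ≤ 6 := by
  rcases lt_or_ge b a with hba | hab
  · have : ∀ ξ, truncInv a b ξ = 0 := fun ξ => if_neg fun h => by linarith [h.1, h.2]
    simp [this]
  set g : ℝ → ℂ := fun ξ => (truncInv a b ξ : ℂ) * Complex.exp ((c * ξ : ℝ) * I) with hg
  have hgi : Integrable g := (integrable_truncInv ha b).ofReal.mul_bdd (c := 1)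
    (by fun_prop : Measurable fun ξ : ℝ => Complex.exp ((c * ξ : ℝ) * I)).aestronglyMeasurable
    (Eventually.of_forall fun ξ => by rw [Complex.norm_exp_ofReal_mul_I])
  set h : ℝ → ℝ := (Icc a b).indicator fun x => sin (c * x) / x with hh
  have h1 : ∀ ξ, g ξ + g (-ξ) = 2 * I * (h |ξ| : ℂ) := fun ξ => by
    have e1 : truncInv a b (-ξ) = - truncInv a b ξ := by
      unfold truncInv; rw [abs_neg]; split_ifs <;> simp [inv_neg]
    have e2 : h |ξ| = truncInv a b ξ * sin (c * ξ) := by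
      by_cases hξ : |ξ| ∈ Icc a b
      · rw [hh, indicator_of_mem hξ, truncInv, if_pos (mem_Icc.1 hξ)]
        rcases abs_cases ξ with ⟨e, _⟩ | ⟨e, _⟩ <;> rw [e]
        · ring
        · rw [mul_neg, Real.sin_neg, neg_div_neg_eq]; ring
      · rw [hh, indicator_of_notMem hξ, truncInv, if_neg fun h => hξ (mem_Icc.2 h), zero_mul]
    simp only [hg, e1, e2]
    rw [Complex.exp_mul_I, Complex.exp_mul_I]
    push_cast
    rw [mul_neg, Complex.cos_neg, Complex.sin_neg]
    ring
  have h2 : 2 * ∫ ξ, g ξ = 2 * I * ((2 * ∫ x in a..b, sin (c * x) / x : ℝ) : ℂ) := by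
    have e := integral_neg_eq_self g volume
    have e2 : 2 * ∫ ξ, g ξ = ∫ ξ, (g ξ + g (-ξ)) := by
      rw [integral_add hgi hgi.comp_neg, e, two_mul]
    rw [e2]
    simp only [h1]
    rw [integral_const_mul]
    congr 1
    rw [integral_complex_ofReal]
    congr 1
    rw [integral_comp_abs]
    congr 1
    rw [hh, setIntegral_indicator measurableSet_Icc, inter_eq_right.2 (show Icc a b ⊆ Ioi 0 from fun x hx => ha.trans_le hx.1),
      integral_Icc_eq_integral_Ioc, intervalIntegral.integral_of_le hab]
  have h3 := abs_integral_sin_div_le c ha hab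
  have h4 : ‖2 * ∫ ξ, g ξ‖ = 2 * (2 * |∫ x in a..b, sin (c * x) / x|) := by
    rw [h2, norm_mul, norm_mul, Complex.norm_I, Complex.norm_real, Real.norm_eq_abs, abs_mul]
    simp
  rw [norm_mul, Complex.norm_ofNat] at h4
  linarith

theorem FreqAdm.eLpNorm_field_add_le {F G : ℝ × ℝ → ℂ} (hF : FreqAdm F) (hG : FreqAdm G) {p : ℝ≥0∞}
    (hp : 1 ≤ p) : eLpNorm (hF.add hG).field p stripMeasure ≤
      eLpNorm hF.field p stripMeasure + eLpNorm hG.field p stripMeasure := by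
  have e : (hF.field + hG.field : StripL2) = (hF.add hG).field :=
    FreqAdm.field_eq _ ((hF.partialFT_field.add hG.partialFT_field).congr (Lp.coeFn_add _ _).symm
      (EventuallyEq.refl _ _))
  rw [← e, eLpNorm_congr_ae (Lp.coeFn_add _ _)]
  exact eLpNorm_add_le (Lp.aestronglyMeasurable _) (Lp.aestronglyMeasurable _) hp

namespace Profile

variable {f : StripL2} {E : ℝ} (P : Profile f E)

theorem adm_truncInv_source {a : ℝ} (ha : 0 < a) (b t : ℝ) :
    FreqAdm fun p => (truncInv a b p.1 : ℂ) * P.source t p := by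
  have := measurable_truncInv a b
  exact (P.adm_source t).bdd_mul (m := fun p => (truncInv a b p.1 : ℂ)) (by fun_prop) (C := a⁻¹)
    fun p _ => by rw [Complex.norm_real]; exact abs_truncInv_le ha b p.1

/-- The truncated Hilbert transform of the data is bounded, because the data are in `L¹` in `x`. -/
theorem eLpNorm_truncInv_source_le {a : ℝ} (ha : 0 < a) (b t : ℝ) :
    eLpNorm (P.adm_truncInv_source ha b t).field ∞ stripMeasure ≤ ofReal (6 * E) := by
  have key : ∀ᵐ p ∂stripMeasure, ‖invFT (fun p => (truncInv a b p.1 : ℂ) * P.source t p) p‖ ≤ 6 * E := by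
    refine ae_strip_of_ae_section ?_
    filter_upwards [P.slices] with y ⟨u, hu, huE, hgu⟩ x
    set β : ℝ → ℂ := fun ξ => (truncInv a b ξ : ℂ) *
      Complex.exp ((2 * π * (x - t * y) * ξ : ℝ) * I) with hβ
    have hβi : Integrable β := (integrable_truncInv ha b).ofReal.mul_bdd (c := 1)
      (by fun_prop : Measurable fun ξ : ℝ => Complex.exp ((2 * π * (x - t * y) * ξ : ℝ) * I)).aestronglyMeasurable
      (Eventually.of_forall fun ξ => by rw [Complex.norm_exp_ofReal_mul_I])
    have e1 : invFT (fun p => (truncInv a b p.1 : ℂ) * P.source t p) (x, y) = ∫ ξ, β ξ * 𝓕 u ξ := by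
      rw [invFT, Real.fourierInv_eq']
      refine integral_congr_ae (Eventually.of_forall fun ξ => ?_)
      simp only [source, hgu ξ, hβ, osc, pow_zero, one_mul, smul_eq_mul]
      rw [show ((2 * π * (x - t * y) * ξ : ℝ) : ℂ) * I =
        ((2 * π * inner ℝ ξ x : ℝ) : ℂ) * I + -((2 * π * ξ * t * y : ℝ) : ℂ) * I by
          simp only [RCLike.inner_apply, conj_trivial]; push_cast; ring, Complex.exp_add]
      ring
    rw [e1, integral_fourier_mul hu hβi]
    have h1 : ∀ x', ‖𝓕 β x'‖ ≤ 6 := fun x' => by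
      rw [Real.fourier_eq']
      refine (le_of_eq (congrArg norm (integral_congr_ae (Eventually.of_forall fun ξ => ?_)))).trans
        (norm_integral_truncInv_mul_exp_le ha b (2 * π * (x - t * y - x')))
      simp only [hβ, smul_eq_mul]
      rw [show ((2 * π * (x - t * y - x') * ξ : ℝ) : ℂ) * I =
        ((-2 * π * inner ℝ ξ x' : ℝ) : ℂ) * I + ((2 * π * (x - t * y) * ξ : ℝ) : ℂ) * I by
          simp only [RCLike.inner_apply, conj_trivial]; push_cast; ring, Complex.exp_add]
      ring
    calc _ ≤ ∫ x', 6 * ‖u x'‖ := norm_integral_le_of_norm_le (hu.norm.const_mul 6)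
          (Eventually.of_forall fun x' => by
            rw [norm_mul]; exact mul_le_mul_of_nonneg_right (h1 x') (norm_nonneg _))
      _ = 6 * ∫ x', ‖u x'‖ := integral_const_mul _ _
      _ ≤ _ := by gcongr
  rw [eLpNorm_congr_ae (FreqAdm.field_ae_eq _), eLpNorm_exponent_top]
  exact eLpNormEssSup_le_of_ae_bound key

end Profile

/-! ### Inviscid damping of `u¹` -/

section

variable {χ : ℝ → ℝ} {s : ℝ}

/-- The weighted Gaussian is close to a sharp cut-off at `ν t³ k² = 1`. -/
theorem abs_weightedDecay_sub_truncInv_le (hχ : IsCutoff χ) (hs : 0 ≤ s) : ∃ D : ℝ, 0 < D ∧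
    ∀ {ν t : ℝ}, 0 < ν → 0 < t → ∀ ξ : ℝ, (2 * π * t)⁻¹ ≤ |ξ| →
    |weightedDecay χ s ν t ξ * ξ⁻¹ -
      exp (-(ν * t)) * truncInv (2 * π * t)⁻¹ (2 * π * sqrt (ν * t ^ 3))⁻¹ ξ| ≤
      D * exp (-(ν * t)) * ((ν * t ^ 3) ^ (1 / 3 : ℝ) *
        (|ξ| ^ (-(1 / 3) : ℝ) * exp (-(ν * t ^ 3 * ξ ^ 2)))) := by
  have hW := weightConst_pos hs
  set B := 2 * s * exp (2 * s) + 1 with hB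
  have hB0 : 0 < B := by positivity
  refine ⟨(B * exp 1 + weightConst s) * 7, by positivity, fun {ν t} hν ht ξ hξ => ?_⟩
  have hpi := Real.pi_pos
  have hξ0 : 0 < |ξ| := (by positivity : 0 < (2 * π * t)⁻¹).trans_le hξ
  set τ := ν * t ^ 3 with hτ
  have hτ0 : 0 < τ := by positivity
  set k := 2 * π * ξ with hk
  set r := (τ * k ^ 2) ^ (1 / 3 : ℝ) with hr
  have hr0 : 0 ≤ r := by positivity
  have hk2 : τ * k ^ 2 = (2 * π * sqrt τ * |ξ|) ^ 2 := by
    rw [mul_pow _ |ξ|, mul_pow _ (sqrt τ), Real.sq_sqrt hτ0.le, sq_abs, hk]; ring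
  have hr1 : r * |ξ|⁻¹ ≤ 7 * (τ ^ (1 / 3 : ℝ) * |ξ| ^ (-(1 / 3) : ℝ)) := by
    have e1 : r = τ ^ (1 / 3 : ℝ) * ((2 * π) ^ (2 / 3 : ℝ) * |ξ| ^ (2 / 3 : ℝ)) := by
      rw [hr, Real.mul_rpow hτ0.le (by positivity), ← sq_abs, ← Real.rpow_natCast, ← Real.rpow_mul (abs_nonneg _),
        hk, abs_mul, abs_of_pos Real.two_pi_pos, Real.mul_rpow Real.two_pi_pos.le (abs_nonneg _)]
      norm_num
    have e2 : |ξ| ^ (2 / 3 : ℝ) * |ξ|⁻¹ = |ξ| ^ (-(1 / 3) : ℝ) := by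
      rw [← Real.rpow_neg_one, ← Real.rpow_add hξ0]; norm_num
    have e3 : (2 * π) ^ (2 / 3 : ℝ) ≤ 7 := by
      calc (2 * π) ^ (2 / 3 : ℝ) ≤ (2 * π) ^ (1 : ℝ) :=
            Real.rpow_le_rpow_of_exponent_le (by linarith [Real.pi_gt_three]) (by norm_num)
        _ ≤ 7 := by rw [Real.rpow_one]; linarith [Real.pi_lt_d2]
    rw [e1]
    calc _ = (2 * π) ^ (2 / 3 : ℝ) * (τ ^ (1 / 3 : ℝ) * (|ξ| ^ (2 / 3 : ℝ) * |ξ|⁻¹)) := by ring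
      _ ≤ _ := by rw [e2]; gcongr
  have hd : weightedDecay χ s ν t ξ =
      exp (-(ν * t)) * (weight χ s ν t k * exp (-(τ * k ^ 2 / 3))) := by
    rw [weightedDecay, decay, sub_eq_add_neg, Real.exp_add]; ring
  have main : |weightedDecay χ s ν t ξ -
      exp (-(ν * t)) * (if τ * k ^ 2 ≤ 1 then 1 else 0)| ≤
      exp (-(ν * t)) * ((B * exp 1 + weightConst s) * r * exp (-(τ * ξ ^ 2))) := by
    split_ifs with h
    · rw [hd, ← mul_sub, abs_mul, abs_of_pos (Real.exp_pos _)]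
      have h1 := abs_weight_mul_exp_sub_one_le hχ hs hν.le ht.le k h
      refine mul_le_mul_of_nonneg_left (h1.trans ?_) (Real.exp_pos _).le
      have h2 : τ * ξ ^ 2 ≤ 1 := by
        have : τ * ξ ^ 2 ≤ τ * k ^ 2 := by
          rw [← sq_abs ξ, ← sq_abs k]
          have := Profile.abs_le_abs_two_pi ξ
          gcongr
        linarith
      have h3 : 1 ≤ exp 1 * exp (-(τ * ξ ^ 2)) := by
        rw [← Real.exp_add]; exact Real.one_le_exp (by linarith)
      calc B * r ≤ B * r * (exp 1 * exp (-(τ * ξ ^ 2))) := le_mul_of_one_le_right (by positivity) h3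
        _ = (B * exp 1) * r * exp (-(τ * ξ ^ 2)) := by ring
        _ ≤ _ := by gcongr; linarith
    · rw [mul_zero, sub_zero, abs_of_nonneg (weightedDecay_nonneg hχ hs hν.le ht.le ξ)]
      refine (weightedDecay_le hχ hs hν.le ht.le ξ).trans ?_
      have h1 : 1 ≤ r := Real.one_le_rpow (not_le.1 h).le (by norm_num)
      calc _ = exp (-(ν * t)) * (weightConst s * 1 * exp (-(τ * ξ ^ 2))) := by ring
        _ ≤ _ := by gcongr; linarith [mul_pos hB0 (Real.exp_pos 1)]
  have htr : truncInv (2 * π * t)⁻¹ (2 * π * sqrt τ)⁻¹ ξ =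
      (if τ * k ^ 2 ≤ 1 then 1 else 0) * ξ⁻¹ := by
    have : |ξ| ≤ (2 * π * sqrt τ)⁻¹ ↔ τ * k ^ 2 ≤ 1 := by
      have hq : 0 < 2 * π * sqrt τ := by have := Real.sqrt_pos.2 hτ0; positivity
      rw [hk2, sq_le_one_iff₀ (by positivity), le_inv_comm₀ hξ0 hq, ← one_div, le_div_iff₀ hξ0]
    simp only [truncInv, hξ, true_and, this]
    split_ifs <;> simp
  rw [htr, ← mul_assoc, ← sub_mul, abs_mul, abs_inv]
  calc _ ≤ exp (-(ν * t)) * ((B * exp 1 + weightConst s) * r * exp (-(τ * ξ ^ 2))) * |ξ|⁻¹ := by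
        gcongr
    _ = exp (-(ν * t)) * (B * exp 1 + weightConst s) * exp (-(τ * ξ ^ 2)) * (r * |ξ|⁻¹) := by ring
    _ ≤ exp (-(ν * t)) * (B * exp 1 + weightConst s) * exp (-(τ * ξ ^ 2)) *
        (7 * (τ ^ (1 / 3 : ℝ) * |ξ| ^ (-(1 / 3) : ℝ))) := by gcongr
    _ = _ := by ring

namespace Profile

variable {f : StripL2} {E : ℝ} (P : Profile f E)

/-- The coefficient of the leading part of the symbol of `u¹` at large times. -/
def leadingCoeff (t : ℝ) : ℂ := ((t / (2 * π * (1 + t ^ 2)) : ℝ) : ℂ) * I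

theorem norm_leadingCoeff_le {t : ℝ} (ht : 0 < t) : ‖leadingCoeff t‖ ≤ t⁻¹ := by
  have hpi := Real.pi_gt_three
  rw [leadingCoeff, norm_mul, Complex.norm_I, mul_one, Complex.norm_real, Real.norm_of_nonneg (by positivity),
    div_le_iff₀ (by positivity)]
  have : t⁻¹ * (2 * π * (1 + t ^ 2)) = 2 * π * t⁻¹ + 2 * π * t := by field_simp
  rw [this]
  have : 0 < t⁻¹ := by positivity
  nlinarith

/-- At large times `∂_y ψ` is the Hilbert transform part plus an integrable remainder. -/
theorem norm_streamDeriv_sub_le {t : ℝ} (ht : 0 < t) {ξ : ℝ} (h : 1 ≤ |2 * π * ξ * t|) {y : ℝ}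
    (hy : y ∈ Icc (-1 : ℝ) 1) :
    ‖P.streamDeriv t (ξ, y) - leadingCoeff t * (ξ⁻¹ : ℝ) * P.source t (ξ, y)‖ ≤
      176 * E * (1 + (2 * π * t * ξ) ^ 2)⁻¹ := by
  have hE := P.size_nonneg
  obtain ⟨h1, h2⟩ := P.stream_decay h hy
  have e : 2 * π * t * ξ = 2 * π * ξ * t := by ring
  have hξ : ξ ≠ 0 := by rintro rfl; norm_num at h
  have hN2 := P.N2_le ξ
  rw [e, ← div_eq_mul_inv]
  set θ := 2 * π * ξ * t with hθ
  have hθ0 : 0 < |θ| := by linarith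
  have e1 : P.streamDeriv t (ξ, y) - leadingCoeff t * (ξ⁻¹ : ℝ) * P.source t (ξ, y) =
      (P.streamDeriv t (ξ, y) + (θ : ℂ) * I * P.stream t (ξ, y)) -
        (θ : ℂ) * I * (P.stream t (ξ, y) - P.streamLeading t (ξ, y)) := by
    have e2 : (θ : ℂ) * I * P.streamLeading t (ξ, y) =
        -(leadingCoeff t * (ξ⁻¹ : ℝ) * P.source t (ξ, y)) := by
      have h3 : |2 * π * ξ| ^ 2 + θ ^ 2 = (2 * π * ξ) ^ 2 * (1 + t ^ 2) := by
        rw [sq_abs, hθ]; ring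
      have hξc : (ξ : ℂ) ≠ 0 := by exact_mod_cast hξ
      have hpc : (π : ℂ) ≠ 0 := by exact_mod_cast Real.pi_ne_zero
      have htc : (1 + (t : ℂ) ^ 2) ≠ 0 := by
        have : (1 + t ^ 2 : ℝ) ≠ 0 := by positivity
        exact_mod_cast this
      simp only [streamLeading, leading, leadingCoeff, source]
      rw [← hθ, h3]
      simp only [hθ]
      push_cast
      field_simp
    linear_combination -e2
  rw [e1, le_div_iff₀ (by positivity)]
  have h3 : ‖(θ : ℂ) * I * (P.stream t (ξ, y) - P.streamLeading t (ξ, y))‖ ≤ 38 * E / |θ| ^ 2 := by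
    rw [norm_mul, norm_mul, Complex.norm_I, mul_one, Complex.norm_real, Real.norm_eq_abs]
    calc _ ≤ |θ| * (38 * P.N2 ξ / |θ| ^ 3) := by gcongr
      _ = 38 * P.N2 ξ / |θ| ^ 2 := by field_simp
      _ ≤ _ := by gcongr
  have h4 : 50 * P.N2 ξ / |θ| ^ 2 ≤ 50 * E / |θ| ^ 2 := by gcongr
  have h5 := (norm_sub_le (P.streamDeriv t (ξ, y) + (θ : ℂ) * I * P.stream t (ξ, y))
    ((θ : ℂ) * I * (P.stream t (ξ, y) - P.streamLeading t (ξ, y)))).trans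
    (add_le_add (h2.trans h4) h3)
  rw [← add_div, le_div_iff₀ (by positivity), sq_abs] at h5
  have h6 : 1 ≤ θ ^ 2 := by rw [← sq_abs]; nlinarith
  nlinarith [norm_nonneg (P.streamDeriv t (ξ, y) + (θ : ℂ) * I * P.stream t (ξ, y) -
    (θ : ℂ) * I * (P.stream t (ξ, y) - P.streamLeading t (ξ, y)))]

end Profile

/-- The inviscid damping of `u¹`. The symbol of `u¹` is only `O(1 / (t |k|))` for `|k| ≥ 1/t`, so that
absolute values would lose a logarithm. The leading part is a truncated Hilbert transform of data that are
`L¹` in `x`, up to the frequency `(ν t³)^{-1/2}`, hence bounded; the remainder is integrable in `k`. -/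
theorem exists_damping_horizontal (hχ : IsCutoff χ) (hs : 0 ≤ s) : ∃ C : ℝ, 0 < C ∧
    ∀ {f : StripL2} {E : ℝ} (P : Profile f E) {ν t : ℝ} (hν : 0 < ν) (ht : 0 ≤ t),
    multNorm (weight χ s ν t) ∞ ((P.adm_streamDeriv t).decay hν.le ht).field ≤
      ofReal (C * (1 + t)⁻¹ * exp (-ν * t) * E) := by
  obtain ⟨D, hD, hD'⟩ := abs_weightedDecay_sub_truncInv_le hχ hs
  obtain ⟨K, hK, hK'⟩ := freqInt_rpow_mul_gaussian (q := -(1 / 3)) (by norm_num)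
  have hW := weightConst_pos hs
  set W := weightConst s with hWdef
  obtain ⟨A, hA, hA'⟩ := Profile.freqInt_envelopes_le
  refine ⟨2 * (88 * W + D * K + 6) + 4 * A * W, by positivity, fun {f E} P {ν t} hν ht => ?_⟩
  have hE := P.size_nonneg
  rcases le_total t 1 with h1 | h1
  · refine ((P.adm_streamDeriv t).multNorm_weight_top_le_of_freqInt hχ hs hν.le ht
      ((P.adm_streamDeriv t).decay hν.le ht).partialFT_field (N := fun ξ => 2 * P.N0 ξ) (A := 2 * (A * E))
      (fun ξ y hy => P.norm_streamDeriv_le t ξ hy) ?_).trans (ENNReal.ofReal_le_ofReal ?_)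
    · rw [freqInt_const_mul two_pos.le, ENNReal.ofReal_mul two_pos.le]
      exact mul_le_mul_right (hA' P).1 _
    · have h2 : 1 ≤ 2 * (1 + t)⁻¹ := by rw [← div_eq_mul_inv, le_div_iff₀ (by positivity)]; linarith
      rw [neg_mul]
      calc _ = 2 * A * W * 1 * exp (-(ν * t)) * E := by rw [hWdef]; ring
        _ ≤ 2 * A * W * (2 * (1 + t)⁻¹) * exp (-(ν * t)) * E := by gcongr
        _ = 4 * A * W * (1 + t)⁻¹ * exp (-(ν * t)) * E := by ring
        _ ≤ _ := by gcongr; linarith [show 0 ≤ 2 * (88 * W + D * K + 6) by positivity]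
  have ht0 : 0 < t := by linarith
  have hpi := Real.pi_pos
  have hτ : 0 < ν * t ^ 3 := by positivity
  rw [neg_mul]
  set a := (2 * π * t)⁻¹ with ha
  have ha0 : 0 < a := by positivity
  set b := (2 * π * sqrt (ν * t ^ 3))⁻¹ with hb
  -- The Hilbert transform part is `c · truncInv a b · source`: the lower cut-off `
  -- k
  --  t = 1` is where
  -- `norm_streamDeriv_sub_le` starts to hold, the upper one is the dissipative frequency.
  set c : ℂ := (exp (-(ν * t)) : ℂ) * Profile.leadingCoeff t with hc
  have hL := P.adm_truncInv_source ha0 b t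
  have hcn : ‖c‖ ≤ exp (-(ν * t)) * t⁻¹ := by
    rw [hc, norm_mul, Complex.norm_real, Real.norm_of_nonneg (Real.exp_pos _).le]
    gcongr
    exact Profile.norm_leadingCoeff_le ht0
  have hR : FreqAdm fun p => (weightedDecay χ s ν t p.1 : ℂ) * P.streamDeriv t p +
      -c * ((truncInv a b p.1 : ℂ) * P.source t p) :=
    ((P.adm_streamDeriv t).weightedDecay hχ hs hν.le ht).add (hL.const_mul (-c))
  have hH := hR.add (hL.const_mul c)
  have h2 := inv_le_two_mul_inv_one_add h1
  have m1 : multNorm (weight χ s ν t) ∞ ((P.adm_streamDeriv t).decay hν.le ht).field ≤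
      eLpNorm hH.field ∞ stripMeasure :=
    multNorm_le ((P.adm_streamDeriv t).decay hν.le ht).partialFT_field hH fun p => by
      simp only [weightedDecay]; push_cast; ring
  have m2 : eLpNorm (hL.const_mul c).field ∞ stripMeasure ≤
      ofReal (exp (-(ν * t)) * t⁻¹ * (6 * E)) := by
    have e : (c • hL.field : StripL2) = (hL.const_mul c).field :=
      FreqAdm.field_eq _ ((hL.partialFT_field.const_mul c).congr (Lp.coeFn_smul c hL.field).symm
        (EventuallyEq.refl _ _))
    rw [← e, eLpNorm_congr_ae (Lp.coeFn_smul c hL.field), eLpNorm_const_smul, ENNReal.ofReal_mul (by positivity),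
      ← ofReal_norm]
    exact mul_le_mul' (ENNReal.ofReal_le_ofReal hcn) (P.eLpNorm_truncInv_source_le ha0 b t)
  set N₁ : ℝ → ℝ := fun ξ => (1 + (2 * π * t * ξ) ^ 2)⁻¹ with hN₁
  set N₂ : ℝ → ℝ := fun ξ => |ξ| ^ (-(1 / 3) : ℝ) * exp (-(ν * t ^ 3 * ξ ^ 2)) with hN₂
  have hN₁m : Measurable N₁ := by fun_prop
  have i1 : freqInt N₁ ≤ ofReal (t⁻¹ / 2) := freqInt_inv_one_add_sq_two_pi ht0
  have i2 : freqInt N₂ ≤ ofReal (K * (ν * t ^ 3) ^ (-(1 / 3) : ℝ)) :=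
    (hK' _ hτ).trans_eq (by norm_num)
  have m3 : eLpNorm hR.field ∞ stripMeasure ≤
      ofReal (exp (-(ν * t)) * E * (176 * W * (t⁻¹ / 2) + D * K * t⁻¹)) := by
    set c₁ := exp (-(ν * t)) * E * (176 * W) with hc₁
    set c₂ := exp (-(ν * t)) * E * (D * t⁻¹ * (ν * t ^ 3) ^ (1 / 3 : ℝ)) with hc₂
    have hc₁0 : 0 ≤ c₁ := by positivity
    have hc₂0 : 0 ≤ c₂ := by positivity
    have hN₂0 : ∀ ξ, 0 ≤ N₂ ξ := fun ξ => by positivity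
    have hN₁0 : ∀ ξ, 0 ≤ N₁ ξ := fun ξ => by positivity
    have bound : ∀ y ∈ Ioo (-1 : ℝ) 1, ∫⁻ ξ, ‖(weightedDecay χ s ν t ξ : ℂ) * P.streamDeriv t (ξ, y) +
        -c * ((truncInv a b ξ : ℂ) * P.source t (ξ, y))‖ₑ ≤ freqInt fun ξ => c₁ * N₁ ξ + c₂ * N₂ ξ := by
      intro y hy
      refine lintegral_mono fun ξ => ?_
      rw [← ofReal_norm]
      refine ENNReal.ofReal_le_ofReal ?_
      have hy' := Ioo_subset_Icc_self hy
      have hwd := weightedDecay_le_const hχ hs hν.le ht ξ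
      have hwd0 := weightedDecay_nonneg hχ hs hν.le ht ξ
      rw [← hWdef] at hwd
      have hθe : |2 * π * ξ * t| = 2 * π * t * |ξ| := by
        rw [abs_mul, abs_mul, abs_of_pos Real.two_pi_pos, abs_of_pos ht0]; ring
      rcases lt_or_ge |2 * π * ξ * t| 1 with h | h
      · have h3 : truncInv a b ξ = 0 := if_neg fun h' => by
          have h4 := h'.1
          rw [ha, inv_le_iff_one_le_mul₀ (by positivity)] at h4
          rw [hθe] at h
          linarith
        rw [h3, Complex.ofReal_zero, zero_mul, mul_zero, add_zero, norm_mul, Complex.norm_real,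
          Real.norm_of_nonneg hwd0]
        -- For `
        -- k
        --  t < 1` the truncated part vanishes and `N₁ ≥ 1/2`.
        have h4 : 1 / 2 ≤ N₁ ξ := by
          have h5 : (2 * π * t * ξ) ^ 2 ≤ 1 := by
            rw [show 2 * π * t * ξ = 2 * π * ξ * t by ring, ← sq_abs]
            nlinarith [abs_nonneg (2 * π * ξ * t)]
          rw [hN₁, one_div]
          exact inv_anti₀ (by positivity) (by linarith)
        have h5 := P.norm_streamDeriv_le t ξ hy'
        have h6 := P.N0_le ξ
        calc _ ≤ (W * exp (-(ν * t))) * (2 * E) := by gcongr; linarith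
          _ ≤ c₁ * (1 / 2) := by
            rw [hc₁]
            have : 0 ≤ W * exp (-(ν * t)) * E := by positivity
            nlinarith
          _ ≤ c₁ * N₁ ξ + c₂ * N₂ ξ := by
            have := mul_le_mul_of_nonneg_left h4 hc₁0
            have := mul_nonneg hc₂0 (hN₂0 ξ)
            linarith
      · have h3 : a ≤ |ξ| := by
          rw [ha, inv_le_iff_one_le_mul₀ (by positivity)]
          rw [hθe] at h
          linarith
        have h4 := P.norm_streamDeriv_sub_le ht0 h hy'
        have h5 := hD' hν ht0 ξ h3
        have e : (weightedDecay χ s ν t ξ : ℂ) * P.streamDeriv t (ξ, y) +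
            -c * ((truncInv a b ξ : ℂ) * P.source t (ξ, y)) =
            (weightedDecay χ s ν t ξ : ℂ) *
              (P.streamDeriv t (ξ, y) - Profile.leadingCoeff t * (ξ⁻¹ : ℝ) * P.source t (ξ, y)) +
            ((weightedDecay χ s ν t ξ * ξ⁻¹ - exp (-(ν * t)) * truncInv a b ξ : ℝ) : ℂ) *
              (Profile.leadingCoeff t * P.source t (ξ, y)) := by
          rw [hc]; push_cast; ring
        rw [e]
        refine (norm_add_le _ _).trans (add_le_add ?_ ?_)
        · rw [norm_mul, Complex.norm_real, Real.norm_of_nonneg hwd0]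
          calc _ ≤ (W * exp (-(ν * t))) * (176 * E * N₁ ξ) := by gcongr
            _ = c₁ * N₁ ξ := by rw [hc₁]; ring
        · rw [norm_mul, Complex.norm_real, Real.norm_eq_abs, norm_mul]
          have h6 := (P.norm_source_le t ξ hy').trans (P.N0_le ξ)
          have h7 := Profile.norm_leadingCoeff_le ht0
          calc _ ≤ (D * exp (-(ν * t)) * ((ν * t ^ 3) ^ (1 / 3 : ℝ) * N₂ ξ)) * (t⁻¹ * E) := by gcongr
            _ = c₂ * N₂ ξ := by rw [hc₂]; ring
    refine (FreqAdm.eLpNorm_top_field_le hR bound).trans ?_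
    refine (freqInt_add_le (by fun_prop)).trans ?_
    rw [freqInt_const_mul hc₁0, freqInt_const_mul hc₂0]
    refine (add_le_add (mul_le_mul_right i1 _) (mul_le_mul_right i2 _)).trans ?_
    rw [← ENNReal.ofReal_mul hc₁0, ← ENNReal.ofReal_mul hc₂0, ← ENNReal.ofReal_add (by positivity) (by positivity)]
    refine ENNReal.ofReal_le_ofReal (le_of_eq ?_)
    have h5 : (ν * t ^ 3) ^ (1 / 3 : ℝ) * (ν * t ^ 3) ^ (-(1 / 3) : ℝ) = 1 := by
      rw [← Real.rpow_add hτ]; simp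
    rw [hc₁, hc₂]
    linear_combination (exp (-(ν * t)) * E * D * t⁻¹ * K) * h5
  refine m1.trans ((FreqAdm.eLpNorm_field_add_le hR (hL.const_mul c) le_top).trans ((add_le_add m3 m2).trans ?_))
  rw [← ENNReal.ofReal_add (by positivity) (by positivity)]
  refine ENNReal.ofReal_le_ofReal ?_
  calc _ = (exp (-(ν * t)) * E * (88 * W + D * K + 6)) * t⁻¹ := by ring
    _ ≤ (exp (-(ν * t)) * E * (88 * W + D * K + 6)) * (2 * (1 + t)⁻¹) :=
      mul_le_mul_of_nonneg_left h2 (by positivity)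
    _ = 2 * (88 * W + D * K + 6) * (1 + t)⁻¹ * exp (-(ν * t)) * E := by ring
    _ ≤ _ := by gcongr; linarith [show 0 ≤ 4 * A * W by positivity]

end

/-! ### Products of fields -/

/-- The convolution of two nonnegative functions. -/
def lconv (a b : ℝ → ℝ≥0∞) (ξ : ℝ) : ℝ≥0∞ := ∫⁻ η, a η * b (ξ - η)

theorem measurable_lconv {a b : ℝ → ℝ≥0∞} (ha : Measurable a) (hb : Measurable b) : Measurable (lconv a b) :=
  Measurable.lintegral_prod_right' (f := fun p : ℝ × ℝ => a p.2 * b (p.1 - p.2)) (by fun_prop)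

theorem lintegral_lconv {a b : ℝ → ℝ≥0∞} (ha : Measurable a) (hb : Measurable b) :
    ∫⁻ ξ, lconv a b ξ = (∫⁻ ξ, a ξ) * ∫⁻ ξ, b ξ := by
  simp only [lconv]
  rw [lintegral_lintegral_swap (by fun_prop)]
  have : ∀ η, ∫⁻ ξ, a η * b (ξ - η) = a η * ∫⁻ ξ, b ξ := fun η => by
    rw [lintegral_const_mul _ (by fun_prop), lintegral_sub_right_eq_self]
  simp only [this]
  exact lintegral_mul_const _ ha

/-- Young's inequality for `L¹ * L² ⊆ L²`. -/
theorem lintegral_lconv_sq_le {a b : ℝ → ℝ≥0∞} (ha : Measurable a) (hb : Measurable b) :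
    ∫⁻ ξ, lconv a b ξ ^ 2 ≤ (∫⁻ ξ, a ξ) ^ 2 * ∫⁻ ξ, b ξ ^ 2 := by
  have h : ∀ ξ, lconv a b ξ ^ 2 ≤ (∫⁻ ξ, a ξ) * lconv a (fun ξ => b ξ ^ 2) ξ := fun ξ => by
    have h1 := ENNReal.lintegral_mul_le_Lp_mul_Lq volume Real.HolderConjugate.two_two
      (f := fun η => a η ^ (1 / 2 : ℝ)) (g := fun η => a η ^ (1 / 2 : ℝ) * b (ξ - η)) (by fun_prop) (by fun_prop)
    have e1 : ∀ x : ℝ≥0∞, (x ^ (1 / 2 : ℝ)) ^ (2 : ℝ) = x := fun x => by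
      rw [← ENNReal.rpow_mul]; norm_num
    have e2 : ∀ x : ℝ≥0∞, x ^ (1 / 2 : ℝ) * x ^ (1 / 2 : ℝ) = x := fun x => by
      rw [← ENNReal.rpow_add_of_nonneg _ _ (by norm_num) (by norm_num)]; norm_num
    simp only [Pi.mul_apply, ← mul_assoc, e2, e1, ENNReal.mul_rpow_of_nonneg _ _ two_pos.le] at h1
    calc lconv a b ξ ^ 2 ≤ ((∫⁻ η, a η) ^ (1 / 2 : ℝ) * (∫⁻ η, a η * b (ξ - η) ^ (2 : ℝ)) ^ (1 / 2 : ℝ)) ^ 2 := by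
          gcongr; exact h1
      _ = _ := by
          rw [mul_pow, ← ENNReal.rpow_natCast, ← ENNReal.rpow_natCast]
          push_cast
          rw [e1, e1]
          simp [lconv]
  calc _ ≤ ∫⁻ ξ, (∫⁻ ξ, a ξ) * lconv a (fun ξ => b ξ ^ 2) ξ := lintegral_mono h
    _ = _ := by
      rw [lintegral_const_mul _ (measurable_lconv ha (by fun_prop)), lintegral_lconv ha (by fun_prop), sq, mul_assoc]

/-- Convolution in the frequency, at fixed `y`: the symbol of a product. -/
def freqConv (A B : ℝ × ℝ → ℂ) (p : ℝ × ℝ) : ℂ := ∫ η, A (η, p.2) * B (p.1 - η, p.2)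

theorem measurable_freqConv {A B : ℝ × ℝ → ℂ} (hA : Measurable A) (hB : Measurable B) :
    Measurable (freqConv A B) :=
  (StronglyMeasurable.integral_prod_right (f := fun (p : ℝ × ℝ) (η : ℝ) => A (η, p.2) * B (p.1 - η, p.2))
    (Measurable.stronglyMeasurable (by simp only [Function.uncurry_def]; fun_prop))).measurable

theorem lintegral_strip_le {F : ℝ × ℝ → ℂ} (hF : Measurable F) {H : ℝ → ℝ≥0∞} (n : ℕ)
    (h : ∀ ξ, ∀ y ∈ Icc (-1 : ℝ) 1, ‖F (ξ, y)‖ₑ ≤ H ξ) :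
    ∫⁻ p, ‖F p‖ₑ ^ n ∂stripMeasure ≤ 2 * ∫⁻ ξ, H ξ ^ n := by
  rw [lintegral_strip' (by fun_prop), ← lintegral_const_mul' _ _ ENNReal.ofNat_ne_top]
  refine lintegral_mono fun ξ => ?_
  calc ∫⁻ y in Ioo (-1 : ℝ) 1, ‖F (ξ, y)‖ₑ ^ n ≤ ∫⁻ _ in Ioo (-1 : ℝ) 1, H ξ ^ n :=
        setLIntegral_mono measurable_const fun y hy => by
          gcongr; exact h ξ y (Ioo_subset_Icc_self hy)
    _ = _ := by rw [setLIntegral_const, Real.volume_Ioo, mul_comm]; norm_num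

/-- Pointwise bound of a convolution of symbols with a submultiplicative weight `m`. -/
theorem enorm_freqConv_le {A B : ℝ × ℝ → ℂ} {m : ℝ → ℝ} {c : ℝ} (hc : 0 ≤ c)
    (hm : ∀ ξ η, |m (ξ + η)| ≤ c * (|m ξ| * |m η|)) {a b : ℝ → ℝ≥0∞}
    (ha : ∀ ξ, ∀ y ∈ Icc (-1 : ℝ) 1, ‖(m ξ : ℂ) * A (ξ, y)‖ₑ ≤ a ξ)
    (hb : ∀ ξ, ∀ y ∈ Icc (-1 : ℝ) 1, ‖(m ξ : ℂ) * B (ξ, y)‖ₑ ≤ b ξ) (ξ : ℝ) {y : ℝ}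
    (hy : y ∈ Icc (-1 : ℝ) 1) :
    ‖(m ξ : ℂ) * freqConv A B (ξ, y)‖ₑ ≤ ofReal c * lconv a b ξ := by
  rw [freqConv, ← integral_const_mul, lconv, ← lintegral_const_mul' _ _ ENNReal.ofReal_ne_top]
  refine (enorm_integral_le_lintegral_enorm _).trans (lintegral_mono fun η => ?_)
  have h1 : ‖(m ξ : ℂ)‖ₑ ≤ ofReal c * (‖(m η : ℂ)‖ₑ * ‖(m (ξ - η) : ℂ)‖ₑ) := by
    have h := hm η (ξ - η)
    rw [add_sub_cancel] at h
    simp only [← ofReal_norm, Complex.norm_real, Real.norm_eq_abs]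
    rw [← ENNReal.ofReal_mul (abs_nonneg _), ← ENNReal.ofReal_mul hc]
    exact ENNReal.ofReal_le_ofReal h
  calc ‖(m ξ : ℂ) * (A (η, y) * B (ξ - η, y))‖ₑ
      ≤ ofReal c * (‖(m η : ℂ)‖ₑ * ‖(m (ξ - η) : ℂ)‖ₑ) * (‖A (η, y)‖ₑ * ‖B (ξ - η, y)‖ₑ) := by
        rw [enorm_mul, enorm_mul]; gcongr
    _ = ofReal c * (‖(m η : ℂ) * A (η, y)‖ₑ * ‖(m (ξ - η) : ℂ) * B (ξ - η, y)‖ₑ) := by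
        rw [enorm_mul, enorm_mul]; ring
    _ ≤ _ := by gcongr; exacts [ha η y hy, hb _ y hy]

/-- Young's inequality for the weighted convolution of symbols, uniformly in `y`. -/
theorem eLpNorm_freqConv_le {A B : ℝ × ℝ → ℂ} (hA : Measurable A) (hB : Measurable B) {m : ℝ → ℝ}
    (hmm : Measurable m) {c : ℝ} (hc : 0 ≤ c) (hm : ∀ ξ η, |m (ξ + η)| ≤ c * (|m ξ| * |m η|))
    {a b : ℝ → ℝ≥0∞} (ham : Measurable a) (hbm : Measurable b)
    (ha : ∀ ξ, ∀ y ∈ Icc (-1 : ℝ) 1, ‖(m ξ : ℂ) * A (ξ, y)‖ₑ ≤ a ξ)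
    (hb : ∀ ξ, ∀ y ∈ Icc (-1 : ℝ) 1, ‖(m ξ : ℂ) * B (ξ, y)‖ₑ ≤ b ξ) {α β : ℝ≥0∞}
    (hα : ∫⁻ ξ, a ξ ≤ α) (hβ : ∫⁻ ξ, b ξ ^ 2 ≤ β ^ 2) :
    eLpNorm (fun p => (m p.1 : ℂ) * freqConv A B p) 2 stripMeasure ≤ 2 * (ofReal c * (α * β)) := by
  have hC := measurable_freqConv hA hB
  rw [eLpNorm_two_le_iff]
  refine (lintegral_strip_le (H := fun ξ => ofReal c * lconv a b ξ) (by fun_prop) 2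
    fun ξ y hy => enorm_freqConv_le hc hm ha hb ξ hy).trans ?_
  simp only [mul_pow]
  rw [lintegral_const_mul' _ _ (by simp)]
  have h1 : ∫⁻ ξ, lconv a b ξ ^ 2 ≤ α ^ 2 * β ^ 2 :=
    (lintegral_lconv_sq_le ham hbm).trans (by gcongr)
  calc _ ≤ 2 * (ofReal c ^ 2 * (α ^ 2 * β ^ 2)) := by gcongr
    _ ≤ _ := by gcongr; norm_num

theorem FreqAdm.freqConv {A B : ℝ × ℝ → ℂ} (hA : FreqAdm A) (hB : FreqAdm B)
    {a b : ℝ → ℝ≥0∞} (ham : Measurable a) (hbm : Measurable b)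
    (ha : ∀ ξ, ∀ y ∈ Icc (-1 : ℝ) 1, ‖A (ξ, y)‖ₑ ≤ a ξ)
    (hb : ∀ ξ, ∀ y ∈ Icc (-1 : ℝ) 1, ‖B (ξ, y)‖ₑ ≤ b ξ)
    (ha1 : ∫⁻ ξ, a ξ < ∞) (hb1 : ∫⁻ ξ, b ξ < ∞) (hb2 : ∫⁻ ξ, b ξ ^ 2 < ∞) :
    FreqAdm (freqConv A B) := by
  have hC := measurable_freqConv hA.meas hB.meas
  have h : ∀ ξ, ∀ y ∈ Icc (-1 : ℝ) 1, ‖_root_.freqConv A B (ξ, y)‖ₑ ≤ lconv a b ξ := fun ξ y hy => by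
    have := enorm_freqConv_le (A := A) (B := B) (m := fun _ => 1) (c := 1) zero_le_one (by simp)
      (by simpa using ha) (by simpa using hb) ξ hy
    simpa using this
  refine ⟨hC, ⟨hC.aestronglyMeasurable, ?_⟩, (memLp_two_iff hC.aestronglyMeasurable).2 ?_⟩
  · have h1 := lintegral_strip_le hC 1 h
    simp only [pow_one] at h1
    refine h1.trans_lt ?_
    rw [lintegral_lconv ham hbm]
    exact ENNReal.mul_lt_top (by simp) (ENNReal.mul_lt_top ha1 hb1)
  · refine (lintegral_strip_le hC 2 h).trans_lt ?_
    exact ENNReal.mul_lt_top (by simp) ((lintegral_lconv_sq_le ham hbm).trans_lt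
      (ENNReal.mul_lt_top (ENNReal.pow_lt_top ha1) hb2))

/-- The inverse transform of a convolution is the product. -/
theorem FreqAdm.field_freqConv {A B : ℝ × ℝ → ℂ} (hA : FreqAdm A) (hB : FreqAdm B)
    (hC : FreqAdm (_root_.freqConv A B)) : hC.field =ᵐ[stripMeasure] fun p => hA.field p * hB.field p := by
  have key : ∀ᵐ p ∂stripMeasure, invFT (_root_.freqConv A B) p = invFT A p * invFT B p := by
    refine ae_strip_of_ae_section ?_
    filter_upwards [integrable_slice hA.l1, integrable_slice hB.l1] with y h1 h2 x
    have := Real.fourier_mul_convolution_eq h1 h2 (-x)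
    simp only [invFT, Real.fourierInv_eq_fourier_neg]
    rw [← this]
    rfl
  filter_upwards [hC.field_ae_eq, hA.field_ae_eq, hB.field_ae_eq, key] with p h1 h2 h3 h4
  rw [h1, h2, h3, h4]

section

variable {χ : ℝ → ℝ} {s : ℝ}

theorem weight_le (hχ : IsCutoff χ) (hs : 0 ≤ s) {ν t : ℝ} (hν : 0 ≤ ν) (ht : 0 ≤ t) (k : ℝ) :
    weight χ s ν t k ≤ (1 + ν ^ (1 / 3 : ℝ) * t * 2) ^ s := by
  have h0 := hχ.symbolM_nonneg k
  have h1 : symbolM χ k ≤ 2 := (hχ.symbolM_le k).trans (by linarith [min_le_left 1 (|k| ^ (2 / 3 : ℝ))])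
  unfold weight
  gcongr

theorem FreqAdm.weight {F : ℝ × ℝ → ℂ} (hF : FreqAdm F) (hχ : IsCutoff χ) (hs : 0 ≤ s) {ν t : ℝ} (hν : 0 ≤ ν)
    (ht : 0 ≤ t) : FreqAdm fun p => (_root_.weight χ s ν t (2 * π * p.1) : ℂ) * F p := by
  have := measurable_weight hχ s ν t
  refine hF.bdd_mul (m := fun p => (_root_.weight χ s ν t (2 * π * p.1) : ℂ)) (by fun_prop)
    (C := (1 + ν ^ (1 / 3 : ℝ) * t * 2) ^ s) fun p _ => ?_
  rw [Complex.norm_real, Real.norm_of_nonneg (zero_le_one.trans (one_le_weight hχ hs hν ht _))]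
  exact weight_le hχ hs hν ht _

/-- The weighted `L²` norm of a product, through Young's inequality. -/
theorem FreqAdm.freqConv_decay (hχ : IsCutoff χ) (hs : 0 ≤ s) {ν t : ℝ} (hν : 0 ≤ ν) (ht : 0 ≤ t)
    {A B : ℝ × ℝ → ℂ} (hA : FreqAdm A) (hB : FreqAdm B) {a b : ℝ → ℝ} (ham : Measurable a) (hbm : Measurable b)
    (ha : ∀ ξ, ∀ y ∈ Icc (-1 : ℝ) 1, ‖A (ξ, y)‖ ≤ a ξ)
    (hb : ∀ ξ, ∀ y ∈ Icc (-1 : ℝ) 1, ‖B (ξ, y)‖ ≤ b ξ) {α β : ℝ} (hα0 : 0 ≤ α) (hβ0 : 0 ≤ β)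
    (hα : freqInt a ≤ ofReal α) (hb1 : freqInt b < ∞) (hb2 : eLpNorm b 2 volume < ∞)
    (hβ : eLpNorm (fun ξ => exp (-(ν * t ^ 3 * ξ ^ 2)) * b ξ) 2 volume ≤ ofReal β) :
    FreqAdm (_root_.freqConv (fun p => (_root_.decay ν t p.1 : ℂ) * A p)
      (fun p => (_root_.decay ν t p.1 : ℂ) * B p)) ∧
    eLpNorm (fun p => (_root_.weight χ s ν t (2 * π * p.1) : ℂ) *
      _root_.freqConv (fun p => (_root_.decay ν t p.1 : ℂ) * A p)
        (fun p => (_root_.decay ν t p.1 : ℂ) * B p) p) 2 stripMeasure ≤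
      ofReal (2 * (2 ^ s * (weightConst s ^ 2 * (α * β)) * exp (-(ν * t)))) := by
  have hW := weightConst_pos hs
  set K := weightConst s * exp (-(ν * t)) with hK
  have hK0 : 0 ≤ K := by positivity
  have hb0 : ∀ ξ, 0 ≤ b ξ := fun ξ => (norm_nonneg _).trans (hb ξ 0 (by norm_num))
  have hdec : ∀ (F : ℝ × ℝ → ℂ) (n : ℝ → ℝ), (∀ ξ, ∀ y ∈ Icc (-1 : ℝ) 1, ‖F (ξ, y)‖ ≤ n ξ) →
      ∀ ξ, ∀ y ∈ Icc (-1 : ℝ) 1, ‖(_root_.decay ν t ξ : ℂ) * F (ξ, y)‖ₑ ≤ ofReal (n ξ) := by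
    intro F n h ξ y hy
    rw [← ofReal_norm, norm_mul, Complex.norm_real, Real.norm_of_nonneg (decay_pos _ _ _).le]
    have h1 := decay_le_one hν ht ξ
    have h2 := h ξ y hy
    exact ENNReal.ofReal_le_ofReal (by nlinarith [norm_nonneg (F (ξ, y))])
  have hb2' : ∀ g : ℝ → ℝ, (∀ ξ, 0 ≤ g ξ) → ∫⁻ ξ, ofReal (g ξ) ^ 2 = eLpNorm g 2 volume ^ 2 :=
    fun g hg => by
      rw [eLpNorm_two_sq]
      refine lintegral_congr fun ξ => ?_
      rw [← ofReal_norm, Real.norm_of_nonneg (hg ξ)]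
  refine ⟨(hA.decay hν ht).freqConv (hB.decay hν ht) ham.ennreal_ofReal hbm.ennreal_ofReal (hdec A a ha)
    (hdec B b hb) (hα.trans_lt ENNReal.ofReal_lt_top) hb1
    (by rw [hb2' b hb0]; exact ENNReal.pow_lt_top hb2), ?_⟩
  have hw := measurable_weight hχ s ν t
  have hwd : ∀ (F : ℝ × ℝ → ℂ) (n : ℝ → ℝ), (∀ ξ, ∀ y ∈ Icc (-1 : ℝ) 1, ‖F (ξ, y)‖ ≤ n ξ) →
      ∀ ξ, ∀ y ∈ Icc (-1 : ℝ) 1, ‖(_root_.weight χ s ν t (2 * π * ξ) : ℂ) *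
        ((_root_.decay ν t ξ : ℂ) * F (ξ, y))‖ ≤ K * (exp (-(ν * t ^ 3 * ξ ^ 2)) * n ξ) := by
    intro F n h ξ y hy
    have h1 := weightedDecay_le hχ hs hν ht ξ
    rw [← mul_assoc, norm_mul, ← Complex.ofReal_mul, Complex.norm_real,
      Real.norm_of_nonneg (show 0 ≤ _ * _ from weightedDecay_nonneg hχ hs hν ht ξ), ← mul_assoc]
    exact mul_le_mul h1 (h ξ y hy) (norm_nonneg _) (by positivity)
  have h := eLpNorm_freqConv_le (hA.decay hν ht).meas (hB.decay hν ht).meas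
    (m := fun ξ => _root_.weight χ s ν t (2 * π * ξ)) (by fun_prop) (c := 2 ^ s) (by positivity)
    (fun ξ η => ?_) (a := fun ξ => ofReal (K * a ξ))
    (b := fun ξ => ofReal (K * (exp (-(ν * t ^ 3 * ξ ^ 2)) * b ξ))) (by fun_prop) (by fun_prop)
    (fun ξ y hy => ?_) (fun ξ y hy => ?_) (α := ofReal (K * α)) (β := ofReal (K * β)) ?_ ?_
  · refine h.trans ?_
    rw [← ENNReal.ofReal_mul (by positivity), ← ENNReal.ofReal_mul (by positivity), ← ENNReal.ofReal_ofNat,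
      ← ENNReal.ofReal_mul two_pos.le]
    refine ENNReal.ofReal_le_ofReal ?_
    have h1 : exp (-(ν * t)) ≤ 1 := Real.exp_le_one_iff.2 (neg_nonpos.2 (by positivity))
    calc _ = 2 * (2 ^ s * (weightConst s ^ 2 * (α * β)) * exp (-(ν * t))) * exp (-(ν * t)) := by
          rw [hK]; ring
      _ ≤ _ := mul_le_of_le_one_right (by positivity) h1
  · have hw1 : ∀ k, 0 ≤ _root_.weight χ s ν t k := fun k => zero_le_one.trans (one_le_weight hχ hs hν ht k)
    rw [abs_of_nonneg (hw1 _), abs_of_nonneg (hw1 _), abs_of_nonneg (hw1 _), mul_add]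
    exact weight_add_le hχ hs hν ht _ _
  · rw [← ofReal_norm]
    refine ENNReal.ofReal_le_ofReal ((hwd A a ha ξ y hy).trans ?_)
    have h1 : exp (-(ν * t ^ 3 * ξ ^ 2)) ≤ 1 := Real.exp_le_one_iff.2 (neg_nonpos.2 (by positivity))
    have h2 : 0 ≤ a ξ := (norm_nonneg _).trans (ha ξ y hy)
    gcongr
    nlinarith
  · rw [← ofReal_norm]
    exact ENNReal.ofReal_le_ofReal (hwd B b hb ξ y hy)
  · refine (le_of_eq (freqInt_const_mul hK0 a)).trans ?_
    rw [ENNReal.ofReal_mul hK0]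
    gcongr
  · rw [hb2' _ fun ξ => mul_nonneg hK0 (mul_nonneg (Real.exp_pos _).le (hb0 ξ))]
    gcongr
    have e := eLpNorm_const_smul K (fun ξ => exp (-(ν * t ^ 3 * ξ ^ 2)) * b ξ) 2 volume
    refine (le_of_eq e).trans ?_
    rw [ENNReal.ofReal_mul hK0, ← ofReal_norm, Real.norm_of_nonneg hK0]
    gcongr

end

/-! ### The error term -/

section

variable {χ : ℝ → ℝ} {s : ℝ}

namespace Profile

variable {f : StripL2} {E : ℝ} (P : Profile f E)

/-- The symbol of `ω + ∂_x² ω + (∂_y + t ∂_x)² ω - 2 t ∂_x (∂_y + t ∂_x) ω`, without the decay: up to the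
factor `-ν`, the linear part of the error. -/
def viscousError (t : ℝ) (p : ℝ × ℝ) : ℂ :=
  P.source t p + (2 * π * p.1 * I) * ((2 * π * p.1 * I) * P.source t p) +
    P.source2 t p + (-2 * (t : ℂ)) * ((2 * π * p.1 * I) * P.source1 t p)

theorem adm_viscousError (t : ℝ) : FreqAdm (P.viscousError t) :=
  (((P.adm_source t).add (P.adm_dxx_source t)).add (P.adm_source2 t)).add
    ((P.adm_dx_source1 t).const_mul (-2 * (t : ℂ)))

theorem norm_viscousError_le {t : ℝ} (ht : 0 ≤ t) (ξ : ℝ) {y : ℝ} (hy : y ∈ Icc (-1 : ℝ) 1) :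
    ‖P.viscousError t (ξ, y)‖ ≤
      P.N0 ξ + 49 * (|ξ| ^ 2 * P.N0 ξ) + P.N2 ξ + 14 * t * (|ξ| ^ 1 * P.N1 ξ) := by
  have h0 := P.norm_source_le t ξ hy
  have h1 := P.norm_source1_le t ξ hy
  have h2 := P.norm_source2_le t ξ hy
  have hk := abs_two_pi_le ξ
  have e1 : ‖2 * π * ξ * I * (2 * π * ξ * I * P.source t (ξ, y))‖ ≤
      49 * (|ξ| ^ 2 * P.N0 ξ) := by
    rw [norm_mul, norm_mul (2 * π * ξ * I), norm_two_pi_I]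
    calc _ ≤ 7 * |ξ| * (7 * |ξ| * P.N0 ξ) := by gcongr
      _ = _ := by ring
  have e2 : ‖(-2 * (t : ℂ)) * (2 * π * ξ * I * P.source1 t (ξ, y))‖ ≤
      14 * t * (|ξ| ^ 1 * P.N1 ξ) := by
    rw [norm_mul, norm_mul, norm_neg, Complex.norm_ofNat, Complex.norm_real, Real.norm_of_nonneg ht, norm_mul,
      norm_two_pi_I]
    calc _ ≤ 2 * t * (7 * |ξ| * P.N1 ξ) := by gcongr
      _ = _ := by ring
  exact (norm_add_le _ _).trans (add_le_add ((norm_add_le _ _).trans (add_le_add ((norm_add_le _ _).trans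
    (add_le_add h0 e1)) h2)) e2)

theorem eLpNorm_sq_mul_N0_le : eLpNorm (fun ξ => |ξ| ^ 2 * P.N0 ξ) 2 volume ≤ ofReal E :=
  (eLpNorm_mono_real fun ξ => by
    have := P.N0_nonneg ξ
    rw [Real.norm_of_nonneg (by positivity)]
    gcongr
    linarith).trans P.sq0

theorem eLpNorm_abs_mul_N1_le : eLpNorm (fun ξ => |ξ| ^ 1 * P.N1 ξ) 2 volume ≤ ofReal E :=
  (eLpNorm_mono_real fun ξ => by
    have := P.N1_nonneg ξ
    rw [Real.norm_of_nonneg (by positivity)]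
    gcongr
    linarith).trans P.sq1

end Profile

theorem eLpNorm_two_const_mul_le {c A : ℝ} (hc : 0 ≤ c) {g : ℝ → ℝ} (h : eLpNorm g 2 volume ≤ ofReal A) :
    eLpNorm (fun ξ => c * g ξ) 2 volume ≤ ofReal (c * A) := by
  refine (le_of_eq (eLpNorm_const_smul c g 2 volume)).trans ?_
  rw [ENNReal.ofReal_mul hc, ← ofReal_norm, Real.norm_of_nonneg hc]
  gcongr

theorem eLpNorm_two_add_le {A B : ℝ} (hA : 0 ≤ A) (hB : 0 ≤ B) {g h : ℝ → ℝ} (hg : Measurable g)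
    (hh : Measurable h) (h1 : eLpNorm g 2 volume ≤ ofReal A)
    (h2 : eLpNorm h 2 volume ≤ ofReal B) :
    eLpNorm (fun ξ => g ξ + h ξ) 2 volume ≤ ofReal (A + B) := by
  rw [ENNReal.ofReal_add hA hB]
  exact (eLpNorm_add_le hg.aestronglyMeasurable hh.aestronglyMeasurable one_le_two).trans (add_le_add h1 h2)

/-- `ν t (1 + ν t³)^{-3/4} ≤ ν^{2/3} (1 + ν t³)^{-5/12}`, because `ν t = ν^{2/3} (ν t³)^{1/3}`. -/
theorem mul_rpow_neg_le_rpow_mul {ν t : ℝ} (hν : 0 ≤ ν) (ht : 0 ≤ t) :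
    ν * t * (1 + ν * t ^ 3) ^ (-(3 / 4) : ℝ) ≤ ν ^ (2 / 3 : ℝ) * (1 + ν * t ^ 3) ^ (-(5 / 12) : ℝ) := by
  have h1 : ν * t = ν ^ (2 / 3 : ℝ) * (ν * t ^ 3) ^ (1 / 3 : ℝ) := by
    rw [Real.mul_rpow hν (by positivity), ← mul_assoc, ← Real.rpow_add_of_nonneg hν (by norm_num) (by norm_num),
      ← Real.rpow_natCast t 3, ← Real.rpow_mul ht]
    norm_num
  have h2 : (0 : ℝ) < 1 + ν * t ^ 3 := by positivity
  have h3 : (1 + ν * t ^ 3) ^ (-(5 / 12) : ℝ) =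
      (1 + ν * t ^ 3) ^ (1 / 3 : ℝ) * (1 + ν * t ^ 3) ^ (-(3 / 4) : ℝ) := by
    rw [← Real.rpow_add h2]; norm_num
  rw [h3, h1, mul_assoc]
  gcongr
  linarith

/-- The weighted `L²` norm of the linear part of the error. -/
theorem exists_viscousError_bound (hχ : IsCutoff χ) (hs : 0 ≤ s) : ∃ C : ℝ, 0 < C ∧
    ∀ {f : StripL2} {E : ℝ} (P : Profile f E) {ν t : ℝ}, 0 < ν → 0 ≤ t →
    eLpNorm (fun p => (weightedDecay χ s ν t p.1 : ℂ) * (-(ν : ℂ) * P.viscousError t p)) 2 stripMeasure ≤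
      ofReal (C * (ν * (1 + ν * t ^ 3) ^ (-(1 / 4) : ℝ) +
        ν ^ (2 / 3 : ℝ) * (1 + ν * t ^ 3) ^ (-(5 / 12) : ℝ)) * exp (-(ν * t)) * E) := by
  obtain ⟨K₀, hK₀, h₀⟩ := eLpNorm_gaussian_mul 0
  obtain ⟨K₁, hK₁, h₁⟩ := eLpNorm_gaussian_mul 1
  obtain ⟨K₂, hK₂, h₂⟩ := eLpNorm_gaussian_mul 2
  have hW := weightConst_pos hs
  refine ⟨2 * weightConst s * (2 * K₀ + 14 * K₁ + 49 * K₂), by positivity, fun {f E} P {ν t} hν ht => ?_⟩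
  have hE := P.size_nonneg
  have m0 := P.measN0
  have m1 := P.measN1
  have m2 := P.measN2
  have hτ : 0 ≤ ν * t ^ 3 := by positivity
  set g : ℝ → ℝ := fun ξ => exp (-(ν * t ^ 3 * ξ ^ 2)) with hg
  have gm : Measurable g := by fun_prop
  set T := 1 + ν * t ^ 3 with hT
  have hT1 : 1 ≤ T := by linarith
  have hT0 : 0 < T := by linarith
  have b0 : eLpNorm (fun ξ => |ξ| ^ 0 * g ξ * P.N0 ξ) 2 volume ≤ ofReal (K₀ * T ^ (-(1 / 4) : ℝ) * E) :=
    (h₀ P.N0 E _ hE hτ P.N0_nonneg P.N0_le (by simpa using P.eLpNorm_N0_le)).trans_eq (by norm_num [hT])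
  have b2 : eLpNorm (fun ξ => |ξ| ^ 0 * g ξ * P.N2 ξ) 2 volume ≤ ofReal (K₀ * T ^ (-(1 / 4) : ℝ) * E) :=
    (h₀ P.N2 E _ hE hτ P.N2_nonneg P.N2_le (by simpa using P.sq2)).trans_eq (by norm_num [hT])
  have b1 : eLpNorm (fun ξ => |ξ| ^ 1 * g ξ * P.N1 ξ) 2 volume ≤ ofReal (K₁ * T ^ (-(3 / 4) : ℝ) * E) :=
    (h₁ P.N1 E _ hE hτ P.N1_nonneg P.N1_le P.eLpNorm_abs_mul_N1_le).trans_eq (by norm_num [hT])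
  have b00 : eLpNorm (fun ξ => |ξ| ^ 2 * g ξ * P.N0 ξ) 2 volume ≤ ofReal (K₂ * T ^ (-(1 / 4) : ℝ) * E) := by
    refine (h₂ P.N0 E _ hE hτ P.N0_nonneg P.N0_le P.eLpNorm_sq_mul_N0_le).trans (ENNReal.ofReal_le_ofReal ?_)
    gcongr ?_ * E
    gcongr ?_ * ?_
    exact Real.rpow_le_rpow_of_exponent_le hT1 (by norm_num)
  have hsum := eLpNorm_two_const_mul_le hν.le (eLpNorm_two_add_le (by positivity) (by positivity) (by fun_prop)
    (by fun_prop) (eLpNorm_two_add_le (by positivity) (by positivity) (by fun_prop) (by fun_prop)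
      (eLpNorm_two_add_le (by positivity) (by positivity) (by fun_prop) (by fun_prop) b0
        (eLpNorm_two_const_mul_le (c := 49) (by norm_num) b00)) b2)
      (eLpNorm_two_const_mul_le (c := 14 * t) (by positivity) b1))
  have hm := (P.adm_viscousError t).meas
  refine (eLpNorm_weightedDecay_mul_le hχ hs hν.le ht (by fun_prop)
    (N := fun ξ => ν * (P.N0 ξ + 49 * (|ξ| ^ 2 * P.N0 ξ) + P.N2 ξ + 14 * t * (|ξ| ^ 1 * P.N1 ξ)))
    (by fun_prop) (fun ξ y hy => ?_) ((le_of_eq ?_).trans hsum)).trans (ENNReal.ofReal_le_ofReal ?_)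
  · rw [norm_mul, norm_neg, Complex.norm_real, Real.norm_of_nonneg hν.le]
    exact mul_le_mul_of_nonneg_left (P.norm_viscousError_le ht ξ hy) hν.le
  · congr 1
    funext ξ
    ring
  · have h3 := mul_rpow_neg_le_rpow_mul hν.le ht
    rw [← hT] at h3
    set a := T ^ (-(1 / 4) : ℝ)
    set b := T ^ (-(3 / 4) : ℝ)
    set c := T ^ (-(5 / 12) : ℝ)
    have ha : 0 ≤ a := by positivity
    have hc : 0 ≤ ν ^ (2 / 3 : ℝ) * c := by positivity
    calc _ = 2 * weightConst s * ((2 * K₀ + 49 * K₂) * (ν * a) + 14 * K₁ * (ν * t * b)) * exp (-(ν * t)) * E := by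
          ring
      _ ≤ 2 * weightConst s * ((2 * K₀ + 49 * K₂) * (ν * a) + 14 * K₁ * (ν ^ (2 / 3 : ℝ) * c)) *
          exp (-(ν * t)) * E := by gcongr
      _ ≤ 2 * weightConst s * ((2 * K₀ + 14 * K₁ + 49 * K₂) * (ν * a + ν ^ (2 / 3 : ℝ) * c)) *
          exp (-(ν * t)) * E := by
        gcongr
        have : 0 ≤ 14 * K₁ * (ν * a) := by positivity
        have : 0 ≤ (2 * K₀ + 49 * K₂) * (ν ^ (2 / 3 : ℝ) * c) := by positivity
        linarith
      _ = _ := by ring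

/-- The error estimate. By the linear equation the error is `-ν (ω + (1 - t²) ∂_x² ω + ∂_y² ω) + u · ∇ω`,
where the first part has the symbol `viscousError`, and
`u · ∇ω = ((∂_y + t ∂_x) φ) ∂_x ω - ∂_x φ (∂_y + t ∂_x) ω`, so that every factor decays. -/
theorem exists_error (hχ : IsCutoff χ) (hs : 0 ≤ s) : ∃ C : ℝ, 0 < C ∧
    ∀ {f : StripL2} {E : ℝ} (P : Profile f E) {ν : ℝ} (hν : 0 < ν) {ω : ℝ → StripL2}
      (_ : IsLinearSolution ν f ω) {t : ℝ} (ht : 0 ≤ t),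
    ∃ e : StripL2, IsErrorTerm ν ω t ((P.adm_stream t).decay hν.le ht).field e ∧
      multNorm (weight χ s ν t) 2 e ≤
        ofReal (C * ((1 + t)⁻¹ * (1 + ν * t ^ 3) ^ (-(1 / 4) : ℝ) * E
          + ν * (1 + ν * t ^ 3) ^ (-(1 / 4) : ℝ)
          + ν ^ (2 / 3 : ℝ) * (1 + ν * t ^ 3) ^ (-(5 / 12) : ℝ)) * exp (-ν * t) * E) := by
  obtain ⟨C₀, hC₀, h₀⟩ := exists_viscousError_bound hχ hs
  obtain ⟨C₁, hC₁, h₁⟩ := exists_good_stream_envelope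
  obtain ⟨C₂, hC₂, h₂⟩ := exists_dx_stream_envelope
  obtain ⟨K₀, hK₀, k₀⟩ := eLpNorm_gaussian_mul 0
  obtain ⟨K₁, hK₁, k₁⟩ := eLpNorm_gaussian_mul 1
  obtain ⟨A, hA, hA'⟩ := Profile.freqInt_envelopes_le
  have hW := weightConst_pos hs
  set W := 2 * (2 ^ s * weightConst s ^ 2) with hWd
  have hW0 : 0 < W := by positivity
  refine ⟨C₀ + W * (C₁ * (7 * K₁) + C₂ * K₀), by positivity, fun {f E} P {ν} hν {ω} hω {t} ht => ?_⟩
  have hE := P.size_nonneg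
  have m0 := P.measN0
  have m1 := P.measN1
  have hτ : 0 ≤ ν * t ^ 3 := by positivity
  obtain ⟨N₁, hN₁, b₁, i₁⟩ := h₁ P ht
  obtain ⟨N₂, hN₂, b₂, i₂⟩ := h₂ P ht
  obtain ⟨-, a1, -, aN1⟩ := hA' P
  rw [neg_mul]
  set T := 1 + ν * t ^ 3 with hT
  have hT1 : 1 ≤ T := by linarith
  have hT0 : 0 < T := by linarith
  have hgood : FreqAdm fun p => P.streamDeriv t p + (t : ℂ) * ((2 * π * p.1 * I) * P.stream t p) :=
    (P.adm_streamDeriv t).add ((P.adm_dx_stream t).const_mul (t : ℂ))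
  have i₂' : freqInt N₂ ≤ ofReal (C₂ * (1 + t)⁻¹ * E) := by
    refine i₂.trans (ENNReal.ofReal_le_ofReal ?_)
    -- The logarithm is absorbed by one power of `1 + t`.
    have hlog : log (2 + t) ≤ 1 + t := by linarith [Real.log_le_sub_one_of_pos (show 0 < 2 + t by linarith)]
    have : ((1 + t) ^ 2)⁻¹ * log (2 + t) ≤ (1 + t)⁻¹ := by
      calc _ ≤ ((1 + t) ^ 2)⁻¹ * (1 + t) := by gcongr
        _ = _ := by field_simp
    rw [mul_assoc C₂]
    gcongr
  have l₁ : eLpNorm (fun ξ => exp (-(ν * t ^ 3 * ξ ^ 2)) * (7 * (|ξ| ^ 1 * P.N0 ξ))) 2 volume ≤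
      ofReal (7 * (K₁ * T ^ (-(1 / 4) : ℝ) * E)) := by
    have e : (fun ξ => exp (-(ν * t ^ 3 * ξ ^ 2)) * (7 * (|ξ| ^ 1 * P.N0 ξ))) =
        fun ξ => 7 * (|ξ| ^ 1 * exp (-(ν * t ^ 3 * ξ ^ 2)) * P.N0 ξ) := by funext ξ; ring
    rw [e]
    refine (eLpNorm_two_const_mul_le (by norm_num)
      (k₁ P.N0 E _ hE hτ P.N0_nonneg P.N0_le P.eLpNorm_abs_mul_N0_le)).trans (ENNReal.ofReal_le_ofReal ?_)
    gcongr 7 * (K₁ * ?_ * E)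
    exact Real.rpow_le_rpow_of_exponent_le hT1 (by norm_num)
  have l₂ : eLpNorm (fun ξ => exp (-(ν * t ^ 3 * ξ ^ 2)) * P.N1 ξ) 2 volume ≤
      ofReal (K₀ * T ^ (-(1 / 4) : ℝ) * E) := by
    have := (k₀ P.N1 E _ hE hτ P.N1_nonneg P.N1_le (by simpa using P.eLpNorm_N1_le)).trans_eq
      (by norm_num [hT] : _ = ofReal (K₀ * T ^ (-(1 / 4) : ℝ) * E))
    simpa using this
  have hfin : ofReal (7 * (A * E)) < ∞ := ENNReal.ofReal_lt_top
  obtain ⟨c₁, c₁'⟩ := hgood.freqConv_decay hχ hs hν.le ht (P.adm_dx_source t) hN₁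
    (b := fun ξ => 7 * (|ξ| ^ 1 * P.N0 ξ)) (by fun_prop) b₁ (fun ξ y hy => by
      rw [norm_mul, Profile.norm_two_pi_I]
      calc _ ≤ (7 * |ξ|) * P.N0 ξ := by
            gcongr; exacts [Profile.abs_two_pi_le ξ, P.norm_source_le t ξ hy]
        _ = _ := by ring) (by positivity) (by positivity) i₁
    (by
      rw [freqInt_const_mul (by norm_num)]
      exact ENNReal.mul_lt_top ENNReal.ofReal_lt_top (a1.trans_lt ENNReal.ofReal_lt_top))
    ((eLpNorm_two_const_mul_le (by norm_num) P.eLpNorm_abs_mul_N0_le).trans_lt ENNReal.ofReal_lt_top) l₁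
  obtain ⟨c₂, c₂'⟩ := (P.adm_dx_stream t).freqConv_decay hχ hs hν.le ht (P.adm_source1 t) hN₂ m1 b₂
    (fun ξ y hy => P.norm_source1_le t ξ hy) (by positivity) (by positivity) i₂'
    (aN1.trans_lt ENNReal.ofReal_lt_top) (P.eLpNorm_N1_le.trans_lt ENNReal.ofReal_lt_top) l₂
  have hv := (P.adm_viscousError t).const_mul (-(ν : ℂ))
  have hL := hv.decay hν.le ht
  have hTot := (hL.add c₁).add (c₂.const_mul (-1))
  refine ⟨hTot.field, ?_, ?_⟩
  · have hω' := P.solution_eq_field hν.le hω ht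
    obtain ⟨-, x1, x2, y1, y2⟩ := P.sobolev_vorticity hν.le ht
    obtain ⟨-, sx1, -, sy1, -⟩ := P.sobolev_stream hν.le ht
    have heq := hω.eqn t ht
    rw [hω', x1, x2] at heq
    rw [IsErrorTerm, hω', x1, x2, y1, y2, sx1, sy1]
    have f1 := (hgood.decay hν.le ht).field_freqConv ((P.adm_dx_source t).decay hν.le ht) c₁
    have f2 := ((P.adm_dx_stream t).decay hν.le ht).field_freqConv ((P.adm_source1 t).decay hν.le ht) c₂
    rw [← (hgood.decay hν.le ht).field_eq (P.partialFT_good_stream hν.le ht)] at f1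
    rw [← ((P.adm_source1 t).decay hν.le ht).field_eq (P.partialFT_good_derivative hν.le ht)] at f2
    have hm : ∀ g : StripL2, AEStronglyMeasurable g stripMeasure := fun g => Lp.aestronglyMeasurable g
    have e1 := hTot.partialFT_field.injective ((hL.partialFT_field.add c₁.partialFT_field).add
      (c₂.partialFT_field.const_mul (-1))) (hm _) (((hm _).add (hm _)).add ((hm _).const_mul _)) hTot.l2.1
    have e2 := hL.partialFT_field.injective (((((P.adm_source t).decay hν.le ht).partialFT_field.add
      ((((P.adm_dxx_source t).decay hν.le ht).partialFT_field).const_mul (1 - (t : ℂ) ^ 2))).add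
      ((P.adm_sourceYY t).decay hν.le ht).partialFT_field).const_mul (-(ν : ℂ)) |>.congr
        (EventuallyEq.refl _ _) (Eventually.of_forall fun p => by
          simp only [Profile.viscousError, Profile.sourceYY]; ring))
      (hm _) ((((hm _).add ((hm _).const_mul _)).add (hm _)).const_mul _) hL.l2.1
    filter_upwards [heq, e1, e2, f1, f2, Lp.coeFn_sub ((P.adm_streamDeriv t).decay hν.le ht).field
      (t • (-((P.adm_dx_stream t).decay hν.le ht).field)),
      Lp.coeFn_smul t (-((P.adm_dx_stream t).decay hν.le ht).field),
      Lp.coeFn_neg ((P.adm_dx_stream t).decay hν.le ht).field,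
      Lp.coeFn_add ((P.adm_sourceY t).decay hν.le ht).field (t • ((P.adm_dx_source t).decay hν.le ht).field),
      Lp.coeFn_smul t ((P.adm_dx_source t).decay hν.le ht).field] with p q e1 e2 f1 f2 r1 r2 r3 r4 r5
    rw [r1, Pi.sub_apply, r2, Pi.smul_apply, r3, Pi.neg_apply, Complex.real_smul] at f1
    rw [r4, Pi.add_apply, r5, Pi.smul_apply, Complex.real_smul] at f2
    rw [e1, e2, f1, f2]
    linear_combination -q
  · have hH := ((hv.weightedDecay hχ hs hν.le ht).add (c₁.weight hχ hs hν.le ht)).add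
      ((c₂.weight hχ hs hν.le ht).const_mul (-1))
    refine (multNorm_le hTot.partialFT_field hH fun p => by
      simp only [weightedDecay]; push_cast; ring).trans ?_
    rw [FreqAdm.eLpNorm_two_field]
    have e3 := eLpNorm_const_smul (-1 : ℂ) (fun p => (weight χ s ν t (2 * π * p.1) : ℂ) *
      freqConv (fun p => (decay ν t p.1 : ℂ) * ((2 * π * p.1 * I) * P.stream t p))
        (fun p => (decay ν t p.1 : ℂ) * P.source1 t p) p) 2 stripMeasure
    refine (eLpNorm_add_le (hv.weightedDecay hχ hs hν.le ht |>.add (c₁.weight hχ hs hν.le ht)).meas.aestronglyMeasurable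
      ((c₂.weight hχ hs hν.le ht).const_mul (-1)).meas.aestronglyMeasurable one_le_two).trans ?_
    have e4 := e3.trans_le (le_of_eq_of_le (by rw [enorm_neg, enorm_one, one_mul]) c₂')
    refine (add_le_add ((eLpNorm_add_le (hv.weightedDecay hχ hs hν.le ht).meas.aestronglyMeasurable
      (c₁.weight hχ hs hν.le ht).meas.aestronglyMeasurable one_le_two).trans
        (add_le_add (h₀ P hν ht) c₁')) e4).trans ?_
    rw [← ENNReal.ofReal_add (by positivity) (by positivity), ← ENNReal.ofReal_add (by positivity) (by positivity)]
    refine ENNReal.ofReal_le_ofReal ?_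
    rw [← hT]
    set a := T ^ (-(1 / 4) : ℝ)
    set c := T ^ (-(5 / 12) : ℝ)
    have ha : 0 ≤ a := by positivity
    have hX : 0 ≤ (1 + t)⁻¹ * a * E := by positivity
    have hY : 0 ≤ ν * a + ν ^ (2 / 3 : ℝ) * c := by positivity
    have hZ : 0 ≤ W * (C₁ * (7 * K₁) + C₂ * K₀) := by positivity
    calc _ = (C₀ * (ν * a + ν ^ (2 / 3 : ℝ) * c) + W * (C₁ * (7 * K₁) + C₂ * K₀) * ((1 + t)⁻¹ * a * E)) *
          exp (-(ν * t)) * E := by rw [hWd]; ring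
      _ ≤ _ := by
        gcongr
        nlinarith

end

end

theorem proposition3p1 (χ : ℝ → ℝ) (hχ : IsCutoff χ) (s : ℝ) (hs : 0 ≤ s) :
    ∃ C : ℝ, 0 < C ∧
      ∀ (ν : ℝ), 0 < ν → ν < 1 →
      ∀ (ωin : StripL2), MemData ωin →
      ∀ (ω : ℝ → StripL2), IsLinearSolution ν ωin ω →
      ∀ t : ℝ, 0 ≤ t →
        -- all derivatives of `ω` used below exist
        MemSobolev 2 (ω t) ∧
        -- weak enhanced dissipation
        multNorm (weight χ s ν t) 2 (ω t)
            + multNorm (weight χ s ν t) 2 (weakPartial 0 1 (ω t) + t • weakPartial 1 0 (ω t))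
          ≤ ENNReal.ofReal (C * (1 + ν * t ^ 3) ^ (-(1 / 4) : ℝ) * Real.exp (-ν * t)
              * dataSize ωin) ∧
        multNorm (weight χ s ν t) 2 (weakPartial 1 0 (ω t))
          ≤ ENNReal.ofReal (C * (1 + ν * t ^ 3) ^ (-(3 / 4) : ℝ) * Real.exp (-ν * t)
              * dataSize ωin) ∧
        multNorm (weight χ s ν t) ∞ (weakPartial 1 0 (ω t))
          ≤ ENNReal.ofReal (C * (1 + ν * t ^ 3) ^ (-1 : ℝ) * Real.exp (-ν * t)
              * dataSize ωin) ∧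
        multNorm (weight χ s ν t) ∞ (weakPartial 0 1 (ω t) + t • weakPartial 1 0 (ω t))
          ≤ ENNReal.ofReal (C * (1 + ν * t ^ 3) ^ (-(1 / 2) : ℝ) * Real.exp (-ν * t)
              * dataSize ωin) ∧
        (0 < t →
          multNorm (weight χ s ν t) ∞ (weakPartial 2 0 (ω t))
            ≤ ENNReal.ofReal (C * (ν * t ^ 3) ^ (-(1 / 3) : ℝ)
                * (1 + ν * t ^ 3) ^ (-(7 / 6) : ℝ) * Real.exp (-ν * t) * dataSize ωin)) ∧
        -- the velocity `u = (∂_y φ, -∂_x φ)` and the error term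
        ∃ φ : StripL2, IsStreamFunction (ω t) φ ∧
          -- inviscid damping
          multNorm (weight χ s ν t) ∞ (weakPartial 0 1 φ)
              + multNorm (weight χ s ν t) ∞ (weakPartial 0 1 φ - t • (-weakPartial 1 0 φ))
            ≤ ENNReal.ofReal (C * (1 + t)⁻¹ * Real.exp (-ν * t) * dataSize ωin) ∧
          multNorm (weight χ s ν t) ∞ (-weakPartial 1 0 φ)
            ≤ ENNReal.ofReal (C * ((1 + t) ^ 2)⁻¹ * Real.log (2 + t) * Real.exp (-ν * t)
                * dataSize ωin) ∧
          -- error estimate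
          ∃ E : StripL2, IsErrorTerm ν ω t φ E ∧
            multNorm (weight χ s ν t) 2 E
              ≤ ENNReal.ofReal (C * ((1 + t)⁻¹ * (1 + ν * t ^ 3) ^ (-(1 / 4) : ℝ) * dataSize ωin
                  + ν * (1 + ν * t ^ 3) ^ (-(1 / 4) : ℝ)
                  + ν ^ (2 / 3 : ℝ) * (1 + ν * t ^ 3) ^ (-(5 / 12) : ℝ))
                  * Real.exp (-ν * t) * dataSize ωin) := by
  obtain ⟨C₁, hC₁, h₁⟩ := exists_dissipation hχ hs
  obtain ⟨C₂, hC₂, h₂⟩ := exists_damping hχ hs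
  obtain ⟨C₃, hC₃, h₃⟩ := exists_damping_horizontal hχ hs
  obtain ⟨C₄, hC₄, h₄⟩ := exists_error hχ hs
  -- The profile has size `48 E₀`; the square pays for the quadratic term `u · ∇ω`.
  obtain ⟨C, hC⟩ : ∃ C, C = 48 ^ 2 * (C₁ + C₂ + C₃ + C₄) := ⟨_, rfl⟩
  refine ⟨C, by rw [hC]; positivity, fun ν hν _ ωin hin ω hω t ht => ?_⟩
  obtain ⟨P⟩ := exists_profile hin (by simpa only [hω.init] using hω.walls 0 le_rfl)
  have hD := dataSize_nonneg ωin
  have c₁ : 96 * C₁ ≤ C := by rw [hC]; linarith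
  have c₂ : 48 * C₂ ≤ C := by rw [hC]; linarith
  have c₃ : 48 * C₂ + 48 * C₃ ≤ C := by rw [hC]; linarith
  have c₄ : 48 ^ 2 * C₄ ≤ C := by rw [hC]; linarith
  have c₅ : 48 * C₄ ≤ C := by rw [hC]; linarith
  have hω' := P.solution_eq_field hν.le hω ht
  obtain ⟨e, he, he'⟩ := h₄ P hν hω ht
  have hstr := P.isStreamFunction hν.le ht
  obtain ⟨d1, d2, d3, d4, d5, d6⟩ := h₁ P hν ht
  obtain ⟨u1, u2⟩ := h₂ P hν ht
  have u3 := h₃ P hν ht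
  obtain ⟨x0, x1, x2, y1, -⟩ := P.sobolev_vorticity hν.le ht
  obtain ⟨-, sx1, -, sy1, -⟩ := P.sobolev_stream hν.le ht
  rw [← hω'] at x0 x1 x2 y1 d1 hstr
  rw [x1, x2, y1]
  have hexp := Real.exp_pos (-ν * t)
  have hlog : 0 ≤ Real.log (2 + t) := Real.log_nonneg (by linarith)
  have mono : ∀ {c r : ℝ}, c ≤ C → 0 ≤ r → c * r ≤ C * r := fun h => mul_le_mul_of_nonneg_right h
  refine ⟨x0, (add_le_add d1 d2).trans ?_, d3.trans (ENNReal.ofReal_le_ofReal ?_),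
    d4.trans (ENNReal.ofReal_le_ofReal ?_), d5.trans (ENNReal.ofReal_le_ofReal ?_),
    fun h => (d6 h).trans (ENNReal.ofReal_le_ofReal ?_), _, hstr, ?_, ?_, e, he,
    he'.trans (ENNReal.ofReal_le_ofReal ?_)⟩
  · rw [← ENNReal.ofReal_add (by positivity) (by positivity)]
    refine ENNReal.ofReal_le_ofReal ?_
    linarith [mono c₁ (show 0 ≤ (1 + ν * t ^ 3) ^ (-(1 / 4) : ℝ) * Real.exp (-ν * t) * dataSize ωin by positivity)]
  · have : 0 ≤ (1 + ν * t ^ 3) ^ (-(3 / 4) : ℝ) * Real.exp (-ν * t) * dataSize ωin := by positivity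
    linarith [mono c₁ this, mul_nonneg hC₁.le this]
  · have : 0 ≤ (1 + ν * t ^ 3) ^ (-1 : ℝ) * Real.exp (-ν * t) * dataSize ωin := by positivity
    linarith [mono c₁ this, mul_nonneg hC₁.le this]
  · have : 0 ≤ (1 + ν * t ^ 3) ^ (-(1 / 2) : ℝ) * Real.exp (-ν * t) * dataSize ωin := by positivity
    linarith [mono c₁ this, mul_nonneg hC₁.le this]
  · have : 0 ≤ (ν * t ^ 3) ^ (-(1 / 3) : ℝ) * (1 + ν * t ^ 3) ^ (-(7 / 6) : ℝ) * Real.exp (-ν * t) *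
        dataSize ωin := by positivity
    linarith [mono c₁ this, mul_nonneg hC₁.le this]
  · rw [sx1, sy1]
    refine (add_le_add u3 u1).trans ?_
    rw [← ENNReal.ofReal_add (by positivity) (by positivity)]
    refine ENNReal.ofReal_le_ofReal ?_
    linarith [mono c₃ (show 0 ≤ (1 + t)⁻¹ * Real.exp (-ν * t) * dataSize ωin by positivity)]
  · rw [sx1]
    refine u2.trans (ENNReal.ofReal_le_ofReal ?_)
    linarith [mono c₂ (show 0 ≤ ((1 + t) ^ 2)⁻¹ * Real.log (2 + t) * Real.exp (-ν * t) * dataSize ωin by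
      positivity)]
  · linarith [mono c₄ (show 0 ≤ (1 + t)⁻¹ * (1 + ν * t ^ 3) ^ (-(1 / 4) : ℝ) * dataSize ωin *
        Real.exp (-ν * t) * dataSize ωin by positivity),
      mono c₅ (show 0 ≤ (ν * (1 + ν * t ^ 3) ^ (-(1 / 4) : ℝ) +
        ν ^ (2 / 3 : ℝ) * (1 + ν * t ^ 3) ^ (-(5 / 12) : ℝ)) * Real.exp (-ν * t) * dataSize ωin by positivity)]
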